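/- Let $F$ be a closed hyperbolic surface, i.e. a compact metric space with a locally isometric (universal) covering $\pi\colon\mathbb H^2\to F$, let $\mathcal S\subset F$ be finite and non-empty, and put $\widetilde{\mathcal S}=\pi^{-1}(\mathcal S)$. For $x\in\widetilde{\mathcal S}$ let $V_x=\{p\in\mathbb H^2 : d(p,x)\le d(p,y)\ \forall y\in\widetilde{\mathcal S}\setminus\{x\}\}$. The set $\widetilde V^{(0)}$ of Voronoi vertices consists of the points of $V_x\cap V_y\cap V_z$ for distinct $x,y,z\in\widetilde{\mathcal S}$. A Voronoi edge is an intersection $e=V_x\cap V_y$ ($x\ne y$ in $\widetilde{\mathcal S}$) with more than one point; its geometric dual is the geodesic arc $\gamma_{xy}$ from $x$ to $y$, and $e$ is centered if $\gamma_{xy}$ meets $e$ at an interior point of $e$. For $v\in\widetilde V^{(0)}$, the Delaunay cell $P_v$ is the convex polygon with vertex set $\{x\in\widetilde{\mathcal S}: v\in V_x\}$. Let $\widetilde V^{(1)}_n$ be the union of the non-centered edges. The Voronoi vertices $V^{(0)}$, the (centered) Voronoi edges and the union $V^{(1)}_n$ of the non-centered edges in $F$ are the images of these objects under $\pi$. Let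 $P^{(1)}_c\subset F$ be the union of the images of the geometric duals to the centered edges. Then $\mathcal S\subset P^{(1)}_c$, and $F$ has the structure of a finite two-dimensional CW complex (the centered dual decomposition) whose $0$-cells are the points of $\mathcal S$, whose open $1$-cells are the images of the interiors of the geometric duals to centered edges, and whose open $2$-cells are the components of $F\setminus P^{(1)}_c$. Moreover, for every component $U$ of $F\setminus P^{(1)}_c$: (a) $U$ is homeomorphic to an open disk. (b) $\overline U=\bigcup\{\pi(P_v) : v\in\widetilde V^{(0)},\ \pi(v)\in U\}$. (c) The completion $\bar Q$ of the induced path metric on $U$ is homeomorphic to a closed disk, and the inclusion $U\to F$ extends to a continuous map $j\colon\bar Q\to F$. (d) One of the following holds. (1) There is a unique $v\in V^{(0)}\cap U$, every Voronoi edge in $F$ containing $v$ is centered, and $\pi(P_{\tilde v})=\overline U$ for every $\tilde v\in\pi^{-1}(v)$. (2) $U$ contains exactly one component $T$ of $V^{(1)}_n$, and $V^{(0)}\cap U=V^{(0)}\cap T$. There is a component $\widetilde T$ of $\widetilde V^{(1)}_n$ with $\pi(\widetilde T)=T$, and every such $\widetilde T$ is a tree with finitely many vertices on which $\pi$ is injective.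 Let $\mathcal F$ be the frontier of $\widetilde T$, i.e. the set of pairs $(e,v)$ with $e$ a Voronoi edge in $\mathbb H^2$ not contained in $\widetilde T$ and $v\in e\cap\widetilde T$. Then $\overline U\setminus U$ is the union of the images in $F$ of the geometric duals to the edges $e$ with $(e,v)\in\mathcal F$, and $$\bar Q\setminus U=\bigcup\{\gamma_{(e,v)} : (e,v)\in\mathcal F\},$$ where each $\gamma_{(e,v)}$ is the image of an isometric embedding $s_{(e,v)}$ of the geometric dual $\gamma$ to $e$ into $\bar Q$ with $j\circ s_{(e,v)}=\pi|_\gamma$, and the interior of $\gamma_{(e,v)}$ is disjoint from $\gamma_{(e',v')}$ whenever $(e',v')\ne(e,v)$. -/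

import Mathlib

open Set Metric Topology
open scoped UpperHalfPlane ENNReal

universe u

namespace CenteredDual

/-! ### General metric and topological notions -/

/-- `U` is a connected component of the subspace `A`. -/
def IsComponent {X : Type*} [TopologicalSpace X] (A U : Set X) : Prop :=
  ∃ a ∈ A, U = connectedComponentIn A a

/-- The relative interior of a geodesic arc `e` in a metric space: the points lying strictly
between two other points of `e`. -/
def arcInterior {X : Type*} [MetricSpace X] (e : Set X) : Set X :=
  {p | p ∈ e ∧ ∃ a ∈ e, ∃ b ∈ e, a ≠ p ∧ b ≠ p ∧ dist a p + dist p b = dist a b}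

/-- The induced path (pseudo-)metric on a subset `U` of a metric space: the infimum of the lengths
of the paths in `U` from `a` to `b`. -/
noncomputable def pathEDist {X : Type*} [MetricSpace X] (U : Set X) (a b : X) : ℝ≥0∞ :=
  ⨅ (γ : Path a b) (_ : range γ ⊆ U), eVariationOn γ univ

/-- `ι : U → Q` exhibits `Q` as the metric completion of `U` with its induced path metric. -/
structure IsPathCompletion {X : Type*} [MetricSpace X] (U : Set X) {Q : Type*} [MetricSpace Q]
    (ι : U → Q) : Prop where
  complete : CompleteSpace Q
  denseRange : DenseRange ι
  edist_eq : ∀ a b : U, edist (ι a) (ι b) = pathEDist U (a : X) (b : X)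

/-- `X` is a finite CW complex of dimension at most two whose open cells of dimension 0, 1 and 2 are
the points of `vertices`, the members of `edges` and the members of `faces`, respectively. -/
def IsFiniteCellDecomposition {X : Type u} [TopologicalSpace X]
    (vertices : Set X) (edges faces : Set (Set X)) : Prop :=
  ∃ C : Topology.CWComplex (univ : Set X),
    (∀ n, Finite (C.cell n)) ∧
    range (fun i : C.cell 0 => C.map 0 i '' ball 0 1) = {A | ∃ x ∈ vertices, A = {x}} ∧
    range (fun i : C.cell 1 => C.map 1 i '' ball 0 1) = edges ∧
    range (fun i : C.cell 2 => C.map 2 i '' ball 0 1) = faces ∧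
    ∀ n, 3 ≤ n → IsEmpty (C.cell n)

/-! ### Voronoi and Delaunay tessellations of the hyperbolic plane

The hyperbolic plane is the upper half-plane `ℍ` with its hyperbolic metric. -/

/-- The geodesic arc joining `x` to `y`. -/
def geodesicArc (x y : ℍ) : Set ℍ := {p | dist x p + dist p y = dist x y}

/-- The (hyperbolic) convex hull of a set. -/
def geodesicHull (A : Set ℍ) : Set ℍ :=
  ⋂₀ {C | A ⊆ C ∧ ∀ x ∈ C, ∀ y ∈ C, geodesicArc x y ⊆ C}

/-- The Voronoi cell `V_x` of `x` with respect to `S`. -/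
def voronoiCell (S : Set ℍ) (x : ℍ) : Set ℍ :=
  {p | ∀ y ∈ S, y ≠ x → dist p x ≤ dist p y}

/-- The vertex set `V^(0)`: points of three distinct Voronoi cells. -/
def voronoiVertices (S : Set ℍ) : Set ℍ :=
  {v | ∃ x ∈ S, ∃ y ∈ S, ∃ z ∈ S, x ≠ y ∧ y ≠ z ∧ x ≠ z ∧
    v ∈ voronoiCell S x ∩ voronoiCell S y ∩ voronoiCell S z}

/-- `e = V_x ∩ V_y` is an edge of the Voronoi tessellation (an intersection of two Voronoi cells
which is neither empty nor a singleton), and `γ` is its geometric dual, the geodesic arc joining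
`x` to `y`. -/
def IsGeometricDual (S : Set ℍ) (e γ : Set ℍ) : Prop :=
  ∃ x ∈ S, ∃ y ∈ S, x ≠ y ∧ e = voronoiCell S x ∩ voronoiCell S y ∧ e.Nontrivial ∧
    γ = geodesicArc x y

/-- The set of edges of the Voronoi tessellation. -/
def voronoiEdges (S : Set ℍ) : Set (Set ℍ) := {e | ∃ γ, IsGeometricDual S e γ}

/-- The set of centered edges: those meeting their geometric dual at an interior point. -/
def centeredEdges (S : Set ℍ) : Set (Set ℍ) :=
  {e | ∃ γ, IsGeometricDual S e γ ∧ (γ ∩ arcInterior e).Nonempty}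

/-- The union of the non-centered edges. -/
def nonCenteredUnion (S : Set ℍ) : Set ℍ := ⋃₀ (voronoiEdges S \ centeredEdges S)

/-- The set of geometric duals to the centered edges. -/
def centeredDuals (S : Set ℍ) : Set (Set ℍ) := {γ | ∃ e ∈ centeredEdges S, IsGeometricDual S e γ}

/-- The Delaunay cell `P_v` of `v ∈ V^(0)`: the convex polygon whose vertices are the points of `S`
whose Voronoi cells contain `v`. -/
def delaunayCell (S : Set ℍ) (v : ℍ) : Set ℍ := geodesicHull {x | x ∈ S ∧ v ∈ voronoiCell S x}

/-- The combinatorial graph of non-centered edges: two distinct Voronoi vertices are adjacent if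
they lie on a common non-centered edge. As an edge is a geodesic arc which meets `V^(0)` exactly in
its two endpoints, and there is one geodesic arc between two points, there are neither loops nor
multiple edges. -/
def nonCenteredGraph (S : Set ℍ) : SimpleGraph ℍ :=
  SimpleGraph.fromRel fun v w => v ∈ voronoiVertices S ∧ w ∈ voronoiVertices S ∧
    ∃ e ∈ voronoiEdges S \ centeredEdges S, v ∈ e ∧ w ∈ e

/-- The frontier of a subgraph `T` of `V^(1)`: the pairs `(e, v)` of an edge `e` not in `T` and a
point `v` of `e ∩ T`. -/
def frontierPairs (S : Set ℍ) (T : Set ℍ) : Set (Set ℍ × ℍ) :=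
  {q | q.1 ∈ voronoiEdges S ∧ ¬ q.1 ⊆ T ∧ q.2 ∈ q.1 ∩ T}

/-! ### Closed hyperbolic surfaces

A closed hyperbolic surface is a compact metric space `F` with a locally isometric covering
`π : ℍ → F`. The tessellations determined by `S ⊆ F` are the images under `π` of those determined
by `π ⁻¹' S`. -/

/-- `π` is a locally isometric (universal) covering. -/
structure IsLocallyIsometricCovering {F : Type*} [MetricSpace F] (π : ℍ → F) : Prop where
  surjective : Function.Surjective π
  isCoveringMap : IsCoveringMap π
  locallyIsometric : ∀ a, ∃ r > 0, ∀ b ∈ ball a r, ∀ c ∈ ball a r, dist (π b) (π c) = dist b c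

variable {F : Type u} [MetricSpace F]

/-- The Voronoi vertices in `F`. -/
def surfaceVertices (π : ℍ → F) (S : Set F) : Set F := π '' voronoiVertices (π ⁻¹' S)

/-- The Voronoi edges in `F`. -/
def surfaceEdges (π : ℍ → F) (S : Set F) : Set (Set F) :=
  {e | ∃ e' ∈ voronoiEdges (π ⁻¹' S), e = π '' e'}

/-- The centered Voronoi edges in `F`: those with a centered lift. -/
def surfaceCenteredEdges (π : ℍ → F) (S : Set F) : Set (Set F) :=
  {e | ∃ e' ∈ centeredEdges (π ⁻¹' S), e = π '' e'}

/-- The union of the non-centered Voronoi edges in `F`. -/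
def surfaceNonCenteredUnion (π : ℍ → F) (S : Set F) : Set F :=
  π '' nonCenteredUnion (π ⁻¹' S)

/-- The centered dual graph, as a subset of `F`: the union of the geometric duals to centered
edges. -/
def centeredDualGraph (π : ℍ → F) (S : Set F) : Set F := ⋃ γ ∈ centeredDuals (π ⁻¹' S), π '' γ

/-- The open edges of the centered dual graph. -/
def centeredDualOpenEdges (π : ℍ → F) (S : Set F) : Set (Set F) :=
  {g | ∃ γ ∈ centeredDuals (π ⁻¹' S), g = π '' arcInterior γ}

end CenteredDual

open CenteredDual

/-! Geometry becomes linear algebra in the hyperboloid model: `hyp` places ℍ on the sheet ⟨P, P⟩ = 1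
of a Lorentz space, where cosh of the distance is the product ⟨·, ·⟩, geodesic arcs are cones over
two vectors and hulls are convex cones. For a point p, let u_p = `ctr S p` be the multiple of p with
⟨u_p, x⟩ = 1 at the nearest sites x. All other sites have ⟨u_p, z⟩ > 1, so Delaunay cells are cones
over faces of the convex hull of the sites, and u_w - u_v separates the cells of v and w. It follows
that distinct cells have disjoint interiors, that the sides of a cell are the duals of the Voronoi
edges through its centre, and that the cells cover the plane (`IsNet.exists_mem_delaunayCell`).

A non-centered edge is oriented towards increasing distance from the sites (`Step`): seen from its
initial point v, no site near v is farther from the midpoint of the dual arc than the ends of that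
arc. The circumradius increases along the edge (`Step.rad_lt`), and at most one such edge leaves a
given vertex (`Step.unique`). Only finitely many radii occur, by periodicity, so every Voronoi
vertex flows to a unique root. The vertices with a common root form a finite `cluster`, on which the
non-centered edges are a tree. The union of the Delaunay cells of a cluster, with the dual graph
removed, is an open `region`, and the regions partition the complement of the dual graph. The root
lies inside its own cell (`IsNet.hyp_mem_interior_of_no_step`); non-centered edges miss the dual
graph, so the whole tree of the cluster stays in the region of the root.

To see that a region is a disk, each cell is replaced by an ideal polygon. The form ⟨P, Q⟩ - ⟨u_v,
P⟩⟨u_v, Q⟩ is again Lorentzian, the sites near v are isotropic for it, and their mutual products ⟨x,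
y⟩ - 1 do not involve v. A linear isometry to Minkowski space therefore turns the cell of v into an
ideal polygon, and the polygons of neighbouring vertices fit along their common side. Ideal polygons
glued in the pattern of a tree form one convex ideal polygon (`IsDev.extend`, `exists_isDev`). Its
slice `plane` is a compact convex set in the Euclidean plane, and `devMap` is a Lipschitz map with
finite fibers from it to ℍ; it sends the interior bijectively onto the region and the frontier into
the dual graph (`IsDev.mem_interior_iff`).

In the surface, a deck transformation carrying a region to itself fixes the root, the unique vertex
of largest radius in the cluster, and so is the identity. Hence π is injective on regions
(`injOn_region`) and π ∘ `devMap` is an `IsDiskMap` onto a face. The Lipschitz bound and the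
finiteness of the fibers make the inverse a uniform embedding of the face, with its path metric,
onto a dense subset of the disk model, so the disk model is the completion
(`IsDiskMap.exists_homeomorph`). The same maps are the characteristic maps of the 2-cells. The
developed sides dual to centered edges make up the frontier of the disk model, and they are
isometric to the dual arcs because each Delaunay cell embeds isometrically in the completion
(`IsDev.dist_eq`). -/

namespace CenteredDual

open scoped NNReal

section
/-! ### The hyperboloid model -/

/-- Three-dimensional Minkowski space. -/
abbrev V3 := ℝ × ℝ × ℝ

/-- The Minkowski form, of signature `(1, 2)`. -/
noncomputable def mink : V3 →ₗ[ℝ] V3 →ₗ[ℝ] ℝ :=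
  LinearMap.mk₂ ℝ (fun P Q => (P.2.1 * Q.2.2 + P.2.2 * Q.2.1) / 2 - P.1 * Q.1)
    (fun _ _ _ => by simp only [Prod.fst_add, Prod.snd_add]; ring)
    (fun _ _ _ => by simp only [Prod.smul_fst, Prod.smul_snd, smul_eq_mul]; ring)
    (fun _ _ _ => by simp only [Prod.fst_add, Prod.snd_add]; ring)
    (fun _ _ _ => by simp only [Prod.smul_fst, Prod.smul_snd, smul_eq_mul]; ring)

theorem mink_apply (P Q : V3) :
    mink P Q = (P.2.1 * Q.2.2 + P.2.2 * Q.2.1) / 2 - P.1 * Q.1 := rfl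

theorem mink_comm (P Q : V3) : mink P Q = mink Q P := by simp only [mink_apply]; ring

/-- The determinant of three vectors. -/
noncomputable def det3 (P Q : V3) : V3 →ₗ[ℝ] ℝ where
  toFun R := P.1 * (Q.2.1 * R.2.2 - Q.2.2 * R.2.1) - P.2.1 * (Q.1 * R.2.2 - Q.2.2 * R.1)
    + P.2.2 * (Q.1 * R.2.1 - Q.2.1 * R.1)
  map_add' _ _ := by simp only [Prod.fst_add, Prod.snd_add]; ring
  map_smul' _ _ := by
    simp only [Prod.smul_fst, Prod.smul_snd, smul_eq_mul, RingHom.id_apply]; ring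

theorem det3_apply (P Q R : V3) : det3 P Q R =
    P.1 * (Q.2.1 * R.2.2 - Q.2.2 * R.2.1) - P.2.1 * (Q.1 * R.2.2 - Q.2.2 * R.1)
    + P.2.2 * (Q.1 * R.2.1 - Q.2.1 * R.1) := rfl

theorem det3_left (P Q : V3) : det3 P Q P = 0 := by simp only [det3_apply]; ring
theorem det3_right (P Q : V3) : det3 P Q Q = 0 := by simp only [det3_apply]; ring
theorem det3_rotate (P Q R : V3) : det3 P Q R = det3 Q R P := by simp only [det3_apply]; ring
theorem det3_swap (P Q R : V3) : det3 P Q R = -det3 Q P R := by simp only [det3_apply]; ring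

/-- Cramer's rule. -/
theorem cramer (x y z P : V3) :
    det3 x y z • P = det3 y z P • x + det3 z x P • y + det3 x y P • z := by
  refine Prod.ext ?_ (Prod.ext ?_ ?_) <;>
  simp only [det3_apply, Prod.smul_fst, Prod.smul_snd, Prod.fst_add, Prod.snd_add, smul_eq_mul] <;>
  ring

theorem cramer_div {x y z : V3} (h : det3 x y z ≠ 0) (P : V3) :
    P = (det3 y z P / det3 x y z) • x + (det3 z x P / det3 x y z) • y
      + (det3 x y P / det3 x y z) • z := by
  have := congrArg (fun v => (det3 x y z)⁻¹ • v) (cramer x y z P)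
  simpa only [smul_smul, inv_mul_cancel₀ h, one_smul, smul_add, div_eq_inv_mul] using this

/-- The Minkowski cross product. -/
noncomputable def cross (P Q : V3) : V3 :=
  (-(P.2.1 * Q.2.2 - P.2.2 * Q.2.1), 2 * (P.1 * Q.2.1 - P.2.1 * Q.1),
    -2 * (P.1 * Q.2.2 - P.2.2 * Q.1))

theorem mink_cross (P Q R : V3) : mink (cross P Q) R = det3 P Q R := by
  simp only [mink_apply, cross, det3_apply]; ring

theorem mink_cross_self (P Q : V3) :
    mink (cross P Q) (cross P Q) = 4 * (mink P P * mink Q Q - mink P Q ^ 2) := by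
  simp only [mink_apply, cross]; ring

/-- The Gram determinant. -/
theorem det3_sq (x y z : V3) : det3 x y z ^ 2 = 4 * (mink x x * (mink y y * mink z z - mink y z ^ 2)
    - mink x y * (mink x y * mink z z - mink y z * mink x z)
    + mink x z * (mink x y * mink y z - mink y y * mink x z)) := by
  simp only [mink_apply, det3_apply]; ring

/-- The open future cone. -/
def IsFut (P : V3) : Prop := 0 < mink P P ∧ 0 < P.2.2

/-- The closed future cone without its apex. -/
def IsCFut (P : V3) : Prop := 0 ≤ mink P P ∧ 0 < P.2.1 + P.2.2

theorem IsFut.cfut {P : V3} (h : IsFut P) : IsCFut P := by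
  refine ⟨h.1.le, ?_⟩
  have h1 := h.1; have h2 := h.2
  rw [mink_apply] at h1
  have : 0 < P.2.1 := by
    by_contra hc
    nlinarith [sq_nonneg P.1, mul_nonneg (neg_nonneg.2 (not_lt.1 hc)) h2.le]
  linarith

theorem IsCFut.nonneg {P : V3} (h : IsCFut P) : 0 ≤ P.2.1 ∧ 0 ≤ P.2.2 := by
  obtain ⟨h1, h2⟩ := h
  rw [mink_apply] at h1
  have h3 : 0 ≤ P.2.1 * P.2.2 := by nlinarith [sq_nonneg P.1]
  constructor
  · by_contra hc
    push Not at hc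
    nlinarith
  · by_contra hc
    push Not at hc
    nlinarith

/-- Reverse Cauchy–Schwarz in null coordinates: ⟨P, P⟩ ≥ 0 bounds the square of the space coordinate
by the product of the two null coordinates, and the inequality of arithmetic and geometric means
handles the mixed terms. -/
theorem IsCFut.mink_nonneg {P Q : V3} (hP : IsCFut P) (hQ : IsCFut Q) : 0 ≤ mink P Q := by
  obtain ⟨p1, p2⟩ := hP.nonneg
  obtain ⟨q1, q2⟩ := hQ.nonneg
  have h1 := hP.1; have h2 := hQ.1
  rw [mink_apply] at h1 h2 ⊢
  have a1 : P.1 ^ 2 ≤ P.2.1 * P.2.2 := by nlinarith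
  have a2 : Q.1 ^ 2 ≤ Q.2.1 * Q.2.2 := by nlinarith
  have e : (P.1 * Q.1) ^ 2 ≤ ((P.2.1 * Q.2.2 + P.2.2 * Q.2.1) / 2) ^ 2 := by
    have : (P.1 * Q.1) ^ 2 ≤ (P.2.1 * P.2.2) * (Q.2.1 * Q.2.2) := by
      rw [mul_pow]; exact mul_le_mul a1 a2 (sq_nonneg _) (by positivity)
    nlinarith [sq_nonneg (P.2.1 * Q.2.2 - P.2.2 * Q.2.1)]
  have := abs_le_of_sq_le_sq e (by positivity)
  linarith [le_abs_self (P.1 * Q.1)]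

theorem IsCFut.add {P Q : V3} (hP : IsCFut P) (hQ : IsCFut Q) : IsCFut (P + Q) := by
  refine ⟨?_, ?_⟩
  · have := hP.mink_nonneg hQ
    have h1 := hP.1; have h2 := hQ.1
    simp only [map_add, LinearMap.add_apply]
    rw [mink_comm Q P]; linarith
  · have := hP.2; have := hQ.2
    simp only [Prod.snd_add, Prod.fst_add]; linarith

theorem IsCFut.smul {P : V3} (hP : IsCFut P) {c : ℝ} (hc : 0 < c) : IsCFut (c • P) := by
  refine ⟨?_, ?_⟩
  · simp only [map_smul, LinearMap.smul_apply, smul_eq_mul]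
    exact mul_nonneg hc.le (mul_nonneg hc.le hP.1)
  · have := mul_pos hc hP.2
    simp only [Prod.smul_snd, Prod.smul_fst, smul_eq_mul]; linarith

theorem IsFut.mink_pos {P Q : V3} (hP : IsFut P) (hQ : IsCFut Q) : 0 < mink P Q := by
  rcases (hP.cfut.mink_nonneg hQ).lt_or_eq with h | h
  · exact h
  exfalso
  obtain ⟨p1, p2⟩ := hP.cfut.nonneg
  obtain ⟨q1, q2⟩ := hQ.nonneg
  have h1 := hP.1; have h2 := hQ.1; have h3 := hQ.2; have h4 := hP.2
  rw [mink_apply] at h1 h2 h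
  have a1 : P.1 ^ 2 < P.2.1 * P.2.2 := by nlinarith
  have a2 : Q.1 ^ 2 ≤ Q.2.1 * Q.2.2 := by nlinarith
  have a3 : (P.2.1 * Q.2.2 + P.2.2 * Q.2.1) / 2 = P.1 * Q.1 := by linarith
  have e : ((P.2.1 * Q.2.2 + P.2.2 * Q.2.1) / 2) ^ 2 = P.1 ^ 2 * Q.1 ^ 2 := by rw [a3]; ring
  have e2 : (P.2.1 * P.2.2) * (Q.2.1 * Q.2.2) ≤ ((P.2.1 * Q.2.2 + P.2.2 * Q.2.1) / 2) ^ 2 := by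
    nlinarith [sq_nonneg (P.2.1 * Q.2.2 - P.2.2 * Q.2.1)]
  have hs : 0 < P.2.1 := by
    by_contra hc
    have : P.2.1 = 0 := le_antisymm (not_lt.1 hc) p1
    rw [this] at a1; nlinarith [sq_nonneg P.1]
  -- If the product were zero, the strict inequality for P would contradict the chain `e`, `e2`
  -- unless the space coordinate of Q vanishes.
  have hq0 : Q.1 ^ 2 = 0 := by
    by_contra hne
    have hp : 0 < Q.1 ^ 2 := lt_of_le_of_ne (sq_nonneg _) (Ne.symm hne)
    nlinarith [mul_lt_mul_of_pos_right a1 hp, mul_le_mul_of_nonneg_left a2 (mul_nonneg p1 p2)]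
  have hq1 : Q.1 = 0 := by simpa using hq0
  rw [hq1] at a3
  nlinarith [mul_nonneg p1 q2, mul_nonneg p2 q1, mul_pos hs h3, mul_pos h4 h3,
    mul_nonneg p1 q1, mul_nonneg p2 q2]

theorem IsFut.smul {P : V3} (hP : IsFut P) {c : ℝ} (hc : 0 < c) : IsFut (c • P) := by
  refine ⟨?_, ?_⟩
  · simp only [map_smul, LinearMap.smul_apply, smul_eq_mul]
    exact mul_pos hc (mul_pos hc hP.1)
  · simpa using mul_pos hc hP.2

theorem IsFut.add_cfut {P Q : V3} (hP : IsFut P) (hQ : IsCFut Q) : IsFut (P + Q) := by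
  refine ⟨?_, ?_⟩
  · have := hP.mink_pos hQ
    have h1 := hP.1; have h2 := hQ.1
    simp only [map_add, LinearMap.add_apply]
    rw [mink_comm Q P]; linarith
  · have := hP.2; have := hQ.nonneg.2
    simp only [Prod.snd_add]; linarith

theorem isOpen_Fut : IsOpen {P | IsFut P} := by
  have h : {P | IsFut P} = {P : V3 | 0 < (P.2.1 * P.2.2 + P.2.2 * P.2.1) / 2 - P.1 * P.1} ∩
    {P : V3 | 0 < P.2.2} := rfl
  rw [h]
  exact (isOpen_lt (by fun_prop) (by fun_prop)).inter (isOpen_lt (by fun_prop) (by fun_prop))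

/-- The point of the hyperboloid corresponding to a point of the upper half-plane. -/
noncomputable def hyp (z : ℍ) : V3 := (z.re / z.im, (z.re ^ 2 + z.im ^ 2) / z.im, 1 / z.im)

theorem continuous_hyp : Continuous hyp := by
  unfold hyp
  have h1 : Continuous (fun z : ℍ => z.re) := UpperHalfPlane.continuous_re
  have h2 : Continuous (fun z : ℍ => z.im) := UpperHalfPlane.continuous_im
  have h3 : ∀ z : ℍ, z.im ≠ 0 := fun z => z.im_ne_zero
  exact (h1.div h2 h3).prodMk ((((h1.pow 2).add (h2.pow 2)).div h2 h3).prodMk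
    (continuous_const.div h2 h3))

/-- This identity moves metric questions into linear algebra: distances from z are compared through
the linear functional ⟨hyp z, ·⟩. -/
theorem cosh_dist_eq (z w : ℍ) : Real.cosh (dist z w) = mink (hyp z) (hyp w) := by
  rw [UpperHalfPlane.cosh_dist', mink_apply]
  have h1 := z.im_ne_zero; have h2 := w.im_ne_zero
  simp only [hyp]
  field_simp
  ring

theorem mink_hyp_self (z : ℍ) : mink (hyp z) (hyp z) = 1 := by
  rw [← cosh_dist_eq]; simp

theorem hyp_mem_Fut (z : ℍ) : IsFut (hyp z) := by
  refine ⟨by rw [mink_hyp_self]; norm_num, ?_⟩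
  have := z.im_pos
  simp only [hyp]; positivity

theorem one_le_mink_hyp (z w : ℍ) : 1 ≤ mink (hyp z) (hyp w) := by
  rw [← cosh_dist_eq]; exact Real.one_le_cosh _

theorem one_lt_mink_hyp {z w : ℍ} (h : z ≠ w) : 1 < mink (hyp z) (hyp w) := by
  rw [← cosh_dist_eq]; exact Real.one_lt_cosh.2 (dist_pos.2 h).ne'

theorem mink_hyp_pos (z w : ℍ) : 0 < mink (hyp z) (hyp w) :=
  zero_lt_one.trans_le (one_le_mink_hyp z w)

theorem eq_of_mink_hyp_eq_one {z w : ℍ} (h : mink (hyp z) (hyp w) = 1) : z = w := by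
  by_contra hne
  exact (one_lt_mink_hyp hne).ne' h

theorem hyp_injective : Function.Injective hyp := fun z w h =>
  eq_of_mink_hyp_eq_one (by rw [h, mink_hyp_self])

theorem dist_le_dist_iff {a b c d : ℍ} :
    dist a b ≤ dist c d ↔ mink (hyp a) (hyp b) ≤ mink (hyp c) (hyp d) := by
  rw [← cosh_dist_eq, ← cosh_dist_eq, Real.cosh_le_cosh, abs_of_nonneg dist_nonneg,
    abs_of_nonneg dist_nonneg]

theorem dist_lt_dist_iff {a b c d : ℍ} :
    dist a b < dist c d ↔ mink (hyp a) (hyp b) < mink (hyp c) (hyp d) := by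
  rw [← not_le, ← not_le, dist_le_dist_iff]

/-- The point of the upper half-plane on the ray spanned by a vector in the future cone. -/
noncomputable def pt (P : V3) : ℍ :=
  open Classical in
  if h : IsFut P then ⟨⟨P.1 / P.2.2, √(mink P P) / P.2.2⟩, div_pos (Real.sqrt_pos.2 h.1) h.2⟩
  else UpperHalfPlane.I

theorem pt_re {P : V3} (h : IsFut P) : (pt P).re = P.1 / P.2.2 := by
  simp [pt, h, UpperHalfPlane.re]

theorem pt_im {P : V3} (h : IsFut P) : (pt P).im = √(mink P P) / P.2.2 := by
  simp [pt, h, UpperHalfPlane.im]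

theorem hyp_pt {P : V3} (h : IsFut P) : hyp (pt P) = (√(mink P P))⁻¹ • P := by
  have h1 : 0 < √(mink P P) := Real.sqrt_pos.2 h.1
  have h2 : √(mink P P) ^ 2 = mink P P := Real.sq_sqrt h.1.le
  have h3 := h.2.ne'
  rw [mink_apply] at h2
  have key : √(mink P P) ^ 2 + P.1 ^ 2 = P.2.1 * P.2.2 := by rw [mink_apply, h2]; ring
  have hn : √(mink P P) ≠ 0 := h1.ne'
  refine Prod.ext ?_ (Prod.ext ?_ ?_) <;>
  simp only [hyp, pt_re h, pt_im h, Prod.smul_fst, Prod.smul_snd, smul_eq_mul] <;>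
  generalize √(mink P P) = r at * <;> field_simp
  linarith

theorem hyp_eq_smul_unique {p q : ℍ} {c : ℝ} (hc : 0 < c) (h : hyp p = c • hyp q) : p = q := by
  have h1 := mink_hyp_self p
  rw [h] at h1
  simp only [map_smul, LinearMap.smul_apply, smul_eq_mul, mink_hyp_self, mul_one] at h1
  have : c = 1 := by nlinarith
  rw [this, one_smul] at h
  exact hyp_injective h

theorem pt_hyp (z : ℍ) : pt (hyp z) = z := by
  apply hyp_injective
  rw [hyp_pt (hyp_mem_Fut z), mink_hyp_self]; simp

theorem eq_pt {P : V3} (hP : IsFut P) {q : ℍ} {c : ℝ} (hc : 0 < c) (h : P = c • hyp q) :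
    pt P = q := by
  have h1 : 0 < √(mink P P) := Real.sqrt_pos.2 hP.1
  refine hyp_eq_smul_unique (c := (√(mink P P))⁻¹ * c) (by positivity) ?_
  rw [hyp_pt hP, mul_smul, ← h]

theorem exists_smul_hyp {P : V3} (hP : IsFut P) : ∃ c : ℝ, 0 < c ∧ P = c • hyp (pt P) := by
  have h1 : 0 < √(mink P P) := Real.sqrt_pos.2 hP.1
  refine ⟨_, h1, ?_⟩
  rw [hyp_pt hP, smul_smul, mul_inv_cancel₀ h1.ne', one_smul]

theorem pt_smul {P : V3} (hP : IsFut P) {c : ℝ} (hc : 0 < c) : pt (c • P) = pt P := by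
  obtain ⟨d, hd, h⟩ := exists_smul_hyp hP
  refine eq_pt (hP.smul hc) (c := c * d) (by positivity) ?_
  rw [mul_smul, ← h]

theorem continuousOn_pt : ContinuousOn pt {P | IsFut P} := by
  rw [continuousOn_iff_continuous_domRestrict]
  rw [UpperHalfPlane.isEmbedding_coe.continuous_iff]
  have : (UpperHalfPlane.coe ∘ {P | IsFut P}.domRestrict pt) = fun P : {P | IsFut P} =>
      (⟨P.1.1 / P.1.2.2, √(mink P.1 P.1) / P.1.2.2⟩ : ℂ) := by
    funext P
    apply Complex.ext
    · exact pt_re P.2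
    · exact pt_im P.2
  rw [this]
  have hm : Continuous fun P : {P | IsFut P} => mink P.1 P.1 := by
    simp only [mink_apply]; fun_prop
  have h2 : ∀ P : {P | IsFut P}, P.1.2.2 ≠ 0 := fun P => P.2.2.ne'
  have c2 : Continuous fun P : {P | IsFut P} => P.1.2.2 := by fun_prop
  have c1 : Continuous fun P : {P | IsFut P} => P.1.1 := by fun_prop
  have e : (fun P : {P | IsFut P} => (⟨P.1.1 / P.1.2.2, √(mink P.1 P.1) / P.1.2.2⟩ : ℂ)) =
    fun P : {P | IsFut P} => Complex.equivRealProdCLM.symm (P.1.1 / P.1.2.2, √(mink P.1 P.1) / P.1.2.2) := by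
    funext P; rfl
  rw [e]
  exact Complex.equivRealProdCLM.symm.continuous.comp
    ((c1.div c2 h2).prodMk (hm.sqrt.div c2 h2))

/-- Vectors orthogonal to a point of the hyperboloid are spacelike. -/
theorem eq_zero_of_orthogonal {v P : V3} (hv : IsFut v) (h : mink v P = 0) (hP : 0 ≤ mink P P) :
    P = 0 := by
  by_contra hne
  have hst : P.2.1 + P.2.2 ≠ 0 := by
    intro h0
    rw [mink_apply] at hP
    have e : P.2.2 = -P.2.1 := by linarith
    rw [e] at hP
    have h1 : P.1 = 0 := by nlinarith [sq_nonneg P.1, sq_nonneg P.2.1]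
    have h2 : P.2.1 = 0 := by nlinarith [sq_nonneg P.1, sq_nonneg P.2.1]
    apply hne
    refine Prod.ext h1 (Prod.ext h2 ?_)
    rw [e, h2]; simp
  -- A nonzero vector of nonnegative square lies, up to sign, in the closed future cone, where the
  -- product with v is positive.
  rcases hst.lt_or_gt with h0 | h0
  · have : IsCFut (-P) := ⟨by simpa using hP, by simp only [Prod.snd_neg, Prod.fst_neg]; linarith⟩
    have := hv.mink_pos this
    rw [map_neg, h] at this; simp at this
  · have := hv.mink_pos (Q := P) ⟨hP, h0⟩
    linarith

theorem mink_nondegenerate {P : V3} (h : ∀ Q, mink P Q = 0) : P = 0 := by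
  have h1 := h (1, 0, 0); have h2 := h (0, 1, 0); have h3 := h (0, 0, 1)
  simp only [mink_apply] at h1 h2 h3
  refine Prod.ext ?_ (Prod.ext ?_ ?_) <;> simp <;> linarith

/-- A vector orthogonal to a common normal of two points is a combination of them. -/
theorem exists_combination {v w D P : V3} (hv : IsFut v) (hw : mink v v * mink w w < mink v w ^ 2)
    (hD : D ≠ 0) (hvD : mink v D = 0) (hwD : mink w D = 0) (hP : mink P D = 0) :
    ∃ α β : ℝ, P = α • v + β • w := by
  -- The inequality `hw` says that v and w span a Lorentzian plane. Its normal is then spacelike, so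
  -- v, w and the normal form a basis.
  have hc : mink (cross v w) (cross v w) < 0 := by rw [mink_cross_self]; linarith
  have hd : det3 v w (cross v w) ≠ 0 := by rw [← mink_cross]; exact hc.ne
  have e1 := cramer_div hd D
  have e2 := cramer_div hd P
  set N := cross v w
  have hvN : mink v N = 0 := by rw [mink_comm, mink_cross, det3_left]
  have hwN : mink w N = 0 := by rw [mink_comm, mink_cross, det3_right]
  -- `D` is a multiple of `N`
  have hDN : ∃ c : ℝ, D = c • N := by
    refine ⟨det3 v w D / det3 v w N, ?_⟩
    set a := det3 w N D / det3 v w N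
    set b := det3 N v D / det3 v w N
    set c := det3 v w D / det3 v w N
    have q : mink v (a • v + b • w) = 0 ∧ mink w (a • v + b • w) = 0 := by
      constructor
      · have := hvD; rw [e1] at this; simpa [hvN] using this
      · have := hwD; rw [e1] at this; simpa [hwN] using this
    -- The component of D in the plane of v and w is orthogonal to that plane, so it has square zero
    -- and is orthogonal to v.
    have z : a • v + b • w = 0 := by
      apply eq_zero_of_orthogonal hv q.1
      have e : ∀ R, mink (a • v + b • w) R = a * mink v R + b * mink w R := fun R => by simp
      rw [e, q.1, q.2]; simp
    rw [e1, z, zero_add]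
  obtain ⟨c, hc'⟩ := hDN
  have hc0 : c ≠ 0 := by rintro rfl; exact hD (by simpa using hc')
  refine ⟨det3 w N P / det3 v w N, det3 N v P / det3 v w N, ?_⟩
  have : det3 v w P = 0 := by
    have h3 : mink P N = 0 := by
      rw [hc', map_smul, smul_eq_mul] at hP
      exact (mul_eq_zero.1 hP).resolve_left hc0
    rw [← mink_cross, mink_comm]; exact h3
  rw [this] at e2
  simpa using e2
end

section
/-! ### Geodesic arcs and convex cones -/

/-- The Gram determinant of two distinct points is 1 - c² with c > 1 the cosh of their distance, so
the points are linearly independent. -/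
theorem pair_unique {x y : ℍ} (h : x ≠ y) {a b a' b' : ℝ}
    (e : a • hyp x + b • hyp y = a' • hyp x + b' • hyp y) : a = a' ∧ b = b' := by
  have e1 := congrArg (mink (hyp x)) e
  have e2 := congrArg (mink (hyp y)) e
  simp only [map_add, map_smul, smul_eq_mul, mink_hyp_self, mink_comm (hyp y) (hyp x)] at e1 e2
  have hc := one_lt_mink_hyp h
  set c := mink (hyp x) (hyp y)
  have : (b - b') * (c ^ 2 - 1) = 0 := by linear_combination c * e1 - e2
  have hb : b = b' := by
    rcases mul_eq_zero.1 this with h | h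
    · linarith
    · nlinarith
  refine ⟨?_, hb⟩
  rw [hb] at e1; linarith

theorem isFut_comb (x y : ℍ) {a b : ℝ} (ha : 0 ≤ a) (hb : 0 ≤ b) (h : 0 < a + b) :
    IsFut (a • hyp x + b • hyp y) := by
  rcases ha.lt_or_eq with ha' | rfl
  · rcases hb.lt_or_eq with hb' | rfl
    · exact ((hyp_mem_Fut x).smul ha').add_cfut ((hyp_mem_Fut y).smul hb').cfut
    · simpa using (hyp_mem_Fut x).smul ha'
  · have : 0 < b := by linarith
    simpa using (hyp_mem_Fut y).smul this

/-- Equality in the triangle inequality corresponds to the addition theorems for sinh and cosh: the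
coefficients of p are sinh d(p, y) / sinh d(x, y) and sinh d(x, p) / sinh d(x, y). -/
theorem mem_geodesicArc_iff {x y p : ℍ} : p ∈ geodesicArc x y ↔
    ∃ a b : ℝ, 0 ≤ a ∧ 0 ≤ b ∧ hyp p = a • hyp x + b • hyp y := by
  constructor
  · intro h
    have h : dist x p + dist p y = dist x y := h
    rcases eq_or_ne x y with rfl | hne
    · refine ⟨1, 0, zero_le_one, le_rfl, ?_⟩
      have : dist x p = 0 := by
        rw [dist_self] at h
        linarith [dist_nonneg (x := x) (y := p), dist_nonneg (x := p) (y := x)]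
      rw [dist_eq_zero.1 this]; simp
    · have hd : 0 < dist x y := dist_pos.2 hne
      have hs : 0 < Real.sinh (dist x y) := Real.sinh_pos_iff.2 hd
      have hsa : 0 ≤ Real.sinh (dist x p) := Real.sinh_nonneg_iff.2 dist_nonneg
      have hsb : 0 ≤ Real.sinh (dist p y) := Real.sinh_nonneg_iff.2 dist_nonneg
      have sadd : Real.sinh (dist x y) = Real.sinh (dist x p) * Real.cosh (dist p y)
          + Real.cosh (dist x p) * Real.sinh (dist p y) := by rw [← h, Real.sinh_add]
      have cadd : Real.cosh (dist x y) = Real.cosh (dist x p) * Real.cosh (dist p y)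
          + Real.sinh (dist x p) * Real.sinh (dist p y) := by rw [← h, Real.cosh_add]
      have ha2 := Real.cosh_sq (dist x p)
      have hb2 := Real.cosh_sq (dist p y)
      have B1 : mink (hyp x) (hyp p) = Real.cosh (dist x p) := (cosh_dist_eq _ _).symm
      have B2 : mink (hyp p) (hyp y) = Real.cosh (dist p y) := (cosh_dist_eq _ _).symm
      have B3 : mink (hyp x) (hyp y) = Real.cosh (dist x y) := (cosh_dist_eq _ _).symm
      set s := Real.sinh (dist x y)
      set sa := Real.sinh (dist x p)
      set sb := Real.sinh (dist p y)
      set ca := Real.cosh (dist x p)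
      set cb := Real.cosh (dist p y)
      set c := Real.cosh (dist x y)
      have hαβ : 0 < sb / s + sa / s := by
        rw [← add_div]
        apply div_pos _ hs
        rcases hsa.lt_or_eq with h1 | h1
        · linarith
        · rcases hsb.lt_or_eq with h2 | h2
          · linarith
          · rw [← h1, ← h2] at sadd; simp at sadd; linarith
      have hF := isFut_comb x y (div_nonneg hsb hs.le) (div_nonneg hsa hs.le) hαβ
      -- The vector with these coefficients has square 1 and product 1 with `hyp p`, and two points
      -- of the sheet with product 1 coincide.
      set P := (sb / s) • hyp x + (sa / s) • hyp y with hP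
      have hPP : mink P P = 1 := by
        simp only [hP, map_add, map_smul, LinearMap.add_apply, LinearMap.smul_apply, smul_eq_mul,
          mink_hyp_self, mink_comm (hyp y) (hyp x), B3]
        have : s ≠ 0 := hs.ne'
        field_simp
        rw [cadd, sadd]
        linear_combination (-sb ^ 2) * ha2 - sa ^ 2 * hb2
      have hPp : mink P (hyp p) = 1 := by
        simp only [hP, map_add, map_smul, LinearMap.add_apply, LinearMap.smul_apply, smul_eq_mul,
          B1, mink_comm (hyp y) (hyp p), B2]
        have : s ≠ 0 := hs.ne'
        field_simp
        rw [sadd]; ring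
      have e : hyp (pt P) = P := by rw [hyp_pt hF, hPP]; simp
      refine ⟨_, _, div_nonneg hsb hs.le, div_nonneg hsa hs.le, ?_⟩
      rw [← hP, ← e]
      congr 1
      refine (eq_of_mink_hyp_eq_one ?_).symm
      rw [e, hPp]
  · rintro ⟨a, b, ha, hb, h⟩
    show dist x p + dist p y = dist x y
    have c1 := cosh_dist_eq x p
    have c2 := cosh_dist_eq p y
    have c3 := cosh_dist_eq x y
    have n := mink_hyp_self p
    rw [h] at c1 c2 n
    simp only [map_add, map_smul, LinearMap.add_apply, LinearMap.smul_apply, smul_eq_mul,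
          mink_hyp_self, mink_comm (hyp y) (hyp x), ← c3] at c1 c2 n
    have ha2 := Real.cosh_sq (dist x p)
    have hb2 := Real.cosh_sq (dist p y)
    have hc2 := Real.cosh_sq (dist x y)
    have hs : 0 ≤ Real.sinh (dist x y) := Real.sinh_nonneg_iff.2 dist_nonneg
    have hsa : 0 ≤ Real.sinh (dist x p) := Real.sinh_nonneg_iff.2 dist_nonneg
    have hsb : 0 ≤ Real.sinh (dist p y) := Real.sinh_nonneg_iff.2 dist_nonneg
    -- The normalization of `hyp p` yields both values of sinh, and from them the cosh of the sum of
    -- the two distances.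
    have ea : Real.sinh (dist x p) = b * Real.sinh (dist x y) := by
      rw [← sq_eq_sq₀ hsa (by positivity)]
      rw [c1] at ha2
      linear_combination (-1) * ha2 + b ^ 2 * hc2 + n
    have eb : Real.sinh (dist p y) = a * Real.sinh (dist x y) := by
      rw [← sq_eq_sq₀ hsb (by positivity)]
      rw [c2] at hb2
      linear_combination (-1) * hb2 + a ^ 2 * hc2 + n
    have : Real.cosh (dist x p + dist p y) = Real.cosh (dist x y) := by
      rw [Real.cosh_add, ea, eb, c1, c2]
      linear_combination Real.cosh (dist x y) * n - a * b * hc2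
    have h1 := Real.cosh_le_cosh.1 this.le
    have h2 := Real.cosh_le_cosh.1 this.ge
    rw [abs_of_nonneg (by positivity), abs_of_nonneg (by positivity)] at h1 h2
    linarith

theorem left_mem_geodesicArc (x y : ℍ) : x ∈ geodesicArc x y := by simp [geodesicArc]
theorem right_mem_geodesicArc (x y : ℍ) : y ∈ geodesicArc x y := by simp [geodesicArc]

theorem geodesicArc_comm (x y : ℍ) : geodesicArc x y = geodesicArc y x := by
  ext p
  show dist x p + dist p y = dist x y ↔ dist y p + dist p x = dist y x
  rw [dist_comm x p, dist_comm p y, dist_comm x y, add_comm]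

theorem isClosed_geodesicArc (x y : ℍ) : IsClosed (geodesicArc x y) :=
  isClosed_eq (by fun_prop) (by fun_prop)

theorem isCompact_geodesicArc (x y : ℍ) : IsCompact (geodesicArc x y) := by
  refine (isCompact_closedBall x (dist x y)).of_isClosed_subset (isClosed_geodesicArc x y) ?_
  intro p hp
  have hp : dist x p + dist p y = dist x y := hp
  rw [mem_closedBall, dist_comm]
  linarith [dist_nonneg (x := p) (y := y)]

/-- If p lies strictly between q and r, a coefficient that vanishes for p vanishes for q as well;
then p and q lie on one ray and are equal. Thus the metric notion of interior amounts to positivity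
of both coefficients. -/
theorem mem_arcInterior_geodesicArc {x y p : ℍ} (hne : x ≠ y) :
    p ∈ arcInterior (geodesicArc x y) ↔
      ∃ a b : ℝ, 0 < a ∧ 0 < b ∧ hyp p = a • hyp x + b • hyp y := by
  constructor
  · rintro ⟨hp, q, hq, r, hr, hqp, hrp, hd⟩
    obtain ⟨a, b, ha, hb, hab⟩ := mem_geodesicArc_iff.1 hp
    obtain ⟨a1, b1, ha1, hb1, h1⟩ := mem_geodesicArc_iff.1 hq
    obtain ⟨a2, b2, ha2, hb2, h2⟩ := mem_geodesicArc_iff.1 hr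
    obtain ⟨s, t, hs, ht, hst⟩ := mem_geodesicArc_iff.1 (show p ∈ geodesicArc q r from hd)
    rw [h1, h2, hab] at hst
    have e : a • hyp x + b • hyp y = (s * a1 + t * a2) • hyp x + (s * b1 + t * b2) • hyp y := by
      rw [hst]; module
    obtain ⟨ea, eb⟩ := pair_unique hne e
    have hst0 : s = 0 → p = r := fun hs0 => by
      rw [hs0, zero_smul, zero_add, ← h2, ← hab] at hst
      rcases ht.lt_or_eq with ht' | ht'
      · exact hyp_eq_smul_unique ht' hst
      · rw [← ht', zero_smul] at hst
        have := mink_hyp_self p; rw [hst] at this; simp at this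
    have hst1 : t = 0 → p = q := fun hs0 => by
      rw [hs0, zero_smul, add_zero, ← h1, ← hab] at hst
      rcases hs.lt_or_eq with ht' | ht'
      · exact hyp_eq_smul_unique ht' hst
      · rw [← ht', zero_smul] at hst
        have := mink_hyp_self p; rw [hst] at this; simp at this
    have hs' : 0 < s := lt_of_le_of_ne hs fun h0 => hrp (hst0 h0.symm).symm
    have ht' : 0 < t := lt_of_le_of_ne ht fun h0 => hqp (hst1 h0.symm).symm
    have aux : ∀ {q : ℍ} {u v w : ℝ} {z : ℍ}, hyp q = u • hyp z → 0 ≤ u → hyp p = w • hyp z →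
        0 ≤ w → q = p := by
      intro q u v w z e1 hu e2 hw
      have hu' : 0 < u := lt_of_le_of_ne hu fun h => by
        have := mink_hyp_self q; rw [e1, ← h] at this; simp at this
      have hw' : 0 < w := lt_of_le_of_ne hw fun h => by
        have := mink_hyp_self p; rw [e2, ← h] at this; simp at this
      rw [hyp_eq_smul_unique hu' e1, hyp_eq_smul_unique hw' e2]
    refine ⟨a, b, lt_of_le_of_ne ha fun h0 => ?_, lt_of_le_of_ne hb fun h0 => ?_, hab⟩
    · have z1 : a1 = 0 := by
        have := mul_nonneg hs ha1; have := mul_nonneg ht ha2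
        have : s * a1 = 0 := by linarith
        exact (mul_eq_zero.1 this).resolve_left hs'.ne'
      rw [z1, zero_smul, zero_add] at h1
      rw [← h0, zero_smul, zero_add] at hab
      exact hqp (aux (v := 0) h1 hb1 hab hb)
    · have z1 : b1 = 0 := by
        have := mul_nonneg hs hb1; have := mul_nonneg ht hb2
        have : s * b1 = 0 := by linarith
        exact (mul_eq_zero.1 this).resolve_left hs'.ne'
      rw [z1, zero_smul, add_zero] at h1
      rw [← h0, zero_smul, add_zero] at hab
      exact hqp (aux (v := 0) h1 ha1 hab ha)
  · rintro ⟨a, b, ha, hb, h⟩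
    have hp : p ∈ geodesicArc x y := mem_geodesicArc_iff.2 ⟨a, b, ha.le, hb.le, h⟩
    refine ⟨hp, x, left_mem_geodesicArc x y, y, right_mem_geodesicArc x y, ?_, ?_, hp⟩
    · rintro rfl
      have : (1 : ℝ) • hyp x + (0 : ℝ) • hyp y = a • hyp x + b • hyp y := by rw [← h]; simp
      exact hb.ne (pair_unique hne this).2
    · rintro rfl
      have : (0 : ℝ) • hyp x + (1 : ℝ) • hyp y = a • hyp x + b • hyp y := by rw [← h]; simp
      exact ha.ne (pair_unique hne this).1

theorem mem_arcInterior_geodesicArc' {x y p : ℍ} (hne : x ≠ y) :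
    p ∈ arcInterior (geodesicArc x y) ↔ p ∈ geodesicArc x y ∧ p ≠ x ∧ p ≠ y := by
  constructor
  · intro h
    refine ⟨h.1, ?_⟩
    obtain ⟨a, b, ha, hb, e⟩ := (mem_arcInterior_geodesicArc hne).1 h
    constructor
    · rintro rfl
      have : (1 : ℝ) • hyp p + (0 : ℝ) • hyp y = a • hyp p + b • hyp y := by rw [← e]; simp
      exact hb.ne (pair_unique hne this).2
    · rintro rfl
      have : (0 : ℝ) • hyp x + (1 : ℝ) • hyp p = a • hyp x + b • hyp p := by rw [← e]; simp
      exact ha.ne (pair_unique hne this).1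
  · rintro ⟨h, h1, h2⟩
    exact ⟨h, x, left_mem_geodesicArc x y, y, right_mem_geodesicArc x y, h1.symm, h2.symm, h⟩

/-- The convex cone spanned by a set of points of the hyperboloid. -/
noncomputable def cone (A : Set ℍ) : Submodule ℝ≥0 V3 := Submodule.span ℝ≥0 (hyp '' A)

theorem hyp_mem_cone {A : Set ℍ} {x : ℍ} (h : x ∈ A) : hyp x ∈ cone A :=
  Submodule.subset_span (mem_image_of_mem _ h)

theorem cone_smul {A : Set ℍ} {P : V3} (h : P ∈ cone A) {c : ℝ} (hc : 0 ≤ c) : c • P ∈ cone A :=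
  (cone A).smul_mem (⟨c, hc⟩ : ℝ≥0) h

theorem cone_mono {A B : Set ℍ} (h : A ⊆ B) : cone A ≤ cone B :=
  Submodule.span_mono (image_mono h)

theorem cone_induction {A : Set ℍ} {C : V3 → Prop} (h0 : C 0) (hx : ∀ x ∈ A, C (hyp x))
    (hadd : ∀ P Q, P ∈ cone A → Q ∈ cone A → C P → C Q → C (P + Q))
    (hsmul : ∀ (c : ℝ) P, 0 < c → P ∈ cone A → C P → C (c • P)) {P : V3} (h : P ∈ cone A) : C P := by
  refine Submodule.span_induction (p := fun P _ => C P) ?_ h0 ?_ ?_ h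
  · rintro _ ⟨x, hxA, rfl⟩; exact hx x hxA
  · exact fun P Q hP hQ => hadd P Q hP hQ
  · intro c P hP hC
    rcases eq_zero_or_pos c with rfl | hc
    · simpa using h0
    · exact hsmul c P (by exact_mod_cast hc) hP hC

theorem convex_cone (A : Set ℍ) : Convex ℝ (cone A : Set V3) := by
  intro P hP Q hQ a b ha hb _
  exact (cone A).add_mem (cone_smul hP ha) (cone_smul hQ hb)

theorem nonneg_of_mem_cone {A : Set ℍ} {l : V3 →ₗ[ℝ] ℝ} (hl : ∀ x ∈ A, 0 ≤ l (hyp x)) {P : V3}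
    (h : P ∈ cone A) : 0 ≤ l P := by
  refine cone_induction (C := fun P => 0 ≤ l P) (by simp) hl ?_ ?_ h
  · intro P Q _ _ h1 h2; rw [map_add]; linarith
  · intro c P hc _ h1; rw [map_smul]; exact mul_nonneg hc.le h1

/-- A sum of nonnegative numbers vanishes only if all of them do. Supporting functionals applied in
this way single out the sides of Delaunay cells. -/
theorem mem_cone_face {A : Set ℍ} {l : V3 →ₗ[ℝ] ℝ} (hl : ∀ x ∈ A, 0 ≤ l (hyp x)) {P : V3}
    (h : P ∈ cone A) (hP : l P = 0) : P ∈ cone {x ∈ A | l (hyp x) = 0} := by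
  refine cone_induction (C := fun P => l P = 0 → P ∈ cone {x ∈ A | l (hyp x) = 0})
    (fun _ => Submodule.zero_mem _) (fun x hx h => hyp_mem_cone ⟨hx, h⟩) ?_ ?_ h hP
  · intro P Q hP hQ h1 h2 h
    have := nonneg_of_mem_cone hl hP; have := nonneg_of_mem_cone hl hQ
    rw [map_add] at h
    exact Submodule.add_mem _ (h1 (by linarith)) (h2 (by linarith))
  · intro c P hc _ h1 h
    rw [map_smul, smul_eq_mul] at h
    exact cone_smul (h1 ((mul_eq_zero.1 h).resolve_left hc.ne')) hc.le

theorem mem_cone_pair {x y : ℍ} {P : V3} : P ∈ cone {x, y} ↔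
    ∃ a b : ℝ, 0 ≤ a ∧ 0 ≤ b ∧ P = a • hyp x + b • hyp y := by
  rw [cone, image_pair, Submodule.mem_span_pair]
  constructor
  · rintro ⟨a, b, rfl⟩; exact ⟨a, b, a.2, b.2, rfl⟩
  · rintro ⟨a, b, ha, hb, rfl⟩; exact ⟨⟨a, ha⟩, ⟨b, hb⟩, rfl⟩

theorem isFut_of_mem_cone {A : Set ℍ} {P : V3} (h : P ∈ cone A) (h0 : P ≠ 0) : IsFut P := by
  refine (cone_induction (C := fun P => P = 0 ∨ IsFut P) (Or.inl rfl)
    (fun x _ => Or.inr (hyp_mem_Fut x)) ?_ ?_ h).resolve_left h0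
  · rintro P Q _ _ (rfl | h1) (rfl | h2)
    · simp
    · simpa using Or.inr h2
    · simpa using Or.inr h1
    · exact Or.inr (h1.add_cfut h2.cfut)
  · rintro c P hc _ (rfl | h1)
    · simp
    · exact Or.inr (h1.smul hc)

theorem smul_mem_cone_iff {A : Set ℍ} {P : V3} {c : ℝ} (hc : 0 < c) :
    c • P ∈ cone A ↔ P ∈ cone A := by
  refine ⟨fun h => ?_, fun h => cone_smul h hc.le⟩
  have := cone_smul h (inv_nonneg.2 hc.le)
  rwa [smul_smul, inv_mul_cancel₀ hc.ne', one_smul] at this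

/-- Arcs are nonnegative combinations, so sets closed under arcs correspond to convex cones. The
zero vector represents no point of ℍ and is carried through the induction as a separate alternative.
-/
theorem mem_geodesicHull {A : Set ℍ} {p : ℍ} : p ∈ geodesicHull A ↔ hyp p ∈ cone A := by
  constructor
  · intro h
    refine mem_sInter.1 h {p | hyp p ∈ cone A} ⟨fun x hx => hyp_mem_cone hx, ?_⟩
    intro x hx y hy p hp
    obtain ⟨a, b, ha, hb, e⟩ := mem_geodesicArc_iff.1 hp
    simp only [mem_ofPred_eq, e]
    exact Submodule.add_mem _ (cone_smul hx ha) (cone_smul hy hb)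
  · intro h
    refine mem_sInter.2 ?_
    rintro C ⟨hA, hC⟩
    have := cone_induction (A := A) (C := fun P => P = 0 ∨ (IsFut P ∧ pt P ∈ C)) (Or.inl rfl)
      (fun x hx => Or.inr ⟨hyp_mem_Fut x, by rw [pt_hyp]; exact hA hx⟩) ?_ ?_ h
    · rcases this with h0 | ⟨_, h1⟩
      · have := mink_hyp_self p; rw [h0] at this; simp at this
      · rwa [pt_hyp] at h1
    · rintro P Q _ _ (rfl | ⟨f1, h1⟩) (rfl | ⟨f2, h2⟩)
      · simp
      · right; simpa using ⟨f2, h2⟩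
      · right; simpa using ⟨f1, h1⟩
      · right
        have hF := f1.add_cfut f2.cfut
        refine ⟨hF, hC _ h1 _ h2 (mem_geodesicArc_iff.2 ?_)⟩
        obtain ⟨c, hc, e⟩ := exists_smul_hyp f1
        obtain ⟨d, hd, e'⟩ := exists_smul_hyp f2
        have hr : 0 ≤ (√(mink (P + Q) (P + Q)))⁻¹ := by positivity
        refine ⟨_, _, mul_nonneg hr hc.le, mul_nonneg hr hd.le, ?_⟩
        rw [hyp_pt hF, mul_smul, mul_smul, ← e, ← e', smul_add]
    · rintro c P hc _ (rfl | ⟨f1, h1⟩)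
      · simp
      · exact Or.inr ⟨f1.smul hc, by rwa [pt_smul f1 hc]⟩

/-- Dividing by the total weight shows that every ray of the cone meets the convex hull of the
generators. For finite sets this gives a compact base, on which compactness of hulls and closedness
of cones rest. -/
theorem exists_convexHull_of_mem_cone {A : Set ℍ} {P : V3} (h : P ∈ cone A) (h0 : P ≠ 0) :
    ∃ c : ℝ, 0 < c ∧ ∃ Q ∈ convexHull ℝ (hyp '' A), P = c • Q := by
  refine (cone_induction (C := fun P => P = 0 ∨ ∃ c : ℝ, 0 < c ∧
    ∃ Q ∈ convexHull ℝ (hyp '' A), P = c • Q) (Or.inl rfl) ?_ ?_ ?_ h).resolve_left h0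
  · exact fun x hx => Or.inr ⟨1, one_pos, hyp x, subset_convexHull _ _ (mem_image_of_mem _ hx),
      by simp⟩
  · rintro P Q _ _ (rfl | ⟨c, hc, P', hP, rfl⟩) (rfl | ⟨d, hd, Q', hQ, rfl⟩)
    · simp
    · right; exact ⟨d, hd, Q', hQ, zero_add _⟩
    · right; exact ⟨c, hc, P', hP, add_zero _⟩
    · right
      have hcd : 0 < c + d := by linarith
      refine ⟨c + d, hcd, (c / (c + d)) • P' + (d / (c + d)) • Q',
        convex_convexHull ℝ _ hP hQ (by positivity) (by positivity)
          (by rw [← add_div, div_self hcd.ne']), ?_⟩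
      rw [smul_add, smul_smul, smul_smul, mul_div_cancel₀ _ hcd.ne', mul_div_cancel₀ _ hcd.ne']
  · rintro c P hc _ (rfl | ⟨d, hd, P', hP, rfl⟩)
    · simp
    · right; exact ⟨c * d, by positivity, P', hP, by rw [smul_smul]⟩

theorem convexHull_subset_cone (A : Set ℍ) : convexHull ℝ (hyp '' A) ⊆ cone A :=
  convexHull_min (by rintro _ ⟨x, hx, rfl⟩; exact hyp_mem_cone hx) (convex_cone A)

theorem isFut_of_mem_convexHull {A : Set ℍ} {P : V3} (h : P ∈ convexHull ℝ (hyp '' A)) :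
    IsFut P := by
  refine (convexHull_min (t := {P | IsFut P}) ?_ ?_ h)
  · rintro _ ⟨x, _, rfl⟩; exact hyp_mem_Fut x
  · intro P hP Q hQ a b ha hb hab
    rcases ha.lt_or_eq with ha' | rfl
    · rcases hb.lt_or_eq with hb' | rfl
      · exact (hP.smul ha').add_cfut (hQ.smul hb').cfut
      · have : a = 1 := by linarith
        simpa [this] using hP
    · have : b = 1 := by linarith
      simpa [this] using hQ

theorem geodesicHull_eq_image (A : Set ℍ) :
    geodesicHull A = pt '' convexHull ℝ (hyp '' A) := by
  ext p
  rw [mem_geodesicHull]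
  constructor
  · intro h
    have hp : hyp p ≠ 0 := fun h0 => by have := mink_hyp_self p; rw [h0] at this; simp at this
    obtain ⟨c, hc, Q, hQ, e⟩ := exists_convexHull_of_mem_cone h hp
    refine ⟨Q, hQ, ?_⟩
    rw [← pt_smul (isFut_of_mem_convexHull hQ) hc, ← e, pt_hyp]
  · rintro ⟨Q, hQ, rfl⟩
    rw [hyp_pt (isFut_of_mem_convexHull hQ)]
    exact cone_smul (convexHull_subset_cone A hQ) (by positivity)

theorem isCompact_geodesicHull {A : Set ℍ} (hA : A.Finite) : IsCompact (geodesicHull A) := by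
  rw [geodesicHull_eq_image]
  exact ((hA.image hyp).isCompact_convexHull ℝ).image_of_continuousOn
    (continuousOn_pt.mono fun P hP => isFut_of_mem_convexHull hP)
end

section
/-! ### Voronoi tessellations of nets -/

/-- A locally finite, relatively dense subset of the hyperbolic plane. -/
structure IsNet (S : Set ℍ) : Prop where
  finite_inter : ∀ p r, (S ∩ closedBall p r).Finite
  exists_dist_le : ∃ R, ∀ p, ∃ x ∈ S, dist p x ≤ R

/-- The points of `S` nearest to `p`. -/
def near (S : Set ℍ) (p : ℍ) : Set ℍ := {x | x ∈ S ∧ p ∈ voronoiCell S x}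

variable {S : Set ℍ}

theorem mem_near_iff {p x : ℍ} : x ∈ near S p ↔
    x ∈ S ∧ ∀ y ∈ S, mink (hyp p) (hyp x) ≤ mink (hyp p) (hyp y) := by
  constructor
  · rintro ⟨h1, h2⟩
    refine ⟨h1, fun y hy => ?_⟩
    rcases eq_or_ne y x with rfl | hne
    · exact le_rfl
    · exact dist_le_dist_iff.1 (h2 y hy hne)
  · rintro ⟨h1, h2⟩
    exact ⟨h1, fun y hy _ => dist_le_dist_iff.2 (h2 y hy)⟩

theorem near_dist_le {p x y : ℍ} (hx : x ∈ near S p) (hy : y ∈ S) : dist p x ≤ dist p y :=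
  dist_le_dist_iff.2 ((mem_near_iff.1 hx).2 y hy)

theorem near_eq {p x y : ℍ} (hx : x ∈ near S p) (hy : y ∈ near S p) :
    mink (hyp p) (hyp x) = mink (hyp p) (hyp y) :=
  le_antisymm ((mem_near_iff.1 hx).2 y hy.1) ((mem_near_iff.1 hy).2 x hx.1)

theorem near_lt {p x z : ℍ} (hx : x ∈ near S p) (hz : z ∈ S) (hz' : z ∉ near S p) :
    mink (hyp p) (hyp x) < mink (hyp p) (hyp z) := by
  refine lt_of_le_of_ne ((mem_near_iff.1 hx).2 z hz) fun h => hz' (mem_near_iff.2 ⟨hz, ?_⟩)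
  rw [← h]; exact (mem_near_iff.1 hx).2

theorem near_of_eq {p x z : ℍ} (hx : x ∈ near S p) (hz : z ∈ S)
    (h : mink (hyp p) (hyp z) = mink (hyp p) (hyp x)) : z ∈ near S p :=
  mem_near_iff.2 ⟨hz, by rw [h]; exact (mem_near_iff.1 hx).2⟩

theorem IsNet.nonempty_near (hS : IsNet S) (p : ℍ) : (near S p).Nonempty := by
  obtain ⟨R, hR⟩ := hS.exists_dist_le
  obtain ⟨x, hx, hxR⟩ := hR p
  obtain ⟨y, hy, hmin⟩ := Set.exists_min_image _ (fun z => dist p z) (hS.finite_inter p R)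
    ⟨x, hx, by rwa [mem_closedBall, dist_comm]⟩
  refine ⟨y, hy.1, fun z hz _ => ?_⟩
  by_cases h : z ∈ closedBall p R
  · exact hmin z ⟨hz, h⟩
  · rw [mem_closedBall, not_le, dist_comm] at h
    have := hy.2
    rw [mem_closedBall, dist_comm] at this
    linarith

theorem IsNet.exists_near_dist_le (hS : IsNet S) : ∃ R, ∀ p, ∀ x ∈ near S p, dist p x ≤ R := by
  obtain ⟨R, hR⟩ := hS.exists_dist_le
  refine ⟨R, fun p x hx => ?_⟩
  obtain ⟨y, hy, hyR⟩ := hR p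
  exact (near_dist_le hx hy).trans hyR

theorem IsNet.finite_near (hS : IsNet S) (p : ℍ) : (near S p).Finite := by
  obtain ⟨R, hR⟩ := hS.exists_near_dist_le
  exact (hS.finite_inter p R).subset fun x hx =>
    ⟨hx.1, by rw [mem_closedBall, dist_comm]; exact hR p x hx⟩

/-- Points close to `p` are strictly closer to the nearest points of `p` than to the others. -/
theorem IsNet.eventually_lt (hS : IsNet S) (p : ℍ) : ∀ᶠ q in 𝓝 p, ∀ z ∈ S, z ∉ near S p →
    ∀ x ∈ near S p, mink (hyp q) (hyp x) < mink (hyp q) (hyp z) := by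
  obtain ⟨R, hR⟩ := hS.exists_near_dist_le
  -- For q within 1 of p, the nearest points of p are at distance less than R + 1 from q, while
  -- sites beyond R + 3 from p stay more than R + 2 away. Only the finitely many sites inside that
  -- ball need an argument.
  have h1 : ∀ᶠ q in 𝓝 p, ∀ z ∈ S ∩ closedBall p (R + 3), ∀ x ∈ near S p, z ∉ near S p →
      dist q x < dist q z := by
    rw [(hS.finite_inter p (R + 3)).eventually_all]
    intro z hz
    rw [(hS.finite_near p).eventually_all]
    intro x hx
    by_cases h : z ∈ near S p
    · exact Filter.Eventually.of_forall fun _ h' => absurd h h'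
    · have : dist p x < dist p z := dist_lt_dist_iff.2 (near_lt hx hz.1 h)
      have ho : IsOpen {q | dist q x < dist q z} := isOpen_lt (by fun_prop) (by fun_prop)
      filter_upwards [ho.mem_nhds this] with q hq _ using hq
  filter_upwards [h1, Metric.ball_mem_nhds p one_pos] with q hq hqp z hz hzn x hx
  rw [← dist_lt_dist_iff]
  by_cases h : z ∈ closedBall p (R + 3)
  · exact hq z ⟨hz, h⟩ x hx hzn
  · rw [mem_closedBall, not_le] at h
    rw [mem_ball] at hqp
    have h2 := hR p x hx
    have h3 := dist_triangle q p x
    have h4 := dist_triangle p q z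
    rw [dist_comm z p] at h
    rw [dist_comm p q] at h4
    linarith

theorem IsNet.eventually_mem_near (hS : IsNet S) (p : ℍ) : ∀ᶠ q in 𝓝 p, ∀ x ∈ near S p,
    (∀ y ∈ near S p, mink (hyp q) (hyp x) ≤ mink (hyp q) (hyp y)) → x ∈ near S q := by
  filter_upwards [hS.eventually_lt p] with q hq x hx h
  refine mem_near_iff.2 ⟨hx.1, fun y hy => ?_⟩
  by_cases hyp' : y ∈ near S p
  · exact h y hyp'
  · exact (hq y hy hyp' x hx).le

/-- The hyperbolic cosine of the distance to the nearest points of `S`. -/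
noncomputable def rad (S : Set ℍ) (p : ℍ) : ℝ :=
  -- The default 1 makes positivity hold for every set S, without assuming that nearest points
  -- exist.
  open Classical in if h : (near S p).Nonempty then mink (hyp p) (hyp h.some) else 1

theorem rad_eq {p x : ℍ} (hx : x ∈ near S p) : rad S p = mink (hyp p) (hyp x) := by
  have h : (near S p).Nonempty := ⟨x, hx⟩
  rw [rad, dif_pos h]
  exact near_eq h.some_mem hx

theorem rad_pos (p : ℍ) : 0 < rad S p := by
  rw [rad]; split_ifs
  · exact mink_hyp_pos _ _
  · exact one_pos

/-- The vector whose Minkowski product with the nearest points of `p` is one. -/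
noncomputable def ctr (S : Set ℍ) (p : ℍ) : V3 := (rad S p)⁻¹ • hyp p

theorem mink_ctr {p : ℍ} (P : V3) : mink (ctr S p) P = mink (hyp p) P / rad S p := by
  rw [ctr, map_smul, LinearMap.smul_apply, smul_eq_mul]; ring

theorem mink_ctr_near {p x : ℍ} (hx : x ∈ near S p) : mink (ctr S p) (hyp x) = 1 := by
  rw [mink_ctr, rad_eq hx, div_self (mink_hyp_pos _ _).ne']

/-- The plane on which ⟨ctr S p, ·⟩ equals 1 supports the set of sites and touches it in the nearest
points of p. The cells are thus faces of the convex hull of the sites, and the separation arguments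
for cells start from this inequality. -/
theorem IsNet.one_le_mink_ctr (hS : IsNet S) {p z : ℍ} (hz : z ∈ S) :
    1 ≤ mink (ctr S p) (hyp z) := by
  obtain ⟨x, hx⟩ := hS.nonempty_near p
  rw [mink_ctr, le_div_iff₀ (rad_pos p), one_mul, rad_eq hx]
  exact (mem_near_iff.1 hx).2 z hz

theorem IsNet.mink_ctr_eq_one_iff (hS : IsNet S) {p z : ℍ} (hz : z ∈ S) :
    mink (ctr S p) (hyp z) = 1 ↔ z ∈ near S p := by
  refine ⟨fun h => ?_, mink_ctr_near⟩
  obtain ⟨x, hx⟩ := hS.nonempty_near p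
  refine near_of_eq hx hz ?_
  rw [mink_ctr, div_eq_one_iff_eq (rad_pos p).ne'] at h
  rw [h, rad_eq hx]

theorem ctr_injective : Function.Injective (ctr S) := by
  intro p q h
  have hp := rad_pos (S := S) p
  have hq := inv_pos.2 (rad_pos (S := S) q)
  refine hyp_eq_smul_unique (c := rad S p * (rad S q)⁻¹) (by positivity) ?_
  rw [mul_smul]
  change _ = rad S p • ctr S q
  rw [← h, ctr, smul_smul, mul_inv_cancel₀ hp.ne', one_smul]

/-- The form obtained from the Minkowski form by subtracting the square of a linear form. -/
noncomputable def gform (u P Q : V3) : ℝ := mink P Q - mink u P * mink u Q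

/-- For this form the sites near p are isotropic, and their products no longer involve p. Cells that
share a side therefore induce the same data on it, which makes the later gluing possible. -/
theorem gform_near {p x y : ℍ} (hx : x ∈ near S p) (hy : y ∈ near S p) :
    gform (ctr S p) (hyp x) (hyp y) = mink (hyp x) (hyp y) - 1 := by
  rw [gform, mink_ctr_near hx, mink_ctr_near hy]; ring

theorem eq_smul_add_of_det3_eq_zero {x y z : V3} (h : det3 x y z = 0)
    (hc : mink x x * mink y y < mink x y ^ 2) : ∃ a b : ℝ, z = a • x + b • y := by
  have hd : det3 x y (cross x y) ≠ 0 := by rw [← mink_cross, mink_cross_self]; linarith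
  have e := cramer_div hd z
  rw [h] at e
  exact ⟨_, _, by simpa using e⟩

theorem mink_mul_lt {x y : ℍ} (h : x ≠ y) :
    mink (hyp x) (hyp x) * mink (hyp y) (hyp y) < mink (hyp x) (hyp y) ^ 2 := by
  rw [mink_hyp_self, mink_hyp_self]
  nlinarith [one_lt_mink_hyp h]

/-- Three distinct points on a circle are linearly independent. -/
theorem det3_ne_zero {p x y z : ℍ} (hx : x ∈ near S p) (hy : y ∈ near S p) (hz : z ∈ near S p)
    (hxy : x ≠ y) (hxz : x ≠ z) (hyz : y ≠ z) : det3 (hyp x) (hyp y) (hyp z) ≠ 0 := by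
  intro h
  obtain ⟨a, b, e⟩ := eq_smul_add_of_det3_eq_zero h (mink_mul_lt hxy)
  have e1 := mink_ctr_near hz
  have e2 := mink_hyp_self z
  rw [e] at e1 e2
  simp only [map_add, map_smul, smul_eq_mul, mink_ctr_near hx, mink_ctr_near hy,
    LinearMap.add_apply, LinearMap.smul_apply, mink_hyp_self, mink_comm (hyp y) (hyp x)] at e1 e2
  -- All three points have product 1 with the centre, so the coefficients add up to 1; the square of
  -- z then gives a(1 - a)(c - 1) = 0, that is, a line meets the sheet at most twice.
  have hb : b = 1 - a := by linarith
  have h3 := one_lt_mink_hyp hxy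
  have : (a * (1 - a)) * (mink (hyp x) (hyp y) - 1) = 0 := by
    rw [hb] at e2; linear_combination e2 / 2
  rcases mul_eq_zero.1 this with h | h
  · rcases mul_eq_zero.1 h with h | h
    · rw [hb, h] at e; exact hyz (hyp_injective (by simpa using e.symm))
    · have ha : a = 1 := by linarith
      rw [hb, ha] at e; exact hxz (hyp_injective (by simpa using e.symm))
  · linarith

theorem eq_zero_of_det3 {x y z : V3} (h : det3 x y z ≠ 0) {l : V3 →ₗ[ℝ] ℝ} (hx : l x = 0)
    (hy : l y = 0) (hz : l z = 0) (P : V3) : l P = 0 := by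
  rw [cramer_div h P]; simp [hx, hy, hz]

/-- A point equidistant from three points on a circle is its center. -/
theorem eq_center {p q x y z : ℍ} (hx : x ∈ near S p) (hy : y ∈ near S p) (hz : z ∈ near S p)
    (hxy : x ≠ y) (hxz : x ≠ z) (hyz : y ≠ z) (h1 : mink (hyp q) (hyp x) = mink (hyp q) (hyp y))
    (h2 : mink (hyp q) (hyp x) = mink (hyp q) (hyp z)) : q = p := by
  have hd := det3_ne_zero hx hy hz hxy hxz hyz
  have key : ∀ P, (mink (hyp q) - mink (hyp q) (hyp x) • mink (ctr S p)) P = 0 := by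
    apply eq_zero_of_det3 hd <;>
    simp [mink_ctr_near hx, mink_ctr_near hy, mink_ctr_near hz, h1]
    rw [← h1, h2]; simp
  have : hyp q - mink (hyp q) (hyp x) • ctr S p = 0 :=
    mink_nondegenerate fun Q => by simpa using key Q
  rw [sub_eq_zero, ctr, smul_smul] at this
  exact hyp_eq_smul_unique (mul_pos (mink_hyp_pos _ _) (inv_pos.2 (rad_pos p))) this

/-- `V_x ∩ V_y` is an edge of the Voronoi tessellation. -/
def IsEdge (S : Set ℍ) (x y : ℍ) : Prop :=
  x ∈ S ∧ y ∈ S ∧ x ≠ y ∧ (voronoiCell S x ∩ voronoiCell S y).Nontrivial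

theorem IsEdge.symm {x y : ℍ} (h : IsEdge S x y) : IsEdge S y x :=
  ⟨h.2.1, h.1, h.2.2.1.symm, by rw [inter_comm]; exact h.2.2.2⟩

theorem isGeometricDual_iff {e γ : Set ℍ} : IsGeometricDual S e γ ↔
    ∃ x y, IsEdge S x y ∧ e = voronoiCell S x ∩ voronoiCell S y ∧ γ = geodesicArc x y := by
  constructor
  · rintro ⟨x, hx, y, hy, hxy, he, hn, hγ⟩
    exact ⟨x, y, ⟨hx, hy, hxy, he ▸ hn⟩, he, hγ⟩
  · rintro ⟨x, y, ⟨hx, hy, hxy, hn⟩, he, hγ⟩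
    exact ⟨x, hx, y, hy, hxy, he, he ▸ hn, hγ⟩

theorem mem_inter_iff_near {x y p : ℍ} (hx : x ∈ S) (hy : y ∈ S) :
    p ∈ voronoiCell S x ∩ voronoiCell S y ↔ x ∈ near S p ∧ y ∈ near S p :=
  ⟨fun h => ⟨⟨hx, h.1⟩, ⟨hy, h.2⟩⟩, fun h => ⟨h.1.2, h.2.2⟩⟩

theorem mem_voronoiVertices_iff {v : ℍ} : v ∈ voronoiVertices S ↔
    ∃ x ∈ near S v, ∃ y ∈ near S v, ∃ z ∈ near S v, x ≠ y ∧ y ≠ z ∧ x ≠ z := by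
  constructor
  · rintro ⟨x, hx, y, hy, z, hz, h1, h2, h3, h⟩
    exact ⟨x, ⟨hx, h.1.1⟩, y, ⟨hy, h.1.2⟩, z, ⟨hz, h.2⟩, h1, h2, h3⟩
  · rintro ⟨x, hx, y, hy, z, hz, h1, h2, h3⟩
    exact ⟨x, hx.1, y, hy.1, z, hz.1, h1, h2, h3, ⟨hx.2, hy.2⟩, hz.2⟩

theorem exists_third {v : ℍ} (hv : v ∈ voronoiVertices S) (x y : ℍ) :
    ∃ z ∈ near S v, z ≠ x ∧ z ≠ y := by
  obtain ⟨a, ha, b, hb, c, hc, h1, h2, h3⟩ := mem_voronoiVertices_iff.1 hv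
  by_contra hcon
  push Not at hcon
  have A := hcon a ha; have B := hcon b hb; have C := hcon c hc
  by_cases ax : a = x
  · have : b ≠ x := fun h => h1 (ax.trans h.symm)
    have : c ≠ x := fun h => h3 (ax.trans h.symm)
    exact h2 ((B ‹_›).trans (C ‹_›).symm)
  · by_cases bx : b = x
    · have : c ≠ x := fun h => h2 (bx.trans h.symm)
      exact h3 ((A ax).trans (C ‹_›).symm)
    · exact h1 ((A ax).trans (B bx).symm)

theorem mem_voronoiVertices_of_third {v x y z : ℍ} (hx : x ∈ near S v) (hy : y ∈ near S v)
    (hz : z ∈ near S v) (hxy : x ≠ y) (hzx : z ≠ x) (hzy : z ≠ y) : v ∈ voronoiVertices S :=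
  mem_voronoiVertices_iff.2 ⟨x, hx, y, hy, z, hz, hxy, hzy.symm, hzx.symm⟩

/-- The intersection of two Voronoi cells is convex. -/
theorem near_convex {x p q r : ℍ} (hp : x ∈ near S p) (hq : x ∈ near S q)
    (hr : r ∈ geodesicArc p q) : x ∈ near S r := by
  obtain ⟨a, b, ha, hb, e⟩ := mem_geodesicArc_iff.1 hr
  refine mem_near_iff.2 ⟨hp.1, fun y hy => ?_⟩
  simp only [e, map_add, map_smul, LinearMap.add_apply, LinearMap.smul_apply, smul_eq_mul]
  have := mul_le_mul_of_nonneg_left ((mem_near_iff.1 hp).2 y hy) ha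
  have := mul_le_mul_of_nonneg_left ((mem_near_iff.1 hq).2 y hy) hb
  linarith

theorem isClosed_voronoiCell (x : ℍ) : IsClosed (voronoiCell S x) := by
  have : voronoiCell S x = ⋂ y ∈ S, ⋂ (_ : y ≠ x), {p | dist p x ≤ dist p y} := by
    ext p; simp [voronoiCell]
  rw [this]
  exact isClosed_biInter fun y _ => isClosed_iInter fun _ =>
    isClosed_le (by fun_prop) (by fun_prop)

theorem IsNet.isCompact_voronoiCell (hS : IsNet S) {x : ℍ} (hx : x ∈ S) :
    IsCompact (voronoiCell S x) := by
  obtain ⟨R, hR⟩ := hS.exists_near_dist_le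
  exact (isCompact_closedBall x R).of_isClosed_subset (isClosed_voronoiCell x)
    fun p hp => hR p x ⟨hx, hp⟩

/-- Equidistance from x and y is orthogonality to x - y, and the plane orthogonal to x - y is
spanned by any two points of the sheet in it. -/
theorem exists_combination_of_equidistant {x y p q : ℍ} (hxy : x ≠ y) (hpq : p ≠ q)
    (hp : mink (hyp p) (hyp x) = mink (hyp p) (hyp y))
    (hq : mink (hyp q) (hyp x) = mink (hyp q) (hyp y)) {R : V3}
    (hr : mink R (hyp x) = mink R (hyp y)) :
    ∃ a b : ℝ, R = a • hyp p + b • hyp q := by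
  refine exists_combination (D := hyp x - hyp y) (hyp_mem_Fut p) (mink_mul_lt hpq) ?_ ?_ ?_ ?_
  · exact sub_ne_zero.2 fun h => hxy (hyp_injective h)
  all_goals rw [map_sub, sub_eq_zero]; assumption

theorem snd_pos_of_hyp (p : ℍ) : 0 < (hyp p).2.2 := (hyp_mem_Fut p).2

/-- Of three collinear points, one lies between the other two. -/
theorem between_of_combination {p q r : ℍ} {a b : ℝ} (h : hyp r = a • hyp p + b • hyp q) :
    r ∈ geodesicArc p q ∨ q ∈ geodesicArc p r ∨ p ∈ geodesicArc r q := by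
  -- The last coordinate is positive on the sheet, so the two coefficients cannot both be
  -- nonpositive.
  have t := congrArg (fun P : V3 => P.2.2) h
  simp only [Prod.snd_add, Prod.smul_snd, smul_eq_mul] at t
  have hp := snd_pos_of_hyp p; have hq := snd_pos_of_hyp q; have hr := snd_pos_of_hyp r
  rcases le_or_gt 0 a with ha | ha
  · rcases le_or_gt 0 b with hb | hb
    · exact Or.inl (mem_geodesicArc_iff.2 ⟨a, b, ha, hb, h⟩)
    · have ha' : 0 < a := by
        rcases ha.lt_or_eq with h | h
        · exact h
        · rw [← h] at t; nlinarith
      right; right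
      refine mem_geodesicArc_iff.2 ⟨a⁻¹, -(a⁻¹ * b), by positivity, ?_, ?_⟩
      · nlinarith [mul_pos (inv_pos.2 ha') (neg_pos.2 hb)]
      · rw [h, smul_add, smul_smul, smul_smul, inv_mul_cancel₀ ha'.ne', one_smul, neg_smul]; abel
  · have hb' : 0 < b := by
      by_contra hb
      nlinarith [mul_pos (neg_pos.2 ha) hp, mul_nonneg (neg_nonneg.2 (not_lt.1 hb)) hq.le]
    right; left
    refine mem_geodesicArc_iff.2 ⟨-(b⁻¹ * a), b⁻¹, ?_, by positivity, ?_⟩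
    · nlinarith [mul_pos (inv_pos.2 hb') (neg_pos.2 ha)]
    · rw [h, smul_add, smul_smul, smul_smul, inv_mul_cancel₀ hb'.ne', one_smul, neg_smul]; abel

/-- A small perturbation of a point in a linear direction. -/
theorem tendsto_pt_add_smul (p : ℍ) (n : V3) :
    Filter.Tendsto (fun t : ℝ => pt (hyp p + t • n)) (𝓝 0) (𝓝 p) := by
  have h1 : ContinuousAt pt (hyp p) :=
    continuousOn_pt.continuousAt (isOpen_Fut.mem_nhds (hyp_mem_Fut p))
  have h2 : Filter.Tendsto (fun t : ℝ => hyp p + t • n) (𝓝 0) (𝓝 (hyp p)) := by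
    have : Continuous fun t : ℝ => hyp p + t • n := by fun_prop
    simpa using this.tendsto 0
  have := h1.tendsto.comp h2
  rwa [pt_hyp] at this

theorem eventually_isFut (p : ℍ) (n : V3) : ∀ᶠ t : ℝ in 𝓝 0, IsFut (hyp p + t • n) := by
  have : Continuous fun t : ℝ => hyp p + t • n := by fun_prop
  exact this.continuousAt.eventually (isOpen_Fut.mem_nhds (by simpa using hyp_mem_Fut p))

/-- If `n` weakly favours `x` and `y` among the nearest points of `p`, then points slightly ahead
of `p` in the direction `n` lie on `V_x ∩ V_y`. -/
theorem IsNet.exists_ahead (hS : IsNet S) {p x : ℍ} {n : V3}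
    (h : ∀ z ∈ near S p, mink n (hyp x) ≤ mink n (hyp z)) :
    ∃ t : ℝ, 0 < t ∧ IsFut (hyp p + t • n) ∧
      ∀ y ∈ near S p, mink n (hyp y) = mink n (hyp x) → y ∈ near S (pt (hyp p + t • n)) := by
  have h1 := (tendsto_pt_add_smul p n).eventually (hS.eventually_mem_near p)
  have h2 := eventually_isFut p n
  obtain ⟨t, ⟨h3, h4⟩, ht⟩ := (((h1.and h2).filter_mono nhdsWithin_le_nhds).and
    (self_mem_nhdsWithin (a := (0 : ℝ)) (s := Ioi 0))).exists
  refine ⟨t, ht, h4, fun y hy hyx => h3 y hy fun z hz => ?_⟩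
  rw [hyp_pt h4]
  simp only [map_add, map_smul, LinearMap.add_apply, LinearMap.smul_apply, smul_eq_mul]
  have := h z hz
  have e := near_eq hy hz
  have : t * mink n (hyp y) ≤ t * mink n (hyp z) := by
    rw [hyx]; exact mul_le_mul_of_nonneg_left this (le_of_lt ht)
  rw [e]
  exact mul_le_mul_of_nonneg_left (by linarith) (by positivity)

/-- Voronoi edges are geodesic arcs, whose endpoints are the vertices they contain. -/
theorem IsNet.exists_endpoints (hS : IsNet S) {x y : ℍ} (h : IsEdge S x y) :
    ∃ v w, v ≠ w ∧ v ∈ voronoiVertices S ∧ w ∈ voronoiVertices S ∧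
      voronoiCell S x ∩ voronoiCell S y = geodesicArc v w ∧
      ∀ u ∈ voronoiVertices S, u ∈ voronoiCell S x ∩ voronoiCell S y → u = v ∨ u = w := by
  obtain ⟨hx, hy, hxy, hnt⟩ := h
  set e := voronoiCell S x ∩ voronoiCell S y with he
  have hnear : ∀ {p}, p ∈ e ↔ x ∈ near S p ∧ y ∈ near S p := fun {p} => mem_inter_iff_near hx hy
  have hc : IsCompact e := (hS.isCompact_voronoiCell hx).inter_right (isClosed_voronoiCell y)
  -- The endpoints are a pair at maximal distance in the compact edge. All points of the edge are
  -- collinear, and maximality puts each of them between these two.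
  obtain ⟨⟨v, w⟩, hvw, hmax⟩ := (hc.prod hc).exists_isMaxOn (hnt.nonempty.prod hnt.nonempty)
    (f := fun q => dist q.1 q.2) (by fun_prop)
  obtain ⟨hv, hw⟩ : v ∈ e ∧ w ∈ e := hvw
  have hmax : ∀ a ∈ e, ∀ b ∈ e, dist a b ≤ dist v w := fun a ha b hb => hmax (mk_mem_prod ha hb)
  have hne : v ≠ w := by
    rintro rfl
    obtain ⟨a, ha, b, hb, hab⟩ := hnt
    have := hmax a ha b hb
    rw [dist_self] at this
    exact hab (dist_le_zero.1 this)
  have equi : ∀ {p}, p ∈ e → mink (hyp p) (hyp x) = mink (hyp p) (hyp y) := fun hp =>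
    near_eq (hnear.1 hp).1 (hnear.1 hp).2
  have harc : e = geodesicArc v w := by
    apply Subset.antisymm
    · intro q hq
      obtain ⟨a, b, hab⟩ := exists_combination_of_equidistant hxy hne (equi hv) (equi hw) (equi hq)
      rcases between_of_combination hab with h | h | h
      · exact h
      · have h : dist v w + dist w q = dist v q := h
        have := hmax v hv q hq
        have : w = q := dist_le_zero.1 (by linarith)
        rw [← this]; exact right_mem_geodesicArc _ _
      · have h : dist q v + dist v w = dist q w := h
        have := hmax q hq w hw
        have : q = v := dist_le_zero.1 (by linarith)
        rw [this]; exact left_mem_geodesicArc _ _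
    · intro q hq
      exact hnear.2 ⟨near_convex (hnear.1 hv).1 (hnear.1 hw).1 hq,
        near_convex (hnear.1 hv).2 (hnear.1 hw).2 hq⟩
  -- If x and y were the only nearest sites of v, the edge could be prolonged beyond v, away from w,
  -- against maximality.
  have hvert : ∀ {v w}, v ∈ e → w ∈ e → v ≠ w → (∀ a ∈ e, dist a w ≤ dist v w) →
      v ∈ voronoiVertices S := by
    intro v w hv hw hne hmax
    by_contra hcon
    have hxy' : ∀ z ∈ near S v, z = x ∨ z = y := by
      intro z hz
      by_contra hz'
      push Not at hz'
      exact hcon (mem_voronoiVertices_of_third (hnear.1 hv).1 (hnear.1 hv).2 hz hxy hz'.1 hz'.2)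
    have heq : mink (hyp v - hyp w) (hyp x) = mink (hyp v - hyp w) (hyp y) := by
      simp only [map_sub, LinearMap.sub_apply, equi hv, equi hw]
    obtain ⟨t, ht, hF, h⟩ := hS.exists_ahead (n := hyp v - hyp w) (x := x) (by
      intro z hz
      rcases hxy' z hz with rfl | rfl
      · exact le_rfl
      · exact heq.le)
    have hq : pt (hyp v + t • (hyp v - hyp w)) ∈ e :=
      hnear.2 ⟨h x (hnear.1 hv).1 rfl, h y (hnear.1 hv).2 heq.symm⟩
    obtain ⟨c, hc, hce⟩ := exists_smul_hyp hF
    set q := pt (hyp v + t • (hyp v - hyp w))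
    have hbt : v ∈ geodesicArc q w := by
      refine mem_geodesicArc_iff.2 ⟨(1 + t)⁻¹ * c, (1 + t)⁻¹ * t, by positivity, by positivity, ?_⟩
      rw [mul_smul, ← hce, mul_smul, ← smul_add]
      have : hyp v + t • (hyp v - hyp w) + t • hyp w = (1 + t) • hyp v := by module
      rw [this, smul_smul, inv_mul_cancel₀ (by positivity), one_smul]
    have hbt : dist q v + dist v w = dist q w := hbt
    have := hmax q hq
    have hqv : q = v := dist_le_zero.1 (by linarith)
    rw [hqv] at hce
    have h1 : c • hyp v + (0 : ℝ) • hyp w = (1 + t) • hyp v + (-t) • hyp w := by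
      rw [← hce]; module
    have := (pair_unique hne h1).2
    linarith
  refine ⟨v, w, hne, hvert hv hw hne fun a ha => hmax a ha w hw,
    hvert hw hv hne.symm fun a ha => by rw [dist_comm w v]; exact hmax a ha v hv, harc, ?_⟩
  intro u hu hue
  have hua : u ∈ geodesicArc v w := harc ▸ hue
  by_contra hcon
  push Not at hcon
  obtain ⟨a, b, ha, hb, hab⟩ := (mem_arcInterior_geodesicArc hne).1
    ((mem_arcInterior_geodesicArc' hne).2 ⟨hua, hcon⟩)
  obtain ⟨z, hz, hzx, hzy⟩ := exists_third hu x y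
  -- A third nearest site z of an interior point u is no nearer to v or w than x is. Since u is a
  -- positive combination of v and w, both inequalities must be equalities; then v is equidistant
  -- from x, y, z and equals u.
  have h1 := near_eq (hnear.1 hue).1 hz
  rw [hab] at h1
  simp only [map_add, map_smul, LinearMap.add_apply, LinearMap.smul_apply, smul_eq_mul] at h1
  have hv1 := (mem_near_iff.1 (hnear.1 hv).1).2 z hz.1
  have hw1 := (mem_near_iff.1 (hnear.1 hw).1).2 z hz.1
  have hz0 : mink (hyp v) (hyp x) = mink (hyp v) (hyp z) := by
    nlinarith [mul_nonneg ha.le (sub_nonneg.2 hv1), mul_nonneg hb.le (sub_nonneg.2 hw1)]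
  exact hcon.1 (eq_center (hnear.1 hue).1 (hnear.1 hue).2 hz hxy hzx.symm hzy.symm
    (equi hv) hz0).symm

theorem IsEdge.near_left {x y p : ℍ} (h : IsEdge S x y)
    (hp : p ∈ voronoiCell S x ∩ voronoiCell S y) : x ∈ near S p := ⟨h.1, hp.1⟩

theorem IsEdge.near_right {x y p : ℍ} (h : IsEdge S x y)
    (hp : p ∈ voronoiCell S x ∩ voronoiCell S y) : y ∈ near S p := ⟨h.2.1, hp.2⟩

/-- An edge of the tessellation determines the two cells containing it. -/
theorem IsEdge.eq_or_eq_of_near {x y z p q : ℍ} (h : IsEdge S x y)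
    (hp : p ∈ voronoiCell S x ∩ voronoiCell S y) (hq : q ∈ voronoiCell S x ∩ voronoiCell S y)
    (hpq : p ≠ q) (hzp : z ∈ near S p) (hzq : z ∈ near S q) : z = x ∨ z = y := by
  by_contra hcon
  push Not at hcon
  exact hpq (eq_center (h.near_left hq) (h.near_right hq) hzq h.2.2.1 hcon.1.symm hcon.2.symm
    (near_eq (h.near_left hp) (h.near_right hp)) (near_eq (h.near_left hp) hzp))

theorem IsEdge.pair_eq {x y x' y' p q : ℍ} (h : IsEdge S x y) (h' : IsEdge S x' y')
    (hp : p ∈ voronoiCell S x ∩ voronoiCell S y) (hq : q ∈ voronoiCell S x ∩ voronoiCell S y)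
    (hp' : p ∈ voronoiCell S x' ∩ voronoiCell S y') (hq' : q ∈ voronoiCell S x' ∩ voronoiCell S y')
    (hpq : p ≠ q) : (x' = x ∧ y' = y) ∨ (x' = y ∧ y' = x) := by
  have h1 := h.eq_or_eq_of_near hp hq hpq (h'.near_left hp') (h'.near_left hq')
  have h2 := h.eq_or_eq_of_near hp hq hpq (h'.near_right hp') (h'.near_right hq')
  have := h'.2.2.1
  grind

theorem IsEdge.arc_eq {x y x' y' : ℍ} (h : IsEdge S x y) (h' : IsEdge S x' y')
    (he : voronoiCell S x ∩ voronoiCell S y = voronoiCell S x' ∩ voronoiCell S y') :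
    (x' = x ∧ y' = y) ∨ (x' = y ∧ y' = x) := by
  obtain ⟨p, hp, q, hq, hpq⟩ := h.2.2.2
  exact h.pair_eq h' hp hq (he ▸ hp) (he ▸ hq) hpq

/-- A Voronoi vertex is determined by its set of nearest sites, and the vertices in a ball have
these sets inside one finite set of sites. -/
theorem IsNet.finite_vertices_inter (hS : IsNet S) (p : ℍ) (r : ℝ) :
    (voronoiVertices S ∩ closedBall p r).Finite := by
  obtain ⟨R, hR⟩ := hS.exists_near_dist_le
  have hfin := hS.finite_inter p (r + R)
  set N := S ∩ closedBall p (r + R)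
  have key : ∀ v ∈ voronoiVertices S ∩ closedBall p r, near S v ⊆ N := by
    rintro v ⟨_, hv⟩ x hx
    refine ⟨hx.1, ?_⟩
    rw [mem_closedBall] at hv ⊢
    have := hR v x hx
    have := dist_triangle x v p
    rw [dist_comm x v] at this
    linarith
  refine Set.Finite.of_finite_image (f := near S) (hfin.finite_subsets.subset ?_) ?_
  · rintro _ ⟨v, hv, rfl⟩; exact key v hv
  · intro v hv w hw h
    obtain ⟨x, hx, y, hy, z, hz, h1, h2, h3⟩ := mem_voronoiVertices_iff.1 hw.1
    have h : near S v = near S w := h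
    rw [← h] at hx hy hz
    exact (eq_center hx hy hz h1 h3 h2 (near_eq (h ▸ hx) (h ▸ hy)) (near_eq (h ▸ hx) (h ▸ hz))).symm
end

section
variable {S : Set ℍ}

/-! ### Sides of Delaunay cells -/

theorem mem_delaunayCell {v p : ℍ} : p ∈ delaunayCell S v ↔ hyp p ∈ cone (near S v) :=
  mem_geodesicHull

theorem hyp_ne_zero (p : ℍ) : hyp p ≠ 0 := fun h => by
  have := mink_hyp_self p; rw [h] at this; simp at this

theorem exists_mink_eq (l : V3 →ₗ[ℝ] ℝ) : ∃ n, l = mink n := by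
  refine ⟨(-l (1, 0, 0), 2 * l (0, 0, 1), 2 * l (0, 1, 0)), LinearMap.ext fun P => ?_⟩
  have : P = P.1 • ((1, 0, 0) : V3) + P.2.1 • ((0, 1, 0) : V3) + P.2.2 • ((0, 0, 1) : V3) := by
    refine Prod.ext ?_ (Prod.ext ?_ ?_) <;> simp
  conv_lhs => rw [this]
  simp only [map_add, map_smul, smul_eq_mul, mink_apply]
  ring

/-- `{x, y}` spans a side of the Delaunay cell of `v`. -/
def IsSide (S : Set ℍ) (v x y : ℍ) : Prop := IsEdge S x y ∧ x ∈ near S v ∧ y ∈ near S v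

theorem IsSide.mem {v x y : ℍ} (h : IsSide S v x y) : v ∈ voronoiCell S x ∩ voronoiCell S y :=
  ⟨h.2.1.2, h.2.2.2⟩

theorem IsEdge.isSide {v x y : ℍ} (h : IsEdge S x y)
    (hv : v ∈ voronoiCell S x ∩ voronoiCell S y) : IsSide S v x y :=
  ⟨h, h.near_left hv, h.near_right hv⟩

/-- The functional is the product with a vector n. Moving from v a little in the direction n keeps x
and y nearest, which produces a second point of V_x ∩ V_y. -/
theorem IsNet.isSide_of_functional (hS : IsNet S) {v x y : ℍ} (hx : x ∈ near S v)
    (hy : y ∈ near S v) (hxy : x ≠ y) {l : V3 →ₗ[ℝ] ℝ} (h0 : l ≠ 0) (lx : l (hyp x) = 0)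
    (ly : l (hyp y) = 0) (hl : ∀ z ∈ near S v, 0 ≤ l (hyp z)) : IsSide S v x y := by
  obtain ⟨n, rfl⟩ := exists_mink_eq l
  obtain ⟨t, ht, hF, h⟩ := hS.exists_ahead (x := x) (n := n) (fun z hz => by rw [lx]; exact hl z hz)
  have h1 := h x hx rfl
  have h2 := h y hy (by rw [lx, ly])
  refine ⟨⟨hx.1, hy.1, hxy, v, ⟨hx.2, hy.2⟩, _, ⟨h1.2, h2.2⟩, fun he => h0 ?_⟩, hx, hy⟩
  obtain ⟨c, hc, e⟩ := exists_smul_hyp hF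
  rw [← he] at e
  have e1 := congrArg (fun P => mink P (hyp x)) e
  simp only [map_add, map_smul, LinearMap.add_apply, LinearMap.smul_apply, smul_eq_mul, lx] at e1
  have hc1 : c = 1 := by
    have := mink_hyp_pos v x
    have : (c - 1) * mink (hyp v) (hyp x) = 0 := by linarith
    rcases mul_eq_zero.1 this with h | h <;> linarith
  rw [hc1, one_smul, add_eq_left, smul_eq_zero] at e
  rw [e.resolve_left ht.ne', map_zero]

/-- For a second point q of the edge, the functional of `ctr S q` minus that of `ctr S v` is
nonnegative on the sites near v and vanishes only at those near q too, that is, at the two sites of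
the edge. -/
theorem IsSide.exists_functional (hS : IsNet S) {v x y : ℍ} (h : IsSide S v x y) :
    ∃ l : V3 →ₗ[ℝ] ℝ, l (hyp x) = 0 ∧ l (hyp y) = 0 ∧
      ∀ z ∈ near S v, z ≠ x → z ≠ y → 0 < l (hyp z) := by
  obtain ⟨q, hq, hqv⟩ := h.1.2.2.2.exists_ne v
  have e1 := h.1.near_left hq
  have e2 := h.1.near_right hq
  refine ⟨mink (ctr S q) - mink (ctr S v), ?_, ?_, fun z hz h1 h2 => ?_⟩
  · simp [mink_ctr_near e1, mink_ctr_near h.2.1]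
  · simp [mink_ctr_near e2, mink_ctr_near h.2.2]
  · rw [LinearMap.sub_apply, mink_ctr_near hz, sub_pos]
    refine lt_of_le_of_ne (hS.one_le_mink_ctr hz.1) fun he => ?_
    have := (hS.mink_ctr_eq_one_iff hz.1).1 he.symm
    rcases h.1.eq_or_eq_of_near h.mem hq hqv.symm hz this with h | h
    · exact h1 h
    · exact h2 h

/-- Every corner of a Delaunay cell lies on two distinct sides. -/
theorem IsNet.exists_two_sides (hS : IsNet S) {v x : ℍ} (hv : v ∈ voronoiVertices S)
    (hx : x ∈ near S v) : ∃ y y', y ≠ y' ∧ IsSide S v x y ∧ IsSide S v x y' := by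
  obtain ⟨y₀, hy₀, hy₀x, -⟩ := exists_third hv x x
  obtain ⟨z₀, hz₀, hz₀x, hz₀y⟩ := exists_third hv x y₀
  -- Both s and t vanish at x, and t is positive at the other sites near v. The ratio s / t is a
  -- slope as seen from x, and the sites with extreme slopes are the neighbours of x on the polygon.
  set s := det3 (hyp x) (hyp y₀) with hs
  set t : V3 →ₗ[ℝ] ℝ := mink (hyp x) - mink (ctr S v) with ht
  have tx : t (hyp x) = 0 := by simp [ht, mink_hyp_self, mink_ctr_near hx]
  have tpos : ∀ z ∈ near S v \ {x}, 0 < t (hyp z) := by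
    rintro z ⟨hz, hzx⟩
    have := one_lt_mink_hyp (Ne.symm (show z ≠ x from hzx))
    rw [ht, LinearMap.sub_apply, mink_ctr_near hz]; linarith
  have sx : s (hyp x) = 0 := det3_left _ _
  have sy : s (hyp y₀) = 0 := det3_right _ _
  have sz : s (hyp z₀) ≠ 0 := det3_ne_zero hx hy₀ hz₀ hy₀x.symm hz₀x.symm hz₀y.symm
  have hfin : (near S v \ {x}).Finite := (hS.finite_near v).subset sdiff_subset
  have hne : (near S v \ {x}).Nonempty := ⟨y₀, hy₀, hy₀x⟩
  obtain ⟨y, hy, hmax⟩ := hfin.exists_maximalFor (fun z => s (hyp z) / t (hyp z)) _ hne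
  obtain ⟨y', hy', hmin⟩ := hfin.exists_minimalFor (fun z => s (hyp z) / t (hyp z)) _ hne
  have hmax : ∀ z ∈ near S v \ {x}, s (hyp z) / t (hyp z) ≤ s (hyp y) / t (hyp y) := fun z hz => by
    by_contra hcon
    exact hcon (hmax hz (not_le.1 hcon).le)
  have hmin : ∀ z ∈ near S v \ {x}, s (hyp y') / t (hyp y') ≤ s (hyp z) / t (hyp z) := fun z hz => by
    by_contra hcon
    exact hcon (hmin hz (not_le.1 hcon).le)
  have hy0 := tpos y hy
  have hy0' := tpos y' hy'
  have r1 : s (hyp y₀) / t (hyp y₀) = 0 := by rw [sy, zero_div]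
  have r2 : s (hyp z₀) / t (hyp z₀) ≠ 0 := div_ne_zero sz (tpos z₀ ⟨hz₀, hz₀x⟩).ne'
  have hx' : ∀ z ∈ near S v, z = x ∨ z ∈ near S v \ {x} := fun z hz => by
    by_cases h : z = x
    · exact Or.inl h
    · exact Or.inr ⟨hz, h⟩
  have nz : ∀ (c d : ℝ), d ≠ 0 → c • t + d • s ≠ 0 := by
    intro c d hd h
    have h1 := LinearMap.congr_fun h (hyp y₀)
    have h2 := LinearMap.congr_fun h (hyp z₀)
    simp only [LinearMap.add_apply, LinearMap.smul_apply, smul_eq_mul, sy, LinearMap.zero_apply] at h1 h2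
    have hc : c = 0 := by
      have := (tpos y₀ ⟨hy₀, hy₀x⟩).ne'
      simpa [this] using h1
    rw [hc] at h2
    simp [hd, sz] at h2
  refine ⟨y, y', ?_, ?_, ?_⟩
  · rintro rfl
    have a1 := hmax y₀ ⟨hy₀, hy₀x⟩; have a2 := hmax z₀ ⟨hz₀, hz₀x⟩
    have b1 := hmin y₀ ⟨hy₀, hy₀x⟩; have b2 := hmin z₀ ⟨hz₀, hz₀x⟩
    exact r2 (by linarith)
  · refine hS.isSide_of_functional hx hy.1 (Ne.symm hy.2) (nz (s (hyp y) / t (hyp y)) (-1) (by norm_num))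
      (by simp [tx, sx]) ?_ ?_
    · simp only [LinearMap.add_apply, LinearMap.smul_apply, smul_eq_mul]
      field_simp; ring
    · intro z hz
      simp only [LinearMap.add_apply, LinearMap.smul_apply, smul_eq_mul]
      rcases hx' z hz with rfl | hz'
      · simp [tx, sx]
      · have := hmax z hz'
        rw [div_le_iff₀ (tpos z hz')] at this
        linarith
  · refine hS.isSide_of_functional hx hy'.1 (Ne.symm hy'.2) (nz (-(s (hyp y') / t (hyp y'))) 1 (by norm_num))
      (by simp [tx, sx]) ?_ ?_
    · simp only [LinearMap.add_apply, LinearMap.smul_apply, smul_eq_mul]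
      field_simp; ring
    · intro z hz
      simp only [LinearMap.add_apply, LinearMap.smul_apply, smul_eq_mul]
      rcases hx' z hz with rfl | hz'
      · simp [tx, sx]
      · have := hmin z hz'
        rw [le_div_iff₀ (tpos z hz')] at this
        linarith

/-! ### Interiors of cones -/

/-- The coefficients in Cramer's rule depend continuously on the vector, so they remain positive
nearby. -/
theorem mem_interior_cone_of_pos {A : Set ℍ} {x y z : ℍ} (hx : x ∈ A) (hy : y ∈ A) (hz : z ∈ A)
    (hd : det3 (hyp x) (hyp y) (hyp z) ≠ 0) {a b c : ℝ} (ha : 0 < a) (hb : 0 < b) (hc : 0 < c) :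
    a • hyp x + b • hyp y + c • hyp z ∈ interior (cone A : Set V3) := by
  set d := det3 (hyp x) (hyp y) (hyp z) with hdd
  have hcont : ∀ l : V3 →ₗ[ℝ] ℝ, Continuous l := fun l => l.continuous_of_finiteDimensional
  refine mem_interior.2 ⟨{P | 0 < det3 (hyp y) (hyp z) P / d} ∩ ({P | 0 < det3 (hyp z) (hyp x) P / d}
    ∩ {P | 0 < det3 (hyp x) (hyp y) P / d}), ?_, ?_, ?_⟩
  · rintro P ⟨h1, h2, h3⟩
    have h1 : 0 < det3 (hyp y) (hyp z) P / d := h1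
    have h2 : 0 < det3 (hyp z) (hyp x) P / d := h2
    have h3 : 0 < det3 (hyp x) (hyp y) P / d := h3
    show P ∈ cone A
    rw [cramer_div hd P]
    exact Submodule.add_mem _ (Submodule.add_mem _ (cone_smul (hyp_mem_cone hx) h1.le)
      (cone_smul (hyp_mem_cone hy) h2.le)) (cone_smul (hyp_mem_cone hz) h3.le)
  · refine IsOpen.inter ?_ (IsOpen.inter ?_ ?_) <;>
    exact isOpen_lt continuous_const ((hcont _).div_const _)
  · have e1 : det3 (hyp y) (hyp z) (hyp x) = d := by rw [hdd, ← det3_rotate]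
    have e2 : det3 (hyp z) (hyp x) (hyp y) = d := by rw [hdd, det3_rotate]
    refine ⟨?_, ?_, ?_⟩
    · simp only [mem_ofPred_eq, map_add, map_smul, det3_left, det3_right, e1, smul_eq_mul, mul_zero, add_zero]
      rwa [mul_div_cancel_right₀ _ hd]
    · simp only [mem_ofPred_eq, map_add, map_smul, det3_left, det3_right, e2, smul_eq_mul, mul_zero, add_zero, zero_add]
      rwa [mul_div_cancel_right₀ _ hd]
    · simp only [mem_ofPred_eq, map_add, map_smul, det3_left, det3_right, ← hdd, smul_eq_mul, mul_zero, zero_add]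
      rwa [mul_div_cancel_right₀ _ hd]

theorem interior_cone_nonempty {v : ℍ} (hv : v ∈ voronoiVertices S) :
    (interior (cone (near S v) : Set V3)).Nonempty := by
  obtain ⟨x, hx, y, hy, z, hz, h1, h2, h3⟩ := mem_voronoiVertices_iff.1 hv
  exact ⟨_, mem_interior_cone_of_pos hx hy hz (det3_ne_zero hx hy hz h1 h3 h2) one_pos one_pos one_pos⟩

/-- Interior points of a set closed under addition and positive scaling absorb its points. -/
theorem interior_add_mem {C : Set V3} (hadd : ∀ P ∈ C, ∀ Q ∈ C, P + Q ∈ C) {P Q : V3}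
    (hP : P ∈ interior C) (hQ : Q ∈ C) : P + Q ∈ interior C := by
  refine mem_interior.2 ⟨(fun R => R - Q) ⁻¹' interior C, ?_,
    isOpen_interior.preimage (by fun_prop), by simpa using hP⟩
  intro R hR
  have := hadd _ (interior_subset (show R - Q ∈ interior C from hR)) _ hQ
  simpa using this

theorem interior_smul_mem {C : Set V3} (hsmul : ∀ (c : ℝ) P, 0 < c → P ∈ C → c • P ∈ C) {P : V3}
    (hP : P ∈ interior C) {c : ℝ} (hc : 0 < c) : c • P ∈ interior C := by
  refine mem_interior.2 ⟨(fun R => c⁻¹ • R) ⁻¹' interior C, ?_,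
    isOpen_interior.preimage (by fun_prop), by
      simpa [smul_smul, inv_mul_cancel₀ hc.ne'] using hP⟩
  intro R hR
  have := hsmul c _ hc (interior_subset (show c⁻¹ • R ∈ interior C from hR))
  simpa [smul_smul, mul_inv_cancel₀ hc.ne'] using this

/-- If l vanished at an interior point, it would be nonnegative in every direction Q and in -Q,
hence zero. -/
theorem pos_of_mem_interior {C : Set V3} {l : V3 →ₗ[ℝ] ℝ} (h0 : l ≠ 0) (hl : ∀ P ∈ C, 0 ≤ l P)
    {P : V3} (hP : P ∈ interior C) : 0 < l P := by
  refine lt_of_le_of_ne (hl P (interior_subset hP)) fun h => h0 (LinearMap.ext fun Q => ?_)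
  have key : ∀ Q, 0 ≤ l Q := by
    intro Q
    have hc : Continuous fun t : ℝ => P + t • Q := by fun_prop
    have : ∀ᶠ t : ℝ in 𝓝 0, P + t • Q ∈ C :=
      hc.continuousAt.eventually (mem_interior_iff_mem_nhds.1 (by simpa using hP))
    obtain ⟨t, ht, ht0⟩ := ((this.filter_mono nhdsWithin_le_nhds).and
      (self_mem_nhdsWithin (a := (0 : ℝ)) (s := Ioi 0))).exists
    have := hl _ ht
    rw [map_add, ← h, zero_add, map_smul, smul_eq_mul] at this
    exact nonneg_of_mul_nonneg_right this ht0
  have h1 := key Q; have h2 := key (-Q)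
  rw [map_neg] at h2
  show l Q = 0
  linarith

/-- A point of a Delaunay cone is interior or lies on a side. -/
theorem IsNet.interior_or_side (hS : IsNet S) {v : ℍ} (hv : v ∈ voronoiVertices S) {P : V3}
    (hP : P ∈ cone (near S v)) : P ∈ interior (cone (near S v) : Set V3) ∨
      ∃ x y, IsSide S v x y ∧ P ∈ cone {x, y} := by
  by_cases hint : P ∈ interior (cone (near S v) : Set V3)
  · exact Or.inl hint
  right
  obtain ⟨f, hf⟩ := geometric_hahn_banach_open_point (convex_cone (near S v)).interior
    isOpen_interior hint
  obtain ⟨a, ha⟩ := interior_cone_nonempty hv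
  have hadd : ∀ P ∈ (cone (near S v) : Set V3), ∀ Q ∈ (cone (near S v) : Set V3),
    P + Q ∈ (cone (near S v) : Set V3) := fun P hP Q hQ => Submodule.add_mem _ hP hQ
  -- Hahn–Banach gives a strict inequality on the interior only. Adding t • a with a interior and
  -- letting t tend to 0 extends it, non-strictly, to the cone.
  have hle : ∀ Q ∈ cone (near S v), f Q ≤ f P := by
    intro Q hQ
    have h1 : ∀ t : ℝ, 0 < t → f Q + t * f a < f P := by
      intro t ht
      have := hf _ (interior_add_mem hadd (interior_smul_mem
        (fun c P hc hP => cone_smul hP hc.le) ha ht) hQ)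
      rw [map_add, map_smul, smul_eq_mul] at this
      linarith
    refine le_of_forall_pos_lt_add fun ε hε => ?_
    have hpos : 0 < ε / (|f a| + 1) := by positivity
    have h2 := h1 (ε / (|f a| + 1)) hpos
    have h3 : ε / (|f a| + 1) * |f a| < ε := by
      rw [div_mul_eq_mul_div, div_lt_iff₀ (by positivity)]; nlinarith [abs_nonneg (f a)]
    have h4 := mul_le_mul_of_nonneg_left (neg_abs_le (f a)) hpos.le
    linarith
  have fP : f P = 0 := by
    have h1 := hle 0 (Submodule.zero_mem _)
    have h2 := hle _ (Submodule.add_mem _ hP hP)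
    rw [map_zero] at h1
    rw [map_add] at h2
    linarith
  set l : V3 →ₗ[ℝ] ℝ := -(f : V3 →ₗ[ℝ] ℝ) with hl
  have lP : l P = 0 := by simp [hl, fP]
  have l0 : l ≠ 0 := by
    intro h
    have := hf a ha
    have h' := LinearMap.congr_fun h a
    simp [hl] at h'
    rw [fP, h'] at this
    exact lt_irrefl _ this
  have lnn : ∀ x ∈ near S v, 0 ≤ l (hyp x) := fun x hx => by
    have := hle _ (hyp_mem_cone hx)
    simp [hl]; linarith
  have hface := mem_cone_face lnn hP lP
  set A := {x ∈ near S v | l (hyp x) = 0} with hA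
  -- Three sites killed by l would force l = 0, so two of them span the whole face. If at most one
  -- is killed, any side through that corner contains the face.
  by_cases hcard : ∃ x ∈ A, ∃ y ∈ A, x ≠ y
  · obtain ⟨x, hx, y, hy, hxy⟩ := hcard
    refine ⟨x, y, hS.isSide_of_functional hx.1 hy.1 hxy l0 hx.2 hy.2 lnn, cone_mono ?_ hface⟩
    intro z hz
    by_contra hcon
    simp only [mem_insert_iff, mem_singleton_iff, not_or] at hcon
    exact l0 (LinearMap.ext (eq_zero_of_det3 (det3_ne_zero hx.1 hy.1 hz.1 hxy (Ne.symm hcon.1)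
      (Ne.symm hcon.2)) hx.2 hy.2 hz.2))
  · push Not at hcard
    obtain ⟨x, hx, hAx⟩ : ∃ x ∈ near S v, A ⊆ {x} := by
      by_cases hne : A.Nonempty
      · obtain ⟨x, hx⟩ := hne
        exact ⟨x, hx.1, fun y hy => hcard y hy x hx⟩
      · obtain ⟨x, hx⟩ := hS.nonempty_near v
        exact ⟨x, hx, fun y hy => absurd ⟨y, hy⟩ hne⟩
    obtain ⟨y, -, -, hside, -⟩ := hS.exists_two_sides hv hx
    exact ⟨x, y, hside, cone_mono (hAx.trans (by simp)) hface⟩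

/-! ### Relative position of Delaunay cells -/

theorem ctr_sub_ne_zero {v w : ℍ} (h : v ≠ w) : mink (ctr S w) - mink (ctr S v) ≠ 0 := by
  intro h0
  refine h (ctr_injective (S := S) ?_)
  have : ctr S w - ctr S v = 0 := mink_nondegenerate fun Q => by
    have := LinearMap.congr_fun h0 Q
    simpa using this
  exact (sub_eq_zero.1 this).symm

/-- The functional of w is at least 1 at every site and that of v equals 1 at the generators.
Exchanging v and w shows that the difference separates the two cells. -/
theorem IsNet.ctr_sub_nonneg (hS : IsNet S) (v w : ℍ) {P : V3} (hP : P ∈ cone (near S v)) :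
    0 ≤ (mink (ctr S w) - mink (ctr S v)) P :=
  nonneg_of_mem_cone (fun x hx => by
    rw [LinearMap.sub_apply, mink_ctr_near hx]; linarith [hS.one_le_mink_ctr (p := w) hx.1]) hP

theorem IsNet.interior_disjoint (hS : IsNet S) {v w : ℍ} (h : v ≠ w) {P : V3}
    (hP : P ∈ interior (cone (near S v) : Set V3)) : P ∉ cone (near S w) := by
  intro hw
  have h1 := pos_of_mem_interior (ctr_sub_ne_zero (S := S) h) (fun Q hQ => hS.ctr_sub_nonneg v w hQ) hP
  have h2 := hS.ctr_sub_nonneg w v hw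
  simp only [LinearMap.sub_apply] at h1 h2
  linarith

/-- Only the Delaunay cells of points of an edge meet the interior of its dual. -/
theorem IsEdge.near_of_mem_cone (hS : IsNet S) {x y u : ℍ} (h : IsEdge S x y) {a b : ℝ} (ha : 0 < a)
    (hb : 0 < b) (hu : a • hyp x + b • hyp y ∈ cone (near S u)) : x ∈ near S u ∧ y ∈ near S u := by
  obtain ⟨v, hv⟩ := h.2.2.2.nonempty
  -- On this vector the functional of v takes the value a + b, so that of u is at most a + b; being
  -- at least 1 at both x and y, it equals 1 at both.
  have h1 := hS.ctr_sub_nonneg u v hu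
  simp only [LinearMap.sub_apply, map_add, map_smul, smul_eq_mul, mink_ctr_near (h.near_left hv),
    mink_ctr_near (h.near_right hv)] at h1
  have h2 := hS.one_le_mink_ctr (p := u) h.1
  have h3 := hS.one_le_mink_ctr (p := u) h.2.1
  have h4 := mul_le_mul_of_nonneg_left h2 ha.le
  have h5 := mul_le_mul_of_nonneg_left h3 hb.le
  constructor
  · rw [← hS.mink_ctr_eq_one_iff h.1]
    refine le_antisymm ?_ h2
    by_contra hc
    have := mul_lt_mul_of_pos_left (not_le.1 hc) ha
    linarith
  · rw [← hS.mink_ctr_eq_one_iff h.2.1]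
    refine le_antisymm ?_ h3
    by_contra hc
    have := mul_lt_mul_of_pos_left (not_le.1 hc) hb
    linarith

theorem IsEdge.pair_eq_of_mem_cone (hS : IsNet S) {x y x' y' : ℍ} (h : IsEdge S x y)
    (h' : IsEdge S x' y') {a b : ℝ} (ha : 0 < a) (hb : 0 < b)
    (hP : a • hyp x + b • hyp y ∈ cone {x', y'}) : (x' = x ∧ y' = y) ∨ (x' = y ∧ y' = x) := by
  obtain ⟨p, hp, q, hq, hpq⟩ := h'.2.2.2
  have key : ∀ {p}, p ∈ voronoiCell S x' ∩ voronoiCell S y' →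
      p ∈ voronoiCell S x ∩ voronoiCell S y := by
    intro p hp
    have hsub : ({x', y'} : Set ℍ) ⊆ near S p := by
      rintro z (rfl | rfl)
      · exact h'.near_left hp
      · exact h'.near_right hp
    have := h.near_of_mem_cone hS ha hb (cone_mono hsub hP)
    exact (mem_inter_iff_near h.1 h.2.1).2 this
  exact h.pair_eq h' (key hp) (key hq) hp hq hpq

/-- The normalization of p gives (a + b)² < 1, so p lies strictly below the plane that supports the
sites along the edge. -/
theorem IsEdge.not_mem_of_pos (hS : IsNet S) {x y p : ℍ} (h : IsEdge S x y) {a b : ℝ} (ha : 0 < a)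
    (hb : 0 < b) (e : hyp p = a • hyp x + b • hyp y) : p ∉ S := by
  intro hp
  obtain ⟨v, hv⟩ := h.2.2.2.nonempty
  have h1 := hS.one_le_mink_ctr (p := v) hp
  have h2 := mink_hyp_self p
  rw [e] at h1 h2
  simp only [map_add, map_smul, smul_eq_mul, mink_ctr_near (h.near_left hv),
    mink_ctr_near (h.near_right hv), LinearMap.add_apply, LinearMap.smul_apply, mink_hyp_self,
    mink_comm (hyp y) (hyp x)] at h1 h2
  have hc := one_lt_mink_hyp h.2.2.1
  nlinarith [mul_pos (mul_pos ha hb) (sub_pos.2 hc)]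

/-- The edge has a point other than v, whose cone contains x and y too and misses the interior of
the cone of v. -/
theorem IsEdge.not_mem_interior (hS : IsNet S) {x y v : ℍ} (h : IsEdge S x y) {P : V3}
    (hP : P ∈ cone {x, y}) : P ∉ interior (cone (near S v) : Set V3) := by
  intro hint
  obtain ⟨q, hq, hqv⟩ := h.2.2.2.exists_ne v
  refine hS.interior_disjoint hqv.symm hint (cone_mono ?_ hP)
  rintro z (rfl | rfl)
  · exact h.near_left hq
  · exact h.near_right hq

/-- The two Delaunay cells at the ends of an edge cover a neighbourhood of the interior of its
dual. -/
theorem IsEdge.mem_interior_union (hS : IsNet S) {x y v w : ℍ} (h : IsEdge S x y)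
    (hv : v ∈ voronoiVertices S) (hw : w ∈ voronoiVertices S) (hvw : v ≠ w)
    (hve : v ∈ voronoiCell S x ∩ voronoiCell S y) (hwe : w ∈ voronoiCell S x ∩ voronoiCell S y)
    {a b : ℝ} (ha : 0 < a) (hb : 0 < b) : a • hyp x + b • hyp y ∈
      interior ((cone (near S v) : Set V3) ∪ (cone (near S w) : Set V3)) := by
  set N := cross (hyp x) (hyp y) with hN
  have hNN : det3 (hyp x) (hyp y) N < 0 := by
    rw [hN, ← mink_cross, mink_cross_self]; linarith [mink_mul_lt h.2.2.1]
  obtain ⟨z, hz, hzx, hzy⟩ := exists_third hv x y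
  obtain ⟨z', hz', hzx', hzy'⟩ := exists_third hw x y
  have xv := h.near_left hve; have yv := h.near_right hve
  have xw := h.near_left hwe; have yw := h.near_right hwe
  have hd := det3_ne_zero xv yv hz h.2.2.1 hzx.symm hzy.symm
  have hd' := det3_ne_zero xw yw hz' h.2.2.1 hzx'.symm hzy'.symm
  set D := det3 (hyp x) (hyp y) (hyp z) with hD
  set D' := det3 (hyp x) (hyp y) (hyp z') with hD'
  -- opposite sides
  have hopp : D * D' < 0 := by
    set l := mink (ctr S w) - mink (ctr S v) with hl
    have lx : l (hyp x) = 0 := by simp [hl, mink_ctr_near xv, mink_ctr_near xw]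
    have ly : l (hyp y) = 0 := by simp [hl, mink_ctr_near yv, mink_ctr_near yw]
    have lz : 0 ≤ l (hyp z) := hS.ctr_sub_nonneg v w (hyp_mem_cone hz)
    have lz' : l (hyp z') ≤ 0 := by
      have := hS.ctr_sub_nonneg w v (hyp_mem_cone hz')
      simp only [LinearMap.sub_apply, hl] at this ⊢; linarith
    have l0 := ctr_sub_ne_zero (S := S) hvw
    have hz0 : l (hyp z) ≠ 0 := fun h0 => l0 (LinearMap.ext (eq_zero_of_det3 hd lx ly h0))
    have hz0' : l (hyp z') ≠ 0 := fun h0 => l0 (LinearMap.ext (eq_zero_of_det3 hd' lx ly h0))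
    have e := congrArg l (cramer_div hd (hyp z'))
    simp only [map_add, map_smul, smul_eq_mul, lx, ly, mul_zero, zero_add] at e
    have lzp : 0 < l (hyp z) := lt_of_le_of_ne lz hz0.symm
    have lzn : l (hyp z') < 0 := lt_of_le_of_ne lz' hz0'
    rw [e] at lzn
    have h3 : D' / D < 0 := by
      by_contra hc
      exact absurd (mul_nonneg (not_lt.1 hc) lzp.le) (not_le.2 lzn)
    rcases lt_or_gt_of_ne hd with hneg | hpos
    · rw [div_lt_iff_of_neg hneg, zero_mul] at h3; exact mul_neg_of_neg_of_pos hneg h3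
    · rw [div_lt_iff₀ hpos, zero_mul] at h3; exact mul_neg_of_pos_of_neg hpos h3
  have hcont : ∀ l : V3 →ₗ[ℝ] ℝ, Continuous l := fun l => l.continuous_of_finiteDimensional
  set P := a • hyp x + b • hyp y with hP
  have pos : ∀ z : ℍ, det3 (hyp x) (hyp y) (hyp z) ≠ 0 →
      ∀ᶠ Q in 𝓝 P, 0 < det3 (hyp y) (hyp z) Q / det3 (hyp x) (hyp y) (hyp z) ∧
        0 < det3 (hyp z) (hyp x) Q / det3 (hyp x) (hyp y) (hyp z) := by
    intro z hd
    have e1 : det3 (hyp y) (hyp z) (hyp x) = det3 (hyp x) (hyp y) (hyp z) := by rw [← det3_rotate]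
    have e2 : det3 (hyp z) (hyp x) (hyp y) = det3 (hyp x) (hyp y) (hyp z) := by rw [det3_rotate]
    refine Filter.Eventually.and ?_ ?_
    · refine (((hcont _).div_const _).continuousAt (x := P)).eventually (lt_mem_nhds ?_)
      simp only [hP, map_add, map_smul, det3_left, e1, smul_eq_mul, mul_zero, add_zero]
      rwa [mul_div_cancel_right₀ _ hd]
    · refine (((hcont _).div_const _).continuousAt (x := P)).eventually (lt_mem_nhds ?_)
      simp only [hP, map_add, map_smul, det3_right, e2, smul_eq_mul, mul_zero, zero_add]
      rwa [mul_div_cancel_right₀ _ hd]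
  rw [mem_interior_iff_mem_nhds]
  filter_upwards [pos z hd, pos z' hd'] with Q h1 h2
  -- Near P the coefficients of x and y are positive with respect to both triples x, y, z and x, y,
  -- z'. The sign of the third coefficient decides which of the two cells contains Q.
  by_cases hs : 0 ≤ det3 (hyp x) (hyp y) Q / D
  · left
    show Q ∈ cone _
    rw [cramer_div hd Q]
    exact Submodule.add_mem _ (Submodule.add_mem _ (cone_smul (hyp_mem_cone xv) h1.1.le)
      (cone_smul (hyp_mem_cone yv) h1.2.le)) (cone_smul (hyp_mem_cone hz) hs)
  · right
    have hs' : 0 ≤ det3 (hyp x) (hyp y) Q / D' := by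
      rw [div_nonneg_iff]
      rw [div_nonneg_iff] at hs
      push Not at hs
      rcases lt_or_gt_of_ne hd with hneg | hpos
      · have : 0 < D' := by by_contra hc; nlinarith
        left; refine ⟨?_, this.le⟩
        by_contra hc
        exact absurd hneg.le (not_le.2 (hs.2 (not_le.1 hc).le))
      · have : D' < 0 := by by_contra hc; nlinarith
        right; refine ⟨?_, this.le⟩
        by_contra hc
        exact absurd hpos.le (not_le.2 (hs.1 (not_le.1 hc).le))
    show Q ∈ cone _
    rw [cramer_div hd' Q]
    exact Submodule.add_mem _ (Submodule.add_mem _ (cone_smul (hyp_mem_cone xw) h2.1.le)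
      (cone_smul (hyp_mem_cone yw) h2.2.le)) (cone_smul (hyp_mem_cone hz') hs')
end

section
variable {S : Set ℍ}

/-! ### Centered edges -/

theorem isFut_add_hyp (x y : ℍ) : IsFut (hyp x + hyp y) := (hyp_mem_Fut x).add_cfut (hyp_mem_Fut y).cfut

/-- The edge dual to the arc from `x` to `y` is centered: the only points of `S` nearest to the
midpoint of the arc are its endpoints. -/
def IsCentered (S : Set ℍ) (x y : ℍ) : Prop :=
  x ∈ S ∧ y ∈ S ∧ x ≠ y ∧ near S (pt (hyp x + hyp y)) = {x, y}

theorem IsCentered.symm {x y : ℍ} (h : IsCentered S x y) : IsCentered S y x :=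
  ⟨h.2.1, h.1, h.2.2.1.symm, by rw [add_comm, h.2.2.2, pair_comm]⟩

theorem eq_pt_midpoint {x y q : ℍ} {a : ℝ} (ha : 0 < a) (h : hyp q = a • (hyp x + hyp y)) :
    pt (hyp x + hyp y) = q :=
  eq_pt (isFut_add_hyp x y) (c := a⁻¹) (by positivity)
    (by rw [h, smul_smul, inv_mul_cancel₀ ha.ne', one_smul])

/-- The normal n to the plane of x and y favours neither site. Since x and y are the only sites
nearest to the midpoint, small moves along n and along -n stay on the edge and exhibit the midpoint
between two of its points. -/
theorem IsCentered.aux (hS : IsNet S) {x y : ℍ} (h : IsCentered S x y) :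
    IsEdge S x y ∧ pt (hyp x + hyp y) ∈ arcInterior (voronoiCell S x ∩ voronoiCell S y) := by
  obtain ⟨hx, hy, hxy, hn⟩ := h
  set m := pt (hyp x + hyp y) with hm
  have hxm : x ∈ near S m := by rw [hn]; simp
  have hym : y ∈ near S m := by rw [hn]; simp
  have ahead : ∀ n : V3, n ≠ 0 → mink n (hyp x) = 0 → mink n (hyp y) = 0 →
      ∃ q ∈ voronoiCell S x ∩ voronoiCell S y, q ≠ m ∧ ∃ c t : ℝ, 0 < c ∧ 0 < t ∧
        c • hyp q = hyp m + t • n := by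
    intro n hn0 nx ny
    obtain ⟨t, ht, hF, h⟩ := hS.exists_ahead (x := x) (n := n) (p := m) (by
      intro z hz
      rw [hn] at hz
      rcases hz with rfl | rfl
      · exact le_rfl
      · rw [nx, ny])
    obtain ⟨c, hc, e⟩ := exists_smul_hyp hF
    refine ⟨_, ⟨(h x hxm rfl).2, (h y hym (by rw [nx, ny])).2⟩, fun he => ?_, c, t, hc, ht, e.symm⟩
    rw [he] at e
    have e1 := congrArg (fun P => mink P (hyp x)) e
    simp only [map_add, map_smul, LinearMap.add_apply, LinearMap.smul_apply, smul_eq_mul, nx] at e1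
    have := mink_hyp_pos m x
    have hc1 : c = 1 := by
      have : (c - 1) * mink (hyp m) (hyp x) = 0 := by linarith
      rcases mul_eq_zero.1 this with h | h <;> linarith
    rw [hc1, one_smul, add_eq_left, smul_eq_zero] at e
    exact hn0 (e.resolve_left ht.ne')
  set n := cross (hyp x) (hyp y) with hnn
  have nx : mink n (hyp x) = 0 := by rw [hnn, mink_cross, det3_left]
  have ny : mink n (hyp y) = 0 := by rw [hnn, mink_cross, det3_right]
  have n0 : n ≠ 0 := by
    intro h0
    have := mink_cross_self (hyp x) (hyp y)
    rw [← hnn, h0] at this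
    have := mink_mul_lt hxy
    simp at *; linarith
  obtain ⟨p, hp, hpm, c, t, hc, ht, e⟩ := ahead n n0 nx ny
  obtain ⟨q, hq, hqm, d, s, hd, hs, e'⟩ := ahead (-n) (neg_ne_zero.2 n0) (by simp [nx]) (by simp [ny])
  refine ⟨⟨hx, hy, hxy, p, hp, m, ⟨hxm.2, hym.2⟩, hpm⟩, ⟨hxm.2, hym.2⟩, p, hp, q, hq, hpm, hqm, ?_⟩
  refine (mem_geodesicArc_iff.2 ⟨(s + t)⁻¹ * (s * c), (s + t)⁻¹ * (t * d), by positivity,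
    by positivity, ?_⟩ : m ∈ geodesicArc p q)
  rw [mul_smul, mul_smul, mul_smul, mul_smul, e, e', ← smul_add]
  have : s • (hyp m + t • n) + t • (hyp m + s • -n) = (s + t) • hyp m := by module
  rw [this, smul_smul, inv_mul_cancel₀ (by positivity), one_smul]

theorem IsCentered.isEdge (hS : IsNet S) {x y : ℍ} (h : IsCentered S x y) : IsEdge S x y :=
  (h.aux hS).1

theorem midpoint_mem_arc (x y : ℍ) : pt (hyp x + hyp y) ∈ geodesicArc x y := by
  refine mem_geodesicArc_iff.2 ⟨_, _, ?_, ?_, by rw [hyp_pt (isFut_add_hyp x y), smul_add]⟩ <;>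
  positivity

/-- A point of the arc equidistant from x and y is the midpoint of the arc, and a point interior to
the edge is not a Voronoi vertex, so no third site is nearest to it. -/
theorem IsNet.mem_centeredEdges_iff (hS : IsNet S) {x y : ℍ} (h : IsEdge S x y) :
    voronoiCell S x ∩ voronoiCell S y ∈ centeredEdges S ↔ IsCentered S x y := by
  constructor
  · rintro ⟨γ, hd, q, hqγ, hqe⟩
    obtain ⟨x', y', h', he, rfl⟩ := isGeometricDual_iff.1 hd
    have hγ : geodesicArc x' y' = geodesicArc x y := by
      rcases h.arc_eq h' he with ⟨rfl, rfl⟩ | ⟨rfl, rfl⟩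
      · rfl
      · exact geodesicArc_comm _ _
    rw [hγ] at hqγ
    obtain ⟨v, w, hvw, -, -, hearc, hend⟩ := hS.exists_endpoints h
    have hqv : q ∉ voronoiVertices S := by
      intro hq
      have h1 := hend q hq hqe.1
      rw [hearc, mem_arcInterior_geodesicArc' hvw] at hqe
      rcases h1 with h1 | h1
      · exact hqe.2.1 h1
      · exact hqe.2.2 h1
    have hxq := h.near_left hqe.1
    have hyq := h.near_right hqe.1
    obtain ⟨a, b, ha, hb, e⟩ := mem_geodesicArc_iff.1 hqγ
    have hab : a = b := by
      have h1 := near_eq hxq hyq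
      rw [e] at h1
      simp only [map_add, map_smul, LinearMap.add_apply, LinearMap.smul_apply, smul_eq_mul,
        mink_hyp_self, mink_comm (hyp y) (hyp x)] at h1
      have := one_lt_mink_hyp h.2.2.1
      have : (a - b) * (mink (hyp x) (hyp y) - 1) = 0 := by linear_combination -h1
      rcases mul_eq_zero.1 this with h | h <;> linarith
    have ha' : 0 < a := by
      refine lt_of_le_of_ne ha fun h0 => hyp_ne_zero q ?_
      rw [e, ← hab, ← h0]; simp
    have hmq := eq_pt_midpoint (x := x) (y := y) ha' (by rw [e, hab, smul_add])
    refine ⟨h.1, h.2.1, h.2.2.1, ?_⟩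
    rw [hmq]
    refine Subset.antisymm (fun z hz => ?_) ?_
    · by_contra hcon
      simp only [mem_insert_iff, mem_singleton_iff, not_or] at hcon
      exact hqv (mem_voronoiVertices_of_third hxq hyq hz h.2.2.1 hcon.1 hcon.2)
    · rintro z (rfl | rfl)
      · exact hxq
      · exact hyq
  · intro hc
    exact ⟨geodesicArc x y, isGeometricDual_iff.2 ⟨x, y, h, rfl, rfl⟩, _, midpoint_mem_arc x y,
      (hc.aux hS).2⟩

theorem IsNet.mem_centeredDuals_iff (hS : IsNet S) {γ : Set ℍ} : γ ∈ centeredDuals S ↔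
    ∃ x y, IsCentered S x y ∧ γ = geodesicArc x y := by
  constructor
  · rintro ⟨e, he, hd⟩
    obtain ⟨x, y, h, rfl, rfl⟩ := isGeometricDual_iff.1 hd
    exact ⟨x, y, (hS.mem_centeredEdges_iff h).1 he, rfl⟩
  · rintro ⟨x, y, h, rfl⟩
    exact ⟨_, (hS.mem_centeredEdges_iff (h.isEdge hS)).2 h,
      isGeometricDual_iff.2 ⟨x, y, h.isEdge hS, rfl, rfl⟩⟩

theorem IsNet.exists_ne_mem (hS : IsNet S) (x : ℍ) : ∃ y ∈ S, y ≠ x := by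
  obtain ⟨R, hR⟩ := hS.exists_dist_le
  have : ∃ p, R < dist p x := by
    by_contra hcon
    push Not at hcon
    have : (univ : Set ℍ) ⊆ closedBall x R := fun p _ => hcon p
    exact noncompact_univ ℍ ((isCompact_closedBall x R).of_isClosed_subset isClosed_univ this)
  obtain ⟨p, hp⟩ := this
  obtain ⟨y, hy, hyR⟩ := hR p
  refine ⟨y, hy, ?_⟩
  rintro rfl; linarith

/-- Join x to a nearest other site y. A further site z satisfies ⟨x, z⟩ ≥ ⟨x, y⟩ and ⟨y, z⟩ > 1, so
it is strictly farther from the midpoint than x and y are. -/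
theorem IsNet.exists_isCentered (hS : IsNet S) {x : ℍ} (hx : x ∈ S) : ∃ y, IsCentered S x y := by
  obtain ⟨y₀, hy₀, hne⟩ := hS.exists_ne_mem x
  obtain ⟨y, hy, hmin⟩ := Set.exists_min_image ((S ∩ closedBall x (dist y₀ x)) \ {x})
    (fun z => dist x z) ((hS.finite_inter x _).subset sdiff_subset)
    ⟨y₀, ⟨hy₀, by simp⟩, hne⟩
  have hmin : ∀ z ∈ S, z ≠ x → dist x y ≤ dist x z := by
    intro z hz hzx
    by_cases hb : z ∈ closedBall x (dist y₀ x)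
    · exact hmin z ⟨⟨hz, hb⟩, hzx⟩
    · have := hmin y₀ ⟨⟨hy₀, by simp⟩, hne⟩
      rw [mem_closedBall, not_le, dist_comm z] at hb
      rw [dist_comm x y₀] at this
      linarith
  have hxy : x ≠ y := Ne.symm hy.2
  refine ⟨y, hx, hy.1.1, hxy, ?_⟩
  have hval : ∀ z, mink (hyp (pt (hyp x + hyp y))) (hyp z) =
      (√(mink (hyp x + hyp y) (hyp x + hyp y)))⁻¹ * (mink (hyp x) (hyp z) + mink (hyp y) (hyp z)) := by
    intro z; rw [hyp_pt (isFut_add_hyp x y)]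
    simp only [map_add, map_smul, LinearMap.add_apply, LinearMap.smul_apply, smul_eq_mul]
  have hr : 0 < (√(mink (hyp x + hyp y) (hyp x + hyp y)))⁻¹ :=
    inv_pos.2 (Real.sqrt_pos.2 (isFut_add_hyp x y).1)
  have hlt : ∀ z ∈ S, z ≠ x → z ≠ y →
      1 + mink (hyp x) (hyp y) < mink (hyp x) (hyp z) + mink (hyp y) (hyp z) := by
    intro z hz h1 h2
    have := dist_le_dist_iff.1 (hmin z hz h1)
    have := one_lt_mink_hyp h2.symm
    linarith
  have hxv := hval x; have hyv := hval y
  rw [mink_hyp_self, mink_comm (hyp y)] at hxv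
  rw [mink_hyp_self, add_comm (mink (hyp x) (hyp y))] at hyv
  have hcase : ∀ z ∈ S, mink (hyp (pt (hyp x + hyp y))) (hyp x) ≤ mink (hyp (pt (hyp x + hyp y))) (hyp z) := by
    intro z hz
    by_cases h1 : z = x
    · rw [h1]
    · by_cases h2 : z = y
      · rw [h2, hxv, hyv]
      · rw [hxv, hval z]
        exact mul_le_mul_of_nonneg_left (hlt z hz h1 h2).le hr.le
  refine Subset.antisymm (fun z hz => ?_) ?_
  · by_contra hcon
    simp only [mem_insert_iff, mem_singleton_iff, not_or] at hcon
    have h1 := (mem_near_iff.1 hz).2 x hx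
    rw [hval z, hxv] at h1
    exact absurd (le_of_mul_le_mul_left h1 hr) (not_le.2 (hlt z hz.1 hcon.1 hcon.2))
  · have hxn : x ∈ near S (pt (hyp x + hyp y)) := mem_near_iff.2 ⟨hx, hcase⟩
    rintro z (rfl | rfl)
    · exact hxn
    · exact near_of_eq hxn hy.1.1 (by rw [hyv, hxv])

/-! ### The orientation of the non-centered edges -/

/-- The edge dual to the arc from `x` to `y` is non-centered and is traversed from `v` to `w` in
the direction of increasing distance to `S`. -/
def Step (S : Set ℍ) (v w x y : ℍ) : Prop :=
  IsEdge S x y ∧ v ≠ w ∧ v ∈ voronoiVertices S ∧ w ∈ voronoiVertices S ∧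
  v ∈ voronoiCell S x ∩ voronoiCell S y ∧ w ∈ voronoiCell S x ∩ voronoiCell S y ∧
  ∀ z ∈ near S v, mink (hyp x) (hyp z) + mink (hyp y) (hyp z) ≤ 1 + mink (hyp x) (hyp y)

namespace Step
variable {v w x y : ℍ}

theorem swap (h : Step S v w x y) : Step S v w y x := by
  obtain ⟨h1, h2, h3, h4, h5, h6, h7⟩ := h
  refine ⟨h1.symm, h2, h3, h4, by rwa [inter_comm], by rwa [inter_comm], fun z hz => ?_⟩
  rw [mink_comm (hyp y) (hyp x), add_comm]; exact h7 z hz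

theorem edge (h : Step S v w x y) : IsEdge S x y := h.1
theorem ne (h : Step S v w x y) : v ≠ w := h.2.1
theorem vertex_left (h : Step S v w x y) : v ∈ voronoiVertices S := h.2.2.1
theorem vertex_right (h : Step S v w x y) : w ∈ voronoiVertices S := h.2.2.2.1
theorem mem_left (h : Step S v w x y) : v ∈ voronoiCell S x ∩ voronoiCell S y := h.2.2.2.2.1
theorem mem_right (h : Step S v w x y) : w ∈ voronoiCell S x ∩ voronoiCell S y := h.2.2.2.2.2.1
theorem le (h : Step S v w x y) : ∀ z ∈ near S v,
  mink (hyp x) (hyp z) + mink (hyp y) (hyp z) ≤ 1 + mink (hyp x) (hyp y) := h.2.2.2.2.2.2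

/-- The sum x + y is a multiple of the midpoint, so the bound in `Step` says that no site near v is
farther from the midpoint than x. If the edge were centered, a third site near v would be strictly
farther. -/
theorem not_isCentered (h : Step S v w x y) : ¬ IsCentered S x y := by
  intro hc
  obtain ⟨z, hz, hzx, hzy⟩ := exists_third h.vertex_left x y
  have hxm : x ∈ near S (pt (hyp x + hyp y)) := by rw [hc.2.2.2]; simp
  have hzm : z ∉ near S (pt (hyp x + hyp y)) := by rw [hc.2.2.2]; simp [hzx, hzy]
  have h1 := near_lt hxm hz.1 hzm
  rw [hyp_pt (isFut_add_hyp x y)] at h1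
  simp only [map_add, map_smul, LinearMap.add_apply, LinearMap.smul_apply, smul_eq_mul, mink_hyp_self,
    mink_comm (hyp y) (hyp x)] at h1
  have := lt_of_mul_lt_mul_left h1 (by positivity)
  have := h.le z hz
  linarith

theorem endpoints (hS : IsNet S) (h : Step S v w x y) :
    voronoiCell S x ∩ voronoiCell S y = geodesicArc v w ∧
      ∀ u ∈ voronoiVertices S, u ∈ voronoiCell S x ∩ voronoiCell S y → u = v ∨ u = w := by
  obtain ⟨v', w', h1, hv', hw', he, hend⟩ := hS.exists_endpoints h.edge
  have a := hend v h.vertex_left h.mem_left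
  have b := hend w h.vertex_right h.mem_right
  have hne := h.ne
  rcases a with rfl | rfl
  · have : w = w' := by grind
    subst this; exact ⟨he, hend⟩
  · have : w = v' := by grind
    subst this; exact ⟨by rw [he, geodesicArc_comm], fun u hu hu' => (hend u hu hu').symm⟩

/-- Write x + y = a v + b w. A third site near v is strictly farther from w than x is, so the bound
in `Step` forces b ≤ 0 and hence a > 0. Pairing with v and with w gives 2 (rad w - rad v) = (a -
b)(k - 1), where k = ⟨v, w⟩ > 1. -/
theorem rad_lt (h : Step S v w x y) : rad S v < rad S w := by
  have xv := h.edge.near_left h.mem_left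
  have yv := h.edge.near_right h.mem_left
  have xw := h.edge.near_left h.mem_right
  have yw := h.edge.near_right h.mem_right
  obtain ⟨a, b, e⟩ := exists_combination_of_equidistant (R := hyp x + hyp y) h.edge.2.2.1 h.ne
    (near_eq xv yv) (near_eq xw yw) (by
      simp only [map_add, LinearMap.add_apply, mink_hyp_self, mink_comm (hyp y) (hyp x)]; ring)
  obtain ⟨z, hz, hzx, hzy⟩ := exists_third h.vertex_left x y
  have hzw : z ∉ near S w := fun hzw => by
    rcases h.edge.eq_or_eq_of_near h.mem_left h.mem_right h.ne hz hzw with h | h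
    · exact hzx h
    · exact hzy h
  have h1 := h.le z hz
  have e1 := congrArg (fun P => mink P (hyp z)) e
  have e2 := congrArg (fun P => mink P (hyp x)) e
  have e3 := congrArg (mink (hyp v)) e
  have e4 := congrArg (mink (hyp w)) e
  have k := one_lt_mink_hyp h.ne
  simp only [map_add, map_smul, LinearMap.add_apply, LinearMap.smul_apply, smul_eq_mul,
    mink_hyp_self, mink_comm (hyp y) (hyp x), mink_comm (hyp w) (hyp v)] at e1 e2 e3 e4
  have h2 := near_lt xw hz.1 hzw
  have h3 := near_eq xv hz
  have rv := rad_eq xv; have rw' := rad_eq xw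
  rw [← near_eq xv yv] at e3
  rw [← near_eq xw yw] at e4
  have hb : b ≤ 0 := by
    by_contra hb
    have := mul_lt_mul_of_pos_left h2 (not_le.1 hb)
    rw [← h3] at e1
    linarith
  have hp := mink_hyp_pos v x
  have ha : 0 < a := by
    by_contra ha
    nlinarith [mul_nonneg (neg_nonneg.2 hb) (sub_nonneg.2 k.le)]
  rw [rv, rw']
  nlinarith [mul_pos (sub_pos.2 k) (show 0 < a - b by linarith)]

/-- At each Voronoi vertex there is at most one outgoing non-centered edge. -/
theorem unique (hS : IsNet S) {w' x' y' : ℍ} (h : Step S v w x y) (h' : Step S v w' x' y') :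
    w' = w ∧ ((x' = x ∧ y' = y) ∨ (x' = y ∧ y' = x)) := by
  have xv := h.edge.near_left h.mem_left
  have yv := h.edge.near_right h.mem_left
  have xv' := h'.edge.near_left h'.mem_left
  have yv' := h'.edge.near_right h'.mem_left
  have xw := h.edge.near_left h.mem_right
  have yw := h.edge.near_right h.mem_right
  -- The difference of the two sums is orthogonal to v, and the bounds of the two steps make its
  -- square nonnegative. Such a vector is zero.
  have hM : hyp x + hyp y - (hyp x' + hyp y') = 0 := by
    refine eq_zero_of_orthogonal (hyp_mem_Fut v) ?_ ?_
    · simp only [map_sub, map_add, ← rad_eq xv, ← rad_eq yv, ← rad_eq xv', ← rad_eq yv']; ring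
    · have a1 := h.le x' xv'; have a2 := h.le y' yv'
      have b1 := h'.le x xv; have b2 := h'.le y yv
      simp only [map_sub, map_add, LinearMap.sub_apply, LinearMap.add_apply, mink_hyp_self]
      linarith [mink_comm (hyp x') (hyp x), mink_comm (hyp y') (hyp x), mink_comm (hyp x') (hyp y),
        mink_comm (hyp y') (hyp y), mink_comm (hyp y) (hyp x), mink_comm (hyp y') (hyp x')]
  -- The two sums have the same product with w and neither summand can be smaller than that of a
  -- nearest site, so x' and y' are nearest to w too.
  have e := congrArg (mink (hyp w)) (sub_eq_zero.1 hM)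
  simp only [map_add] at e
  have n1 := (mem_near_iff.1 xw).2 x' xv'.1
  have n2 := (mem_near_iff.1 xw).2 y' yv'.1
  have n3 := near_eq xw yw
  have m1 : x' ∈ near S w := near_of_eq xw xv'.1 (by linarith)
  have m2 : y' ∈ near S w := near_of_eq xw yv'.1 (by linarith)
  have c1 := h.edge.eq_or_eq_of_near h.mem_left h.mem_right h.ne xv' m1
  have c2 := h.edge.eq_or_eq_of_near h.mem_left h.mem_right h.ne yv' m2
  have hne := h'.edge.2.2.1
  have hpair : (x' = x ∧ y' = y) ∨ (x' = y ∧ y' = x) := by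
    clear * - hne c1 c2
    grind
  refine ⟨?_, hpair⟩
  have hmem : w' ∈ voronoiCell S x ∩ voronoiCell S y := by
    rcases hpair with ⟨rfl, rfl⟩ | ⟨rfl, rfl⟩
    · exact h'.mem_right
    · rw [inter_comm]; exact h'.mem_right
  exact ((h.endpoints hS).2 w' h'.vertex_right hmem).resolve_left h'.ne.symm

end Step

/-- With x + y = a v + b w, the case b ≤ 0 orients the edge from v to w and the case a ≤ 0 from w to
v. If both coefficients are positive, the midpoint is interior to the edge, which is then centered.
-/
theorem IsNet.step_of_isEdge (hS : IsNet S) {x y v w : ℍ} (h : IsEdge S x y)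
    (hc : ¬ IsCentered S x y) (hv : v ∈ voronoiVertices S) (hw : w ∈ voronoiVertices S)
    (hvw : v ≠ w) (hve : v ∈ voronoiCell S x ∩ voronoiCell S y)
    (hwe : w ∈ voronoiCell S x ∩ voronoiCell S y) : Step S v w x y ∨ Step S w v x y := by
  have xv := h.near_left hve
  have yv := h.near_right hve
  have xw := h.near_left hwe
  have yw := h.near_right hwe
  obtain ⟨a, b, e⟩ := exists_combination_of_equidistant (R := hyp x + hyp y) h.2.2.1 hvw
    (near_eq xv yv) (near_eq xw yw) (by
      simp only [map_add, LinearMap.add_apply, mink_hyp_self, mink_comm (hyp y) (hyp x)]; ring)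
  have key : ∀ z, mink (hyp x) (hyp z) + mink (hyp y) (hyp z) =
      a * mink (hyp v) (hyp z) + b * mink (hyp w) (hyp z) := fun z => by
    have := congrArg (fun P => mink P (hyp z)) e
    simpa using this
  have keyx := key x
  rw [mink_hyp_self, mink_comm (hyp y)] at keyx
  by_cases hb : b ≤ 0
  · left
    refine ⟨h, hvw, hv, hw, hve, hwe, fun z hz => ?_⟩
    have := mul_le_mul_of_nonpos_left ((mem_near_iff.1 xw).2 z hz.1) hb
    rw [key z, keyx, near_eq xv hz]; linarith
  by_cases ha : a ≤ 0
  · right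
    refine ⟨h, hvw.symm, hw, hv, hwe, hve, fun z hz => ?_⟩
    have := mul_le_mul_of_nonpos_left ((mem_near_iff.1 xv).2 z hz.1) ha
    rw [key z, keyx, near_eq xw hz]; linarith
  exfalso
  push Not at ha hb
  obtain ⟨v', w', h1, hv', hw', he, hend⟩ := hS.exists_endpoints h
  have harc : voronoiCell S x ∩ voronoiCell S y = geodesicArc v w := by
    have c1 := hend v hv hve
    have c2 := hend w hw hwe
    rcases c1 with rfl | rfl
    · have : w = w' := by grind
      subst this; exact he
    · have : w = v' := by grind
      subst this; rw [he, geodesicArc_comm]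
  set m := pt (hyp x + hyp y) with hm
  have hF := isFut_add_hyp x y
  have hr : 0 < (√(mink (hyp x + hyp y) (hyp x + hyp y)))⁻¹ := inv_pos.2 (Real.sqrt_pos.2 hF.1)
  have hmi : m ∈ arcInterior (geodesicArc v w) := by
    refine (mem_arcInterior_geodesicArc hvw).2 ⟨_, _, mul_pos hr ha, mul_pos hr hb, ?_⟩
    rw [mul_smul, mul_smul, ← smul_add, ← e, hm, hyp_pt hF]
  have hme : m ∈ voronoiCell S x ∩ voronoiCell S y := harc ▸ hmi.1
  rw [mem_arcInterior_geodesicArc' hvw] at hmi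
  refine hc ⟨h.1, h.2.1, h.2.2.1, Subset.antisymm (fun z hz => ?_) ?_⟩
  · by_contra hcon
    simp only [mem_insert_iff, mem_singleton_iff, not_or] at hcon
    have hmv := mem_voronoiVertices_of_third (h.near_left hme) (h.near_right hme) hz h.2.2.1
      hcon.1 hcon.2
    have c0 := hend m hmv hme
    have c1 := hend v hv hve
    have c2 := hend w hw hwe
    have := hmi.2
    grind
  · rintro z (rfl | rfl)
    · exact h.near_left hme
    · exact h.near_right hme

/-- The arms of a vertex without outgoing edges surround it. -/
theorem IsNet.hyp_mem_interior_of_no_step (hS : IsNet S) {v : ℍ} (hv : v ∈ voronoiVertices S)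
    (h : ∀ w x y, ¬ Step S v w x y) : hyp v ∈ interior (cone (near S v) : Set V3) := by
  -- No side satisfies the bound in `Step`, since its dual edge would leave v.
  have step : ∀ x y, IsSide S v x y → ¬ ∀ z ∈ near S v,
      mink (hyp x) (hyp z) + mink (hyp y) (hyp z) ≤ 1 + mink (hyp x) (hyp y) := by
    intro x y hs hle
    obtain ⟨v', w', h1, hv', hw', he, hend⟩ := hS.exists_endpoints hs.1
    have hmem : ∀ u ∈ geodesicArc v' w', u ∈ voronoiCell S x ∩ voronoiCell S y := fun u hu => he ▸ hu
    rcases hend v hv hs.mem with rfl | rfl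
    · exact h w' x y ⟨hs.1, h1, hv, hw', hs.mem, hmem _ (right_mem_geodesicArc _ _), hle⟩
    · exact h v' x y ⟨hs.1, h1.symm, hv, hv', hs.mem, hmem _ (left_mem_geodesicArc _ _), hle⟩
  -- the longest chord
  have hfin : ((near S v) ×ˢ (near S v)).Finite := (hS.finite_near v).prod (hS.finite_near v)
  obtain ⟨x₀, hx₀⟩ := hS.nonempty_near v
  obtain ⟨⟨x, y⟩, ⟨hx, hy⟩, hmax⟩ := Set.exists_max_image _ (fun q : ℍ × ℍ => mink (hyp q.1) (hyp q.2)) hfin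
    ⟨(x₀, x₀), hx₀, hx₀⟩
  simp only at hx hy
  have hmax : ∀ a ∈ near S v, ∀ b ∈ near S v, mink (hyp a) (hyp b) ≤ mink (hyp x) (hyp y) :=
    fun a ha b hb => hmax (a, b) ⟨ha, hb⟩
  have hxy : x ≠ y := by
    rintro rfl
    obtain ⟨z, hz, hzx, -⟩ := exists_third hv x x
    have := hmax z hz x hx
    rw [mink_hyp_self] at this
    exact absurd this (not_le.2 (one_lt_mink_hyp hzx))
  by_cases hle : ∀ z ∈ near S v,
      mink (hyp x) (hyp z) + mink (hyp y) (hyp z) ≤ 1 + mink (hyp x) (hyp y)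
  · -- then `v` lies on the chord
    -- This functional is nonnegative on the cell and vanishes at x and y. If it is nonzero, xy is
    -- one of the sides just excluded; if it is zero, x + y is proportional to v.
    by_cases hM : (1 + mink (hyp x) (hyp y)) • mink (ctr S v) - (mink (hyp x) + mink (hyp y)) = 0
    · have hMv : hyp x + hyp y = ((1 + mink (hyp x) (hyp y)) * (rad S v)⁻¹) • hyp v := by
        have : hyp x + hyp y - ((1 + mink (hyp x) (hyp y)) * (rad S v)⁻¹) • hyp v = 0 := by
          refine mink_nondegenerate fun Q => ?_
          have := LinearMap.congr_fun hM Q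
          simp only [LinearMap.sub_apply, LinearMap.smul_apply, LinearMap.add_apply, ctr, map_smul,
            smul_eq_mul, LinearMap.zero_apply] at this
          simp only [map_sub, map_add, map_smul, LinearMap.sub_apply, LinearMap.smul_apply,
            LinearMap.add_apply, smul_eq_mul]
          linarith
        exact sub_eq_zero.1 this
      have hpos : 0 < (1 + mink (hyp x) (hyp y)) * (rad S v)⁻¹ :=
        mul_pos (by linarith [mink_hyp_pos x y]) (inv_pos.2 (rad_pos v))
      set k := (1 + mink (hyp x) (hyp y)) * (rad S v)⁻¹
      set l := det3 (hyp x) (hyp y) with hl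
      have l0 : l ≠ 0 := by
        obtain ⟨z, hz, hzx, hzy⟩ := exists_third hv x y
        intro h0
        exact det3_ne_zero hx hy hz hxy hzx.symm hzy.symm (by rw [← hl, h0]; rfl)
      have side : ∀ l' : V3 →ₗ[ℝ] ℝ, (l' = l ∨ l' = -l) → ¬ ∀ z ∈ near S v, 0 ≤ l' (hyp z) := by
        intro l' hl' hnn
        refine step x y (hS.isSide_of_functional hx hy hxy (l := l') ?_ ?_ ?_ hnn) hle
        · rcases hl' with rfl | rfl
          · exact l0
          · exact neg_ne_zero.2 l0
        · rcases hl' with rfl | rfl <;> simp [hl, det3_left]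
        · rcases hl' with rfl | rfl <;> simp [hl, det3_right]
      have s1 := side l (Or.inl rfl)
      have s2 := side (-l) (Or.inr rfl)
      push Not at s1 s2
      obtain ⟨z, hz, hz0⟩ := s1
      obtain ⟨z', hz', hz0'⟩ := s2
      simp only [LinearMap.neg_apply, Left.neg_neg_iff] at hz0'
      -- `v` is a positive combination of `x, y, z, z'`
      have hxz : x ≠ z := by rintro rfl; simp [hl, det3_left] at hz0
      have hyz : y ≠ z := by rintro rfl; simp [hl, det3_right] at hz0
      have hd := det3_ne_zero hx hy hz hxy hxz hyz
      -- the combination `w = -l z' z + l z z'` is in the span of `x, y`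
      have hC := cramer_div hd (hyp z')
      set D := det3 (hyp x) (hyp y) (hyp z)
      set α := det3 (hyp y) (hyp z) (hyp z') / D
      set β := det3 (hyp z) (hyp x) (hyp z') / D
      have hγ : 0 < -(det3 (hyp x) (hyp y) (hyp z') / D) := by
        rw [neg_pos]; exact div_neg_of_pos_of_neg hz0' hz0
      set γ := -(det3 (hyp x) (hyp y) (hyp z') / D) with hγd
      have hC' : hyp z' + γ • hyp z = α • hyp x + β • hyp y := by
        rw [hC, hγd]; module
      -- Adding ε times the relation `hC'` to x + y brings in z and z' with positive weights; ε is
      -- small enough to keep the weights of x and y positive.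
      obtain ⟨ε, hε, h1, h2⟩ : ∃ ε : ℝ, 0 < ε ∧ 0 < 1 - ε * α ∧ 0 < 1 - ε * β := by
        refine ⟨(|α| + |β| + 1)⁻¹ / 2, by positivity, ?_, ?_⟩
        · have hq : 0 < |α| + |β| + 1 := by positivity
          rw [sub_pos, div_mul_eq_mul_div, inv_mul_eq_div, div_div, div_lt_one (by positivity)]
          linarith [le_abs_self α, abs_nonneg α, abs_nonneg β]
        · have hq : 0 < |α| + |β| + 1 := by positivity
          rw [sub_pos, div_mul_eq_mul_div, inv_mul_eq_div, div_div, div_lt_one (by positivity)]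
          linarith [le_abs_self β, abs_nonneg α, abs_nonneg β]
      have hint := mem_interior_cone_of_pos hx hy hz hd h1 h2 (mul_pos hε hγ)
      have hadd : ∀ P ∈ (cone (near S v) : Set V3), ∀ Q ∈ (cone (near S v) : Set V3),
        P + Q ∈ (cone (near S v) : Set V3) := fun P hP Q hQ => Submodule.add_mem _ hP hQ
      have h3 := interior_add_mem hadd hint (cone_smul (hyp_mem_cone hz') hε.le)
      have h4 : (1 - ε * α) • hyp x + (1 - ε * β) • hyp y + (ε * γ) • hyp z + ε • hyp z'
          = k • hyp v := by
        rw [← hMv]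
        have : ε • (hyp z' + γ • hyp z) = ε • (α • hyp x + β • hyp y) := by rw [hC']
        have e : (1 - ε * α) • hyp x + (1 - ε * β) • hyp y + (ε * γ) • hyp z + ε • hyp z'
          = hyp x + hyp y + (ε • (hyp z' + γ • hyp z) - ε • (α • hyp x + β • hyp y)) := by module
        rw [e, this, sub_self, add_zero]
      rw [h4] at h3
      have h5 := interior_smul_mem (fun c P hc hP => cone_smul hP hc.le) h3 (inv_pos.2 hpos)
      rwa [smul_smul, inv_mul_cancel₀ hpos.ne', one_smul] at h5
    · exfalso
      refine step x y (hS.isSide_of_functional hx hy hxy hM ?_ ?_ ?_) hle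
      · simp [mink_ctr_near hx, mink_hyp_self, mink_comm (hyp y) (hyp x)]
      · simp [mink_ctr_near hy, mink_hyp_self]
        ring
      · intro z hz
        simp only [LinearMap.sub_apply, LinearMap.smul_apply, LinearMap.add_apply, mink_ctr_near hz,
          smul_eq_mul, mul_one]
        linarith [hle z hz]
  · push Not at hle
    obtain ⟨z, hz, hlt⟩ := hle
    have hzx : z ≠ x := by rintro rfl; rw [mink_hyp_self, mink_comm] at hlt; linarith
    have hzy : z ≠ y := by rintro rfl; rw [mink_hyp_self] at hlt; linarith
    have hd := det3_ne_zero hx hy hz hxy hzx.symm hzy.symm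
    have p := one_lt_mink_hyp hxy
    have q := one_lt_mink_hyp hzx.symm
    have r := one_lt_mink_hyp hzy.symm
    have m1 := hmax x hx z hz
    have m2 := hmax y hy z hz
    set c := mink (hyp x) (hyp y) - 1 with hc
    set b := mink (hyp x) (hyp z) - 1 with hb
    set a := mink (hyp y) (hyp z) - 1 with ha
    -- Since xy is a longest chord, a ≤ c and b ≤ c, and the choice of z gives c < a + b. These
    -- weights locate the circumcentre of the triangle, and they are positive.
    have A : 0 < a * (b + c - a) := mul_pos (by linarith) (by linarith)
    have B : 0 < b * (a + c - b) := mul_pos (by linarith) (by linarith)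
    have C : 0 < c * (a + b - c) := mul_pos (by linarith) (by linarith)
    have hint := mem_interior_cone_of_pos hx hy hz hd A B C
    set P := (a * (b + c - a)) • hyp x + (b * (a + c - b)) • hyp y + (c * (a + b - c)) • hyp z with hP
    set s := a * (b + c - a) + b * (a + c - b) + c * (a + b - c) with hs
    -- The combination P has the same product s + 2abc with x, y and z, so it is a multiple of their
    -- centre v.
    have key : ∀ Q, (mink P - (s + 2 * a * b * c) • mink (ctr S v)) Q = 0 := by
      apply eq_zero_of_det3 hd
      · simp only [hP, hs, LinearMap.sub_apply, LinearMap.smul_apply, LinearMap.add_apply, map_add, map_smul,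
          smul_eq_mul, mink_ctr_near hx, mink_hyp_self, mink_comm (hyp y) (hyp x),
          mink_comm (hyp z) (hyp x)]
        rw [show mink (hyp x) (hyp y) = c + 1 by rw [hc]; ring,
          show mink (hyp x) (hyp z) = b + 1 by rw [hb]; ring]
        ring
      · simp only [hP, hs, LinearMap.sub_apply, LinearMap.smul_apply, LinearMap.add_apply, map_add, map_smul,
          smul_eq_mul, mink_ctr_near hy, mink_hyp_self, 
          mink_comm (hyp z) (hyp y)]
        rw [show mink (hyp x) (hyp y) = c + 1 by rw [hc]; ring,
          show mink (hyp y) (hyp z) = a + 1 by rw [ha]; ring]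
        ring
      · simp only [hP, hs, LinearMap.sub_apply, LinearMap.smul_apply, LinearMap.add_apply, map_add, map_smul,
          smul_eq_mul, mink_ctr_near hz, mink_hyp_self]
        rw [show mink (hyp y) (hyp z) = a + 1 by rw [ha]; ring,
          show mink (hyp x) (hyp z) = b + 1 by rw [hb]; ring]
        ring
    have hPe : P = ((s + 2 * a * b * c) * (rad S v)⁻¹) • hyp v := by
      have : P - (s + 2 * a * b * c) • ctr S v = 0 := mink_nondegenerate fun Q => by
        simpa using key Q
      rw [sub_eq_zero, ctr, smul_smul] at this
      exact this
    have hk : 0 < (s + 2 * a * b * c) * (rad S v)⁻¹ := by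
      have ha0 : 0 < a := by linarith
      have hb0 : 0 < b := by linarith
      have hc0 : 0 < c := by linarith
      exact mul_pos (by positivity) (inv_pos.2 (rad_pos v))
    rw [hPe] at hint
    have h5 := interior_smul_mem (fun c P hc hP => cone_smul hP hc.le) hint (inv_pos.2 hk)
    rwa [smul_smul, inv_mul_cancel₀ hk.ne', one_smul] at h5
end

/-! ### The Delaunay tessellation and the dual graph of the centered edges -/

section
variable {S : Set ℍ}

/-- On generators the form is ⟨x, y⟩ - 1 ≥ 0, and bilinearity carries this to the cone. -/
theorem gform_nonneg {v : ℍ} {P Q : V3} (hP : P ∈ cone (near S v)) (hQ : Q ∈ cone (near S v)) :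
    0 ≤ gform (ctr S v) P Q := by
  have hadd : ∀ P P' Q, gform (ctr S v) (P + P') Q = gform (ctr S v) P Q + gform (ctr S v) P' Q := by
    intro P P' Q; simp only [gform, map_add, LinearMap.add_apply]; ring
  have hadd' : ∀ P Q Q', gform (ctr S v) P (Q + Q') = gform (ctr S v) P Q + gform (ctr S v) P Q' := by
    intro P P' Q; simp only [gform, map_add]; ring
  have hsmul : ∀ (c : ℝ) P Q, gform (ctr S v) (c • P) Q = c * gform (ctr S v) P Q := by
    intro c P Q; simp only [gform, map_smul, LinearMap.smul_apply, smul_eq_mul]; ring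
  have hsmul' : ∀ (c : ℝ) P Q, gform (ctr S v) P (c • Q) = c * gform (ctr S v) P Q := by
    intro c P Q; simp only [gform, map_smul, smul_eq_mul]; ring
  refine cone_induction (C := fun P => 0 ≤ gform (ctr S v) P Q) (by simp [gform]) ?_ ?_ ?_ hP
  · intro x hx
    refine cone_induction (C := fun Q => 0 ≤ gform (ctr S v) (hyp x) Q) (by simp [gform]) ?_ ?_ ?_ hQ
    · intro y hy
      rw [gform_near hx hy, sub_nonneg]; exact one_le_mink_hyp _ _
    · intro A B _ _ hA hB; rw [hadd']; exact add_nonneg hA hB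
    · intro c A hc _ hA; rw [hsmul']; exact mul_nonneg hc.le hA
  · intro A B _ _ hA hB; rw [hadd]; exact add_nonneg hA hB
  · intro c A hc _ hA; rw [hsmul]; exact mul_nonneg hc.le hA

/-- A Delaunay cell is contained in the disk bounded by the circle through its vertices. -/
theorem dist_le_of_mem_delaunayCell {v p x : ℍ} (hp : p ∈ delaunayCell S v) (hx : x ∈ near S v) :
    dist v p ≤ dist v x := by
  rw [dist_le_dist_iff, ← rad_eq hx]
  have h := mem_delaunayCell.1 hp
  have h1 := gform_nonneg h h
  rw [gform, mink_hyp_self, mink_ctr] at h1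
  have h2 := mink_hyp_pos v p
  have hr := rad_pos (S := S) v
  by_contra hcon
  push Not at hcon
  have : 1 < mink (hyp v) (hyp p) / rad S v := (one_lt_div hr).2 hcon
  nlinarith

theorem countable_of_isNet (hS : IsNet S) : S.Countable := by
  have : S = ⋃ n : ℕ, S ∩ closedBall UpperHalfPlane.I n := by
    ext x
    simp only [mem_iUnion, mem_inter_iff, mem_closedBall]
    refine ⟨fun h => ?_, fun ⟨_, h, _⟩ => h⟩
    obtain ⟨n, hn⟩ := exists_nat_ge (dist x UpperHalfPlane.I)
    exact ⟨n, h, hn⟩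
  rw [this]
  exact countable_iUnion fun n => (hS.finite_inter _ _).countable

/-- The coordinates (re, log im) identify ℍ with ℂ, where complements of countable sets are path
connected. -/
theorem isPreconnected_compl_of_countable (hS : S.Countable) : IsPreconnected Sᶜ := by
  let f : ℂ → ℍ := fun z => ⟨⟨z.re, Real.exp z.im⟩, Real.exp_pos _⟩
  have hf : Continuous f := by
    refine UpperHalfPlane.isEmbedding_coe.continuous_iff.2 ?_
    change Continuous fun z : ℂ => (⟨z.re, Real.exp z.im⟩ : ℂ)
    have : (fun z : ℂ => (⟨z.re, Real.exp z.im⟩ : ℂ))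
        = fun z : ℂ => (z.re : ℂ) + (Real.exp z.im : ℂ) * Complex.I := by
      funext z; exact Complex.mk_eq_add_mul_I _ _
    rw [this]; fun_prop
  have hinj : Function.Injective f := by
    intro z w h
    have h' := congrArg (fun p : ℍ => (p : ℂ)) h
    have h1 := congrArg Complex.re h'
    have h2 := congrArg Complex.im h'
    exact Complex.ext h1 (Real.exp_injective h2)
  have hsurj : Function.Surjective f := fun p =>
    ⟨⟨p.re, Real.log p.im⟩, UpperHalfPlane.ext (Complex.ext rfl (Real.exp_log p.im_pos))⟩
  have h1 : IsPreconnected (f ⁻¹' S)ᶜ := by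
    refine (Set.Countable.isPathConnected_compl_of_one_lt_rank ?_
      (hS.preimage_of_injOn hinj.injOn)).isConnected.isPreconnected
    rw [Complex.rank_real_complex]; norm_num
  have h2 := h1.image f hf.continuousOn
  rwa [← preimage_compl, image_preimage_eq _ hsurj] at h2

theorem isCompact_delaunayCell (hS : IsNet S) (v : ℍ) : IsCompact (delaunayCell S v) :=
  isCompact_geodesicHull (hS.finite_near v)

theorem mem_interior_delaunayCell {v p : ℍ}
    (h : hyp p ∈ interior (cone (near S v) : Set V3)) : p ∈ interior (delaunayCell S v) := by
  rw [mem_interior_iff_mem_nhds] at h ⊢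
  filter_upwards [continuous_hyp.continuousAt.preimage_mem_nhds h] with q hq
  exact mem_delaunayCell.2 hq

/-- A point of a Delaunay cell is a site, an interior point of the cell, or an interior point
of the dual of an edge. -/
theorem IsNet.cell_trichotomy (hS : IsNet S) {v p : ℍ} (hv : v ∈ voronoiVertices S)
    (hp : p ∈ delaunayCell S v) (hpS : p ∉ S) :
    hyp p ∈ interior (cone (near S v) : Set V3) ∨
      ∃ x y, IsSide S v x y ∧ ∃ a b : ℝ, 0 < a ∧ 0 < b ∧ hyp p = a • hyp x + b • hyp y := by
  refine (hS.interior_or_side hv (mem_delaunayCell.1 hp)).imp id ?_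
  rintro ⟨x, y, hs, hc⟩
  obtain ⟨a, b, ha, hb, e⟩ := mem_cone_pair.1 hc
  have key : ∀ {c : ℝ} {z : ℍ}, z ∈ S → 0 ≤ c → hyp p = c • hyp z → False := by
    intro c z hz hc e
    rcases hc.eq_or_lt with rfl | hc
    · exact hyp_ne_zero p (by simpa using e)
    · exact hpS (hyp_eq_smul_unique hc e ▸ hz)
  refine ⟨x, y, hs, a, b, lt_of_le_of_ne ha ?_, lt_of_le_of_ne hb ?_, e⟩
  · rintro rfl; exact key hs.2.2.1 hb (by simpa using e)
  · rintro rfl; exact key hs.2.1.1 ha (by simpa using e)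

theorem IsNet.mem_interior_delaunayCell_union (hS : IsNet S) {x y v w p : ℍ} (h : IsEdge S x y)
    (hv : v ∈ voronoiVertices S) (hw : w ∈ voronoiVertices S) (hvw : v ≠ w)
    (hve : v ∈ voronoiCell S x ∩ voronoiCell S y) (hwe : w ∈ voronoiCell S x ∩ voronoiCell S y)
    {a b : ℝ} (ha : 0 < a) (hb : 0 < b) (e : hyp p = a • hyp x + b • hyp y) :
    p ∈ interior (delaunayCell S v ∪ delaunayCell S w) := by
  have := h.mem_interior_union hS hv hw hvw hve hwe ha hb
  rw [← e] at this
  rw [mem_interior_iff_mem_nhds] at this ⊢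
  filter_upwards [continuous_hyp.continuousAt.preimage_mem_nhds this] with q hq
  exact hq.imp mem_delaunayCell.2 mem_delaunayCell.2

theorem IsNet.locallyFinite_delaunayCell (hS : IsNet S) :
    LocallyFinite fun v : voronoiVertices S => delaunayCell S v := by
  obtain ⟨R, hR⟩ := hS.exists_near_dist_le
  intro p
  refine ⟨ball p 1, ball_mem_nhds _ one_pos, ?_⟩
  refine Finite.of_finite_image (f := Subtype.val) ?_ Subtype.val_injective.injOn
  refine (hS.finite_vertices_inter p (R + 1)).subset ?_
  rintro _ ⟨v, ⟨q, hq1, hq2⟩, rfl⟩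
  refine ⟨v.2, ?_⟩
  obtain ⟨x, hx⟩ := hS.nonempty_near v
  have h1 := dist_le_of_mem_delaunayCell hq1 hx
  have h2 := hR v x hx
  rw [mem_ball] at hq2
  rw [mem_closedBall]
  linarith [dist_triangle (v : ℍ) q p]

/-- The Delaunay cells cover the plane. -/
theorem IsNet.exists_mem_delaunayCell (hS : IsNet S) (p : ℍ) :
    ∃ v ∈ voronoiVertices S, p ∈ delaunayCell S v := by
  set D := ⋃ v : voronoiVertices S, delaunayCell S v with hD
  have hcl : IsClosed D :=
    hS.locallyFinite_delaunayCell.isClosed_iUnion fun v => (isCompact_delaunayCell hS v).isClosed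
  have hSD : S ⊆ D := by
    intro x hx
    obtain ⟨y, hy⟩ := hS.exists_isCentered hx
    have he := hy.isEdge hS
    obtain ⟨v, w, -, hv, -, hvw, -⟩ := hS.exists_endpoints he
    have : v ∈ voronoiCell S x ∩ voronoiCell S y := by rw [hvw]; exact left_mem_geodesicArc _ _
    exact mem_iUnion.2 ⟨⟨v, hv⟩, mem_delaunayCell.2 (hyp_mem_cone (he.near_left this))⟩
  -- The union D of the cells is closed and is a neighbourhood of each of its points other than
  -- sites. If D were not the whole plane, D and its complement would disconnect the complement of
  -- the countable set S.
  have hint : ∀ q ∈ D, q ∉ S → q ∈ interior D := by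
    intro q hq hqS
    obtain ⟨v, hq⟩ := mem_iUnion.1 hq
    rcases hS.cell_trichotomy v.2 hq hqS with h | ⟨x, y, hs, a, b, ha, hb, e⟩
    · exact interior_mono (subset_iUnion (fun v : voronoiVertices S => delaunayCell S v) v)
        (mem_interior_delaunayCell h)
    · obtain ⟨v', w', hne, hv', hw', he, -⟩ := hS.exists_endpoints hs.1
      refine interior_mono (union_subset ?_ ?_) (hS.mem_interior_delaunayCell_union hs.1 hv' hw' hne
        (he ▸ left_mem_geodesicArc _ _) (he ▸ right_mem_geodesicArc _ _) ha hb e)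
      · exact subset_iUnion (fun v : voronoiVertices S => delaunayCell S v) ⟨v', hv'⟩
      · exact subset_iUnion (fun v : voronoiVertices S => delaunayCell S v) ⟨w', hw'⟩
  suffices p ∈ D by
    obtain ⟨v, hv⟩ := mem_iUnion.1 this
    exact ⟨v, v.2, hv⟩
  by_contra hp
  have hconn := isPreconnected_compl_of_countable (countable_of_isNet hS)
  obtain ⟨x, hx⟩ : S.Nonempty := by
    obtain ⟨x, hx⟩ := hS.nonempty_near p
    exact ⟨x, hx.1⟩
  obtain ⟨y, hy⟩ := hS.exists_isCentered hx
  have he := hy.isEdge hS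
  obtain ⟨v, w, -, hv, -, hvw, -⟩ := hS.exists_endpoints he
  have hve : v ∈ voronoiCell S x ∩ voronoiCell S y := by rw [hvw]; exact left_mem_geodesicArc _ _
  have hm := hyp_pt (isFut_add_hyp x y)
  have hmS : pt (hyp x + hyp y) ∉ S := by
    have hpos : 0 < (√(mink (hyp x + hyp y) (hyp x + hyp y)))⁻¹ :=
      inv_pos.2 (Real.sqrt_pos.2 (isFut_add_hyp x y).1)
    exact he.not_mem_of_pos hS hpos hpos (by rw [hm, smul_add])
  have hmD : pt (hyp x + hyp y) ∈ D := by
    refine mem_iUnion.2 ⟨⟨v, hv⟩, mem_delaunayCell.2 ?_⟩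
    rw [hm]
    exact cone_smul (add_mem (hyp_mem_cone (he.near_left hve)) (hyp_mem_cone (he.near_right hve)))
      (inv_nonneg.2 (Real.sqrt_nonneg _))
  obtain ⟨q, -, hq1, hq2⟩ := hconn (interior D) Dᶜ isOpen_interior hcl.isOpen_compl
    (fun q hq => by
      by_cases h : q ∈ D
      · exact Or.inl (hint q h hq)
      · exact Or.inr h)
    ⟨_, hmS, hint _ hmD hmS⟩ ⟨p, fun h => hp (hSD h), hp⟩
  exact hq2 (interior_subset hq1)

/-- The union of the geometric duals to the centered edges. -/
def dualGraph (S : Set ℍ) : Set ℍ := ⋃₀ centeredDuals S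

theorem IsNet.mem_dualGraph_iff (hS : IsNet S) {p : ℍ} :
    p ∈ dualGraph S ↔ ∃ x y, IsCentered S x y ∧ p ∈ geodesicArc x y := by
  constructor
  · rintro ⟨γ, hγ, hp⟩
    obtain ⟨x, y, h, rfl⟩ := hS.mem_centeredDuals_iff.1 hγ
    exact ⟨x, y, h, hp⟩
  · rintro ⟨x, y, h, hp⟩
    exact ⟨_, hS.mem_centeredDuals_iff.2 ⟨x, y, h, rfl⟩, hp⟩

theorem IsNet.subset_dualGraph (hS : IsNet S) : S ⊆ dualGraph S := by
  intro x hx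
  obtain ⟨y, hy⟩ := hS.exists_isCentered hx
  exact hS.mem_dualGraph_iff.2 ⟨x, y, hy, left_mem_geodesicArc _ _⟩

theorem IsNet.exists_edge_dist_le (hS : IsNet S) : ∃ R, ∀ x y, IsEdge S x y → dist x y ≤ R := by
  obtain ⟨R, hR⟩ := hS.exists_near_dist_le
  refine ⟨R + R, fun x y h => ?_⟩
  obtain ⟨p, hp, -⟩ := h.2.2.2
  exact (dist_triangle_left x y p).trans
    (add_le_add (hR p x (h.near_left hp)) (hR p y (h.near_right hp)))

theorem dist_le_of_mem_geodesicArc {x y p : ℍ} (h : p ∈ geodesicArc x y) : dist x p ≤ dist x y := by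
  have : dist x p + dist p y = dist x y := h
  linarith [dist_nonneg (x := p) (y := y)]

theorem IsNet.finite_duals_inter (hS : IsNet S) (p : ℍ) (r : ℝ) :
    {γ ∈ centeredDuals S | (γ ∩ closedBall p r).Nonempty}.Finite := by
  obtain ⟨R, hR⟩ := hS.exists_edge_dist_le
  have hN := hS.finite_inter p (r + R)
  refine ((hN.prod hN).image fun q : ℍ × ℍ => geodesicArc q.1 q.2).subset ?_
  rintro γ ⟨hγ, q, hq, hqp⟩
  obtain ⟨x, y, h, rfl⟩ := hS.mem_centeredDuals_iff.1 hγ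
  have he := h.isEdge hS
  rw [mem_closedBall] at hqp
  have h1 := dist_le_of_mem_geodesicArc hq
  have h2 := dist_le_of_mem_geodesicArc (geodesicArc_comm x y ▸ hq)
  rw [dist_comm y x] at h2
  have h3 := hR x y he
  refine ⟨(x, y), ⟨⟨he.1, ?_⟩, he.2.1, ?_⟩, rfl⟩
  · rw [mem_closedBall]; linarith [dist_triangle x q p]
  · rw [mem_closedBall]; linarith [dist_triangle y q p]

theorem IsNet.isClosed_dualGraph (hS : IsNet S) : IsClosed (dualGraph S) := by
  rw [dualGraph, sUnion_eq_iUnion]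
  refine LocallyFinite.isClosed_iUnion ?_ ?_
  · intro p
    refine ⟨closedBall p 1, closedBall_mem_nhds _ one_pos, ?_⟩
    refine Finite.of_finite_image (f := Subtype.val) ?_ Subtype.val_injective.injOn
    refine (hS.finite_duals_inter p 1).subset ?_
    rintro _ ⟨γ, h, rfl⟩
    exact ⟨γ.2, h⟩
  · rintro ⟨γ, hγ⟩
    obtain ⟨x, y, h, rfl⟩ := hS.mem_centeredDuals_iff.1 hγ
    exact isClosed_geodesicArc x y

/-- The only points of the dual of a centered edge with several nearest sites is the midpoint. -/
theorem IsCentered.near_of_mem_arc {x y p : ℍ} (h : IsCentered S x y) (hp : p ∈ geodesicArc x y)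
    {z z' : ℍ} (hz : z ∈ near S p) (hz' : z' ∈ near S p) (hne : z ≠ z') :
    p = pt (hyp x + hyp y) := by
  obtain ⟨a, b, ha, hb, e⟩ := mem_geodesicArc_iff.1 hp
  obtain ⟨hx, hy, hxy, hn⟩ := h
  -- On the half of the arc nearer to x, write p as b (x + y) + (a - b) x. A site other than x and y
  -- is no nearer to the midpoint than x and strictly farther from x than x itself, so x is the only
  -- nearest site of p.
  have key : ∀ {x y : ℍ} {a b : ℝ}, x ∈ S → y ∈ S → x ≠ y → near S (pt (hyp x + hyp y)) = {x, y} →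
      0 ≤ b → b < a → hyp p = a • hyp x + b • hyp y → ∀ z ∈ near S p, z = x := by
    intro x y a b hx hy hxy hn hb hab e z hz
    by_contra hzx
    have h1 := (mem_near_iff.1 hz).2 x hx
    simp only [e, map_add, map_smul, LinearMap.add_apply, LinearMap.smul_apply, smul_eq_mul,
      mink_hyp_self] at h1
    have h2 := one_lt_mink_hyp hxy
    rw [mink_comm (hyp y) (hyp x)] at h1
    rcases eq_or_ne z y with rfl | hzy
    · rw [mink_hyp_self] at h1; nlinarith
    · have hxm : x ∈ near S (pt (hyp x + hyp y)) := by rw [hn]; simp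
      have h3 := (mem_near_iff.1 hxm).2 z hz.1
      rw [hyp_pt (isFut_add_hyp x y)] at h3
      have hpos : 0 < (√(mink (hyp x + hyp y) (hyp x + hyp y)))⁻¹ :=
        inv_pos.2 (Real.sqrt_pos.2 (isFut_add_hyp x y).1)
      generalize (√(mink (hyp x + hyp y) (hyp x + hyp y)))⁻¹ = k at h3 hpos
      simp only [map_add, map_smul, LinearMap.add_apply, LinearMap.smul_apply, smul_eq_mul,
        mink_hyp_self] at h3
      have h4 := le_of_mul_le_mul_left h3 hpos
      rw [mink_comm (hyp y) (hyp x)] at h4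
      have h5 := one_lt_mink_hyp (Ne.symm hzx)
      nlinarith
  rcases lt_trichotomy a b with hab | hab | hab
  · have k := key hy hx hxy.symm (by rw [add_comm, hn, pair_comm]) ha hab (by rw [e, add_comm])
    exact absurd ((k z hz).trans (k z' hz').symm) hne
  · subst hab
    have : 0 < a := lt_of_le_of_ne ha fun h => hyp_ne_zero p (by rw [e, ← h]; simp)
    exact (eq_pt_midpoint this (by rw [e, smul_add])).symm
  · have k := key hx hy hxy hn hb hab e
    exact absurd ((k z hz).trans (k z' hz').symm) hne

/-- The non-centered edges miss the duals of the centered edges. -/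
theorem IsNet.not_mem_dualGraph (hS : IsNet S) {x y p : ℍ} (hxy : x ≠ y) (hx : x ∈ near S p)
    (hy : y ∈ near S p) (hc : ¬ IsCentered S x y) : p ∉ dualGraph S := by
  intro hp
  obtain ⟨x', y', h, hp⟩ := hS.mem_dualGraph_iff.1 hp
  have e := h.near_of_mem_arc hp hx hy hxy
  have hn := h.2.2.2
  rw [← e] at hn
  rw [hn] at hx hy
  rcases hx with rfl | rfl <;> rcases hy with rfl | rfl
  · exact hxy rfl
  · exact hc h
  · exact hc h.symm
  · exact hxy rfl

theorem IsNet.vertex_not_mem_dualGraph (hS : IsNet S) {v : ℍ} (hv : v ∈ voronoiVertices S) :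
    v ∉ dualGraph S := by
  intro hp
  obtain ⟨x', y', h, hp⟩ := hS.mem_dualGraph_iff.1 hp
  obtain ⟨x, hx, y, hy, z, hz, h1, h2, h3⟩ := mem_voronoiVertices_iff.1 hv
  have e := h.near_of_mem_arc hp hx hy h1
  have hn := h.2.2.2
  rw [← e] at hn
  rw [hn] at hx hy hz
  simp only [mem_insert_iff, mem_singleton_iff] at hx hy hz
  grind
end

/-! ### Roots, clusters and the faces in the universal cover -/

section
variable {S : Set ℍ}

/-- A net whose Voronoi vertices have only finitely many circumradii. -/
structure IsFiniteNet (S : Set ℍ) : Prop extends IsNet S where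
  finite_rad : (rad S '' voronoiVertices S).Finite

/-- `w` is the successor of `v`: the two are joined by a non-centered edge along which the distance
to the sites increases from `v` to `w`. -/
def Next (S : Set ℍ) (v w : ℍ) : Prop := ∃ x y, Step S v w x y

theorem Next.unique (hS : IsNet S) {v w w' : ℍ} (h : Next S v w) (h' : Next S v w') : w = w' := by
  obtain ⟨x, y, h⟩ := h
  obtain ⟨x', y', h'⟩ := h'
  exact (h'.unique hS h).1

def IsRoot (S : Set ℍ) (v : ℍ) : Prop := v ∈ voronoiVertices S ∧ ∀ w, ¬ Next S v w

/-- The Voronoi vertices leading to the root `v₀`. -/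
def cluster (S : Set ℍ) (v₀ : ℍ) : Set ℍ :=
  {v | v ∈ voronoiVertices S ∧ Relation.ReflTransGen (Next S) v v₀}

theorem IsRoot.mem_cluster {v₀ : ℍ} (h : IsRoot S v₀) : v₀ ∈ cluster S v₀ := ⟨h.1, .refl⟩

theorem Next.rad_lt {v w : ℍ} (h : Next S v w) : rad S v < rad S w := by
  obtain ⟨x, y, h⟩ := h; exact h.rad_lt

theorem Next.mem_left {v w : ℍ} (h : Next S v w) : v ∈ voronoiVertices S := by
  obtain ⟨x, y, h⟩ := h; exact h.vertex_left

theorem Next.mem_right {v w : ℍ} (h : Next S v w) : w ∈ voronoiVertices S := by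
  obtain ⟨x, y, h⟩ := h; exact h.vertex_right

/-- Along a step the circumradius increases, so the number of radii that exceed it drops. This rank
proves termination and bounds the number of steps to the root. -/
theorem IsFiniteNet.exists_rank (hS : IsFiniteNet S) : ∃ (N : ℕ) (k : ℍ → ℕ),
    (∀ v, k v ≤ N) ∧ ∀ v w, Next S v w → k w < k v := by
  refine ⟨(rad S '' voronoiVertices S).ncard,
    fun v => {r ∈ rad S '' voronoiVertices S | rad S v < r}.ncard,
    fun v => ncard_le_ncard (sep_subset _ _) hS.finite_rad, fun v w h => ?_⟩
  refine ncard_lt_ncard ⟨fun r hr => ⟨hr.1, h.rad_lt.trans hr.2⟩, fun hsub => ?_⟩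
    (hS.finite_rad.subset (sep_subset _ _))
  exact lt_irrefl _ (hsub ⟨mem_image_of_mem _ h.mem_right, h.rad_lt⟩).2

theorem IsFiniteNet.exists_root (hS : IsFiniteNet S) {v : ℍ} (hv : v ∈ voronoiVertices S) :
    ∃ v₀, IsRoot S v₀ ∧ v ∈ cluster S v₀ := by
  obtain ⟨N, k, -, hk⟩ := hS.exists_rank
  induction h : k v using Nat.strong_induction_on generalizing v with
  | _ n ih =>
    by_cases hr : ∀ w, ¬ Next S v w
    · exact ⟨v, ⟨hv, hr⟩, hv, .refl⟩
    · push Not at hr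
      obtain ⟨w, hw⟩ := hr
      obtain ⟨v₀, h1, h2⟩ := ih (k w) (h ▸ hk _ _ hw) hw.mem_right rfl
      exact ⟨v₀, h1, hv, .head hw h2.2⟩

theorem eq_of_root_reach {v₀ v : ℍ} (h : IsRoot S v₀) (h' : Relation.ReflTransGen (Next S) v₀ v) :
    v = v₀ := by
  rcases h'.cases_head with rfl | ⟨w, hw, -⟩
  · rfl
  · exact absurd hw (h.2 w)

theorem IsNet.root_unique (hS : IsNet S) {v v₀ v₁ : ℍ} (h₀ : IsRoot S v₀) (h₁ : IsRoot S v₁)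
    (hv₀ : v ∈ cluster S v₀) (hv₁ : v ∈ cluster S v₁) : v₀ = v₁ := by
  rcases Relation.ReflTransGen.total_of_right_unique (fun _ _ _ h h' => h.unique hS h') hv₀.2 hv₁.2
    with h | h
  · exact (eq_of_root_reach h₀ h).symm
  · exact eq_of_root_reach h₁ h

theorem mem_cluster_of_next {v w v₀ : ℍ} (h : Next S v w) (hw : w ∈ cluster S v₀) :
    v ∈ cluster S v₀ := ⟨h.mem_left, .head h hw.2⟩

theorem IsNet.mem_cluster_of_next' (hS : IsNet S) {v w v₀ : ℍ} (h₀ : IsRoot S v₀) (h : Next S v w)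
    (hv : v ∈ cluster S v₀) : w ∈ cluster S v₀ := by
  refine ⟨h.mem_right, ?_⟩
  rcases hv.2.cases_head with rfl | ⟨w', hw', hr⟩
  · exact absurd h (h₀.2 w)
  · rwa [h.unique hS hw']

/-- The root is reached in at most N steps, each of length at most 2R, so the cluster lies in a
ball, and a ball contains finitely many Voronoi vertices. -/
theorem IsFiniteNet.finite_cluster (hS : IsFiniteNet S) (v₀ : ℍ) : (cluster S v₀).Finite := by
  obtain ⟨N, k, hN, hk⟩ := hS.exists_rank
  obtain ⟨R, hR⟩ := hS.exists_near_dist_le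
  obtain ⟨x, hx⟩ := hS.nonempty_near v₀
  have hR0 : 0 ≤ R := dist_nonneg.trans (hR v₀ x hx)
  have key : ∀ v, Relation.ReflTransGen (Next S) v v₀ → dist v v₀ ≤ k v * (R + R) := by
    intro v h
    induction h using Relation.ReflTransGen.head_induction_on with
    | refl => rw [dist_self]; positivity
    | head h _ ih =>
      rename_i a c _
      have h1 : (k c : ℝ) + 1 ≤ k a := by exact_mod_cast hk _ _ h
      obtain ⟨x, y, h⟩ := h
      have h2 := hR a x (h.edge.near_left h.mem_left)
      have h3 := hR c x (h.edge.near_left h.mem_right)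
      have h4 : dist a c ≤ R + R := (dist_triangle_right a c x).trans (add_le_add h2 h3)
      calc dist a v₀ ≤ (R + R) + k c * (R + R) := (dist_triangle _ c _).trans (add_le_add h4 ih)
        _ = (k c + 1) * (R + R) := by ring
        _ ≤ k a * (R + R) := by gcongr
  refine (hS.finite_vertices_inter v₀ (N * (R + R))).subset fun v hv => ⟨hv.1, ?_⟩
  rw [mem_closedBall]
  refine (key v hv.2).trans ?_
  gcongr
  exact hN v

/-- The face of the centered dual decomposition belonging to the root `v₀`. -/
def region (S : Set ℍ) (v₀ : ℍ) : Set ℍ := (⋃ v ∈ cluster S v₀, delaunayCell S v) \ dualGraph S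

/-- If an edge is not centered then its endpoints belong to the same cluster. -/
theorem IsNet.step_of_side (hS : IsNet S) {x y v w : ℍ} (h : IsEdge S x y)
    (hc : ¬ IsCentered S x y) (hv : v ∈ voronoiVertices S) (hw : w ∈ voronoiVertices S)
    (hvw : v ≠ w) (hve : v ∈ voronoiCell S x ∩ voronoiCell S y)
    (hwe : w ∈ voronoiCell S x ∩ voronoiCell S y) : Next S v w ∨ Next S w v :=
  (hS.step_of_isEdge h hc hv hw hvw hve hwe).imp (fun h => ⟨x, y, h⟩) fun h => ⟨x, y, h⟩

theorem IsNet.mem_cluster_iff_of_next (hS : IsNet S) {v w v₀ : ℍ} (h₀ : IsRoot S v₀)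
    (h : Next S v w ∨ Next S w v) : v ∈ cluster S v₀ ↔ w ∈ cluster S v₀ := by
  rcases h with h | h
  · exact ⟨hS.mem_cluster_of_next' h₀ h, mem_cluster_of_next h⟩
  · exact ⟨mem_cluster_of_next h, hS.mem_cluster_of_next' h₀ h⟩

theorem mem_dualGraph_of_comb (hS : IsNet S) {x y p : ℍ} (h : IsCentered S x y) {a b : ℝ}
    (ha : 0 ≤ a) (hb : 0 ≤ b) (e : hyp p = a • hyp x + b • hyp y) : p ∈ dualGraph S :=
  hS.mem_dualGraph_iff.2 ⟨x, y, h, mem_geodesicArc_iff.2 ⟨a, b, ha, hb, e⟩⟩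

/-- A point off the dual graph lies inside a Delaunay cell or on the common side of two cells
joined by a non-centered edge. -/
theorem IsNet.off_dualGraph (hS : IsNet S) {v p : ℍ} (hv : v ∈ voronoiVertices S)
    (hp : p ∈ delaunayCell S v) (hpd : p ∉ dualGraph S) :
    hyp p ∈ interior (cone (near S v) : Set V3) ∨
      ∃ w x y, (Step S v w x y ∨ Step S w v x y) ∧
        ∃ a b : ℝ, 0 < a ∧ 0 < b ∧ hyp p = a • hyp x + b • hyp y := by
  refine (hS.cell_trichotomy hv hp fun h => hpd (hS.subset_dualGraph h)).imp id ?_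
  rintro ⟨x, y, hs, a, b, ha, hb, e⟩
  have hc : ¬ IsCentered S x y := fun h => hpd (mem_dualGraph_of_comb hS h ha.le hb.le e)
  obtain ⟨v', w', hne, hv', hw', he, hu⟩ := hS.exists_endpoints hs.1
  have h1 : v' ∈ voronoiCell S x ∩ voronoiCell S y := he ▸ left_mem_geodesicArc _ _
  have h2 : w' ∈ voronoiCell S x ∩ voronoiCell S y := he ▸ right_mem_geodesicArc _ _
  rcases hu v hv hs.mem with rfl | rfl
  · exact ⟨w', x, y, hS.step_of_isEdge hs.1 hc hv hw' hne h1 h2, a, b, ha, hb, e⟩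
  · exact ⟨v', x, y, hS.step_of_isEdge hs.1 hc hv hv' hne.symm h2 h1, a, b, ha, hb, e⟩

/-- Two cells meeting off the dual graph coincide or are joined by a non-centered edge. -/
theorem IsNet.eq_or_step (hS : IsNet S) {v w p : ℍ} (hv : v ∈ voronoiVertices S)
    (hw : w ∈ voronoiVertices S) (hpv : p ∈ delaunayCell S v) (hpw : p ∈ delaunayCell S w)
    (hpd : p ∉ dualGraph S) : v = w ∨ ∃ x y, (Step S v w x y ∨ Step S w v x y) ∧
      ∃ a b : ℝ, 0 < a ∧ 0 < b ∧ hyp p = a • hyp x + b • hyp y := by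
  by_cases hvw : v = w
  · exact Or.inl hvw
  refine Or.inr ?_
  rcases hS.off_dualGraph hv hpv hpd with h | ⟨u, x, y, hst, a, b, ha, hb, e⟩
  · exact absurd (mem_delaunayCell.1 hpw) (hS.interior_disjoint hvw h)
  · have hed : IsEdge S x y := hst.elim Step.edge Step.edge
    have hn := hed.near_of_mem_cone hS ha hb (e ▸ mem_delaunayCell.1 hpw)
    have hwu : w = u := by
      rcases hst with hst | hst
      · exact ((hst.endpoints hS).2 w hw ⟨hn.1.2, hn.2.2⟩).resolve_left fun h => hvw h.symm
      · exact ((hst.endpoints hS).2 w hw ⟨hn.1.2, hn.2.2⟩).resolve_right fun h => hvw h.symm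
    exact ⟨x, y, hwu ▸ hst, a, b, ha, hb, e⟩

theorem IsNet.mem_cluster_of_mem (hS : IsNet S) {v₀ v p : ℍ} (h₀ : IsRoot S v₀)
    (hp : p ∈ region S v₀) (hv : v ∈ voronoiVertices S) (hpv : p ∈ delaunayCell S v) :
    v ∈ cluster S v₀ := by
  obtain ⟨hpc, hpd⟩ := hp
  obtain ⟨w, hw, hpw⟩ := mem_iUnion₂.1 hpc
  rcases hS.eq_or_step hv hw.1 hpv hpw hpd with rfl | ⟨x, y, h, -⟩
  · exact hw
  · exact (hS.mem_cluster_iff_of_next h₀ (h.imp (fun h => ⟨x, y, h⟩) fun h => ⟨x, y, h⟩)).2 hw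

theorem IsNet.region_disjoint (hS : IsNet S) {v₀ v₁ p : ℍ} (h₀ : IsRoot S v₀) (h₁ : IsRoot S v₁)
    (hp₀ : p ∈ region S v₀) (hp₁ : p ∈ region S v₁) : v₀ = v₁ := by
  obtain ⟨w, hw, hpw⟩ := mem_iUnion₂.1 hp₁.1
  exact hS.root_unique h₀ h₁ (hS.mem_cluster_of_mem h₀ hp₀ hw.1 hpw) hw

theorem IsFiniteNet.exists_region (hS : IsFiniteNet S) {p : ℍ} (hp : p ∉ dualGraph S) :
    ∃ v₀, IsRoot S v₀ ∧ p ∈ region S v₀ := by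
  obtain ⟨v, hv, hpv⟩ := hS.exists_mem_delaunayCell p
  obtain ⟨v₀, h₀, hvc⟩ := hS.exists_root hv
  exact ⟨v₀, h₀, mem_iUnion₂.2 ⟨v, hvc, hpv⟩, hp⟩

/-- A point off the dual graph is inside a cell or inside a side dual to a non-centered edge. In the
second case the two cells along the side belong to the same cluster and together cover a
neighbourhood of the point. -/
theorem IsNet.isOpen_region (hS : IsNet S) {v₀ : ℍ} (h₀ : IsRoot S v₀) :
    IsOpen (region S v₀) := by
  rw [isOpen_iff_mem_nhds]
  intro p hp
  obtain ⟨v, hv, hpv⟩ := mem_iUnion₂.1 hp.1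
  have hd := hS.isClosed_dualGraph.isOpen_compl.mem_nhds hp.2
  rcases hS.off_dualGraph hv.1 hpv hp.2 with h | ⟨u, x, y, hst, a, b, ha, hb, e⟩
  · filter_upwards [hd, mem_interior_iff_mem_nhds.1 (mem_interior_delaunayCell h)] with q h1 h2
    exact ⟨mem_iUnion₂.2 ⟨v, hv, h2⟩, h1⟩
  · have hu : u ∈ cluster S v₀ :=
      (hS.mem_cluster_iff_of_next h₀ (hst.imp (fun h => ⟨x, y, h⟩) fun h => ⟨x, y, h⟩)).1 hv
    have : p ∈ interior (delaunayCell S v ∪ delaunayCell S u) := by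
      rcases hst with h | h
      · exact hS.mem_interior_delaunayCell_union h.edge hv.1 hu.1 h.ne h.mem_left h.mem_right
          ha hb e
      · exact hS.mem_interior_delaunayCell_union h.edge hv.1 hu.1 h.ne.symm h.mem_right h.mem_left
          ha hb e
    filter_upwards [hd, mem_interior_iff_mem_nhds.1 this] with q h1 h2
    exact ⟨h2.elim (fun h => mem_iUnion₂.2 ⟨v, hv, h⟩) (fun h => mem_iUnion₂.2 ⟨u, hu, h⟩), h1⟩

/-- A preconnected set off the dual graph lies in a single region. -/
theorem IsFiniteNet.subset_region (hS : IsFiniteNet S) {A : Set ℍ} (hA : IsPreconnected A)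
    (hd : Disjoint A (dualGraph S)) {v₀ p : ℍ} (h₀ : IsRoot S v₀) (hpA : p ∈ A)
    (hp : p ∈ region S v₀) : A ⊆ region S v₀ := by
  have hopen : IsOpen (⋃ v ∈ {v | IsRoot S v ∧ v ≠ v₀}, region S v) :=
    isOpen_biUnion fun v hv => hS.isOpen_region hv.1
  refine hA.subset_left_of_subset_union (hS.isOpen_region h₀) hopen ?_ ?_ ⟨p, hpA, hp⟩
  · rw [disjoint_left]
    rintro q hq hq'
    obtain ⟨v, hv, hqv⟩ := mem_iUnion₂.1 hq'
    exact hv.2 (hS.region_disjoint hv.1 h₀ hqv hq)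
  · intro q hq
    obtain ⟨v, hv, hqv⟩ := hS.exists_region (disjoint_left.1 hd hq)
    by_cases h : v = v₀
    · exact Or.inl (h ▸ hqv)
    · exact Or.inr (mem_iUnion₂.2 ⟨v, ⟨hv, h⟩, hqv⟩)

theorem isConnected_geodesicArc (x y : ℍ) : IsConnected (geodesicArc x y) := by
  have h : geodesicArc x y = pt '' segment ℝ (hyp x) (hyp y) := by
    ext p
    rw [mem_geodesicArc_iff]
    constructor
    · rintro ⟨a, b, ha, hb, e⟩
      have hab : 0 < a + b := by
        refine lt_of_le_of_ne (add_nonneg ha hb) fun h => hyp_ne_zero p ?_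
        have h1 : a = 0 := by linarith
        have h2 : b = 0 := by linarith
        rw [e, h1, h2, zero_smul, zero_smul, add_zero]
      refine ⟨(a + b)⁻¹ • hyp p, ⟨a / (a + b), b / (a + b), by positivity, by positivity,
        by field_simp, ?_⟩, ?_⟩
      · rw [e, smul_add, smul_smul, smul_smul, div_eq_inv_mul, div_eq_inv_mul]
      · rw [pt_smul (hyp_mem_Fut p) (inv_pos.2 hab), pt_hyp]
    · rintro ⟨_, ⟨a, b, ha, hb, hab, rfl⟩, rfl⟩
      refine ⟨_, _, ?_, ?_, (hyp_pt (isFut_comb x y ha hb (by linarith))).trans (smul_add _ _ _) |>.trans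
        (congrArg₂ _ (smul_smul _ _ _) (smul_smul _ _ _))⟩ <;> positivity
  rw [h]
  refine (((convex_segment _ _).isConnected ⟨_, left_mem_segment ℝ _ _⟩).image _
    (continuousOn_pt.mono ?_))
  rintro _ ⟨a, b, ha, hb, hab, rfl⟩
  exact isFut_comb x y ha hb (by linarith)

theorem Step.edge_disjoint_dualGraph (hS : IsNet S) {v w x y : ℍ} (h : Step S v w x y) :
    Disjoint (voronoiCell S x ∩ voronoiCell S y) (dualGraph S) :=
  disjoint_left.2 fun _ hp => hS.not_mem_dualGraph h.edge.2.2.1 (h.edge.near_left hp)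
    (h.edge.near_right hp) h.not_isCentered

theorem Step.isConnected_edge (hS : IsNet S) {v w x y : ℍ} (h : Step S v w x y) :
    IsConnected (voronoiCell S x ∩ voronoiCell S y) :=
  (h.endpoints hS).1 ▸ isConnected_geodesicArc v w

/-- The vertices of a cluster lie in the region. -/
theorem IsFiniteNet.cluster_subset_region (hS : IsFiniteNet S) {v₀ : ℍ} (h₀ : IsRoot S v₀) :
    cluster S v₀ ⊆ region S v₀ := by
  rintro v ⟨-, hv⟩
  -- The root lies inside its own cell. Each further step runs along a connected edge that misses
  -- the dual graph, so it cannot leave the region.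
  induction hv using Relation.ReflTransGen.head_induction_on with
  | refl =>
    refine ⟨mem_iUnion₂.2 ⟨v₀, h₀.mem_cluster, ?_⟩, hS.vertex_not_mem_dualGraph h₀.1⟩
    exact mem_delaunayCell.2 (interior_subset
      (hS.hyp_mem_interior_of_no_step h₀.1 fun w x y h => h₀.2 w ⟨x, y, h⟩))
  | head h _ ih =>
    obtain ⟨x, y, h⟩ := h
    exact hS.subset_region (h.isConnected_edge hS.toIsNet).isPreconnected
      (h.edge_disjoint_dualGraph hS.toIsNet) h₀ h.mem_right ih h.mem_left

theorem IsFiniteNet.vertices_inter_region (hS : IsFiniteNet S) {v₀ : ℍ} (h₀ : IsRoot S v₀) :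
    voronoiVertices S ∩ region S v₀ = cluster S v₀ := by
  refine Subset.antisymm ?_ fun v hv => ⟨hv.1, hS.cluster_subset_region h₀ hv⟩
  rintro v ⟨hv, hvr⟩
  obtain ⟨v₁, h₁, hv₁⟩ := hS.exists_root hv
  rwa [hS.region_disjoint h₀ h₁ hvr (hS.cluster_subset_region h₁ hv₁)]

theorem Step.edge_subset_region (hS : IsFiniteNet S) {v w x y v₀ : ℍ} (h₀ : IsRoot S v₀)
    (h : Step S v w x y) (hw : w ∈ cluster S v₀) :
    voronoiCell S x ∩ voronoiCell S y ⊆ region S v₀ :=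
  hS.subset_region (h.isConnected_edge hS.toIsNet).isPreconnected
    (h.edge_disjoint_dualGraph hS.toIsNet) h₀ h.mem_right (hS.cluster_subset_region h₀ hw)

theorem IsNet.mem_nonCenteredUnion (hS : IsNet S) {p : ℍ} : p ∈ nonCenteredUnion S ↔
    ∃ v w x y, Step S v w x y ∧ p ∈ voronoiCell S x ∩ voronoiCell S y := by
  constructor
  · rintro ⟨e, ⟨⟨γ, hγ⟩, hc⟩, hp⟩
    obtain ⟨x, y, hed, rfl, rfl⟩ := isGeometricDual_iff.1 hγ
    rw [hS.mem_centeredEdges_iff hed] at hc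
    obtain ⟨v, w, hne, hv, hw, he, -⟩ := hS.exists_endpoints hed
    rcases hS.step_of_isEdge hed hc hv hw hne (he ▸ left_mem_geodesicArc _ _)
      (he ▸ right_mem_geodesicArc _ _) with h | h
    · exact ⟨v, w, x, y, h, hp⟩
    · exact ⟨w, v, x, y, h, hp⟩
  · rintro ⟨v, w, x, y, h, hp⟩
    exact ⟨_, ⟨⟨_, isGeometricDual_iff.2 ⟨x, y, h.edge, rfl, rfl⟩⟩,
      fun hc => h.not_isCentered ((hS.mem_centeredEdges_iff h.edge).1 hc)⟩, hp⟩

/-- The part of the union of the non-centered edges in a region. -/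
def tree (S : Set ℍ) (v₀ : ℍ) : Set ℍ := nonCenteredUnion S ∩ region S v₀

theorem IsFiniteNet.mem_tree_iff (hS : IsFiniteNet S) {v₀ p : ℍ} (h₀ : IsRoot S v₀) :
    p ∈ tree S v₀ ↔ ∃ v w x y, Step S v w x y ∧ w ∈ cluster S v₀ ∧
      p ∈ voronoiCell S x ∩ voronoiCell S y := by
  constructor
  · rintro ⟨hp, hr⟩
    obtain ⟨v, w, x, y, h, hp⟩ := hS.mem_nonCenteredUnion.1 hp
    refine ⟨v, w, x, y, h, ?_, hp⟩
    obtain ⟨v₁, h₁, hv₁⟩ := hS.exists_root h.vertex_right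
    rwa [hS.region_disjoint h₀ h₁ hr (h.edge_subset_region hS h₁ hv₁ hp)]
  · rintro ⟨v, w, x, y, h, hw, hp⟩
    exact ⟨hS.mem_nonCenteredUnion.2 ⟨v, w, x, y, h, hp⟩, h.edge_subset_region hS h₀ hw hp⟩

theorem IsFiniteNet.nonCenteredUnion_subset (hS : IsFiniteNet S) :
    Disjoint (nonCenteredUnion S) (dualGraph S) := by
  rw [disjoint_left]
  intro p hp
  obtain ⟨v, w, x, y, h, hp⟩ := hS.mem_nonCenteredUnion.1 hp
  exact disjoint_left.1 (h.edge_disjoint_dualGraph hS.toIsNet) hp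

theorem IsFiniteNet.cluster_subset_tree (hS : IsFiniteNet S) {v₀ : ℍ} (h₀ : IsRoot S v₀)
    (hne : cluster S v₀ ≠ {v₀}) : cluster S v₀ ⊆ tree S v₀ := by
  have key : ∀ v ∈ cluster S v₀, v ≠ v₀ → v ∈ tree S v₀ ∧ v₀ ∈ tree S v₀ := by
    intro v hv hvne
    refine ⟨?_, ?_⟩
    · rcases hv.2.cases_head with rfl | ⟨w, ⟨x, y, h⟩, hr⟩
      · exact absurd rfl hvne
      · exact (hS.mem_tree_iff h₀).2 ⟨v, w, x, y, h, ⟨h.vertex_right, hr⟩, h.mem_left⟩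
    · rcases hv.2.cases_tail with rfl | ⟨w, hr, x, y, h⟩
      · exact absurd rfl hvne
      · exact (hS.mem_tree_iff h₀).2 ⟨w, v₀, x, y, h, h₀.mem_cluster, h.mem_right⟩
  obtain ⟨v, hv, hvne⟩ : ∃ v ∈ cluster S v₀, v ≠ v₀ := by
    by_contra hcon
    push Not at hcon
    exact hne (Subset.antisymm hcon (singleton_subset_iff.2 h₀.mem_cluster))
  intro w hw
  by_cases h : w = v₀
  · exact h ▸ (key v hv hvne).2
  · exact (key w hw h).1

theorem IsFiniteNet.tree_eq_empty (hS : IsFiniteNet S) {v₀ : ℍ} (h₀ : IsRoot S v₀)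
    (he : cluster S v₀ = {v₀}) : tree S v₀ = ∅ := by
  rw [eq_empty_iff_forall_notMem]
  intro p hp
  obtain ⟨v, w, x, y, h, hw, -⟩ := (hS.mem_tree_iff h₀).1 hp
  have hv := mem_cluster_of_next ⟨x, y, h⟩ hw
  rw [he] at hv hw
  exact h.ne (hv.trans hw.symm)

theorem IsFiniteNet.isPreconnected_tree (hS : IsFiniteNet S) {v₀ : ℍ} (h₀ : IsRoot S v₀) :
    IsPreconnected (tree S v₀) := by
  have hsub : ∀ {v w x y}, Step S v w x y → w ∈ cluster S v₀ →
      voronoiCell S x ∩ voronoiCell S y ⊆ tree S v₀ := fun h hw p hp =>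
    (hS.mem_tree_iff h₀).2 ⟨_, _, _, _, h, hw, hp⟩
  have key : ∀ v, Relation.ReflTransGen (Next S) v v₀ → v ≠ v₀ →
      ∃ t ⊆ tree S v₀, v₀ ∈ t ∧ v ∈ t ∧ IsPreconnected t := by
    intro v hv
    induction hv using Relation.ReflTransGen.head_induction_on with
    | refl => exact fun h => absurd rfl h
    | head h hr ih =>
      rename_i a c
      intro _
      obtain ⟨x, y, h⟩ := h
      have hc : c ∈ cluster S v₀ := ⟨h.vertex_right, hr⟩
      by_cases hcv : c = v₀
      · subst hcv
        exact ⟨_, hsub h hc, h.mem_right, h.mem_left, (h.isConnected_edge hS.toIsNet).isPreconnected⟩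
      · obtain ⟨t, h1, h2, h3, h4⟩ := ih hcv
        exact ⟨t ∪ _, union_subset h1 (hsub h hc), Or.inl h2, Or.inr h.mem_left,
          h4.union c h3 h.mem_right (h.isConnected_edge hS.toIsNet).isPreconnected⟩
  refine isPreconnected_of_forall v₀ fun p hp => ?_
  obtain ⟨v, w, x, y, h, hw, hpe⟩ := (hS.mem_tree_iff h₀).1 hp
  have hc := (h.isConnected_edge hS.toIsNet).isPreconnected
  by_cases hwv : w = v₀
  · subst hwv
    exact ⟨_, hsub h hw, h.mem_right, hpe, hc⟩
  · obtain ⟨t, h1, h2, h3, h4⟩ := key w hw.2 hwv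
    exact ⟨t ∪ _, union_subset h1 (hsub h hw), Or.inl h2, Or.inr hpe, h4.union w h3 h.mem_right hc⟩
end

/-! ### Developing one Delaunay cell as an ideal polygon -/

section
variable {S : Set ℍ}

theorem isClosed_cone {A : Set ℍ} (hA : A.Finite) : IsClosed (cone A : Set V3) := by
  rcases A.eq_empty_or_nonempty with rfl | ⟨x₀, hx₀⟩
  · have : (cone (∅ : Set ℍ) : Set V3) = {0} := by
      ext P
      refine ⟨fun h => ?_, fun h => by rw [mem_singleton_iff.1 h]; exact zero_mem _⟩
      exact cone_induction (C := fun P => P ∈ ({0} : Set V3)) rfl (by simp)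
        (by rintro P Q - - rfl rfl; simp) (by rintro c P - - rfl; simp) h
    rw [this]; exact isClosed_singleton
  have hK : IsCompact (convexHull ℝ (hyp '' A)) := (hA.image hyp).isCompact_convexHull ℝ
  -- The functional τ is positive on the compact base, so it recovers the scaling factors and shows
  -- that they converge.
  let τ : V3 → ℝ := fun P => P.2.1 + P.2.2
  have hτ : Continuous τ := by fun_prop
  refine isClosed_of_closure_subset fun P hP => ?_
  obtain ⟨s, hs, hlim⟩ := mem_closure_iff_seq_limit.1 hP
  have : ∀ n, ∃ c : ℝ, 0 ≤ c ∧ ∃ Q ∈ convexHull ℝ (hyp '' A), s n = c • Q := by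
    intro n
    by_cases h0 : s n = 0
    · exact ⟨0, le_rfl, hyp x₀, subset_convexHull ℝ _ (mem_image_of_mem _ hx₀), by rw [h0, zero_smul]⟩
    · obtain ⟨c, hc, h⟩ := exists_convexHull_of_mem_cone (hs n) h0
      exact ⟨c, hc.le, h⟩
  choose c hc Q hQ hsQ using this
  obtain ⟨Q₀, hQ₀, φ, hφ, hφlim⟩ := hK.tendsto_subseq hQ
  have hpos : ∀ Q ∈ convexHull ℝ (hyp '' A), 0 < τ Q := fun Q hQ => (isFut_of_mem_convexHull hQ).cfut.2
  have h1 : Filter.Tendsto (fun n => c (φ n)) Filter.atTop (𝓝 (τ P / τ Q₀)) := by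
    have h2 : (fun n => c (φ n)) = fun n => τ (s (φ n)) / τ (Q (φ n)) := by
      funext n
      rw [eq_div_iff (hpos _ (hQ _)).ne', hsQ (φ n)]
      simp only [τ, Prod.smul_snd, Prod.smul_fst, smul_eq_mul]; ring
    rw [h2]
    exact ((hτ.tendsto P).comp (hlim.comp hφ.tendsto_atTop)).div ((hτ.tendsto Q₀).comp hφlim)
      (hpos _ hQ₀).ne'
  have h2 : P = (τ P / τ Q₀) • Q₀ := by
    refine tendsto_nhds_unique (hlim.comp hφ.tendsto_atTop) ?_
    refine (h1.smul hφlim).congr fun n => ?_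
    exact (hsQ (φ n)).symm
  rw [h2]
  refine cone_smul (convexHull_subset_cone A hQ₀) (ge_of_tendsto' h1 fun n => hc _)

theorem det3_sq_of_isotropic {a b c : V3} (ha : mink a a = 0) (hb : mink b b = 0)
    (hc : mink c c = 0) : det3 a b c ^ 2 = 8 * (mink a b * mink b c * mink a c) := by
  rw [det3_sq, ha, hb, hc]; ring

theorem isCFut_of_mink_pos {P Q : V3} (hP : 0 ≤ mink P P) (hQ : IsCFut Q) (h : 0 < mink P Q) :
    IsCFut P := by
  refine ⟨hP, ?_⟩
  by_contra hcon
  push Not at hcon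
  rcases hcon.eq_or_lt with h0 | h0
  · have : P = 0 := by
      have e := hP
      rw [mink_apply] at e
      have h1 : P.2.2 = -P.2.1 := by linarith
      rw [h1] at e
      have h2 : P.2.1 = 0 := sq_eq_zero_iff.1 (by nlinarith [sq_nonneg P.1, sq_nonneg P.2.1])
      have h3 : P.1 = 0 := sq_eq_zero_iff.1 (by nlinarith [sq_nonneg P.1, sq_nonneg P.2.1])
      exact Prod.ext h3 (Prod.ext h2 (by simp [h1, h2]))
    rw [this] at h; simp at h
  · have hn : IsCFut (-P) := ⟨by simpa using hP, by
      simp only [Prod.snd_neg, Prod.fst_neg]; linarith⟩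
    have := hn.mink_nonneg hQ
    rw [map_neg, LinearMap.neg_apply] at this
    linarith

/-- A causal vector in the plane of two isotropic ones is a nonnegative combination of them. -/
theorem exists_comb_of_isotropic {a b R : V3} (ha : mink a a = 0) (hb : mink b b = 0)
    (hab : 0 < mink a b) (ha' : IsCFut a) (hb' : IsCFut b) (hR : R = 0 ∨ IsCFut R)
    (h : det3 a b R = 0) : ∃ α β : ℝ, 0 ≤ α ∧ 0 ≤ β ∧ R = α • a + β • b := by
  rcases hR with rfl | hR
  · exact ⟨0, 0, le_rfl, le_rfl, by simp⟩
  obtain ⟨α, β, rfl⟩ := eq_smul_add_of_det3_eq_zero h (by rw [ha, hb, mul_zero]; exact pow_pos hab 2)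
  have h1 := hR.mink_nonneg ha'
  have h2 := hR.mink_nonneg hb'
  simp only [map_add, map_smul, LinearMap.add_apply, LinearMap.smul_apply, smul_eq_mul, ha, hb,
    mink_comm b a, mul_zero, zero_add, add_zero] at h1 h2
  exact ⟨α, β, nonneg_of_mul_nonneg_left h2 hab, nonneg_of_mul_nonneg_left h1 hab, rfl⟩

/-- `L` is an isometry from the form `gform` of a Voronoi vertex to the Minkowski form, mapping the
sites near `v` to the future. -/
structure IsLocalDev (S : Set ℍ) (v : ℍ) (L : V3 →ₗ[ℝ] V3) : Prop where
  mem : v ∈ voronoiVertices S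
  mink_eq : ∀ P Q, mink (L P) (L Q) = gform (ctr S v) P Q
  cfut : ∀ x ∈ near S v, IsCFut (L (hyp x))

namespace IsLocalDev
variable {v x y z : ℍ} {L : V3 →ₗ[ℝ] V3}

theorem mink_near (h : IsLocalDev S v L) (hx : x ∈ near S v) (hy : y ∈ near S v) :
    mink (L (hyp x)) (L (hyp y)) = mink (hyp x) (hyp y) - 1 := by
  rw [h.mink_eq, gform_near hx hy]

theorem mink_self (h : IsLocalDev S v L) (hx : x ∈ near S v) :
    mink (L (hyp x)) (L (hyp x)) = 0 := by
  rw [h.mink_near hx hx, mink_hyp_self, sub_self]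

theorem mink_pos (h : IsLocalDev S v L) (hx : x ∈ near S v) (hy : y ∈ near S v) (hxy : x ≠ y) :
    0 < mink (L (hyp x)) (L (hyp y)) := by
  rw [h.mink_near hx hy, sub_pos]; exact one_lt_mink_hyp hxy

/-- The square of the determinant of three isotropic vectors is 8 times the product of their three
mutual products, which are positive here. -/
theorem det3_ne_zero (h : IsLocalDev S v L) (hx : x ∈ near S v) (hy : y ∈ near S v)
    (hz : z ∈ near S v) (hxy : x ≠ y) (hxz : x ≠ z) (hyz : y ≠ z) :
    det3 (L (hyp x)) (L (hyp y)) (L (hyp z)) ≠ 0 := by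
  intro h0
  have := det3_sq_of_isotropic (h.mink_self hx) (h.mink_self hy) (h.mink_self hz)
  have h1 := h.mink_pos hx hy hxy
  have h2 := h.mink_pos hy hz hyz
  have h3 := h.mink_pos hx hz hxz
  rw [h0] at this
  have : 0 < 8 * (mink (L (hyp x)) (L (hyp y)) * mink (L (hyp y)) (L (hyp z))
    * mink (L (hyp x)) (L (hyp z))) := by positivity
  linarith

theorem ker_eq_bot (h : IsLocalDev S v L) : LinearMap.ker L = ⊥ := by
  obtain ⟨x, hx, y, hy, z, hz, hxy, hyz, hxz⟩ := mem_voronoiVertices_iff.1 h.mem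
  rw [LinearMap.ker_eq_bot']
  intro P hP
  have hd := h.det3_ne_zero hx hy hz hxy hxz hyz
  have e := cramer_div (CenteredDual.det3_ne_zero hx hy hz hxy hxz hyz) P
  generalize det3 (hyp y) (hyp z) P / _ = a at e
  generalize det3 (hyp z) (hyp x) P / _ = b at e
  generalize det3 (hyp x) (hyp y) P / _ = c at e
  rw [e, map_add, map_add, map_smul, map_smul, map_smul] at hP
  have h1 := congrArg (det3 (L (hyp x)) (L (hyp y))) hP
  have h2 := congrArg (det3 (L (hyp y)) (L (hyp z))) hP
  have h3 := congrArg (det3 (L (hyp z)) (L (hyp x))) hP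
  simp only [map_add, map_smul, smul_eq_mul, det3_left, det3_right, map_zero, mul_zero, add_zero,
    zero_add] at h1 h2 h3
  rw [← det3_rotate] at h2
  rw [det3_rotate] at h3
  have hc := (mul_eq_zero.1 h1).resolve_right hd
  have ha := (mul_eq_zero.1 h2).resolve_right hd
  have hb := (mul_eq_zero.1 h3).resolve_right hd
  rw [e, ha, hb, hc]; simp

theorem injective (h : IsLocalDev S v L) : Function.Injective L :=
  LinearMap.ker_eq_bot.1 h.ker_eq_bot

theorem isClosed_image (hS : IsNet S) (h : IsLocalDev S v L) :
    IsClosed (L '' (cone (near S v) : Set V3)) :=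
  (LinearMap.isClosedEmbedding_of_injective h.ker_eq_bot).isClosedMap _
    (isClosed_cone (hS.finite_near v))

theorem causal (h : IsLocalDev S v L) {P : V3} (hP : P ∈ cone (near S v)) :
    L P = 0 ∨ IsCFut (L P) := by
  refine cone_induction (C := fun P => L P = 0 ∨ IsCFut (L P)) (Or.inl (map_zero _)) ?_ ?_ ?_ hP
  · exact fun x hx => Or.inr (h.cfut x hx)
  · rintro P Q - - (h1 | h1) (h2 | h2)
    · exact Or.inl (by rw [map_add, h1, h2, add_zero])
    · exact Or.inr (by rw [map_add, h1, zero_add]; exact h2)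
    · exact Or.inr (by rw [map_add, h2, add_zero]; exact h1)
    · exact Or.inr (by rw [map_add]; exact h1.add h2)
  · rintro c P hc - (h1 | h1)
    · exact Or.inl (by rw [map_smul, h1, smul_zero])
    · exact Or.inr (by rw [map_smul]; exact h1.smul hc)

/-- Linear maps keep coefficients: writing z' in terms of x, y, z, the supporting functional of the
side is positive at both z and z', so the coefficient of z is positive, before and after developing.
-/
theorem same_side (hS : IsNet S) (h : IsLocalDev S v L) (hs : IsSide S v x y) {z' : ℍ}
    (hz : z ∈ near S v) (hzx : z ≠ x) (hzy : z ≠ y) (hz' : z' ∈ near S v) (hzx' : z' ≠ x)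
    (hzy' : z' ≠ y) : 0 < det3 (L (hyp x)) (L (hyp y)) (L (hyp z)) *
      det3 (L (hyp x)) (L (hyp y)) (L (hyp z')) := by
  obtain ⟨l, hlx, hly, hl⟩ := hs.exists_functional hS
  have hx := hs.2.1
  have hy := hs.2.2
  have hxy := hs.1.2.2.1
  have e := cramer_div (CenteredDual.det3_ne_zero hx hy hz hxy hzx.symm hzy.symm) (hyp z')
  generalize det3 (hyp y) (hyp z) (hyp z') / _ = a at e
  generalize det3 (hyp z) (hyp x) (hyp z') / _ = b at e
  generalize det3 (hyp x) (hyp y) (hyp z') / _ = c at e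
  have h1 := hl z hz hzx hzy
  have h2 := hl z' hz' hzx' hzy'
  rw [e] at h2
  simp only [map_add, map_smul, hlx, hly, smul_eq_mul, mul_zero, zero_add] at h2
  have hc : 0 < c := pos_of_mul_pos_left h2 h1.le
  have hd := h.det3_ne_zero hx hy hz hxy hzx.symm hzy.symm
  rw [e]
  simp only [map_add, map_smul, det3_left, det3_right, smul_eq_mul, mul_zero, zero_add]
  have := mul_pos hc (pow_two_pos_of_ne_zero hd)
  nlinarith

theorem nonneg_of_side (hS : IsNet S) (h : IsLocalDev S v L) (hs : IsSide S v x y)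
    (hz : z ∈ near S v) (hzx : z ≠ x) (hzy : z ≠ y) {P : V3} (hP : P ∈ cone (near S v)) :
    0 ≤ det3 (L (hyp x)) (L (hyp y)) (L (hyp z)) * det3 (L (hyp x)) (L (hyp y)) (L P) := by
  refine nonneg_of_mem_cone (l := det3 (L (hyp x)) (L (hyp y)) (L (hyp z)) •
    (det3 (L (hyp x)) (L (hyp y))).comp L) (fun z' hz' => ?_) hP
  change 0 ≤ det3 (L (hyp x)) (L (hyp y)) (L (hyp z)) * det3 (L (hyp x)) (L (hyp y)) (L (hyp z'))
  by_cases h1 : z' = x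
  · rw [h1, det3_left, mul_zero]
  by_cases h2 : z' = y
  · rw [h2, det3_right, mul_zero]
  exact (h.same_side hS hs hz hzx hzy hz' h1 h2).le

end IsLocalDev

/-- Two isotropic vectors with the correct product extend to a local developing map, on a prescribed
side. -/
theorem exists_isLocalDev {v x y z : ℍ} (hx : x ∈ near S v) (hy : y ∈ near S v) (hz : z ∈ near S v)
    (hxy : x ≠ y) (hxz : x ≠ z) (hyz : y ≠ z) {a b : V3} (ha : IsCFut a)
    (haa : mink a a = 0) (hbb : mink b b = 0) (hab : mink a b = mink (hyp x) (hyp y) - 1) {ε : ℝ}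
    (hε : ε ≠ 0) : ∃ L, IsLocalDev S v L ∧ L (hyp x) = a ∧ L (hyp y) = b ∧
      0 < ε * det3 a b (L (hyp z)) := by
  set s := mink a b with hs
  have hs0 : 0 < s := by rw [hab, sub_pos]; exact one_lt_mink_hyp hxy
  set p := mink (hyp x) (hyp z) - 1 with hp
  have hp0 : 0 < p := by rw [hp, sub_pos]; exact one_lt_mink_hyp hxz
  set q := mink (hyp y) (hyp z) - 1 with hq
  have hq0 : 0 < q := by rw [hq, sub_pos]; exact one_lt_mink_hyp hyz
  set n := cross a b with hn
  have hna : mink n a = 0 := by rw [hn, mink_cross, det3_left]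
  have hnb : mink n b = 0 := by rw [hn, mink_cross, det3_right]
  have hnn : mink n n = -4 * s ^ 2 := by rw [hn, mink_cross_self, haa, hbb]; ring
  -- The image of z must be isotropic with product p with a and q with b. This fixes its
  -- coefficients along a and b and the square of its coefficient k along the normal; the sign of k
  -- is free and selects the side.
  obtain ⟨k, hk, hkε⟩ : ∃ k : ℝ, k ^ 2 = p * q / (2 * s ^ 3) ∧ ε * k < 0 := by
    have h0 : 0 < p * q / (2 * s ^ 3) := by positivity
    rcases lt_or_gt_of_ne hε with h | h
    · exact ⟨√(p * q / (2 * s ^ 3)), Real.sq_sqrt h0.le, mul_neg_of_neg_of_pos h (Real.sqrt_pos.2 h0)⟩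
    · exact ⟨-√(p * q / (2 * s ^ 3)), by rw [neg_sq, Real.sq_sqrt h0.le],
        mul_neg_of_pos_of_neg h (neg_neg_of_pos (Real.sqrt_pos.2 h0))⟩
  set c := (q / s) • a + (p / s) • b + k • n with hc
  have hca : mink c a = p := by
    simp only [hc, map_add, map_smul, LinearMap.add_apply, LinearMap.smul_apply, smul_eq_mul, haa,
      hna, mink_comm b a, ← hs]
    field_simp; ring
  have hcb : mink c b = q := by
    simp only [hc, map_add, map_smul, LinearMap.add_apply, LinearMap.smul_apply, smul_eq_mul, hbb,
      hnb, ← hs]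
    field_simp; ring
  have hcc : mink c c = 0 := by
    have hcn : mink c n = k * (-4 * s ^ 2) := by
      simp only [hc, map_add, map_smul, LinearMap.add_apply, LinearMap.smul_apply, smul_eq_mul,
        mink_comm a n, mink_comm b n, hna, hnb, hnn]
      ring
    have e : mink c c = q / s * mink c a + p / s * mink c b + k * mink c n := by
      conv_lhs => rw [hc, map_add, map_add, map_smul, map_smul, map_smul]
      rfl
    rw [e, hca, hcb, hcn]
    have : k * (k * (-4 * s ^ 2)) = -4 * s ^ 2 * k ^ 2 := by ring
    rw [this, hk]
    field_simp; ring
  have hd := CenteredDual.det3_ne_zero hx hy hz hxy hxz hyz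
  set d := det3 (hyp x) (hyp y) (hyp z) with hdd
  let L : V3 →ₗ[ℝ] V3 := (d⁻¹ • det3 (hyp y) (hyp z)).smulRight a +
    (d⁻¹ • det3 (hyp z) (hyp x)).smulRight b + (d⁻¹ • det3 (hyp x) (hyp y)).smulRight c
  have hL : ∀ P, L P = (d⁻¹ * det3 (hyp y) (hyp z) P) • a + (d⁻¹ * det3 (hyp z) (hyp x) P) • b +
    (d⁻¹ * det3 (hyp x) (hyp y) P) • c := fun P => rfl
  have hLx : L (hyp x) = a := by
    rw [hL, det3_right, det3_left, ← det3_rotate, ← hdd, inv_mul_cancel₀ hd]; simp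
  have hLy : L (hyp y) = b := by
    rw [hL, det3_left, det3_right, det3_rotate, ← hdd, inv_mul_cancel₀ hd]; simp
  have hLz : L (hyp z) = c := by
    rw [hL, det3_right, det3_left, ← hdd, inv_mul_cancel₀ hd]; simp
  have key : ∀ P, ∃ α β γ : ℝ, P = α • hyp x + β • hyp y + γ • hyp z := fun P =>
    ⟨_, _, _, cramer_div hd P⟩
  have hmink : ∀ P Q, mink (L P) (L Q) = gform (ctr S v) P Q := by
    intro P Q
    obtain ⟨α, β, γ, rfl⟩ := key P
    obtain ⟨α', β', γ', rfl⟩ := key Q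
    have e1 : mink a b = mink (hyp x) (hyp y) - 1 := hab
    have e2 : mink c a = mink (hyp x) (hyp z) - 1 := hca
    have e3 : mink c b = mink (hyp y) (hyp z) - 1 := hcb
    simp only [gform, map_add, map_smul, hLx, hLy, hLz, LinearMap.add_apply, LinearMap.smul_apply,
      smul_eq_mul, mink_ctr_near hx, mink_ctr_near hy, mink_ctr_near hz, mink_hyp_self, haa, hbb,
      hcc, mink_comm b a, mink_comm a c, mink_comm b c, e1, e2, e3, mink_comm (hyp y) (hyp x),
      mink_comm (hyp z) (hyp x), mink_comm (hyp z) (hyp y)]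
    ring
  refine ⟨L, ⟨mem_voronoiVertices_iff.2 ⟨x, hx, y, hy, z, hz, hxy, hyz, hxz⟩, hmink,
    fun w hw => ?_⟩, hLx, hLy, ?_⟩
  · by_cases hwx : w = x
    · rw [hwx, hLx]; exact ha
    · refine isCFut_of_mink_pos ?_ ha ?_
      · rw [hmink, gform_near hw hw, mink_hyp_self, sub_self]
      · rw [← hLx, hmink, gform_near hw hx, sub_pos]; exact one_lt_mink_hyp hwx
  · have : det3 a b (L (hyp z)) = k * (-4 * s ^ 2) := by
      rw [hLz, hc, map_add, map_add, map_smul, map_smul, map_smul, det3_left, det3_right,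
        ← mink_cross, ← hn, hnn]
      simp
    rw [this]
    have : 0 < s ^ 2 := by positivity
    nlinarith
end

/-! ### Developing a whole cluster as a convex ideal polygon -/

section
variable {S : Set ℍ}

/-- A developing map of a set `W` of Voronoi vertices: local developing maps agreeing on the sides
dual to the non-centered edges, with convex and injective union. -/
structure IsDev (S W : Set ℍ) (L : ℍ → V3 →ₗ[ℝ] V3) : Prop where
  dev : ∀ v ∈ W, IsLocalDev S v (L v)
  closed : ∀ u ∈ W, ∀ w x y, Step S u w x y → w ∈ W
  glue : ∀ u ∈ W, ∀ w x y, Step S u w x y → L u (hyp x) = L w (hyp x)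
  opp : ∀ u ∈ W, ∀ w x y, Step S u w x y → ∀ z ∈ near S u, z ≠ x → z ≠ y → ∀ z' ∈ near S w,
    z' ≠ x → z' ≠ y → det3 (L u (hyp x)) (L u (hyp y)) (L u (hyp z)) *
      det3 (L u (hyp x)) (L u (hyp y)) (L w (hyp z')) < 0
  convex : ∀ v ∈ W, ∀ w ∈ W, ∀ P ∈ cone (near S v), ∀ Q ∈ cone (near S w),
    ∃ u ∈ W, ∃ R ∈ cone (near S u), L u R = L v P + L w Q
  inj : ∀ v ∈ W, ∀ w ∈ W, ∀ P ∈ cone (near S v), ∀ Q ∈ cone (near S w), L v P = L w Q → P = Q ∧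
    (v = w ∨ (∃ x y, (Step S v w x y ∨ Step S w v x y) ∧
      ∃ a b : ℝ, 0 < a ∧ 0 < b ∧ P = a • hyp x + b • hyp y) ∨ ∃ x ∈ S, ∃ c : ℝ, 0 ≤ c ∧ P = c • hyp x)

namespace IsDev
variable {W : Set ℍ} {L : ℍ → V3 →ₗ[ℝ] V3}

theorem glue_right (h : IsDev S W L) {u w x y : ℍ} (hu : u ∈ W) (hs : Step S u w x y) :
    L u (hyp y) = L w (hyp y) := h.glue u hu w y x hs.swap

/-- The developed cone lies on one side of each of its sides that is not an internal one. -/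
theorem support (hS : IsNet S) (h : IsDev S W L) (hW : W.Finite) {v x y z : ℍ} (hv : v ∈ W)
    (hs : IsSide S v x y) (hn : ∀ w ∈ W, ¬ Step S v w x y ∧ ¬ Step S w v x y)
    (hz : z ∈ near S v) (hzx : z ≠ x) (hzy : z ≠ y) {w : ℍ} (hw : w ∈ W) {P : V3}
    (hP : P ∈ cone (near S w)) : 0 ≤ det3 (L v (hyp x)) (L v (hyp y)) (L v (hyp z)) *
      det3 (L v (hyp x)) (L v (hyp y)) (L w P) := by
  by_contra hneg
  push Not at hneg
  -- M is interior to the side, and its development avoids the developed cones of the other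
  -- vertices; these are closed, so a small motion towards the offending vector avoids them too. By
  -- convexity the moved point lies in the developed cone of v, which is on the correct side.
  set M := hyp x + hyp y with hM
  have hMv : M ∈ cone (near S v) := add_mem (hyp_mem_cone hs.2.1) (hyp_mem_cone hs.2.2)
  have hM1 : M = (1 : ℝ) • hyp x + (1 : ℝ) • hyp y := by simp [hM]
  have hnot : ∀ u ∈ W, u ≠ v → L v M ∉ L u '' (cone (near S u) : Set V3) := by
    rintro u hu huv ⟨Q, hQ, e⟩
    obtain ⟨rfl, h1 | ⟨x', y', hst, a, b, ha, hb, e'⟩ | ⟨x', hx', c, hc, e'⟩⟩ :=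
      h.inj u hu v hv Q hQ M hMv e
    · exact huv h1
    · have hed : IsEdge S x' y' := hst.elim Step.edge Step.edge
      have hp := hs.1.pair_eq_of_mem_cone hS hed one_pos one_pos (by
        rw [← hM1, e']; exact mem_cone_pair.2 ⟨a, b, ha.le, hb.le, rfl⟩)
      have := hn u hu
      rcases hp with ⟨rfl, rfl⟩ | ⟨rfl, rfl⟩
      · exact hst.elim this.2 this.1
      · exact hst.elim (fun h => this.2 h.swap) (fun h => this.1 h.swap)
    · have hF : IsFut (hyp x + hyp y) := isFut_add_hyp x y
      have hk : 0 < (√(mink M M))⁻¹ := inv_pos.2 (Real.sqrt_pos.2 hF.1)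
      have hpt := hyp_pt hF
      refine hs.1.not_mem_of_pos hS hk hk (by rw [hpt, smul_add]) ?_
      have hc' : 0 < c := by
        refine lt_of_le_of_ne hc ?_
        rintro rfl
        have := hF.2
        rw [zero_smul] at e'
        rw [← hM, e'] at this
        exact lt_irrefl _ this
      rw [eq_pt hF hc' e']
      exact hx'
  have hev : ∀ᶠ ε : ℝ in 𝓝 0, ∀ u ∈ W, u ≠ v → L v M + ε • L w P ∉ L u '' (cone (near S u) : Set V3) := by
    rw [hW.eventually_all]
    intro u hu
    by_cases huv : u = v
    · exact Filter.Eventually.of_forall fun _ h => absurd huv h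
    have hc : Continuous fun ε : ℝ => L v M + ε • L w P := by fun_prop
    have ho := ((h.dev u hu).isClosed_image hS).isOpen_compl
    filter_upwards [hc.continuousAt.preimage_mem_nhds (ho.mem_nhds (by simpa using hnot u hu huv))]
      with ε hε _ using hε
  obtain ⟨ε, hε, hε0⟩ := ((hev.filter_mono nhdsWithin_le_nhds).and
    (self_mem_nhdsWithin (a := (0 : ℝ)) (s := Ioi 0))).exists
  obtain ⟨u, hu, R, hR, e⟩ := h.convex v hv w hw M hMv (ε • P) (cone_smul hP (le_of_lt hε0))
  rw [map_smul] at e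
  by_cases huv : u = v
  · subst huv
    have h1 := (h.dev u hu).nonneg_of_side hS hs hz hzx hzy hR
    rw [e, hM] at h1
    simp only [map_add, map_smul, det3_left, det3_right, smul_eq_mul, zero_add, add_zero] at h1
    have : (0 : ℝ) < ε := hε0
    nlinarith
  · exact hε u hu huv ⟨R, hR, e⟩

theorem singleton {v₀ : ℍ} (h₀ : IsRoot S v₀) {L : V3 →ₗ[ℝ] V3} (hL : IsLocalDev S v₀ L) :
    IsDev S {v₀} fun _ => L where
  dev := by rintro v rfl; exact hL
  closed := by rintro u rfl w x y h; exact absurd ⟨x, y, h⟩ (h₀.2 w)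
  glue := by rintro u rfl w x y h; exact absurd ⟨x, y, h⟩ (h₀.2 w)
  opp := by rintro u rfl w x y h; exact absurd ⟨x, y, h⟩ (h₀.2 w)
  convex := by
    rintro v rfl w rfl P hP Q hQ
    exact ⟨_, rfl, P + Q, add_mem hP hQ, map_add _ _ _⟩
  inj := by
    rintro v rfl w rfl P hP Q hQ h
    exact ⟨hL.injective h, Or.inl rfl⟩

/-- The new ideal polygon is attached along the developed side a, b, opposite to the cell of w. By
`support` the old union lies on one side of the plane of a and b, and the new cell lies on the
other. A causal vector in that plane is a nonnegative combination of a and b, hence belongs to the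
common side. So old and new meet exactly there, and anything joining them passes through it;
convexity and injectivity persist. -/
theorem extend (hS : IsNet S) (h : IsDev S W L) (hW : W.Finite) {u w x y : ℍ} (hu : u ∉ W)
    (hw : w ∈ W) (hst : Step S u w x y) : ∃ L', IsDev S (insert u W) L' := by
  classical
  have hed := hst.edge
  have hxy := hed.2.2.1
  have hxu := hed.near_left hst.mem_left
  have hyu := hed.near_right hst.mem_left
  have hxw := hed.near_left hst.mem_right
  have hyw := hed.near_right hst.mem_right
  have hsu : IsSide S u x y := ⟨hed, hxu, hyu⟩
  have hsw : IsSide S w x y := ⟨hed, hxw, hyw⟩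
  have hno : ∀ v ∈ W, ∀ x y, ¬ Step S v u x y := fun v hv x y hs => hu (h.closed v hv u x y hs)
  have hend : ∀ v ∈ W, x ∈ near S v → y ∈ near S v → v = w := fun v hv hx hy =>
    ((hst.endpoints hS).2 v (h.dev v hv).mem ⟨hx.2, hy.2⟩).resolve_left fun e => hu (e ▸ hv)
  obtain ⟨z, hz, hzx, hzy⟩ := exists_third hst.vertex_left x y
  obtain ⟨z', hz', hzx', hzy'⟩ := exists_third hst.vertex_right x y
  have hdw := h.dev w hw
  set a := L w (hyp x) with ha
  set b := L w (hyp y) with hb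
  have haa : mink a a = 0 := hdw.mink_self hxw
  have hbb : mink b b = 0 := hdw.mink_self hyw
  have hab : 0 < mink a b := hdw.mink_pos hxw hyw hxy
  have haf : IsCFut a := hdw.cfut x hxw
  have hbf : IsCFut b := hdw.cfut y hyw
  set D := det3 a b (L w (hyp z')) with hD
  have hD0 : D ≠ 0 := hdw.det3_ne_zero hxw hyw hz' hxy hzx'.symm hzy'.symm
  obtain ⟨Lu, hLu, hLx, hLy, hLz⟩ := exists_isLocalDev hxu hyu hz hxy hzx.symm hzy.symm haf haa hbb
    (hdw.mink_near hxw hyw) (neg_ne_zero.2 hD0)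
  have hsupp : ∀ v ∈ W, ∀ P ∈ cone (near S v), 0 ≤ D * det3 a b (L v P) := fun v hv P hP =>
    h.support hS hW hw hsw (fun v' hv' => ⟨fun hs => by
        have := h.closed w hw v' x y hs
        exact hs.ne (hend v' hv' (hed.near_left hs.mem_right) (hed.near_right hs.mem_right)).symm,
      fun hs => hs.ne (hend v' hv' (hed.near_left hs.mem_left) (hed.near_right hs.mem_left))⟩)
      hz' hzx' hzy' hv hP
  have hsuppu : ∀ P ∈ cone (near S u), D * det3 a b (Lu P) ≤ 0 := by
    intro P hP
    have := hLu.nonneg_of_side hS hsu hz hzx hzy hP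
    rw [hLx, hLy] at this
    by_contra hcon
    push Not at hcon
    nlinarith [mul_pos hLz hcon, sq_nonneg D, pow_two_pos_of_ne_zero hD0]
  -- Isotropy of a and b is what makes this work: in their plane the causal vectors are exactly the
  -- cone over the side, with nothing outside it.
  have hplane : ∀ R, R = 0 ∨ IsCFut R → D * det3 a b R = 0 → ∃ Q ∈ cone (near S u) , ∃ α β : ℝ,
      0 ≤ α ∧ 0 ≤ β ∧ Q = α • hyp x + β • hyp y ∧ Q ∈ cone (near S w) ∧ Lu Q = R ∧ L w Q = R := by
    intro R hR h0
    obtain ⟨α, β, hα, hβ, e⟩ := exists_comb_of_isotropic haa hbb hab haf hbf hR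
      ((mul_eq_zero.1 h0).resolve_left hD0)
    refine ⟨α • hyp x + β • hyp y, add_mem (cone_smul (hyp_mem_cone hxu) hα)
      (cone_smul (hyp_mem_cone hyu) hβ), α, β, hα, hβ, rfl, add_mem (cone_smul (hyp_mem_cone hxw) hα)
      (cone_smul (hyp_mem_cone hyw) hβ), ?_, ?_⟩
    · rw [map_add, map_smul, map_smul, hLx, hLy, e]
    · rw [map_add, map_smul, map_smul, e]
  have hcausal : ∀ {A B : V3}, (A = 0 ∨ IsCFut A) → (B = 0 ∨ IsCFut B) → ∀ t : ℝ, 0 ≤ t →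
      (t • A + B = 0 ∨ IsCFut (t • A + B)) := by
    intro A B hA hB t ht
    have h1 : t • A = 0 ∨ IsCFut (t • A) := by
      rcases ht.eq_or_lt with rfl | ht
      · exact Or.inl (zero_smul _ _)
      · rcases hA with rfl | hA
        · exact Or.inl (smul_zero _)
        · exact Or.inr (hA.smul ht)
    rcases h1 with h1 | h1 <;> rcases hB with hB | hB
    · exact Or.inl (by rw [h1, hB, add_zero])
    · exact Or.inr (by rw [h1, zero_add]; exact hB)
    · exact Or.inr (by rw [hB, add_zero]; exact h1)
    · exact Or.inr (h1.add hB)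
  have hne : ∀ {v}, v ∈ W → v ≠ u := fun hv e => hu (e ▸ hv)
  let L' := Function.update L u Lu
  have hL'u : L' u = Lu := Function.update_self _ _ _
  have hL' : ∀ {v}, v ∈ W → L' v = L v := fun hv => Function.update_of_ne (hne hv) _ _
  have hconv : ∀ v ∈ W, ∀ P ∈ cone (near S v), ∀ Q ∈ cone (near S u),
      ∃ u' ∈ insert u W, ∃ R ∈ cone (near S u'), L' u' R = L v P + Lu Q := by
    intro v hv P hP Q hQ
    have h1 := hsupp v hv P hP
    have h2 := hsuppu Q hQ
    have hA := (h.dev v hv).causal hP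
    have hB := hLu.causal hQ
    -- The sign tells on which side the sum falls. The summand from that side is split so that a
    -- part t of it, added to the other summand, lies in the dividing plane and hence in the common
    -- side; the rest is then added within the old union or within the new cell.
    rcases le_or_gt 0 (D * det3 a b (L v P) + D * det3 a b (Lu Q)) with hle | hlt
    · obtain ⟨t, ht0, ht1, ht⟩ : ∃ t : ℝ, 0 ≤ t ∧ t ≤ 1 ∧
          t * (D * det3 a b (L v P)) + D * det3 a b (Lu Q) = 0 := by
        rcases h1.eq_or_lt with h0 | h0
        · exact ⟨0, le_rfl, zero_le_one, by linarith⟩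
        · refine ⟨-(D * det3 a b (Lu Q)) / (D * det3 a b (L v P)), div_nonneg (by linarith) h0.le,
            (div_le_one h0).2 (by linarith), ?_⟩
          rw [div_mul_cancel₀ _ h0.ne']; ring
      obtain ⟨R, -, α, β, -, -, -, hRw, -, hR⟩ := hplane _ (hcausal hA hB t ht0) (by
        rw [map_add, map_smul, smul_eq_mul, ← ht]; ring)
      obtain ⟨u', hu', R', hR', e⟩ := h.convex v hv w hw _ (cone_smul hP (sub_nonneg.2 ht1)) R hRw
      refine ⟨u', mem_insert_of_mem _ hu', R', hR', ?_⟩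
      rw [hL' hu', e, hR, map_smul, sub_smul, one_smul]
      abel
    · have h0 : D * det3 a b (Lu Q) < 0 := by linarith
      obtain ⟨t, ht0, ht1, ht⟩ : ∃ t : ℝ, 0 ≤ t ∧ t ≤ 1 ∧
          t * (D * det3 a b (Lu Q)) + D * det3 a b (L v P) = 0 := by
        refine ⟨(D * det3 a b (L v P)) / -(D * det3 a b (Lu Q)), div_nonneg h1 (by linarith),
            (div_le_one (by linarith)).2 (by linarith), ?_⟩
        rw [div_neg, neg_mul, div_mul_cancel₀ _ h0.ne]; ring
      obtain ⟨R, hRu, α, β, -, -, -, -, hR, -⟩ := hplane _ (hcausal hB hA t ht0) (by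
        rw [map_add, map_smul, smul_eq_mul, ← ht]; ring)
      refine ⟨u, mem_insert _ _, (1 - t) • Q + R, add_mem (cone_smul hQ (sub_nonneg.2 ht1)) hRu, ?_⟩
      rw [hL'u, map_add, hR, map_smul, sub_smul, one_smul]
      abel
  have hinj : ∀ v ∈ W, ∀ P ∈ cone (near S v), ∀ Q ∈ cone (near S u), L v P = Lu Q → P = Q ∧
      ((∃ x y, Step S u v x y ∧ ∃ a b : ℝ, 0 < a ∧ 0 < b ∧ P = a • hyp x + b • hyp y) ∨
        ∃ x ∈ S, ∃ c : ℝ, 0 ≤ c ∧ P = c • hyp x) := by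
    intro v hv P hP Q hQ e
    have h1 := hsupp v hv P hP
    have h2 := hsuppu Q hQ
    rw [e] at h1
    obtain ⟨R, hRu, α, β, hα, hβ, hR, hRw, e1, e2⟩ := hplane _ (hLu.causal hQ) (le_antisymm h2 h1)
    have hQR : R = Q := hLu.injective e1
    have hPR := (h.inj v hv w hw P hP R hRw (by rw [e2, e])).1
    refine ⟨hPR.trans hQR, ?_⟩
    rcases hα.eq_or_lt with rfl | hα
    · exact Or.inr ⟨y, hed.2.1, β, hβ, by rw [hPR, hR, zero_smul, zero_add]⟩
    rcases hβ.eq_or_lt with rfl | hβ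
    · exact Or.inr ⟨x, hed.1, α, hα.le, by rw [hPR, hR, zero_smul, add_zero]⟩
    have hnv := hed.near_of_mem_cone hS (u := v) hα hβ (by rw [← hR, ← hPR]; exact hP)
    have := hend v hv hnv.1 hnv.2
    subst this
    exact Or.inl ⟨x, y, hst, α, β, hα, hβ, hPR.trans hR⟩
  refine ⟨L', ⟨?_, ?_, ?_, ?_, ?_, ?_⟩⟩
  · rintro v (rfl | hv)
    · rw [hL'u]; exact hLu
    · rw [hL' hv]; exact h.dev v hv
  · rintro v (rfl | hv) w' x' y' hs
    · exact mem_insert_of_mem _ ((hst.unique hS hs).1 ▸ hw)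
    · exact mem_insert_of_mem _ (h.closed v hv w' x' y' hs)
  · rintro v (rfl | hv) w' x' y' hs
    · obtain ⟨rfl, hxy'⟩ := hst.unique hS hs
      rw [hL'u, hL' hw]
      rcases hxy' with ⟨rfl, rfl⟩ | ⟨rfl, rfl⟩
      · exact hLx
      · exact hLy
    · rw [hL' hv, hL' (h.closed v hv w' x' y' hs)]
      exact h.glue v hv w' x' y' hs
  · have key : ∀ z₁ ∈ near S u, z₁ ≠ x → z₁ ≠ y → ∀ z₂ ∈ near S w, z₂ ≠ x → z₂ ≠ y →
        det3 a b (Lu (hyp z₁)) * det3 a b (L w (hyp z₂)) < 0 := by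
      intro z₁ h1 h1x h1y z₂ h2 h2x h2y
      have k1 := hLu.same_side hS hsu hz hzx hzy h1 h1x h1y
      have k2 := hdw.same_side hS hsw hz' hzx' hzy' h2 h2x h2y
      rw [hLx, hLy] at k1
      rw [← ha, ← hb, ← hD] at k2
      set A := det3 a b (Lu (hyp z))
      set B := det3 a b (Lu (hyp z₁))
      set C := det3 a b (L w (hyp z₂))
      have k3 : 0 < (A * B) * (D * C) := mul_pos k1 k2
      by_contra hcon
      push Not at hcon
      nlinarith [mul_nonneg hLz.le hcon]
    rintro v (rfl | hv) w' x' y' hs z₁ h1 h1x h1y z₂ h2 h2x h2y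
    · obtain ⟨rfl, hxy'⟩ := hst.unique hS hs
      rw [hL'u, hL' hw]
      rcases hxy' with ⟨rfl, rfl⟩ | ⟨rfl, rfl⟩
      · rw [hLx, hLy]
        exact key z₁ h1 h1x h1y z₂ h2 h2x h2y
      · rw [hLx, hLy, det3_swap, det3_swap b a, neg_mul_neg]
        exact key z₁ h1 h1y h1x z₂ h2 h2y h2x
    · rw [hL' hv, hL' (h.closed v hv w' x' y' hs)]
      exact h.opp v hv w' x' y' hs z₁ h1 h1x h1y z₂ h2 h2x h2y
  · rintro v₁ (rfl | hv₁) v₂ (rfl | hv₂) P hP Q hQ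
    · exact ⟨_, mem_insert _ _, P + Q, add_mem hP hQ, map_add _ _ _⟩
    · rw [hL'u, hL' hv₂, add_comm]
      exact hconv v₂ hv₂ Q hQ P hP
    · rw [hL'u, hL' hv₁]
      exact hconv v₁ hv₁ P hP Q hQ
    · obtain ⟨u', hu', R, hR, e⟩ := h.convex v₁ hv₁ v₂ hv₂ P hP Q hQ
      exact ⟨u', mem_insert_of_mem _ hu', R, hR, by rw [hL' hu', hL' hv₁, hL' hv₂, e]⟩
  · rintro v₁ (rfl | hv₁) v₂ (rfl | hv₂) P hP Q hQ e
    · rw [hL'u] at e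
      exact ⟨hLu.injective e, Or.inl rfl⟩
    · rw [hL'u, hL' hv₂] at e
      obtain ⟨rfl, h1⟩ := hinj v₂ hv₂ Q hQ P hP e.symm
      exact ⟨rfl, Or.inr (h1.imp_left fun ⟨x, y, h1, h2⟩ => ⟨x, y, Or.inl h1, h2⟩)⟩
    · rw [hL'u, hL' hv₁] at e
      obtain ⟨h0, h1⟩ := hinj v₁ hv₁ P hP Q hQ e
      exact ⟨h0, Or.inr (h1.imp_left fun ⟨x, y, h1, h2⟩ => ⟨x, y, Or.inr h1, h2⟩)⟩
    · rw [hL' hv₁, hL' hv₂] at e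
      exact h.inj v₁ hv₁ v₂ hv₂ P hP Q hQ e

end IsDev

theorem exists_isDev (hS : IsFiniteNet S) {v₀ : ℍ} (h₀ : IsRoot S v₀) :
    ∃ L, IsDev S (cluster S v₀) L := by
  have hfin := hS.finite_cluster v₀
  have base : ∃ L, IsDev S {v₀} L := by
    obtain ⟨x, hx, y, hy, z, hz, hxy, hyz, hxz⟩ := mem_voronoiVertices_iff.1 h₀.1
    have hs : 0 < mink (hyp x) (hyp y) - 1 := sub_pos.2 (one_lt_mink_hyp hxy)
    -- The start is a pair of explicit vectors on the two null axes, scaled so that their product is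
    -- ⟨x, y⟩ - 1.
    obtain ⟨L, hL, -⟩ := exists_isLocalDev (a := ((0, 2 * (mink (hyp x) (hyp y) - 1), 0) : V3))
      (b := ((0, 0, 1) : V3)) hx hy hz hxy hxz hyz ⟨by simp [mink_apply], by simpa using hs⟩
      (by simp [mink_apply]) (by simp [mink_apply]) (by simp [mink_apply]) one_ne_zero
    exact ⟨_, IsDev.singleton h₀ hL⟩
  have key : ∀ n, ∀ W ⊆ cluster S v₀, v₀ ∈ W → (cluster S v₀ \ W).ncard = n →
      (∃ L, IsDev S W L) → ∃ L, IsDev S (cluster S v₀) L := by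
    intro n
    induction n with
    | zero =>
      intro W hW hv hn hL
      have : cluster S v₀ \ W = ∅ := (ncard_eq_zero (hfin.subset sdiff_subset)).1 hn
      rwa [Subset.antisymm hW (sdiff_eq_empty.1 this)] at hL
    | succ n ih =>
      rintro W hW hv hn ⟨L, hL⟩
      obtain ⟨u₀, hu₀, hu₀W⟩ : (cluster S v₀ \ W).Nonempty := by
        by_contra h
        rw [not_nonempty_iff_eq_empty.1 h, ncard_empty] at hn
        omega
      -- On the way from a missing vertex to the root, some step enters W.
      have : ∃ u w, Next S u w ∧ u ∉ W ∧ w ∈ W ∧ u ∈ cluster S v₀ := by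
        have hr := hu₀.2
        clear hu₀
        induction hr using Relation.ReflTransGen.head_induction_on with
        | refl => exact absurd hv hu₀W
        | head h hr ih' =>
          rename_i a c
          by_cases hc : c ∈ W
          · exact ⟨a, c, h, hu₀W, hc, h.mem_left, .head h hr⟩
          · exact ih' hc
      obtain ⟨u, w, ⟨x, y, hst⟩, hu, hw, huc⟩ := this
      refine ih (insert u W) (insert_subset huc hW) (mem_insert_of_mem _ hv) ?_
        (hL.extend hS.toIsNet (hfin.subset hW) hu hw hst)
      have h1 : cluster S v₀ \ insert u W = (cluster S v₀ \ W) \ {u} := by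
        rw [sdiff_sdiff, union_singleton]
      rw [h1, ncard_sdiff_singleton_of_mem (by exact ⟨huc, hu⟩), hn]
      rfl
  exact key _ {v₀} (singleton_subset_iff.2 h₀.mem_cluster) rfl rfl base
end

/-! ### The slice of Minkowski space and Lipschitz estimates -/

section
variable {S : Set ℍ}

/-- The Euclidean plane. -/
abbrev E2 := EuclideanSpace ℝ (Fin 2)

/-- The affine embedding of the plane as the slice `s + t = 2` of Minkowski space. -/
noncomputable def hom (c : E2) : V3 := (c 0, 1 + c 1, 1 - c 1)

/-- The central projection to the slice `s + t = 2`. -/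
noncomputable def proj (P : V3) : E2 :=
  !₂[2 * P.1 / (P.2.1 + P.2.2), (P.2.1 - P.2.2) / (P.2.1 + P.2.2)]

theorem hom_add_smul (c c' : E2) {a b : ℝ} (hab : a + b = 1) :
    hom (a • c + b • c') = a • hom c + b • hom c' := by
  ext
  · simp [hom]
  · simp [hom]; linear_combination -hab
  · simp [hom]; linear_combination -hab

theorem continuous_hom : Continuous hom := by unfold hom; fun_prop

theorem proj_hom (c : E2) : proj (hom c) = c := by
  ext i
  fin_cases i <;> simp [proj, hom] <;> ring

theorem hom_ne_zero (c : E2) : hom c ≠ 0 := by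
  intro h
  have h1 := congrArg (fun P : V3 => P.2.1 + P.2.2) h
  simp [hom] at h1

theorem hom_proj {P : V3} (hP : 0 < P.2.1 + P.2.2) :
    hom (proj P) = (2 / (P.2.1 + P.2.2)) • P := by
  ext <;> simp [proj, hom] <;> field_simp <;> ring

theorem proj_smul (P : V3) {k : ℝ} (hk : 0 < k) : proj (k • P) = proj P := by
  ext i
  have hk' := hk.ne'
  fin_cases i
  · simp only [proj, Fin.zero_eta, Prod.smul_fst, Prod.smul_snd, smul_eq_mul]
    change 2 * (k * P.1) / (k * P.2.1 + k * P.2.2) = 2 * P.1 / (P.2.1 + P.2.2)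
    rw [← mul_add, mul_left_comm, mul_div_mul_left _ _ hk']
  · change (k * P.2.1 - k * P.2.2) / (k * P.2.1 + k * P.2.2) = (P.2.1 - P.2.2) / (P.2.1 + P.2.2)
    rw [← mul_add, ← mul_sub, mul_div_mul_left _ _ hk']

theorem continuousOn_proj : ContinuousOn proj {P | 0 < P.2.1 + P.2.2} := by
  refine (PiLp.continuous_toLp 2 _).comp_continuousOn (continuousOn_pi.2 fun i => ?_)
  have h : ∀ P ∈ {P : V3 | 0 < P.2.1 + P.2.2}, P.2.1 + P.2.2 ≠ 0 := fun P hP => ne_of_gt hP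
  fin_cases i
  · exact ContinuousOn.div (by fun_prop) (by fun_prop) h
  · exact ContinuousOn.div (by fun_prop) (by fun_prop) h

theorem mink_hom (c : E2) : mink (hom c) (hom c) = 1 - (c 0 ^ 2 + c 1 ^ 2) := by
  simp [mink_apply, hom]; ring

theorem sq_le_two_mul_cosh_sub_one (d : ℝ) : d ^ 2 ≤ 2 * (Real.cosh d - 1) := by
  have h1 : Real.cosh d = 2 * Real.sinh (d / 2) ^ 2 + 1 := by
    have := Real.cosh_two_mul (d / 2)
    have h2 := Real.cosh_sq (d / 2)
    rw [mul_div_cancel₀ d two_ne_zero] at this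
    rw [this, h2]; ring
  have h3 : (d / 2) ^ 2 ≤ Real.sinh (d / 2) ^ 2 := by
    rw [sq_le_sq]
    rcases le_total 0 (d / 2) with h | h
    · rw [abs_of_nonneg h, abs_of_nonneg (Real.sinh_nonneg_iff.2 h)]
      exact Real.self_le_sinh_iff.2 h
    · rw [abs_of_nonpos h, abs_of_nonpos (Real.sinh_nonpos_iff.2 h), neg_le_neg_iff]
      exact Real.sinh_le_self_iff.2 h
  rw [h1]; linarith

theorem abs_mink_le (P Q : V3) : |mink P Q| ≤ 2 * ‖P‖ * ‖Q‖ := by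
  have h1 := norm_fst_le P
  have h2 := (norm_fst_le P.2).trans (norm_snd_le P)
  have h3 := (norm_snd_le P.2).trans (norm_snd_le P)
  have k1 := norm_fst_le Q
  have k2 := (norm_fst_le Q.2).trans (norm_snd_le Q)
  have k3 := (norm_snd_le Q.2).trans (norm_snd_le Q)
  rw [Real.norm_eq_abs] at h1 h2 h3 k1 k2 k3
  have m1 := mul_le_mul h2 k3 (abs_nonneg _) (norm_nonneg _)
  have m2 := mul_le_mul h3 k2 (abs_nonneg _) (norm_nonneg _)
  have m3 := mul_le_mul h1 k1 (abs_nonneg _) (norm_nonneg _)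
  rw [← abs_mul] at m1 m2 m3
  rw [mink_apply, abs_le]
  have := abs_le.1 m1; have := abs_le.1 m2; have := abs_le.1 m3
  constructor <;> linarith

/-- The projection to the hyperbolic plane is Lipschitz on compact sets. -/
theorem exists_dist_pt_le {T : Set V3} (hT : IsCompact T) (hF : ∀ P ∈ T, IsFut P) :
    ∃ K : ℝ≥0, ∀ P ∈ T, ∀ Q ∈ T, dist (pt P) (pt Q) ≤ K * dist P Q := by
  rcases T.eq_empty_or_nonempty with rfl | hne
  · exact ⟨0, by simp⟩
  have hc : Continuous fun P : V3 => mink P P := by simp only [mink_apply]; fun_prop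
  obtain ⟨P₀, hP₀, hmin⟩ := hT.exists_isMinOn hne hc.continuousOn
  obtain ⟨B, hB⟩ := hT.isBounded.exists_norm_le
  set m := mink P₀ P₀ with hm
  have hm0 : 0 < m := (hF P₀ hP₀).1
  have hmin' : ∀ P ∈ T, m ≤ mink P P := fun P hP => hmin hP
  have hB0 : 0 ≤ B := (norm_nonneg _).trans (hB P₀ hP₀)
  -- With D = P - Q and p, q the norms, d² ≤ 2 (cosh d - 1) = ((p - q)² - ⟨D, D⟩) / (pq). The three
  -- terms of k come from (p - q)² ≤ 16 B² ‖D‖² / (4m), from -⟨D, D⟩ ≤ 2 ‖D‖² and from pq ≥ m.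
  set k : ℝ := (16 * B ^ 2 / (4 * m) + 2) / m with hk
  have hk0 : 0 ≤ k := by positivity
  refine ⟨⟨√k, Real.sqrt_nonneg _⟩, fun P hP Q hQ => ?_⟩
  change _ ≤ √k * dist P Q
  have hp := (hF P hP).1
  have hq := (hF Q hQ).1
  set p := √(mink P P) with hpd
  set q := √(mink Q Q) with hqd
  have hp0 : 0 < p := Real.sqrt_pos.2 hp
  have hq0 : 0 < q := Real.sqrt_pos.2 hq
  have hpp : p ^ 2 = mink P P := Real.sq_sqrt hp.le
  have hqq : q ^ 2 = mink Q Q := Real.sq_sqrt hq.le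
  have hpm : √m ≤ p := Real.sqrt_le_sqrt (hmin' P hP)
  have hqm : √m ≤ q := Real.sqrt_le_sqrt (hmin' Q hQ)
  have hsm : 0 < √m := Real.sqrt_pos.2 hm0
  have hmm : √m ^ 2 = m := Real.sq_sqrt hm0.le
  set D := P - Q with hD
  have hDn : dist P Q = ‖D‖ := dist_eq_norm _ _
  have e1 : mink D D = mink P P + mink Q Q - 2 * mink P Q := by
    simp only [hD, map_sub, LinearMap.sub_apply, mink_comm Q P]; ring
  have e2 : (p - q) * (p + q) = mink (P + Q) D := by
    have : mink (P + Q) D = mink P P - mink Q Q := by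
      simp only [hD, map_sub, map_add, LinearMap.add_apply, mink_comm Q P]; ring
    rw [this, ← hpp, ← hqq]; ring
  have e3 : |mink (P + Q) D| ≤ 4 * B * ‖D‖ := by
    refine (abs_mink_le _ _).trans ?_
    have : ‖P + Q‖ ≤ B + B := (norm_add_le _ _).trans (add_le_add (hB P hP) (hB Q hQ))
    nlinarith [norm_nonneg D]
  have e4 : (p - q) ^ 2 * (4 * m) ≤ 16 * B ^ 2 * ‖D‖ ^ 2 := by
    have h1 : (p - q) ^ 2 * (p + q) ^ 2 ≤ (4 * B * ‖D‖) ^ 2 := by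
      rw [← mul_pow, e2]; exact sq_le_sq.2 (e3.trans (le_abs_self _))
    have h2 : 4 * m ≤ (p + q) ^ 2 := by nlinarith
    nlinarith [sq_nonneg (p - q)]
  have e5 : -mink D D ≤ 2 * ‖D‖ ^ 2 := by
    have := abs_le.1 (abs_mink_le D D)
    nlinarith
  have e6 : Real.cosh (dist (pt P) (pt Q)) = mink P Q / (p * q) := by
    rw [cosh_dist_eq, hyp_pt (hF P hP), hyp_pt (hF Q hQ)]
    simp only [map_smul, LinearMap.smul_apply, smul_eq_mul]
    rw [← hpd, ← hqd]; field_simp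
  have e7 : mink P Q - p * q = ((p - q) ^ 2 - mink D D) / 2 := by
    rw [e1, ← hpp, ← hqq]; ring
  have e8 : dist (pt P) (pt Q) ^ 2 ≤ k * ‖D‖ ^ 2 := by
    refine (sq_le_two_mul_cosh_sub_one _).trans ?_
    have h1 : 2 * (mink P Q / (p * q) - 1) = ((p - q) ^ 2 - mink D D) / (p * q) := by
      rw [eq_div_iff (by positivity)]
      have : 2 * (mink P Q / (p * q) - 1) * (p * q) = 2 * (mink P Q - p * q) := by field_simp
      rw [this, e7]; ring
    rw [e6, h1, div_le_iff₀ (by positivity)]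
    have h2 : m ≤ p * q := by nlinarith
    have h3 : (p - q) ^ 2 ≤ 16 * B ^ 2 / (4 * m) * ‖D‖ ^ 2 := by
      rw [div_mul_eq_mul_div, le_div_iff₀ (by positivity)]; exact e4
    have h4 : k * ‖D‖ ^ 2 * m = (16 * B ^ 2 / (4 * m) + 2) * ‖D‖ ^ 2 := by
      rw [hk]; field_simp
    have h5 : k * ‖D‖ ^ 2 * m ≤ k * ‖D‖ ^ 2 * (p * q) := by gcongr
    rw [add_mul] at h4
    linarith
  rw [hDn]
  refine abs_le_of_sq_le_sq' ?_ (by positivity) |>.2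
  rw [mul_pow, Real.sq_sqrt hk0]; exact e8

/-- A map which is Lipschitz on the members of a finite closed cover of an interval is Lipschitz. -/
theorem dist_le_of_closed_cover {X ι : Type*} [PseudoMetricSpace X] {A : ι → Set ℝ} {f : ℝ → X}
    {K : ℝ} (hA : ∀ i, IsClosed (A i))
    (hf : ∀ i, ∀ s ∈ A i, ∀ t ∈ A i, dist (f s) (f t) ≤ K * |s - t|) (I : Finset ι) {a b : ℝ}
    (hab : a ≤ b) (hI : Icc a b ⊆ ⋃ i ∈ I, A i) : dist (f a) (f b) ≤ K * (b - a) := by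
  classical
  induction I using Finset.strongInduction generalizing a b with
  | H I ih =>
    obtain ⟨i, hi, hai⟩ := mem_iUnion₂.1 (hI (left_mem_Icc.2 hab))
    have hcomp : IsCompact (A i ∩ Icc a b) := isCompact_Icc.inter_left (hA i)
    have hne : (A i ∩ Icc a b).Nonempty := ⟨a, hai, left_mem_Icc.2 hab⟩
    obtain ⟨hT, hTab⟩ := hcomp.sSup_mem hne
    have hub := fun t ht => le_csSup hcomp.bddAbove (a := t) ht
    -- T is the last parameter in A i. What follows is covered by the other sets, after taking a
    -- closure to include T itself.
    set T := sSup (A i ∩ Icc a b)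
    have h1 := hf i a hai T hT
    rw [abs_sub_comm, abs_of_nonneg (sub_nonneg.2 hTab.1)] at h1
    rcases hTab.2.eq_or_lt with h | h
    · rwa [h] at h1
    have h2 : Icc T b ⊆ ⋃ j ∈ I.erase i, A j := by
      rw [← closure_Ioc h.ne]
      refine closure_minimal ?_ (isClosed_biUnion_finset fun j _ => hA j)
      intro t ht
      obtain ⟨j, hj, htj⟩ := mem_iUnion₂.1 (hI ⟨hTab.1.trans ht.1.le, ht.2⟩)
      refine mem_iUnion₂.2 ⟨j, Finset.mem_erase.2 ⟨?_, hj⟩, htj⟩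
      rintro rfl
      exact not_lt_of_ge (hub t ⟨htj, hTab.1.trans ht.1.le, ht.2⟩) ht.1
    have h3 := ih _ (Finset.erase_ssubset hi) h.le h2
    calc dist (f a) (f b) ≤ K * (T - a) + K * (b - T) := (dist_triangle _ _ _).trans (add_le_add h1 h3)
      _ = K * (b - a) := by ring

/-- A map which is Lipschitz on the members of a finite closed cover of a convex set is Lipschitz. -/
theorem exists_lipschitzOnWith_of_closed_cover {X ι : Type*} [PseudoMetricSpace X] {C : Set E2}
    (hC : Convex ℝ C) {f : E2 → X} {I : Set ι} (hI : I.Finite) {A : ι → Set E2}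
    (hA : ∀ i ∈ I, IsClosed (A i)) (hCA : C ⊆ ⋃ i ∈ I, A i)
    (hf : ∀ i ∈ I, ∃ K : ℝ≥0, LipschitzOnWith K f (A i)) : ∃ K : ℝ≥0, LipschitzOnWith K f C := by
  classical
  have := hI.fintype
  choose! K hK using hf
  let K₀ : ℝ≥0 := ∑ i : I, K i
  have hK₀ : ∀ i ∈ I, K i ≤ K₀ := fun i hi =>
    Finset.single_le_sum (f := fun i : I => K i) (fun _ _ => zero_le) (Finset.mem_univ (⟨i, hi⟩ : I))
  refine ⟨K₀, LipschitzOnWith.of_dist_le_mul fun c hc c' hc' => ?_⟩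
  let g : ℝ → E2 := fun t => c + t • (c' - c)
  have hg : Continuous g := by fun_prop
  have hdist : ∀ s t, dist (g s) (g t) = |s - t| * dist c c' := by
    intro s t
    rw [dist_eq_norm, dist_eq_norm, ← norm_neg (c - c'), neg_sub, ← Real.norm_eq_abs, ← norm_smul]
    congr 1
    simp only [g, sub_smul]; abel
  have h := dist_le_of_closed_cover (A := fun i : I => g ⁻¹' (A i)) (f := f ∘ g)
    (K := K₀ * dist c c')
    (fun i => (hA i i.2).preimage hg) (fun i s hs t ht => by
      refine ((hK i i.2).dist_le_mul _ hs _ ht).trans ?_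
      rw [hdist]
      have : (K i : ℝ) ≤ K₀ := hK₀ i i.2
      rw [mul_assoc, mul_comm (dist c c')]
      exact mul_le_mul_of_nonneg_right this (by positivity)) Finset.univ zero_le_one (fun t ht => by
      have hgt : g t ∈ C := by
        have := hC hc hc' (sub_nonneg.2 ht.2) ht.1 (by ring)
        convert this using 1
        simp only [g, smul_sub, sub_smul, one_smul]; abel
      obtain ⟨i, hi, hit⟩ := mem_iUnion₂.1 (hCA hgt)
      exact mem_iUnion₂.2 ⟨⟨i, hi⟩, Finset.mem_univ _, hit⟩)
  simpa [g] using h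
end

/-! ### The disk model of a cluster and its map to the hyperbolic plane -/

section
variable {S : Set ℍ}

/-- The developed image of a point of the Delaunay cell of `v` in the disk model. -/
noncomputable def sect (L : ℍ → V3 →ₗ[ℝ] V3) (v p : ℍ) : E2 := proj (L v (hyp p))

/-- The disk model. -/
def plane (S W : Set ℍ) (L : ℍ → V3 →ₗ[ℝ] V3) : Set E2 :=
  {c | ∃ v ∈ W, ∃ P ∈ cone (near S v), hom c = L v P}

open Classical in
/-- The map from the disk model to the hyperbolic plane. -/
noncomputable def devMap (S W : Set ℍ) (L : ℍ → V3 →ₗ[ℝ] V3) (c : E2) : ℍ :=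
  if h : ∃ P : V3, ∃ v ∈ W, P ∈ cone (near S v) ∧ hom c = L v P then pt h.choose
  else UpperHalfPlane.I

namespace IsLocalDev
variable {v x y z p : ℍ} {L : V3 →ₗ[ℝ] V3}

theorem cfut_hyp (h : IsLocalDev S v L) (hp : p ∈ delaunayCell S v) : IsCFut (L (hyp p)) :=
  (h.causal (mem_delaunayCell.1 hp)).resolve_left fun h0 =>
    hyp_ne_zero p (h.injective (h0.trans (map_zero L).symm))

theorem hom_proj (h : IsLocalDev S v L) (hp : p ∈ delaunayCell S v) :
    ∃ k : ℝ, 0 < k ∧ hom (proj (L (hyp p))) = L (k • hyp p) := by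
  have := (h.cfut_hyp hp).2
  exact ⟨_, div_pos two_pos this, by rw [CenteredDual.hom_proj this, map_smul]⟩

theorem isOpenMap (h : IsLocalDev S v L) : IsOpenMap L :=
  LinearMap.isOpenMap_of_finiteDimensional L (LinearMap.injective_iff_surjective.1 h.injective)

end IsLocalDev

theorem mem_near_of_mem_delaunayCell {v p : ℍ} (hS : IsNet S) (hp : p ∈ delaunayCell S v)
    (hpS : p ∈ S) : p ∈ near S v := by
  obtain ⟨x, hx⟩ := hS.nonempty_near v
  have := dist_le_of_mem_delaunayCell hp hx
  exact mem_near_iff.2 ⟨hpS, fun y hy =>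
    (dist_le_dist_iff.1 this).trans ((mem_near_iff.1 hx).2 y hy)⟩

theorem exists_overshoot {C : Set E2} {c : E2} (hc : c ∈ interior C) (c₁ : E2) :
    ∃ δ : ℝ, 0 < δ ∧ (1 + δ) • c + (-δ) • c₁ ∈ C := by
  have hcont : Continuous fun δ : ℝ => (1 + δ) • c + (-δ) • c₁ := by fun_prop
  have h := hcont.continuousAt.preimage_mem_nhds
    (t := C) (x := 0) (by simpa using mem_interior_iff_mem_nhds.1 hc)
  obtain ⟨δ, h1, h2⟩ := ((Filter.Eventually.filter_mono nhdsWithin_le_nhds h).and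
    (self_mem_nhdsWithin (a := (0 : ℝ)) (s := Ioi 0))).exists
  exact ⟨δ, h2, h1⟩

namespace IsDev
variable {W : Set ℍ} {L : ℍ → V3 →ₗ[ℝ] V3} {v w p q : ℍ} {c : E2}

/-- The value does not depend on the chosen vertex and vector because equal developed vectors come
from equal vectors, the first half of `IsDev.inj`. -/
theorem devMap_eq (h : IsDev S W L) (hv : v ∈ W) {P : V3} (hP : P ∈ cone (near S v))
    (e : hom c = L v P) : devMap S W L c = pt P := by
  have hex : ∃ P : V3, ∃ v ∈ W, P ∈ cone (near S v) ∧ hom c = L v P := ⟨P, v, hv, hP, e⟩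
  rw [devMap, dif_pos hex]
  obtain ⟨w, hw, hQ, e'⟩ := hex.choose_spec
  rw [(h.inj w hw v hv _ hQ P hP (e'.symm.trans e)).1]

theorem sect_mem (h : IsDev S W L) (hv : v ∈ W) (hp : p ∈ delaunayCell S v) :
    sect L v p ∈ plane S W L := by
  obtain ⟨k, hk, e⟩ := (h.dev v hv).hom_proj hp
  exact ⟨v, hv, _, cone_smul (mem_delaunayCell.1 hp) hk.le, e⟩

theorem devMap_sect (h : IsDev S W L) (hv : v ∈ W) (hp : p ∈ delaunayCell S v) :
    devMap S W L (sect L v p) = p := by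
  obtain ⟨k, hk, e⟩ := (h.dev v hv).hom_proj hp
  rw [sect, h.devMap_eq hv (cone_smul (mem_delaunayCell.1 hp) hk.le) e, pt_smul (hyp_mem_Fut p) hk, pt_hyp]

theorem exists_sect (h : IsDev S W L) (hc : c ∈ plane S W L) :
    ∃ v ∈ W, devMap S W L c ∈ delaunayCell S v ∧ c = sect L v (devMap S W L c) := by
  obtain ⟨v, hv, P, hP, e⟩ := hc
  have h0 : P ≠ 0 := by
    rintro rfl
    exact hom_ne_zero c (by rw [e, map_zero])
  obtain ⟨k, hk, hPk⟩ := exists_smul_hyp (isFut_of_mem_cone hP h0)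
  refine ⟨v, hv, ?_, ?_⟩
  · rw [h.devMap_eq hv hP e, mem_delaunayCell]
    rw [hPk] at hP
    exact (smul_mem_cone_iff hk).1 hP
  · rw [h.devMap_eq hv hP e, sect]
    conv_lhs => rw [← proj_hom c, e, hPk, map_smul, proj_smul _ hk]

theorem plane_eq (h : IsDev S W L) : plane S W L = ⋃ v ∈ W, sect L v '' delaunayCell S v := by
  ext c
  constructor
  · intro hc
    obtain ⟨v, hv, h1, h2⟩ := h.exists_sect hc
    exact mem_iUnion₂.2 ⟨v, hv, _, h1, h2.symm⟩
  · intro hc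
    obtain ⟨v, hv, p, hp, rfl⟩ := mem_iUnion₂.1 hc
    exact h.sect_mem hv hp

theorem continuousOn_sect (h : IsDev S W L) (hv : v ∈ W) :
    ContinuousOn (sect L v) (delaunayCell S v) := by
  refine continuousOn_proj.comp ?_ fun p hp => ((h.dev v hv).cfut_hyp hp).2
  exact ((L v).continuous_of_finiteDimensional.comp continuous_hyp).continuousOn

theorem isCompact_piece (hS : IsNet S) (h : IsDev S W L) (hv : v ∈ W) :
    IsCompact (sect L v '' delaunayCell S v) :=
  (isCompact_delaunayCell hS v).image_of_continuousOn (h.continuousOn_sect hv)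

theorem isCompact_plane (hS : IsNet S) (h : IsDev S W L) (hW : W.Finite) :
    IsCompact (plane S W L) := by
  rw [h.plane_eq]
  exact hW.isCompact_biUnion fun v hv => h.isCompact_piece hS hv

theorem convex_plane (h : IsDev S W L) : Convex ℝ (plane S W L) := by
  rintro c ⟨v, hv, P, hP, e⟩ c' ⟨w, hw, Q, hQ, e'⟩ a b ha hb hab
  obtain ⟨u, hu, R, hR, e''⟩ := h.convex v hv w hw _ (cone_smul hP ha) _ (cone_smul hQ hb)
  exact ⟨u, hu, R, hR, by rw [hom_add_smul _ _ hab, e, e', e'', map_smul, map_smul]⟩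

/-- On the piece of v the map is `hom`, then the inverse of `L v`, then the projection to ℍ of a
compact set of future vectors, each of them Lipschitz. Convexity of the disk model turns the bounds
on the finitely many closed pieces into a global one. -/
theorem exists_lipschitz (hS : IsNet S) (h : IsDev S W L) (hW : W.Finite) :
    ∃ K : ℝ≥0, LipschitzOnWith K (devMap S W L) (plane S W L) := by
  refine exists_lipschitzOnWith_of_closed_cover h.convex_plane hW
    (A := fun v => sect L v '' delaunayCell S v) (fun v hv => (h.isCompact_piece hS hv).isClosed)
    h.plane_eq.subset fun v hv => ?_
  have hd := h.dev v hv
  let M : V3 ≃ₗ[ℝ] V3 := LinearEquiv.ofBijective (L v)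
    ⟨hd.injective, LinearMap.injective_iff_surjective.1 hd.injective⟩
  have hM : ∀ P, M.symm (L v P) = P := fun P => M.symm_apply_apply P
  let g : E2 → V3 := fun c => M.symm (hom c)
  obtain ⟨K₁, hK₁⟩ : ∃ K₁ : ℝ≥0, LipschitzWith K₁ M.symm :=
    ⟨_, (LinearMap.toContinuousLinearMap (M.symm : V3 →ₗ[ℝ] V3)).lipschitz⟩
  have hhom : LipschitzWith 1 hom := by
    refine LipschitzWith.of_dist_le_mul fun c c' => ?_
    have h0 : ∀ i, |c i - c' i| ≤ dist c c' := fun i => by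
      rw [dist_eq_norm, ← Real.norm_eq_abs]; exact PiLp.norm_apply_le (c - c') i
    simp only [hom, NNReal.coe_one, one_mul, Prod.dist_eq, Real.dist_eq]
    refine max_le (h0 0) (max_le ?_ ?_)
    · rw [add_sub_add_left_eq_sub]; exact h0 1
    · rw [sub_sub_sub_cancel_left, abs_sub_comm]; exact h0 1
  have hg : LipschitzWith (K₁ * 1) g := hK₁.comp hhom
  have hmaps : ∀ c ∈ sect L v '' delaunayCell S v, IsFut (g c) ∧ devMap S W L c = pt (g c) := by
    rintro _ ⟨p, hp, rfl⟩
    obtain ⟨k, hk, e⟩ := hd.hom_proj hp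
    have : g (sect L v p) = k • hyp p := by
      change M.symm (hom (proj (L v (hyp p)))) = _
      rw [e, hM]
    rw [this, h.devMap_sect hv hp, pt_smul (hyp_mem_Fut p) hk, pt_hyp]
    exact ⟨(hyp_mem_Fut p).smul hk, rfl⟩
  obtain ⟨K₂, hK₂⟩ := exists_dist_pt_le ((h.isCompact_piece hS hv).image hg.continuous) (by
    rintro _ ⟨c, hc, rfl⟩; exact (hmaps c hc).1)
  refine ⟨K₂ * (K₁ * 1), LipschitzOnWith.of_dist_le_mul fun c hc c' hc' => ?_⟩
  rw [(hmaps c hc).2, (hmaps c' hc').2]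
  refine (hK₂ _ (mem_image_of_mem _ hc) _ (mem_image_of_mem _ hc')).trans ?_
  rw [NNReal.coe_mul, mul_assoc]
  exact mul_le_mul_of_nonneg_left (hg.dist_le_mul c c') K₂.2

theorem image_devMap (h : IsDev S W L) : devMap S W L '' plane S W L = ⋃ v ∈ W, delaunayCell S v := by
  ext p
  constructor
  · rintro ⟨c, hc, rfl⟩
    obtain ⟨v, hv, h1, -⟩ := h.exists_sect hc
    exact mem_iUnion₂.2 ⟨v, hv, h1⟩
  · intro hp
    obtain ⟨v, hv, hp⟩ := mem_iUnion₂.1 hp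
    exact ⟨_, h.sect_mem hv hp, h.devMap_sect hv hp⟩

theorem finite_fiber (h : IsDev S W L) (hW : W.Finite) (p : ℍ) :
    {c ∈ plane S W L | devMap S W L c = p}.Finite := by
  refine (hW.image fun v => sect L v p).subset ?_
  rintro c ⟨hc, rfl⟩
  obtain ⟨v, hv, -, h2⟩ := h.exists_sect hc
  exact ⟨v, hv, h2.symm⟩

theorem sect_mem_interior (h : IsDev S W L) (hv : v ∈ W)
    (hp : hyp p ∈ interior (cone (near S v) : Set V3)) : sect L v p ∈ interior (plane S W L) := by
  have hd := h.dev v hv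
  obtain ⟨k, hk, e⟩ := hd.hom_proj (mem_delaunayCell.2 (interior_subset hp))
  have ho : IsOpen (hom ⁻¹' (L v '' interior (cone (near S v) : Set V3))) :=
    (hd.isOpenMap _ isOpen_interior).preimage continuous_hom
  refine mem_interior.2 ⟨_, ?_, ho, ?_⟩
  · rintro c ⟨P, hP, e⟩
    exact ⟨v, hv, P, interior_subset hP, e.symm⟩
  · exact ⟨_, interior_smul_mem (fun c P hc hP => cone_smul hP hc.le) hp hk, e.symm⟩

theorem interior_nonempty (h : IsDev S W L) (hv : v ∈ W) : (interior (plane S W L)).Nonempty := by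
  obtain ⟨P, hP⟩ := interior_cone_nonempty (h.dev v hv).mem
  have h0 : P ≠ 0 := by
    rintro rfl
    obtain ⟨x, hx, -⟩ := mem_voronoiVertices_iff.1 (h.dev v hv).mem
    have hl : mink (hyp v) ≠ 0 := fun h0 => by
      have := mink_hyp_self v
      rw [h0] at this; simp at this
    exact lt_irrefl _ ((map_zero (mink (hyp v))) ▸ pos_of_mem_interior hl (fun P hP =>
      nonneg_of_mem_cone (fun x _ => (mink_hyp_pos v x).le) hP) hP)
  obtain ⟨k, hk, e⟩ := exists_smul_hyp (isFut_of_mem_cone (interior_subset hP) h0)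
  refine ⟨_, h.sect_mem_interior hv (p := pt P) ?_⟩
  have : hyp (pt P) = k⁻¹ • P := by rw [e, pt_smul (hyp_mem_Fut _) hk, pt_hyp, smul_smul,
    inv_mul_cancel₀ hk.ne', one_smul]
  rw [this]
  exact interior_smul_mem (fun c P hc hP => cone_smul hP hc.le) hP (inv_pos.2 hk)

/-- Points on the sides dual to non-centered edges are interior points of the disk model. -/
theorem step_mem_interior (h : IsDev S W L) (hv : v ∈ W) {x y : ℍ} (hst : Step S v w x y)
    {a b : ℝ} (ha : 0 < a) (hb : 0 < b) (e : hom c = L v (a • hyp x + b • hyp y)) :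
    c ∈ interior (plane S W L) := by
  have hw := h.closed v hv w x y hst
  have hxv := hst.edge.near_left hst.mem_left
  have hyv := hst.edge.near_right hst.mem_left
  have hxw := hst.edge.near_left hst.mem_right
  have hyw := hst.edge.near_right hst.mem_right
  obtain ⟨z, hz, hzx, hzy⟩ := exists_third hst.vertex_left x y
  obtain ⟨z', hz', hzx', hzy'⟩ := exists_third hst.vertex_right x y
  have hopp := h.opp v hv w x y hst z hz hzx hzy z' hz' hzx' hzy'
  have hgx := h.glue v hv w x y hst
  have hgy := h.glue_right hv hst
  set A := L v (hyp x) with hA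
  set B := L v (hyp y) with hB
  set Z := L v (hyp z) with hZ
  set Z' := L w (hyp z') with hZ'
  have hd : det3 A B Z ≠ 0 := fun h0 => by rw [h0, zero_mul] at hopp; exact lt_irrefl _ hopp
  set α := det3 B Z Z' / det3 A B Z
  set β := det3 Z A Z' / det3 A B Z
  set γ := det3 A B Z' / det3 A B Z with hγ
  have hγ0 : γ < 0 := by
    rw [hγ, div_neg_iff]
    rcases mul_neg_iff.1 hopp with h | h
    · exact Or.inr ⟨h.2, h.1⟩
    · exact Or.inl ⟨h.2, h.1⟩
  have eZ' : Z' = α • A + β • B + γ • Z := cramer_div hd Z'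
  let fp : V3 → ℝ := fun P => det3 B Z P / det3 A B Z
  let fq : V3 → ℝ := fun P => det3 Z A P / det3 A B Z
  let fr : V3 → ℝ := fun P => det3 A B P / det3 A B Z
  have eP : ∀ P, P = fp P • A + fq P • B + fr P • Z := fun P => cramer_div hd P
  have cp : Continuous fp := (LinearMap.continuous_of_finiteDimensional _).div_const _
  have cq : Continuous fq := (LinearMap.continuous_of_finiteDimensional _).div_const _
  have cr : Continuous fr := (LinearMap.continuous_of_finiteDimensional _).div_const _
  have e0 : hom c = a • A + b • B := by rw [e, map_add, map_smul, map_smul]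
  have hp0 : fp (hom c) = a := by
    simp only [fp, e0, map_add, map_smul, det3_left, ← det3_rotate A B Z, smul_eq_mul, mul_zero,
      add_zero]
    rw [mul_div_cancel_right₀ _ hd]
  have hq0 : fq (hom c) = b := by
    simp only [fq, e0, map_add, map_smul, det3_right, det3_rotate Z A B, smul_eq_mul, mul_zero,
      zero_add]
    rw [mul_div_cancel_right₀ _ hd]
  have hr0 : fr (hom c) = 0 := by
    simp only [fr, e0, map_add, map_smul, det3_right, det3_left, smul_eq_mul, mul_zero,
      zero_add, zero_div]
  -- Near c the coefficients of A and B are positive both in the basis A, B, Z and in the basis A,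
  -- B, Z'. As γ < 0, the sign of the remaining coefficient selects the cell of v or that of w.
  have ev : ∀ᶠ c' in 𝓝 c, 0 < fp (hom c') ∧ 0 < fq (hom c') ∧
      0 < fp (hom c') - fr (hom c') / γ * α ∧ 0 < fq (hom c') - fr (hom c') / γ * β := by
    have k : ∀ {f : V3 → ℝ}, Continuous f → 0 < f (hom c) → ∀ᶠ c' in 𝓝 c, 0 < f (hom c') :=
      fun hf h => (hf.comp continuous_hom).continuousAt.eventually (lt_mem_nhds h)
    refine (k cp (hp0 ▸ ha)).and ((k cq (hq0 ▸ hb)).and ((k (f := fun P => fp P - fr P / γ * α)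
      (by fun_prop) ?_).and (k (f := fun P => fq P - fr P / γ * β) (by fun_prop) ?_)))
    · simp only [hp0, hr0, zero_div, zero_mul, sub_zero]; exact ha
    · simp only [hq0, hr0, zero_div, zero_mul, sub_zero]; exact hb
  refine mem_interior_iff_mem_nhds.2 ?_
  filter_upwards [ev] with c' ⟨h1, h2, h3, h4⟩
  rcases le_or_gt 0 (fr (hom c')) with hr | hr
  · refine ⟨v, hv, fp (hom c') • hyp x + fq (hom c') • hyp y + fr (hom c') • hyp z, add_mem (add_mem
      (cone_smul (hyp_mem_cone hxv) h1.le) (cone_smul (hyp_mem_cone hyv) h2.le))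
      (cone_smul (hyp_mem_cone hz) hr), ?_⟩
    rw [map_add, map_add, map_smul, map_smul, map_smul]
    exact eP _
  · have h5 : 0 < fr (hom c') / γ := div_pos_of_neg_of_neg hr hγ0
    refine ⟨w, hw, (fp (hom c') - fr (hom c') / γ * α) • hyp x +
      (fq (hom c') - fr (hom c') / γ * β) • hyp y + (fr (hom c') / γ) • hyp z', add_mem (add_mem
      (cone_smul (hyp_mem_cone hxw) h3.le) (cone_smul (hyp_mem_cone hyw) h4.le))
      (cone_smul (hyp_mem_cone hz') h5.le), ?_⟩
    rw [map_add, map_add, map_smul, map_smul, map_smul, ← hgx, ← hgy, ← hZ', eZ']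
    conv_lhs => rw [eP (hom c')]
    rw [smul_add, smul_add, smul_smul, smul_smul, smul_smul, div_mul_cancel₀ _ hγ0.ne, sub_smul,
      sub_smul]
    abel

end IsDev
end

/-! ### The frontier of the disk model -/

section
variable {S : Set ℍ}

/-- A point of the dual graph in a Delaunay cell is a vertex of the cell or lies on the interior of
a side dual to a centered edge. -/
theorem IsNet.on_dualGraph (hS : IsNet S) {v p : ℍ} (hv : v ∈ voronoiVertices S)
    (hp : p ∈ delaunayCell S v) (hpd : p ∈ dualGraph S) : p ∈ near S v ∨
      ∃ x y, IsSide S v x y ∧ IsCentered S x y ∧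
        ∃ a b : ℝ, 0 < a ∧ 0 < b ∧ hyp p = a • hyp x + b • hyp y := by
  by_cases hpS : p ∈ S
  · exact Or.inl (mem_near_of_mem_delaunayCell hS hp hpS)
  right
  obtain ⟨x', y', hc, hpa⟩ := hS.mem_dualGraph_iff.1 hpd
  obtain ⟨a', b', ha', hb', e'⟩ := mem_geodesicArc_iff.1 hpa
  have hpc : hyp p ∈ cone {x', y'} := mem_cone_pair.2 ⟨a', b', ha', hb', e'⟩
  rcases hS.cell_trichotomy hv hp hpS with h | ⟨x, y, hs, a, b, ha, hb, e⟩
  · exact absurd h ((hc.isEdge hS).not_mem_interior hS hpc)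
  · refine ⟨x, y, hs, ?_, a, b, ha, hb, e⟩
    rcases hs.1.pair_eq_of_mem_cone hS (hc.isEdge hS) ha hb (e ▸ hpc) with ⟨rfl, rfl⟩ | ⟨rfl, rfl⟩
    · exact hc
    · exact hc.symm

/-- A convex body in the plane has no isolated frontier points, even after removing finitely many
points. -/
theorem frontier_subset_closure_diff {C K : Set E2} (hC : Convex ℝ C)
    (hne : (interior C).Nonempty) (hb : Bornology.IsBounded C) (hK : K.Finite) :
    frontier C ⊆ closure (frontier C \ K) := by
  obtain ⟨e, -, -, he⟩ := exists_homeomorph_image_interior_closure_frontier_eq_unitBall hC hne hb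
  have hs : frontier C = e.symm '' sphere 0 1 := by
    rw [← he, ← image_comp]; simp
  have hpre : IsPreconnected (frontier C) := by
    rw [hs]
    refine (isPreconnected_sphere ?_ _ _).image _ e.symm.continuous.continuousOn
    rw [← Module.finrank_eq_rank, finrank_euclideanSpace_fin]
    norm_num
  have hnt : (frontier C).Nontrivial := by
    rw [hs]
    refine Set.Nontrivial.image ?_ e.symm.injective
    refine ⟨EuclideanSpace.single 0 1, by simp, EuclideanSpace.single 1 1, by simp, fun h => ?_⟩
    have := congrArg (fun c : E2 => c 0) h
    simp at this
  intro c hc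
  -- The frontier is a topological circle, connected with more than one point, so it has no isolated
  -- points, and deleting a finite set leaves it dense.
  have hacc := hpre.preperfect_of_nontrivial hnt c hc
  rw [accPt_iff_frequently] at hacc
  have hev : ∀ᶠ y in 𝓝 c, y ∉ K \ {c} :=
    (hK.subset sdiff_subset).isClosed.isOpen_compl.mem_nhds fun h => h.2 rfl
  rw [mem_closure_iff_frequently]
  refine (hacc.and_eventually hev).mono fun y hy => ⟨hy.1.2, fun hyK => hy.2 ⟨hyK, hy.1.1⟩⟩

namespace IsDev
variable {v₀ v w p q : ℍ} {L : ℍ → V3 →ₗ[ℝ] V3} {c : E2}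

/-- Sites develop to isotropic vectors, hence to points of the unit circle, while the disk model
lies in the closed unit disk; pushing such a point away from the origin leaves it. -/
theorem sect_site_not_mem_interior (h : IsDev S (cluster S v₀) L) (hv : v ∈ cluster S v₀)
    (hp : p ∈ near S v) : sect L v p ∉ interior (plane S (cluster S v₀) L) := by
  intro hi
  have hpc : p ∈ delaunayCell S v := mem_delaunayCell.2 (hyp_mem_cone hp)
  obtain ⟨k, hk, e⟩ := (h.dev v hv).hom_proj hpc
  have h1 : mink (hom (sect L v p)) (hom (sect L v p)) = 0 := by
    rw [sect, e, map_smul, map_smul, map_smul, LinearMap.smul_apply, (h.dev v hv).mink_self hp]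
    simp
  obtain ⟨δ, hδ, hm⟩ := exists_overshoot hi 0
  obtain ⟨u, hu, P, hP, e'⟩ := hm
  have h2 : 0 ≤ mink (hom ((1 + δ) • sect L v p + -δ • 0)) (hom ((1 + δ) • sect L v p + -δ • 0)) := by
    rw [e']
    rcases (h.dev u hu).causal hP with h0 | h0
    · rw [h0]; simp
    · exact h0.1
  rw [mink_hom] at h1 h2
  simp only [smul_zero, add_zero, PiLp.smul_apply, smul_eq_mul, mul_pow, ← mul_add] at h2
  rw [sub_eq_zero] at h1
  rw [← h1] at h2
  nlinarith

theorem side_not_internal {x y : ℍ} (hc : IsCentered S x y) (w : ℍ) :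
    ¬ Step S v w x y ∧ ¬ Step S w v x y :=
  ⟨fun h => h.not_isCentered hc, fun h => h.not_isCentered hc⟩

/-- By `support` the whole disk model lies on one side of the line of a side dual to a centered
edge. Overshooting from a third site of the cell past a point of the side would cross that line. -/
theorem side_not_mem_interior (hS : IsFiniteNet S) (h : IsDev S (cluster S v₀) L)
    (hv : v ∈ cluster S v₀) {x y : ℍ} (hs : IsSide S v x y) (hc : IsCentered S x y)
    (hp : p ∈ geodesicArc x y) : sect L v p ∉ interior (plane S (cluster S v₀) L) := by
  intro hi
  obtain ⟨a, b, ha, hb, ep⟩ := mem_geodesicArc_iff.1 hp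
  have hpc : p ∈ delaunayCell S v := by
    rw [mem_delaunayCell, ep]
    exact add_mem (cone_smul (hyp_mem_cone hs.2.1) ha) (cone_smul (hyp_mem_cone hs.2.2) hb)
  obtain ⟨k, hk, e⟩ := (h.dev v hv).hom_proj hpc
  obtain ⟨z, hz, hzx, hzy⟩ := exists_third (h.dev v hv).mem x y
  have hzc : z ∈ delaunayCell S v := mem_delaunayCell.2 (hyp_mem_cone hz)
  obtain ⟨k', hk', e'⟩ := (h.dev v hv).hom_proj hzc
  obtain ⟨δ, hδ, u, hu, P, hP, e''⟩ := exists_overshoot hi (sect L v z)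
  have h1 := h.support hS.toIsNet (hS.finite_cluster v₀) hv hs (fun w _ =>
    side_not_internal hc w) hz hzx hzy hu hP
  have hd := (h.dev v hv).det3_ne_zero hs.2.1 hs.2.2 hz hs.1.2.2.1 hzx.symm hzy.symm
  rw [← e'', hom_add_smul _ _ (by ring), sect, sect, e, e', ep] at h1
  simp only [map_add, map_smul, det3_left, det3_right, smul_eq_mul, mul_zero, zero_add] at h1
  have := mul_pos (mul_pos hδ hk') (pow_two_pos_of_ne_zero hd)
  nlinarith

/-- The frontier of the disk model corresponds to the dual graph. -/
theorem mem_interior_iff (hS : IsFiniteNet S) (h : IsDev S (cluster S v₀) L)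
    (hc : c ∈ plane S (cluster S v₀) L) :
    c ∈ interior (plane S (cluster S v₀) L) ↔ devMap S (cluster S v₀) L c ∉ dualGraph S := by
  obtain ⟨v, hv, h1, h2⟩ := h.exists_sect hc
  set p := devMap S (cluster S v₀) L c
  constructor
  · intro hi hd
    rw [h2] at hi
    rcases hS.on_dualGraph hv.1 h1 hd with h3 | ⟨x, y, hs, hxy, a, b, ha, hb, e⟩
    · exact h.sect_site_not_mem_interior hv h3 hi
    · exact h.side_not_mem_interior hS hv hs hxy
        (mem_geodesicArc_iff.2 ⟨a, b, ha.le, hb.le, e⟩) hi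
  · intro hd
    rcases hS.off_dualGraph hv.1 h1 hd with h3 | ⟨w, x, y, hst, a, b, ha, hb, e⟩
    · rw [h2]; exact h.sect_mem_interior hv h3
    · obtain ⟨k, hk, e'⟩ := (h.dev v hv).hom_proj h1
      have e2 : hom c = L v ((k * a) • hyp x + (k * b) • hyp y) := by
        rw [← smul_smul, ← smul_smul, ← smul_add, ← e, ← e', ← sect, ← h2]
      rcases hst with hst | hst
      · exact h.step_mem_interior hv hst (mul_pos hk ha) (mul_pos hk hb) e2
      · have hw : w ∈ cluster S v₀ := mem_cluster_of_next ⟨x, y, hst⟩ hv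
        refine h.step_mem_interior hw hst (mul_pos hk ha) (mul_pos hk hb) ?_
        rw [e2, map_add, map_add, map_smul, map_smul, map_smul, map_smul, h.glue w hw v x y hst,
          h.glue_right hw hst]

/-- Two preimages of a point off the dual graph come from one cell or from two cells with the point
on their common side, dual to a non-centered edge; the developments agree on that side. -/
theorem injOn_interior (hS : IsFiniteNet S) (h : IsDev S (cluster S v₀) L) {c c' : E2}
    (hc : c ∈ plane S (cluster S v₀) L) (hc' : c' ∈ plane S (cluster S v₀) L)
    (hd : devMap S (cluster S v₀) L c ∉ dualGraph S)
    (e : devMap S (cluster S v₀) L c = devMap S (cluster S v₀) L c') : c = c' := by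
  obtain ⟨v, hv, h1, h2⟩ := h.exists_sect hc
  obtain ⟨w, hw, h1', h2'⟩ := h.exists_sect hc'
  rw [← e] at h1' h2'
  set p := devMap S (cluster S v₀) L c
  rw [h2, h2']
  rcases hS.eq_or_step hv.1 hw.1 h1 h1' hd with rfl | ⟨x, y, hst, a, b, ha, hb, e⟩
  · rfl
  · rw [sect, sect]
    congr 1
    rcases hst with hst | hst
    · rw [e, map_add, map_add, map_smul, map_smul, map_smul, map_smul, h.glue v hv w x y hst,
        h.glue_right hv hst]
    · rw [e, map_add, map_add, map_smul, map_smul, map_smul, map_smul, h.glue w hw v x y hst,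
        h.glue_right hw hst]

theorem sect_inj (h : IsDev S (cluster S v₀) L) (hv : v ∈ cluster S v₀) (hw : w ∈ cluster S v₀)
    (hp : p ∈ delaunayCell S v) (hq : q ∈ delaunayCell S w) (e : sect L v p = sect L w q) : p = q := by
  rw [← h.devMap_sect hv hp, e, h.devMap_sect hw hq]

/-- The developed sides meet in vertices only. -/
theorem eq_of_sect_eq (hS : IsFiniteNet S) (h : IsDev S (cluster S v₀) L)
    (hv : v ∈ cluster S v₀) (hw : w ∈ cluster S v₀) (hp : p ∈ delaunayCell S v)
    (hq : p ∈ delaunayCell S w) (e : sect L v p = sect L w p) (hpd : p ∈ dualGraph S) (hpS : p ∉ S) :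
    v = w := by
  obtain ⟨k, hk, e1⟩ := (h.dev v hv).hom_proj hp
  obtain ⟨k', hk', e2⟩ := (h.dev w hw).hom_proj hq
  have e3 : L v (k • hyp p) = L w (k' • hyp p) := by
    rw [← e1, ← e2]; exact congrArg hom e
  obtain ⟨-, h1 | ⟨x, y, hst, a, b, ha, hb, e4⟩ | ⟨x, hx, a, ha, e4⟩⟩ := h.inj v hv w hw _
    (cone_smul (mem_delaunayCell.1 hp) hk.le) _ (cone_smul (mem_delaunayCell.1 hq) hk'.le) e3
  · exact h1
  · exfalso
    obtain ⟨x', y', hc, hpa⟩ := hS.mem_dualGraph_iff.1 hpd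
    obtain ⟨a', b', ha', hb', e'⟩ := mem_geodesicArc_iff.1 hpa
    have hed : IsEdge S x y := hst.elim Step.edge Step.edge
    have hn : ¬ IsCentered S x y := hst.elim Step.not_isCentered Step.not_isCentered
    have hm : a • hyp x + b • hyp y ∈ cone {x', y'} := by
      rw [← e4]; exact cone_smul (mem_cone_pair.2 ⟨a', b', ha', hb', e'⟩) hk.le
    rcases hed.pair_eq_of_mem_cone hS.toIsNet (hc.isEdge hS.toIsNet) ha hb hm with
      ⟨rfl, rfl⟩ | ⟨rfl, rfl⟩
    · exact hn hc
    · exact hn hc.symm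
  · exfalso
    have e5 : hyp p = (k⁻¹ * a) • hyp x := by
      rw [← smul_smul, ← e4, smul_smul, inv_mul_cancel₀ hk.ne', one_smul]
    rcases ha.eq_or_lt with rfl | ha
    · exact hyp_ne_zero p (by rw [e5]; simp)
    · exact hpS (hyp_eq_smul_unique (by positivity) e5 ▸ hx)

/-- The frontier of the disk model is the union of the developed sides dual to centered edges. -/
theorem exists_side_of_mem_frontier (hS : IsFiniteNet S) (h₀ : IsRoot S v₀)
    (h : IsDev S (cluster S v₀) L) (hc : c ∈ frontier (plane S (cluster S v₀) L)) :
    ∃ v ∈ cluster S v₀, ∃ x y, IsSide S v x y ∧ IsCentered S x y ∧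
      ∃ p ∈ geodesicArc x y, c = sect L v p := by
  have hfin := hS.finite_cluster v₀
  have hcomp := h.isCompact_plane hS.toIsNet hfin
  set K := ⋃ v ∈ cluster S v₀, sect L v '' near S v with hK
  have hKfin : K.Finite := hfin.biUnion fun v _ => (hS.finite_near v).image _
  set I := ⋃ v ∈ cluster S v₀, (fun q : ℍ × ℍ => (v, q)) ''
    {q : ℍ × ℍ | IsSide S v q.1 q.2 ∧ IsCentered S q.1 q.2} with hI
  have hIfin : I.Finite := hfin.biUnion fun v _ => Finite.image _
    (((hS.finite_near v).prod (hS.finite_near v)).subset fun q hq => ⟨hq.1.2.1, hq.1.2.2⟩)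
  set B := ⋃ i ∈ I, sect L i.1 '' geodesicArc i.2.1 i.2.2 with hB
  have hImem : ∀ {i : ℍ × ℍ × ℍ}, i ∈ I ↔ i.1 ∈ cluster S v₀ ∧ IsSide S i.1 i.2.1 i.2.2 ∧
      IsCentered S i.2.1 i.2.2 := by
    intro i
    constructor
    · intro hi
      obtain ⟨v, hv, q, hq, rfl⟩ := mem_iUnion₂.1 hi
      exact ⟨hv, hq⟩
    · intro hi
      exact mem_iUnion₂.2 ⟨i.1, hi.1, i.2, hi.2, rfl⟩
  have harc : ∀ {v x y : ℍ}, IsSide S v x y → geodesicArc x y ⊆ delaunayCell S v := by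
    intro v x y hs p hp
    obtain ⟨a, b, ha, hb, e⟩ := mem_geodesicArc_iff.1 hp
    rw [mem_delaunayCell, e]
    exact add_mem (cone_smul (hyp_mem_cone hs.2.1) ha) (cone_smul (hyp_mem_cone hs.2.2) hb)
  have hBcl : IsClosed B := by
    refine (hIfin.isCompact_biUnion fun i hi => ?_).isClosed
    obtain ⟨h1, h2, -⟩ := hImem.1 hi
    exact (isCompact_geodesicArc _ _).image_of_continuousOn ((h.continuousOn_sect h1).mono (harc h2))
  have hsub : frontier (plane S (cluster S v₀) L) \ K ⊆ B := by
    rintro c ⟨hc, hcK⟩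
    have hcp := hcomp.isClosed.frontier_subset hc
    obtain ⟨v, hv, h1, h2⟩ := h.exists_sect hcp
    have hd := mt (h.mem_interior_iff hS hcp).2 hc.2
    rw [not_not] at hd
    rcases hS.on_dualGraph hv.1 h1 hd with h3 | ⟨x, y, hs, hxy, a, b, ha, hb, e⟩
    · exact (hcK (mem_iUnion₂.2 ⟨v, hv, _, h3, h2.symm⟩)).elim
    · exact mem_iUnion₂.2 ⟨(v, x, y), (hImem (i := (v, x, y))).2 ⟨hv, hs, hxy⟩,
        ⟨_, mem_geodesicArc_iff.2 ⟨a, b, ha.le, hb.le, e⟩, h2.symm⟩⟩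
  -- The previous step covers the frontier away from the finitely many developed sites. Those sites
  -- are limits of the remaining frontier points, and B is closed.
  have hcB : c ∈ B := closure_minimal hsub hBcl (frontier_subset_closure_diff h.convex_plane
    (h.interior_nonempty h₀.mem_cluster) hcomp.isBounded hKfin hc)
  obtain ⟨i, hi, p, hp, rfl⟩ := mem_iUnion₂.1 hcB
  obtain ⟨h1, h2, h3⟩ := hImem.1 hi
  exact ⟨i.1, h1, i.2.1, i.2.2, h2, h3, p, hp, rfl⟩

end IsDev
end

/-! ### Lengths of paths, deck transformations and periodic nets -/

section
variable {S : Set ℍ}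

theorem eVariationOn_congr_of_edist {α E E' : Type*} [LinearOrder α] [PseudoEMetricSpace E]
    [PseudoEMetricSpace E'] {f : α → E} {g : α → E'} {A : Set α}
    (h : ∀ s ∈ A, ∀ t ∈ A, edist (f s) (f t) = edist (g s) (g t)) :
    eVariationOn f A = eVariationOn g A := by
  unfold eVariationOn
  congr 1
  funext p
  exact Finset.sum_congr rfl fun i _ => h _ (p.2.2.2 _) _ (p.2.2.2 _)

/-- Any two points are joined by a path along the geodesic arc whose length is their distance. -/
theorem exists_geodesic_path (x y : ℍ) : ∃ γ : Path x y, range γ ⊆ geodesicArc x y ∧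
    eVariationOn γ univ ≤ edist x y := by
  have hF : ∀ t : unitInterval, IsFut ((1 - (t : ℝ)) • hyp x + (t : ℝ) • hyp y) := fun t =>
    isFut_comb x y (sub_nonneg.2 t.2.2) t.2.1 (by linarith)
  have hc : Continuous fun t : unitInterval => pt ((1 - (t : ℝ)) • hyp x + (t : ℝ) • hyp y) :=
    continuousOn_pt.comp_continuous (by fun_prop) hF
  have hk : ∀ t : unitInterval, ∃ k : ℝ, 0 < k ∧ hyp (pt ((1 - (t : ℝ)) • hyp x + (t : ℝ) • hyp y)) =
      k • ((1 - (t : ℝ)) • hyp x + (t : ℝ) • hyp y) := fun t =>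
    ⟨_, inv_pos.2 (Real.sqrt_pos.2 (hF t).1), hyp_pt (hF t)⟩
  let γ : Path x y := ⟨⟨_, hc⟩, by simp [pt_hyp], by simp [pt_hyp]⟩
  have hγ : ∀ t, γ t = pt ((1 - (t : ℝ)) • hyp x + (t : ℝ) • hyp y) := fun t => rfl
  have hmono : ∀ s t : unitInterval, s ≤ t → dist x (γ s) + dist (γ s) (γ t) = dist x (γ t) := by
    intro s t hst
    change γ s ∈ geodesicArc x (γ t)
    rcases (show (0 : ℝ) ≤ t from t.2.1).eq_or_lt with ht | ht
    · have hs : (s : ℝ) = 0 := le_antisymm ((show (s : ℝ) ≤ t from hst).trans ht.ge) s.2.1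
      have : s = 0 := Subtype.ext hs
      rw [this, γ.source]
      exact left_mem_geodesicArc _ _
    obtain ⟨k, hk0, e⟩ := hk t
    obtain ⟨l, hl0, e'⟩ := hk s
    have h1 : (s : ℝ) / t ≤ 1 := (div_le_one ht).2 hst
    have hs0 : (0 : ℝ) ≤ s := s.2.1
    refine mem_geodesicArc_iff.2 ⟨l * (1 - s / t), l * (s / t) / k,
      mul_nonneg hl0.le (sub_nonneg.2 h1), by positivity, ?_⟩
    rw [hγ, hγ, e, e', smul_smul, div_mul_cancel₀ _ hk0.ne', smul_add, smul_add, smul_smul, smul_smul,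
      smul_smul, smul_smul, ← add_assoc, ← add_smul]
    congr 2
    · field_simp; ring
    · field_simp
  refine ⟨γ, ?_, ?_⟩
  · rintro _ ⟨t, rfl⟩
    obtain ⟨k, hk0, e⟩ := hk t
    refine mem_geodesicArc_iff.2 ⟨k * (1 - t), k * t, mul_nonneg hk0.le (sub_nonneg.2 t.2.2),
      mul_nonneg hk0.le t.2.1, ?_⟩
    rw [hγ, e, smul_add, smul_smul, smul_smul]
  · have hg : Monotone fun t => dist x (γ t) := fun s t hst => by
      have := hmono s t hst
      have := dist_nonneg (x := γ s) (y := γ t)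
      change dist x (γ s) ≤ dist x (γ t)
      linarith
    have h1 : eVariationOn γ univ = eVariationOn (fun t => dist x (γ t)) univ := by
      refine eVariationOn_congr_of_edist fun s _ t _ => ?_
      rw [edist_dist, edist_dist, Real.dist_eq]
      congr 1
      rcases le_total s t with hst | hst
      · have := hmono s t hst
        rw [abs_sub_comm, abs_of_nonneg (sub_nonneg.2 (hg hst))]
        linarith
      · have := hmono t s hst
        rw [abs_of_nonneg (sub_nonneg.2 (hg hst)), dist_comm]
        linarith
    have h2 := ((hg.monotoneOn univ).eVariationOn_eq (mem_univ (0 : unitInterval)) (mem_univ 1)).le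
    have h3 : univ ∩ Icc (0 : unitInterval) 1 = univ := by
      ext t; simp [unitInterval.le_one']
    rw [h3] at h2
    rw [h1]
    refine h2.trans ?_
    simp [edist_dist]

variable {F : Type u} [MetricSpace F] {π : ℍ → F}

/-- A locally isometric covering preserves the lengths of paths. -/
theorem IsLocallyIsometricCovering.eVariationOn_comp (hπ : IsLocallyIsometricCovering π)
    {η : unitInterval → ℍ} (hη : Continuous η) :
    eVariationOn (π ∘ η) univ = eVariationOn η univ := by
  choose r hr hd using hπ.locallyIsometric
  obtain ⟨t, h0, hmono, ⟨n, hn⟩, hcov⟩ := exists_monotone_Icc_subset_open_cover_unitInterval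
    (c := fun a => η ⁻¹' ball a (r a)) (fun a => isOpen_ball.preimage hη)
    (fun s _ => mem_iUnion.2 ⟨η s, mem_ball_self (hr _)⟩)
  have key : ∀ n, eVariationOn (π ∘ η) (univ ∩ Icc 0 (t n)) = eVariationOn η (univ ∩ Icc 0 (t n)) := by
    intro n
    induction n with
    | zero =>
      rw [h0, Icc_self]
      rw [eVariationOn.subsingleton _ (by simp), eVariationOn.subsingleton _ (by simp)]
    | succ n ih =>
      have h1 : (0 : unitInterval) ≤ t n := unitInterval.nonneg'
      rw [← eVariationOn.Icc_add_Icc _ h1 (hmono n.le_succ) (mem_univ _),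
        ← eVariationOn.Icc_add_Icc _ h1 (hmono n.le_succ) (mem_univ _), ih]
      congr 1
      obtain ⟨a, ha⟩ := hcov n
      refine eVariationOn_congr_of_edist fun s hs s' hs' => ?_
      rw [edist_dist, edist_dist]
      exact congrArg _ (hd a _ (ha hs.2) _ (ha hs'.2))
  have h3 : univ ∩ Icc (0 : unitInterval) (t n) = univ := by
    rw [hn n le_rfl]
    ext t; simp [unitInterval.le_one']
  simpa only [h3] using key n

theorem IsLocallyIsometricCovering.continuous (hπ : IsLocallyIsometricCovering π) :
    Continuous π := hπ.isCoveringMap.continuous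

theorem edist_le_eVariationOn {E : Type*} [PseudoEMetricSpace E] {x y : E} [TopologicalSpace E]
    (γ : Path x y) : edist x y ≤ eVariationOn γ univ := by
  have := eVariationOn.edist_le γ (mem_univ (0 : unitInterval)) (mem_univ 1)
  rwa [γ.source, γ.target] at this

/-- `g` is a deck transformation of `π`. -/
def IsDeck (π : ℍ → F) (g : ℍ ≃ᵢ ℍ) : Prop := ∀ x, π (g x) = π x

theorem IsDeck.symm {g : ℍ ≃ᵢ ℍ} (hg : IsDeck π g) : IsDeck π g.symm := fun x => by
  rw [← hg, g.apply_symm_apply]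

/-- Lifts of the covering through itself do not increase distances. -/
theorem IsLocallyIsometricCovering.edist_lift_le (hπ : IsLocallyIsometricCovering π) {g : ℍ → ℍ}
    (hg : Continuous g) (hgπ : π ∘ g = π) (x y : ℍ) : edist (g x) (g y) ≤ edist x y := by
  obtain ⟨γ, -, h⟩ := exists_geodesic_path x y
  refine (edist_le_eVariationOn (γ.map hg)).trans ?_
  change eVariationOn (g ∘ γ) univ ≤ _
  rw [← hπ.eVariationOn_comp (hg.comp γ.continuous), ← Function.comp_assoc, hgπ,
    hπ.eVariationOn_comp γ.continuous]
  exact h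

/-- The plane is simply connected, so π lifts through itself from p to q and from q to p. Uniqueness
of lifts makes the two lifts inverse to each other, and neither increases distances. -/
theorem IsLocallyIsometricCovering.exists_deck (hπ : IsLocallyIsometricCovering π) {p q : ℍ}
    (h : π p = π q) : ∃ g : ℍ ≃ᵢ ℍ, IsDeck π g ∧ g p = q := by
  let f : C(ℍ, F) := ⟨π, hπ.continuous⟩
  have hu := fun p q h => hπ.isCoveringMap.existsUnique_continuousMap_lifts f p q h
  obtain ⟨G, ⟨hG, hGf⟩, -⟩ := hu p q h.symm
  obtain ⟨H, ⟨hH, hHf⟩, -⟩ := hu q p h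
  have e1 : H.comp G = ContinuousMap.id ℍ := by
    refine (hu p p rfl).unique ⟨by simp [hG, hH], ?_⟩ ⟨rfl, rfl⟩
    change π ∘ H ∘ G = π
    rw [← Function.comp_assoc]
    rw [hHf]; exact hGf
  have e2 : G.comp H = ContinuousMap.id ℍ := by
    refine (hu q q rfl).unique ⟨by simp [hG, hH], ?_⟩ ⟨rfl, rfl⟩
    change (π ∘ G) ∘ H = π
    rw [hGf]; exact hHf
  have e1' : ∀ x, H (G x) = x := fun x => DFunLike.congr_fun e1 x
  have e2' : ∀ x, G (H x) = x := fun x => DFunLike.congr_fun e2 x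
  refine ⟨⟨⟨G, H, e1', e2'⟩, fun x y => le_antisymm (hπ.edist_lift_le G.continuous hGf x y) ?_⟩,
    fun x => congrFun hGf x, hG⟩
  have := hπ.edist_lift_le H.continuous hHf (G x) (G y)
  rwa [e1', e1'] at this

theorem IsLocallyIsometricCovering.deck_unique (hπ : IsLocallyIsometricCovering π) {g : ℍ ≃ᵢ ℍ}
    (hg : IsDeck π g) {p : ℍ} (hp : g p = p) (x : ℍ) : g x = x := by
  let f : C(ℍ, F) := ⟨π, hπ.continuous⟩
  have := (hπ.isCoveringMap.existsUnique_continuousMap_lifts f p p rfl).unique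
    (y₁ := ⟨g, g.continuous⟩) (y₂ := ContinuousMap.id ℍ) ⟨hp, funext hg⟩ ⟨rfl, rfl⟩
  exact DFunLike.congr_fun this x

/-- Finitely many images of unit balls cover the compact surface. Every point can be moved into one
of these balls, and the sum of the distances of the centres from o bounds each of them. -/
theorem IsLocallyIsometricCovering.exists_deck_dist_le [CompactSpace F]
    (hπ : IsLocallyIsometricCovering π) (o : ℍ) :
    ∃ R, ∀ p, ∃ g, IsDeck π g ∧ dist (g p) o ≤ R := by
  choose σ hσ using hπ.surjective
  have hopen : ∀ y : F, IsOpen (π '' ball (σ y) 1) := fun y =>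
    hπ.isCoveringMap.isLocalHomeomorph.isOpenMap _ isOpen_ball
  obtain ⟨t, ht⟩ := isCompact_univ.elim_finite_subcover _ hopen fun y _ =>
    mem_iUnion.2 ⟨y, σ y, mem_ball_self one_pos, hσ y⟩
  refine ⟨1 + ∑ y ∈ t, dist (σ y) o, fun p => ?_⟩
  obtain ⟨y, hy, q, hq, e⟩ := mem_iUnion₂.1 (ht (mem_univ (π p)))
  obtain ⟨g, hg, hgp⟩ := hπ.exists_deck e.symm
  refine ⟨g, hg, ?_⟩
  rw [hgp]
  have h1 := Finset.single_le_sum (f := fun y => dist (σ y) o) (fun _ _ => dist_nonneg) hy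
  have h2 := dist_triangle q (σ y) o
  rw [mem_ball] at hq
  linarith

theorem IsLocallyIsometricCovering.isNet [CompactSpace F] (hπ : IsLocallyIsometricCovering π)
    {S : Set F} (hS : S.Finite) (hS₀ : S.Nonempty) : IsNet (π ⁻¹' S) where
  finite_inter p r := by
    refine (isCompact_closedBall p r).induction_on (p := fun A => (π ⁻¹' S ∩ A).Finite) (by simp)
      (fun A B hAB h => h.subset (inter_subset_inter_right _ hAB))
      (fun A B hA hB => by rw [inter_union_distrib_left]; exact hA.union hB) fun a _ => ?_
    obtain ⟨r, hr, hd⟩ := hπ.locallyIsometric a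
    refine ⟨ball a r, mem_nhdsWithin_of_mem_nhds (ball_mem_nhds _ hr), ?_⟩
    refine Finite.of_finite_image (f := π) (hS.subset ?_) ?_
    · rintro _ ⟨x, hx, rfl⟩; exact hx.1
    · intro x hx y hy e
      have := hd x hx.2 y hy.2
      rw [e, dist_self] at this
      exact dist_eq_zero.1 this.symm
  exists_dist_le := by
    obtain ⟨s, hs⟩ := hS₀
    obtain ⟨o, rfl⟩ := hπ.surjective s
    obtain ⟨R, hR⟩ := hπ.exists_deck_dist_le o
    refine ⟨R, fun p => ?_⟩
    obtain ⟨g, hg, hgp⟩ := hR p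
    refine ⟨g.symm o, ?_, ?_⟩
    · rw [mem_preimage, hg.symm]; exact hs
    · rwa [← g.dist_eq, g.apply_symm_apply]

/-! ### Equivariance -/

/-- `g` preserves `S`. -/
def Preserves (g : ℍ ≃ᵢ ℍ) (S : Set ℍ) : Prop := ∀ x, g x ∈ S ↔ x ∈ S

theorem IsDeck.preserves {S : Set F} {g : ℍ ≃ᵢ ℍ} (hg : IsDeck π g) : Preserves g (π ⁻¹' S) :=
  fun x => by rw [mem_preimage, hg, mem_preimage]

namespace Preserves
variable {g : ℍ ≃ᵢ ℍ} {p x y v : ℍ}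

theorem symm (h : Preserves g S) : Preserves g.symm S := fun x => by
  rw [← h, g.apply_symm_apply]

theorem voronoiCell (h : Preserves g S) : g p ∈ voronoiCell S (g x) ↔ p ∈ voronoiCell S x := by
  have key : ∀ {g : ℍ ≃ᵢ ℍ} {p x}, Preserves g S → p ∈ CenteredDual.voronoiCell S x →
      g p ∈ CenteredDual.voronoiCell S (g x) := by
    intro g p x h hp y hy hyx
    have := hp (g.symm y) ((h.symm y).2 hy) (fun e => hyx (by rw [← e, g.apply_symm_apply]))
    rwa [← g.dist_eq, ← g.dist_eq p, g.apply_symm_apply] at this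
  refine ⟨fun hp => ?_, key h⟩
  have := key h.symm hp
  rwa [g.symm_apply_apply, g.symm_apply_apply] at this

theorem near (h : Preserves g S) : g x ∈ near S (g p) ↔ x ∈ near S p :=
  and_congr (h x) h.voronoiCell

theorem rad (hS : IsNet S) (h : Preserves g S) : rad S (g p) = rad S p := by
  obtain ⟨x, hx⟩ := hS.nonempty_near p
  rw [rad_eq hx, rad_eq (h.near.2 hx), ← cosh_dist_eq, ← cosh_dist_eq, g.dist_eq]

theorem voronoiVertices (h : Preserves g S) :
    g v ∈ voronoiVertices S ↔ v ∈ voronoiVertices S := by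
  have key : ∀ {g : ℍ ≃ᵢ ℍ} {v}, Preserves g S → v ∈ CenteredDual.voronoiVertices S →
      g v ∈ CenteredDual.voronoiVertices S := by
    intro g v h hv
    obtain ⟨x, hx, y, hy, z, hz, h1, h2, h3⟩ := mem_voronoiVertices_iff.1 hv
    exact mem_voronoiVertices_iff.2 ⟨g x, h.near.2 hx, g y, h.near.2 hy, g z, h.near.2 hz,
      g.injective.ne h1, g.injective.ne h2, g.injective.ne h3⟩
  refine ⟨fun hp => ?_, key h⟩
  have := key h.symm hp
  rwa [g.symm_apply_apply] at this

theorem geodesicArc : g p ∈ geodesicArc (g x) (g y) ↔ p ∈ geodesicArc x y := by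
  change dist _ _ + dist _ _ = dist _ _ ↔ dist _ _ + dist _ _ = dist _ _
  rw [g.dist_eq, g.dist_eq, g.dist_eq]

theorem image_eq {A B : Set ℍ} (h : ∀ p, g p ∈ B ↔ p ∈ A) : g '' A = B := by
  ext p
  rw [← g.apply_symm_apply p, h, g.injective.mem_set_image]

theorem image_arcInterior (g : ℍ ≃ᵢ ℍ) (e : Set ℍ) : g '' arcInterior e = arcInterior (g '' e) := by
  have key : ∀ (g : ℍ ≃ᵢ ℍ) (e : Set ℍ) p, p ∈ arcInterior e → g p ∈ arcInterior (g '' e) := by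
    rintro g e p ⟨hp, a, ha, b, hb, h1, h2, h3⟩
    exact ⟨mem_image_of_mem _ hp, g a, mem_image_of_mem _ ha, g b, mem_image_of_mem _ hb,
      g.injective.ne h1, g.injective.ne h2, by rw [g.dist_eq, g.dist_eq, g.dist_eq, h3]⟩
  refine image_eq fun p => ⟨fun h => ?_, key g e p⟩
  have := key g.symm _ _ h
  rwa [g.symm_apply_apply, ← image_comp, show (g.symm ∘ g : ℍ → ℍ) = id from
    funext g.symm_apply_apply, image_id] at this

theorem isGeometricDual (h : Preserves g S) {e γ : Set ℍ} (hd : IsGeometricDual S e γ) :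
    IsGeometricDual S (g '' e) (g '' γ) := by
  obtain ⟨x, hx, y, hy, hxy, rfl, hn, rfl⟩ := hd
  refine ⟨g x, (h x).2 hx, g y, (h y).2 hy, g.injective.ne hxy, ?_, hn.image g.injective, ?_⟩
  · exact image_eq fun p => and_congr h.voronoiCell h.voronoiCell
  · exact image_eq fun p => geodesicArc

theorem voronoiEdges (h : Preserves g S) {e : Set ℍ} (he : e ∈ voronoiEdges S) :
    g '' e ∈ voronoiEdges S := by
  obtain ⟨γ, hγ⟩ := he
  exact ⟨_, h.isGeometricDual hγ⟩

theorem centeredEdges (h : Preserves g S) {e : Set ℍ} (he : e ∈ centeredEdges S) :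
    g '' e ∈ centeredEdges S := by
  obtain ⟨γ, hγ, p, hp⟩ := he
  refine ⟨_, h.isGeometricDual hγ, g p, mem_image_of_mem _ hp.1, ?_⟩
  rw [← image_arcInterior]
  exact mem_image_of_mem _ hp.2

theorem symm_image_image (g : ℍ ≃ᵢ ℍ) (A : Set ℍ) : g.symm '' (g '' A) = A := by
  rw [← image_comp, show (g.symm ∘ g : ℍ → ℍ) = id from funext g.symm_apply_apply, image_id]

theorem centeredEdges_iff (h : Preserves g S) {e : Set ℍ} :
    g '' e ∈ CenteredDual.centeredEdges S ↔ e ∈ CenteredDual.centeredEdges S := by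
  refine ⟨fun he => ?_, h.centeredEdges⟩
  rw [← symm_image_image g e]
  exact h.symm.centeredEdges he

theorem dualGraph (h : Preserves g S) : g p ∈ dualGraph S ↔ p ∈ dualGraph S := by
  have key : ∀ {g : ℍ ≃ᵢ ℍ} {p}, Preserves g S → p ∈ CenteredDual.dualGraph S →
      g p ∈ CenteredDual.dualGraph S := by
    rintro g p h ⟨γ, ⟨e, he, hd⟩, hp⟩
    exact ⟨g '' γ, ⟨g '' e, h.centeredEdges he, h.isGeometricDual hd⟩, mem_image_of_mem _ hp⟩
  refine ⟨fun hp => ?_, key h⟩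
  have := key h.symm hp
  rwa [g.symm_apply_apply] at this

theorem nonCenteredUnion (h : Preserves g S) :
    g p ∈ nonCenteredUnion S ↔ p ∈ nonCenteredUnion S := by
  have key : ∀ {g : ℍ ≃ᵢ ℍ} {p}, Preserves g S → p ∈ CenteredDual.nonCenteredUnion S →
      g p ∈ CenteredDual.nonCenteredUnion S := by
    rintro g p h ⟨e, ⟨he, hn⟩, hp⟩
    exact ⟨g '' e, ⟨h.voronoiEdges he, fun hc => hn (h.centeredEdges_iff.1 hc)⟩,
      mem_image_of_mem _ hp⟩
  refine ⟨fun hp => ?_, key h⟩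
  have := key h.symm hp
  rwa [g.symm_apply_apply] at this

theorem delaunayCell (h : Preserves g S) : g p ∈ delaunayCell S (g v) ↔ p ∈ delaunayCell S v := by
  have key : ∀ {g : ℍ ≃ᵢ ℍ} {p v}, Preserves g S → p ∈ CenteredDual.delaunayCell S v →
      g p ∈ CenteredDual.delaunayCell S (g v) := by
    intro g p v h hp C hC
    refine hp (g ⁻¹' C) ⟨fun x hx => hC.1 (h.near.2 hx), fun x hx y hy q hq => ?_⟩
    exact hC.2 _ hx _ hy (geodesicArc.2 hq)
  refine ⟨fun hp => ?_, key h⟩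
  have := key h.symm hp
  rwa [g.symm_apply_apply, g.symm_apply_apply] at this

end Preserves

/-- Deck transformations preserve circumradii and bring every Voronoi vertex into a fixed ball,
which contains finitely many of them. -/
theorem IsLocallyIsometricCovering.isFiniteNet [CompactSpace F] (hπ : IsLocallyIsometricCovering π)
    {S : Set F} (hS : S.Finite) (hS₀ : S.Nonempty) : IsFiniteNet (π ⁻¹' S) := by
  have hnet := hπ.isNet hS hS₀
  refine ⟨hnet, ?_⟩
  obtain ⟨R, hR⟩ := hπ.exists_deck_dist_le UpperHalfPlane.I
  refine ((hnet.finite_vertices_inter UpperHalfPlane.I R).image (rad (π ⁻¹' S))).subset ?_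
  rintro _ ⟨v, hv, rfl⟩
  obtain ⟨g, hg, hgv⟩ := hR v
  exact ⟨g v, ⟨hg.preserves.voronoiVertices.2 hv, hgv⟩, hg.preserves.rad hnet⟩
end

/-! ### Components of the complement of the dual graph and of the non-centered edges -/

section
theorem connectedComponentIn_eq_of_separated {X : Type*} [TopologicalSpace X] {A K O O' : Set X}
    {a : X} (hO : IsOpen O) (hO' : IsOpen O') (hA : A ⊆ O ∪ O') (hd : Disjoint O O')
    (hK : K = A ∩ O) (hconn : IsPreconnected K) (ha : a ∈ K) : connectedComponentIn A a = K := by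
  have haA : a ∈ A ∩ O := hK ▸ ha
  refine Subset.antisymm ?_ (hconn.subset_connectedComponentIn ha (hK ▸ inter_subset_left))
  have h1 := connectedComponentIn_subset A a
  have h2 := isPreconnected_connectedComponentIn.subset_left_of_subset_union hO hO' hd
    (h1.trans hA) ⟨a, mem_connectedComponentIn haA.1, haA.2⟩
  rw [hK]
  exact subset_inter h1 h2

section
variable {S : Set ℍ} {v₀ v₁ v w p q : ℍ}

theorem IsFiniteNet.image_interior (hS : IsFiniteNet S)
    {L : ℍ → V3 →ₗ[ℝ] V3} (h : IsDev S (cluster S v₀) L) :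
    devMap S (cluster S v₀) L '' interior (plane S (cluster S v₀) L) = region S v₀ := by
  ext p
  constructor
  · rintro ⟨c, hc, rfl⟩
    have hcp := interior_subset hc
    refine ⟨?_, (h.mem_interior_iff hS hcp).1 hc⟩
    rw [← h.image_devMap]
    exact mem_image_of_mem _ hcp
  · rintro ⟨hp, hd⟩
    rw [← h.image_devMap] at hp
    obtain ⟨c, hc, rfl⟩ := hp
    exact ⟨c, (h.mem_interior_iff hS hc).2 hd, rfl⟩

theorem IsFiniteNet.isPreconnected_region (hS : IsFiniteNet S) (h₀ : IsRoot S v₀) :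
    IsPreconnected (region S v₀) := by
  obtain ⟨L, h⟩ := exists_isDev hS h₀
  rw [← hS.image_interior h]
  obtain ⟨K, hK⟩ := h.exists_lipschitz hS.toIsNet (hS.finite_cluster v₀)
  exact h.convex_plane.interior.isPreconnected.image _ (hK.continuousOn.mono interior_subset)

/-- A convex body is the closure of its interior, so its image under the continuous `devMap` lies in
the closure of the image of the interior. -/
theorem IsFiniteNet.closure_region (hS : IsFiniteNet S) (h₀ : IsRoot S v₀) :
    closure (region S v₀) = ⋃ v ∈ cluster S v₀, delaunayCell S v := by
  obtain ⟨L, h⟩ := exists_isDev hS h₀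
  obtain ⟨K, hK⟩ := h.exists_lipschitz hS.toIsNet (hS.finite_cluster v₀)
  refine Subset.antisymm (closure_minimal sdiff_subset ?_) ?_
  · exact ((hS.finite_cluster v₀).isCompact_biUnion fun v _ =>
      isCompact_delaunayCell hS.toIsNet v).isClosed
  · rw [← h.image_devMap, ← hS.image_interior h]
    have hcl := (h.isCompact_plane hS.toIsNet (hS.finite_cluster v₀)).isClosed
    have hC := h.convex_plane.closure_interior_eq_closure_of_nonempty_interior
      (h.interior_nonempty h₀.mem_cluster)
    rw [hcl.closure_eq] at hC
    conv_lhs => rw [← hC]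
    exact ContinuousOn.image_closure (by rw [hC]; exact hK.continuousOn)

theorem IsFiniteNet.isCompact_closure_region (hS : IsFiniteNet S) (h₀ : IsRoot S v₀) :
    IsCompact (closure (region S v₀)) := by
  rw [hS.closure_region h₀]
  exact (hS.finite_cluster v₀).isCompact_biUnion fun v _ => isCompact_delaunayCell hS.toIsNet v

theorem rad_lt_of_mem_cluster (hv : v ∈ cluster S v₀) (hne : v ≠ v₀) : rad S v < rad S v₀ := by
  have key : ∀ v, Relation.ReflTransGen (Next S) v v₀ → v = v₀ ∨ rad S v < rad S v₀ := by
    intro v h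
    induction h using Relation.ReflTransGen.head_induction_on with
    | refl => exact Or.inl rfl
    | head h _ ih =>
      rcases ih with rfl | ih
      · exact Or.inr h.rad_lt
      · exact Or.inr (h.rad_lt.trans ih)
  exact (key v hv.2).resolve_left hne

theorem Preserves.image_region {g : ℍ ≃ᵢ ℍ} (hS : IsFiniteNet S) (hg : Preserves g S)
    (h₀ : IsRoot S v₀) (h₁ : IsRoot S v₁) (hp : p ∈ region S v₀) (hgp : g p ∈ region S v₁) :
    g '' region S v₀ = region S v₁ := by
  have key : ∀ {g : ℍ ≃ᵢ ℍ} {v₀ v₁ p}, Preserves g S → IsRoot S v₀ → IsRoot S v₁ →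
      p ∈ region S v₀ → g p ∈ region S v₁ → g '' region S v₀ ⊆ region S v₁ := by
    intro g v₀ v₁ p hg h₀ h₁ hp hgp
    refine hS.subset_region ((hS.isPreconnected_region h₀).image _ g.continuous.continuousOn) ?_ h₁
      (mem_image_of_mem _ hp) hgp
    rw [disjoint_left]
    rintro _ ⟨q, hq, rfl⟩ h
    exact hq.2 (hg.dualGraph.1 h)
  refine Subset.antisymm (key hg h₀ h₁ hp hgp) ?_
  have := key hg.symm h₁ h₀ hgp (by rwa [g.symm_apply_apply])
  intro q hq
  exact ⟨g.symm q, this (mem_image_of_mem _ hq), g.apply_symm_apply q⟩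

end

/-! ### Regions and trees under the covering -/

section
variable {F : Type u} [MetricSpace F] {π : ℍ → F} {S : Set F} {v₀ v₁ v p q : ℍ}

theorem exists_deck_region (hπ : IsLocallyIsometricCovering π) (hN : IsFiniteNet (π ⁻¹' S))
    (h₀ : IsRoot (π ⁻¹' S) v₀) (h₁ : IsRoot (π ⁻¹' S) v₁) (hp : p ∈ region (π ⁻¹' S) v₀)
    (hq : q ∈ region (π ⁻¹' S) v₁) (e : π p = π q) : ∃ g, IsDeck π g ∧ g p = q ∧
      ∀ x, g x ∈ region (π ⁻¹' S) v₁ ↔ x ∈ region (π ⁻¹' S) v₀ := by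
  obtain ⟨g, hg, rfl⟩ := hπ.exists_deck e
  refine ⟨g, hg, rfl, fun x => ?_⟩
  rw [← hg.preserves.image_region hN h₀ h₁ hp hq, g.injective.mem_set_image]

/-- The covering is injective on every region. -/
theorem injOn_region (hπ : IsLocallyIsometricCovering π) (hN : IsFiniteNet (π ⁻¹' S))
    (h₀ : IsRoot (π ⁻¹' S) v₀) : InjOn π (region (π ⁻¹' S) v₀) := by
  intro p hp q hq e
  obtain ⟨g, hg, rfl, hr⟩ := exists_deck_region hπ hN h₀ h₀ hp hq e
  have hv₀ := hN.cluster_subset_region h₀ h₀.mem_cluster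
  have hgc : g v₀ ∈ cluster (π ⁻¹' S) v₀ := by
    rw [← hN.vertices_inter_region h₀]
    exact ⟨hg.preserves.voronoiVertices.2 h₀.1, (hr v₀).2 hv₀⟩
  -- The image of the root is again in the cluster and has the same radius, while every other vertex
  -- of the cluster has a smaller one.
  have hfix : g v₀ = v₀ := by
    by_contra hne
    exact (rad_lt_of_mem_cluster hgc hne).ne (hg.preserves.rad hN.toIsNet)
  exact (hπ.deck_unique hg hfix p).symm

theorem image_mem_centeredDualGraph (hπ : IsLocallyIsometricCovering π) :
    π p ∈ centeredDualGraph π S ↔ p ∈ dualGraph (π ⁻¹' S) := by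
  constructor
  · intro h
    obtain ⟨γ, hγ, q, hq, e⟩ := mem_iUnion₂.1 h
    obtain ⟨g, hg, rfl⟩ := hπ.exists_deck e
    exact hg.preserves.dualGraph.2 ⟨γ, hγ, hq⟩
  · rintro ⟨γ, hγ, hp⟩
    exact mem_iUnion₂.2 ⟨γ, hγ, p, hp, rfl⟩

theorem image_mem_surfaceNonCenteredUnion (hπ : IsLocallyIsometricCovering π) :
    π p ∈ surfaceNonCenteredUnion π S ↔ p ∈ nonCenteredUnion (π ⁻¹' S) := by
  constructor
  · rintro ⟨q, hq, e⟩
    obtain ⟨g, hg, rfl⟩ := hπ.exists_deck e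
    exact hg.preserves.nonCenteredUnion.2 hq
  · exact fun h => ⟨p, h, rfl⟩

theorem image_region_eq (hπ : IsLocallyIsometricCovering π) (hN : IsFiniteNet (π ⁻¹' S))
    (h₀ : IsRoot (π ⁻¹' S) v₀) (h₁ : IsRoot (π ⁻¹' S) v₁)
    (h : (π '' region (π ⁻¹' S) v₀ ∩ π '' region (π ⁻¹' S) v₁).Nonempty) :
    ∃ g, IsDeck π g ∧ ∀ x, g x ∈ region (π ⁻¹' S) v₁ ↔ x ∈ region (π ⁻¹' S) v₀ := by
  obtain ⟨_, ⟨p, hp, rfl⟩, q, hq, e⟩ := h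
  obtain ⟨g, hg, -, hr⟩ := exists_deck_region hπ hN h₀ h₁ hp hq e.symm
  exact ⟨g, hg, hr⟩

theorem IsDeck.image_eq {g : ℍ ≃ᵢ ℍ} (hg : IsDeck π g) {A B : Set ℍ} (h : ∀ x, g x ∈ B ↔ x ∈ A) :
    π '' A = π '' B := by
  ext y
  constructor
  · rintro ⟨x, hx, rfl⟩
    exact ⟨g x, (h x).2 hx, hg x⟩
  · rintro ⟨x, hx, rfl⟩
    refine ⟨g.symm x, (h _).1 (by rwa [g.apply_symm_apply]), hg.symm x⟩

theorem isOpen_image (hπ : IsLocallyIsometricCovering π) {A : Set ℍ} (hA : IsOpen A) :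
    IsOpen (π '' A) := hπ.isCoveringMap.isLocalHomeomorph.isOpenMap _ hA

/-- The faces other than the one of `v₀`. -/
def otherFaces (π : ℍ → F) (S : Set F) (v₀ : ℍ) : Set F :=
  ⋃ v ∈ {v | IsRoot (π ⁻¹' S) v ∧ π '' region (π ⁻¹' S) v ≠ π '' region (π ⁻¹' S) v₀},
    π '' region (π ⁻¹' S) v

theorem isOpen_otherFaces (hπ : IsLocallyIsometricCovering π) (hN : IsFiniteNet (π ⁻¹' S)) :
    IsOpen (otherFaces π S v₀) :=
  isOpen_biUnion fun _ hv => isOpen_image hπ (hN.isOpen_region hv.1)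

theorem disjoint_otherFaces (hπ : IsLocallyIsometricCovering π) (hN : IsFiniteNet (π ⁻¹' S))
    (h₀ : IsRoot (π ⁻¹' S) v₀) : Disjoint (π '' region (π ⁻¹' S) v₀) (otherFaces π S v₀) := by
  rw [disjoint_left]
  intro y hy hy'
  obtain ⟨v, hv, hyv⟩ := mem_iUnion₂.1 hy'
  obtain ⟨g, hg, hr⟩ := image_region_eq hπ hN hv.1 h₀ ⟨y, hyv, hy⟩
  exact hv.2 (hg.image_eq hr)

theorem compl_subset_faces (hπ : IsLocallyIsometricCovering π) (hN : IsFiniteNet (π ⁻¹' S)) :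
    (centeredDualGraph π S)ᶜ ⊆ π '' region (π ⁻¹' S) v₀ ∪ otherFaces π S v₀ := by
  intro y hy
  obtain ⟨p, rfl⟩ := hπ.surjective y
  obtain ⟨v, hv, hpv⟩ := hN.exists_region (mt (image_mem_centeredDualGraph hπ).2 hy)
  by_cases h : π '' region (π ⁻¹' S) v = π '' region (π ⁻¹' S) v₀
  · exact Or.inl (h ▸ mem_image_of_mem _ hpv)
  · exact Or.inr (mem_iUnion₂.2 ⟨v, ⟨hv, h⟩, mem_image_of_mem _ hpv⟩)

theorem image_region_subset (hπ : IsLocallyIsometricCovering π) :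
    π '' region (π ⁻¹' S) v₀ ⊆ (centeredDualGraph π S)ᶜ := by
  rintro _ ⟨p, hp, rfl⟩ h
  exact hp.2 ((image_mem_centeredDualGraph hπ).1 h)

theorem component_eq (hπ : IsLocallyIsometricCovering π) (hN : IsFiniteNet (π ⁻¹' S))
    (h₀ : IsRoot (π ⁻¹' S) v₀) (hp : p ∈ region (π ⁻¹' S) v₀) :
    connectedComponentIn (centeredDualGraph π S)ᶜ (π p) = π '' region (π ⁻¹' S) v₀ :=
  connectedComponentIn_eq_of_separated (isOpen_image hπ (hN.isOpen_region h₀))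
    (isOpen_otherFaces hπ hN) (compl_subset_faces hπ hN) (disjoint_otherFaces hπ hN h₀)
    (inter_eq_right.2 (image_region_subset hπ)).symm
    ((hN.isPreconnected_region h₀).image _ hπ.continuous.continuousOn) (mem_image_of_mem _ hp)

/-- Images of regions are open and connected, cover the complement of the dual graph, and are
pairwise equal or disjoint because a common point yields a deck transformation between the regions.
-/
theorem isComponent_iff (hπ : IsLocallyIsometricCovering π) (hN : IsFiniteNet (π ⁻¹' S)) {U : Set F} :
    IsComponent (centeredDualGraph π S)ᶜ U ↔
      ∃ v₀, IsRoot (π ⁻¹' S) v₀ ∧ U = π '' region (π ⁻¹' S) v₀ := by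
  constructor
  · rintro ⟨y, hy, rfl⟩
    obtain ⟨p, rfl⟩ := hπ.surjective y
    obtain ⟨v, hv, hpv⟩ := hN.exists_region (mt (image_mem_centeredDualGraph hπ).2 hy)
    exact ⟨v, hv, component_eq hπ hN hv hpv⟩
  · rintro ⟨v, hv, rfl⟩
    have h := hN.cluster_subset_region hv hv.mem_cluster
    exact ⟨π v, image_region_subset hπ (mem_image_of_mem _ h), (component_eq hπ hN hv h).symm⟩

theorem surfaceNonCenteredUnion_subset (hπ : IsLocallyIsometricCovering π)
    (hN : IsFiniteNet (π ⁻¹' S)) : surfaceNonCenteredUnion π S ⊆ (centeredDualGraph π S)ᶜ := by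
  rintro _ ⟨p, hp, rfl⟩ h
  exact disjoint_left.1 hN.nonCenteredUnion_subset hp ((image_mem_centeredDualGraph hπ).1 h)

theorem image_tree (hπ : IsLocallyIsometricCovering π) : π '' tree (π ⁻¹' S) v₀ =
    surfaceNonCenteredUnion π S ∩ π '' region (π ⁻¹' S) v₀ := by
  ext y
  constructor
  · rintro ⟨p, hp, rfl⟩
    exact ⟨mem_image_of_mem _ hp.1, mem_image_of_mem _ hp.2⟩
  · rintro ⟨h, p, hp, rfl⟩
    exact ⟨p, ⟨(image_mem_surfaceNonCenteredUnion hπ).1 h, hp⟩, rfl⟩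

theorem component_tree_eq (hπ : IsLocallyIsometricCovering π) (hN : IsFiniteNet (π ⁻¹' S))
    (h₀ : IsRoot (π ⁻¹' S) v₀) (hp : p ∈ tree (π ⁻¹' S) v₀) :
    connectedComponentIn (surfaceNonCenteredUnion π S) (π p) = π '' tree (π ⁻¹' S) v₀ :=
  connectedComponentIn_eq_of_separated (isOpen_image hπ (hN.isOpen_region h₀))
    (isOpen_otherFaces hπ hN)
    ((surfaceNonCenteredUnion_subset hπ hN).trans (compl_subset_faces hπ hN))
    (disjoint_otherFaces hπ hN h₀) (image_tree hπ)
    ((hN.isPreconnected_tree h₀).image _ hπ.continuous.continuousOn) (mem_image_of_mem _ hp)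

theorem isComponent_surfaceNonCenteredUnion_iff (hπ : IsLocallyIsometricCovering π)
    (hN : IsFiniteNet (π ⁻¹' S)) {T : Set F} : IsComponent (surfaceNonCenteredUnion π S) T ↔
      ∃ v₀, IsRoot (π ⁻¹' S) v₀ ∧ (tree (π ⁻¹' S) v₀).Nonempty ∧ T = π '' tree (π ⁻¹' S) v₀ := by
  constructor
  · rintro ⟨_, ⟨p, hp, rfl⟩, rfl⟩
    obtain ⟨v, hv, hpv⟩ := hN.exists_region (disjoint_left.1 hN.nonCenteredUnion_subset hp)
    exact ⟨v, hv, ⟨p, hp, hpv⟩, component_tree_eq hπ hN hv ⟨hp, hpv⟩⟩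
  · rintro ⟨v, hv, ⟨p, hp⟩, rfl⟩
    exact ⟨π p, mem_image_of_mem _ hp.1, (component_tree_eq hπ hN hv hp).symm⟩

end

section
variable {S : Set ℍ} {v₀ p : ℍ}

theorem IsFiniteNet.component_tree_eq (hN : IsFiniteNet S) (h₀ : IsRoot S v₀)
    (hp : p ∈ tree S v₀) : connectedComponentIn (nonCenteredUnion S) p = tree S v₀ := by
  refine connectedComponentIn_eq_of_separated (hN.isOpen_region h₀)
    (O' := ⋃ v ∈ {v | IsRoot S v ∧ v ≠ v₀}, region S v)
    (isOpen_biUnion fun v hv => hN.isOpen_region hv.1) ?_ ?_ rfl (hN.isPreconnected_tree h₀) hp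
  · intro q hq
    obtain ⟨v, hv, hqv⟩ := hN.exists_region (disjoint_left.1 hN.nonCenteredUnion_subset hq)
    by_cases h : v = v₀
    · exact Or.inl (h ▸ hqv)
    · exact Or.inr (mem_iUnion₂.2 ⟨v, ⟨hv, h⟩, hqv⟩)
  · rw [disjoint_left]
    intro q hq hq'
    obtain ⟨v, hv, hqv⟩ := mem_iUnion₂.1 hq'
    exact hv.2 (hN.region_disjoint hv.1 h₀ hqv hq)

theorem IsFiniteNet.isComponent_nonCenteredUnion_iff (hN : IsFiniteNet S) {T : Set ℍ} :
    IsComponent (nonCenteredUnion S) T ↔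
      ∃ v₀, IsRoot S v₀ ∧ (tree S v₀).Nonempty ∧ T = tree S v₀ := by
  constructor
  · rintro ⟨p, hp, rfl⟩
    obtain ⟨v, hv, hpv⟩ := hN.exists_region (disjoint_left.1 hN.nonCenteredUnion_subset hp)
    exact ⟨v, hv, ⟨p, hp, hpv⟩, hN.component_tree_eq hv ⟨hp, hpv⟩⟩
  · rintro ⟨v, hv, ⟨p, hp⟩, rfl⟩
    exact ⟨p, hp.1, (hN.component_tree_eq hv hp).symm⟩

end

section
variable {F : Type u} [MetricSpace F] {π : ℍ → F} {S : Set F} {v₀ v₁ v w p q : ℍ}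

theorem surfaceVertices_inter (hπ : IsLocallyIsometricCovering π) (hN : IsFiniteNet (π ⁻¹' S))
    (h₀ : IsRoot (π ⁻¹' S) v₀) :
    surfaceVertices π S ∩ π '' region (π ⁻¹' S) v₀ = π '' cluster (π ⁻¹' S) v₀ := by
  ext y
  constructor
  · rintro ⟨⟨v, hv, rfl⟩, p, hp, e⟩
    obtain ⟨g, hg, rfl⟩ := hπ.exists_deck e.symm
    refine ⟨g v, ?_, hg v⟩
    rw [← hN.vertices_inter_region h₀]
    exact ⟨hg.preserves.voronoiVertices.2 hv, hp⟩
  · rintro ⟨v, hv, rfl⟩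
    exact ⟨mem_image_of_mem _ hv.1, mem_image_of_mem _ (hN.cluster_subset_region h₀ hv)⟩

theorem IsDeck.image_delaunayCell {g : ℍ ≃ᵢ ℍ} (hg : IsDeck π g) (v : ℍ) :
    π '' delaunayCell (π ⁻¹' S) (g v) = π '' delaunayCell (π ⁻¹' S) v :=
  (hg.image_eq fun _ => hg.preserves.delaunayCell).symm

theorem closure_image_region (hπ : IsLocallyIsometricCovering π) (hN : IsFiniteNet (π ⁻¹' S))
    (h₀ : IsRoot (π ⁻¹' S) v₀) : closure (π '' region (π ⁻¹' S) v₀) =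
      ⋃ v ∈ cluster (π ⁻¹' S) v₀, π '' delaunayCell (π ⁻¹' S) v := by
  rw [← image_iUnion₂, ← hN.closure_region h₀]
  refine Subset.antisymm (closure_minimal (image_mono subset_closure) ?_)
    (image_closure_subset_closure_image hπ.continuous)
  exact ((hN.isCompact_closure_region h₀).image hπ.continuous).isClosed

theorem closure_face (hπ : IsLocallyIsometricCovering π) (hN : IsFiniteNet (π ⁻¹' S))
    (h₀ : IsRoot (π ⁻¹' S) v₀) : closure (π '' region (π ⁻¹' S) v₀) =
      ⋃ v ∈ voronoiVertices (π ⁻¹' S) ∩ π ⁻¹' (π '' region (π ⁻¹' S) v₀),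
        π '' delaunayCell (π ⁻¹' S) v := by
  rw [closure_image_region hπ hN h₀]
  refine Subset.antisymm ?_ ?_
  · refine biUnion_mono (fun v hv => ⟨hv.1, mem_image_of_mem _ (hN.cluster_subset_region h₀ hv)⟩)
      fun _ _ => Subset.rfl
  · refine iUnion₂_subset fun v hv => ?_
    obtain ⟨w, hw, e⟩ := hv.2
    obtain ⟨g, hg, rfl⟩ := hπ.exists_deck e.symm
    rw [← hg.image_delaunayCell v]
    refine subset_biUnion_of_mem (u := fun v => π '' delaunayCell (π ⁻¹' S) v) ?_
    rw [← hN.vertices_inter_region h₀]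
    exact ⟨hg.preserves.voronoiVertices.2 hv.1, hw⟩

end
end

/-! ### The induced path metric and disk maps -/

section
section
variable {X : Type u} [MetricSpace X] {U : Set X} {a b c : X}

theorem pathEDist_le (γ : Path a b) (h : range γ ⊆ U) : pathEDist U a b ≤ eVariationOn γ univ :=
  iInf₂_le γ h

theorem exists_path_of_pathEDist_lt {r : ℝ≥0∞} (h : pathEDist U a b < r) :
    ∃ γ : Path a b, range γ ⊆ U ∧ eVariationOn γ univ < r := by
  obtain ⟨γ, h⟩ := iInf_lt_iff.1 h
  obtain ⟨hγ, h⟩ := iInf_lt_iff.1 h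
  exact ⟨γ, hγ, h⟩

theorem edist_le_pathEDist : edist a b ≤ pathEDist U a b :=
  le_iInf₂ fun γ _ => edist_le_eVariationOn γ

theorem pathEDist_self (ha : a ∈ U) : pathEDist U a a = 0 := by
  refine le_antisymm ((pathEDist_le (Path.refl a) ?_).trans ?_) zero_le
  · rintro _ ⟨t, rfl⟩; exact ha
  · refine (eVariationOn.constant_on (s := univ) (f := Path.refl a) ?_).le
    rintro _ ⟨s, -, rfl⟩ _ ⟨t, -, rfl⟩; rfl

theorem pathEDist_comm : pathEDist U a b = pathEDist U b a := by
  have key : ∀ a b : X, pathEDist U a b ≤ pathEDist U b a := by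
    intro a b
    refine le_iInf₂ fun γ hγ => (pathEDist_le γ.symm ?_).trans ?_
    · rwa [Path.symm_range]
    · exact eVariationOn.comp_le_of_antitoneOn γ unitInterval.symm
        (unitInterval.strictAnti_symm.antitone.antitoneOn _) (mapsTo_univ _ _)
  exact le_antisymm (key a b) (key b a)

theorem eVariationOn_trans_le (γ : Path a b) (γ' : Path b c) :
    eVariationOn (γ.trans γ') univ ≤ eVariationOn γ univ + eVariationOn γ' univ := by
  let h : unitInterval := ⟨1 / 2, by norm_num, by norm_num⟩
  let φ : unitInterval → unitInterval := fun t => projIcc 0 1 zero_le_one (2 * (t : ℝ))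
  let ψ : unitInterval → unitInterval := fun t => projIcc 0 1 zero_le_one (2 * (t : ℝ) - 1)
  have hφ : Monotone φ := fun s t hst => monotone_projIcc _ (by
    have : (s : ℝ) ≤ t := hst
    linarith)
  have hψ : Monotone ψ := fun s t hst => monotone_projIcc _ (by
    have : (s : ℝ) ≤ t := hst
    linarith)
  have e1 : EqOn (γ.trans γ') (γ ∘ φ) (univ ∩ Icc 0 h) := by
    rintro t ⟨-, -, ht⟩
    have ht' : (t : ℝ) ≤ 1 / 2 := ht
    rw [Path.trans_apply, dif_pos ht', Function.comp_apply]
    congr 1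
    exact (projIcc_of_mem zero_le_one (⟨by linarith [t.2.1], by linarith⟩ :
      2 * (t : ℝ) ∈ Icc (0 : ℝ) 1)).symm
  have e2 : EqOn (γ.trans γ') (γ' ∘ ψ) (univ ∩ Icc h 1) := by
    rintro t ⟨-, ht, -⟩
    have ht' : 1 / 2 ≤ (t : ℝ) := ht
    have hp : ψ t = ⟨2 * (t : ℝ) - 1, by linarith, by linarith [t.2.2]⟩ :=
      projIcc_of_mem zero_le_one (⟨by linarith, by linarith [t.2.2]⟩ :
        2 * (t : ℝ) - 1 ∈ Icc (0 : ℝ) 1)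
    rw [Path.trans_apply, Function.comp_apply, hp]
    split_ifs with h1
    · have h2 : (t : ℝ) = 1 / 2 := le_antisymm h1 ht'
      have h3 : (⟨2 * (t : ℝ), by linarith, by linarith⟩ : unitInterval) = 1 :=
        Subtype.ext (by change 2 * (t : ℝ) = 1; rw [h2]; norm_num)
      have h4 : (⟨2 * (t : ℝ) - 1, by linarith, by linarith⟩ : unitInterval) = 0 :=
        Subtype.ext (by change 2 * (t : ℝ) - 1 = 0; rw [h2]; norm_num)
      rw [h3, h4, γ.target, γ'.source]
    · rfl
  have h0 : (0 : unitInterval) ≤ h := unitInterval.nonneg'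
  have h1 : h ≤ 1 := unitInterval.le_one'
  have e3 : univ ∩ Icc (0 : unitInterval) 1 = univ := by
    ext t; simp [unitInterval.le_one']
  have := eVariationOn.Icc_add_Icc (γ.trans γ') h0 h1 (mem_univ h)
  rw [e3] at this
  rw [← this, eVariationOn.congr e1, eVariationOn.congr e2]
  exact add_le_add (eVariationOn.comp_le_of_monotoneOn _ φ (hφ.monotoneOn _) (mapsTo_univ _ _))
    (eVariationOn.comp_le_of_monotoneOn _ ψ (hψ.monotoneOn _) (mapsTo_univ _ _))

theorem pathEDist_triangle : pathEDist U a c ≤ pathEDist U a b + pathEDist U b c := by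
  refine ENNReal.le_of_forall_pos_le_add fun ε hε hfin => ?_
  have hε' : (ε / 2 : ℝ≥0∞) ≠ 0 := by simpa using hε.ne'
  obtain ⟨h1, h2⟩ := ENNReal.add_lt_top.1 hfin
  obtain ⟨γ, hγ, hl⟩ := exists_path_of_pathEDist_lt (ENNReal.lt_add_right h1.ne hε')
  obtain ⟨γ', hγ', hl'⟩ := exists_path_of_pathEDist_lt (ENNReal.lt_add_right h2.ne hε')
  refine (pathEDist_le (γ.trans γ') ?_).trans ?_
  · rw [Path.trans_range]; exact union_subset hγ hγ'
  · refine (eVariationOn_trans_le γ γ').trans ((add_le_add hl.le hl'.le).trans_eq ?_)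
    rw [add_add_add_comm, ENNReal.add_halves]

/-- A set, to be equipped with its induced path metric. -/
@[ext] structure PathSpace (U : Set X) : Type u where
  /-- the underlying point -/
  val : X
  mem : val ∈ U

/-- The induced path metric on a set all of whose points are joined by paths of finite length. -/
@[reducible] noncomputable def pathMetric (h : ∀ a ∈ U, ∀ b ∈ U, pathEDist U a b ≠ ⊤) :
    MetricSpace (PathSpace U) :=
  letI : EMetricSpace (PathSpace U) :=
    { edist := fun a b => pathEDist U a.1 b.1
      edist_self := fun a => pathEDist_self a.2
      edist_comm := fun _ _ => pathEDist_comm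
      edist_triangle := fun _ _ _ => pathEDist_triangle
      eq_of_edist_eq_zero := fun {_ _} h0 =>
        PathSpace.ext (edist_eq_zero.1 (le_antisymm (edist_le_pathEDist.trans_eq h0) zero_le)) }
  EMetricSpace.toMetricSpace fun a b => h a.1 a.2 b.1 b.2

end

/-- A continuous map with finite fibers on a compact set cannot contract connected sets too much. -/
theorem exists_dist_lt_of_finite_fiber {X Y : Type*} [MetricSpace X] [MetricSpace Y] {C : Set X}
    (hC : IsCompact C) {f : X → Y} (hf : ContinuousOn f C)
    (hfin : ∀ y, {c ∈ C | f c = y}.Finite) {ε : ℝ} (hε : 0 < ε) : ∃ δ > 0, ∀ K ⊆ C,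
      IsPreconnected K → (∀ a ∈ K, ∀ b ∈ K, dist (f a) (f b) < δ) → ∀ a ∈ K, ∀ b ∈ K, dist a b < ε := by
  have key : ∀ y, ∃ δ > 0, ∀ K ⊆ C, IsPreconnected K → f '' K ⊆ ball y δ →
      ∀ a ∈ K, ∀ b ∈ K, dist a b < ε := by
    intro y
    -- The finitely many points over y get small disjoint neighbourhoods, and the rest of C has a
    -- closed image that avoids a ball about y. A connected set lying over that ball stays in one
    -- neighbourhood. A Lebesgue number later makes the radius uniform in y.
    obtain ⟨V, hV, hd⟩ := (hfin y).t2_separation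
    set V' : X → Set X := fun z => V z ∩ ball z (ε / 2)
    have hV' : ∀ z, IsOpen (V' z) := fun z => (hV z).2.inter isOpen_ball
    set Z := {c ∈ C | f c = y}
    have hcl : IsClosed (f '' (C \ ⋃ z ∈ Z, V' z)) :=
      ((hC.diff (isOpen_biUnion fun z _ => hV' z)).image_of_continuousOn
        (hf.mono sdiff_subset)).isClosed
    have hy : y ∉ f '' (C \ ⋃ z ∈ Z, V' z) := by
      rintro ⟨c, ⟨hc, hn⟩, e⟩
      exact hn (mem_iUnion₂.2 ⟨c, ⟨hc, e⟩, (hV c).1, mem_ball_self (half_pos hε)⟩)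
    obtain ⟨δ, hδ, hb⟩ := Metric.isOpen_iff.1 hcl.isOpen_compl y hy
    refine ⟨δ, hδ, fun K hK hconn hKb a ha b hb' => ?_⟩
    have hcov : K ⊆ ⋃ z ∈ Z, V' z := by
      intro c hc
      by_contra hn
      exact hb (hKb (mem_image_of_mem f hc)) ⟨c, ⟨hK hc, hn⟩, rfl⟩
    obtain ⟨z, hz, haz⟩ := mem_iUnion₂.1 (hcov ha)
    have hsub : K ⊆ V' z := by
      refine hconn.subset_left_of_subset_union (hV' z)
        (v := ⋃ w ∈ {w ∈ Z | w ≠ z}, V' w) (isOpen_biUnion fun w _ => hV' w) ?_ ?_ ⟨a, ha, haz⟩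
      · rw [disjoint_left]
        intro c hc hc'
        obtain ⟨w, hw, hcw⟩ := mem_iUnion₂.1 hc'
        exact disjoint_left.1 (hd hz hw.1 hw.2.symm) hc.1 hcw.1
      · intro c hc
        obtain ⟨w, hw, hcw⟩ := mem_iUnion₂.1 (hcov hc)
        by_cases h : w = z
        · exact Or.inl (h ▸ hcw)
        · exact Or.inr (mem_iUnion₂.2 ⟨w, ⟨hw, h⟩, hcw⟩)
    have h1 := (hsub ha).2
    have h2 := (hsub hb').2
    rw [mem_ball] at h1 h2
    linarith [dist_triangle_right a b z]
  choose δ hδ h using key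
  obtain ⟨δ', hδ', hL⟩ := lebesgue_number_lemma_of_metric (hC.image_of_continuousOn hf)
    (c := fun y => ball y (δ y)) (fun y => isOpen_ball)
    (fun y _ => mem_iUnion.2 ⟨y, mem_ball_self (hδ y)⟩)
  refine ⟨δ', hδ', fun K hK hconn hd a ha b hb => ?_⟩
  obtain ⟨y, hy⟩ := hL (f a) (mem_image_of_mem f (hK ha))
  refine h y K hK hconn ?_ a ha b hb
  rintro _ ⟨c, hc, rfl⟩
  exact hy (hd c hc a ha)

/-- On the compact set C the map f is closed, and `hm` ensures that no point of C outside I has its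
image in f(I). Preimages of open sets under g are thus cut out by complements of closed images. -/
theorem continuousOn_of_leftInvOn {X Y : Type*} [TopologicalSpace X] [TopologicalSpace Y] [T2Space Y]
    {C I : Set X} {f : X → Y} {g : Y → X} (hC : IsCompact C) (hf : ContinuousOn f C) (hI : I ⊆ C)
    (hm : ∀ c ∈ C, f c ∈ f '' I → c ∈ I) (hg : LeftInvOn g f I) : ContinuousOn g (f '' I) := by
  rw [_root_.continuousOn_iff']
  intro t ht
  refine ⟨(f '' (C \ t))ᶜ, ((hC.diff ht).image_of_continuousOn
    (hf.mono sdiff_subset)).isClosed.isOpen_compl, ?_⟩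
  ext y
  refine and_congr_left ?_
  rintro ⟨c, hc, rfl⟩
  rw [mem_preimage, hg hc]
  constructor
  · rintro hct ⟨c', ⟨hc', hn⟩, e⟩
    have := hg (hm c' hc' (e ▸ mem_image_of_mem f hc))
    rw [e, hg hc] at this
    exact hn (this ▸ hct)
  · intro hn
    by_contra hct
    exact hn ⟨c, ⟨hI hc, hct⟩, rfl⟩

/-- `f` maps the compact convex body `C` to a space, and its interior bijectively onto `U`. -/
structure IsDiskMap {X : Type u} [MetricSpace X] (C : Set E2) (f : E2 → X) (U : Set X) : Prop where
  compact : IsCompact C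
  convex : Convex ℝ C
  nonempty : (interior C).Nonempty
  continuousOn : ContinuousOn f C
  mem_iff : ∀ c ∈ C, f c ∈ U ↔ c ∈ interior C
  injOn : InjOn f (interior C)
  image : f '' interior C = U
  finite_fiber : ∀ y, {c ∈ C | f c = y}.Finite
  exists_le : ∃ K : ℝ≥0, ∀ c ∈ interior C, ∀ c' ∈ interior C, pathEDist U (f c) (f c') ≤ K * edist c c'

namespace IsDiskMap
variable {X : Type u} [MetricSpace X] {C : Set E2} {f : E2 → X} {U : Set X}

theorem closure_interior (h : IsDiskMap C f U) : closure (interior C) = C := by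
  rw [h.convex.closure_interior_eq_closure_of_nonempty_interior h.nonempty,
    h.compact.isClosed.closure_eq]

/-- The inverse of a disk map. -/
noncomputable def inv (C : Set E2) (f : E2 → X) : X → E2 := Function.invFunOn f (interior C)

theorem inv_mem (h : IsDiskMap C f U) {y : X} (hy : y ∈ U) : inv C f y ∈ interior C :=
  Function.invFunOn_mem (by rwa [← h.image] at hy)

theorem apply_inv (h : IsDiskMap C f U) {y : X} (hy : y ∈ U) : f (inv C f y) = y :=
  Function.invFunOn_eq (by rwa [← h.image] at hy)

theorem inv_apply (h : IsDiskMap C f U) {c : E2} (hc : c ∈ interior C) : inv C f (f c) = c := by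
  have hy : f c ∈ U := h.image ▸ mem_image_of_mem f hc
  exact h.injOn (h.inv_mem hy) hc (h.apply_inv hy)

theorem continuousOn_inv (h : IsDiskMap C f U) : ContinuousOn (inv C f) U := by
  rw [← h.image]
  refine continuousOn_of_leftInvOn h.compact h.continuousOn interior_subset (fun c hc hm => ?_)
    fun c hc => h.inv_apply hc
  exact (h.mem_iff c hc).1 (h.image ▸ hm)

/-- A disk map restricts to a homeomorphism of the open disk onto its image. -/
noncomputable def homeomorph (h : IsDiskMap C f U) : U ≃ₜ interior C where
  toFun y := ⟨inv C f y, h.inv_mem y.2⟩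
  invFun c := ⟨f c, h.image ▸ mem_image_of_mem f c.2⟩
  left_inv y := Subtype.ext (h.apply_inv y.2)
  right_inv c := Subtype.ext (h.inv_apply c.2)
  continuous_toFun := (continuousOn_iff_continuous_domRestrict.1 h.continuousOn_inv).subtype_mk _
  continuous_invFun := (continuousOn_iff_continuous_domRestrict.1
    (h.continuousOn.mono interior_subset)).subtype_mk _

theorem pathEDist_ne_top (h : IsDiskMap C f U) : ∀ a ∈ U, ∀ b ∈ U, pathEDist U a b ≠ ⊤ := by
  intro a ha b hb
  obtain ⟨K, hK⟩ := h.exists_le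
  have := hK _ (h.inv_mem ha) _ (h.inv_mem hb)
  rw [h.apply_inv ha, h.apply_inv hb] at this
  exact ne_top_of_le_ne_top (ENNReal.mul_ne_top ENNReal.coe_ne_top (edist_ne_top _ _)) this

theorem isUniformInducing_inv (h : IsDiskMap C f U) :
    letI := pathMetric h.pathEDist_ne_top
    IsUniformInducing fun y : PathSpace U => (⟨inv C f y.1, interior_subset (h.inv_mem y.2)⟩ : C) := by
  let := pathMetric h.pathEDist_ne_top
  have hed : ∀ a b : PathSpace U, edist a b = pathEDist U a.1 b.1 := fun a b => rfl
  rw [Metric.isUniformInducing_iff]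
  constructor
  · rw [Metric.uniformContinuous_iff]
    intro ε hε
    obtain ⟨δ, hδ, hK⟩ := exists_dist_lt_of_finite_fiber h.compact h.continuousOn h.finite_fiber hε
    refine ⟨δ, hδ, fun {a b} hab => ?_⟩
    have h1 : pathEDist U a.1 b.1 < ENNReal.ofReal δ := by
      rw [← hed, edist_dist]
      exact (ENNReal.ofReal_lt_ofReal_iff hδ).2 hab
    obtain ⟨γ, hγ, hl⟩ := exists_path_of_pathEDist_lt h1
    have hcont : Continuous fun t => inv C f (γ t) :=
      h.continuousOn_inv.comp_continuous γ.continuous fun t => hγ (mem_range_self t)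
    refine hK (range fun t => inv C f (γ t)) ?_ (isPreconnected_range hcont) ?_ _ ⟨0, by simp⟩ _
      ⟨1, by simp⟩
    · rintro _ ⟨t, rfl⟩
      exact interior_subset (h.inv_mem (hγ (mem_range_self t)))
    · rintro _ ⟨s, rfl⟩ _ ⟨t, rfl⟩
      rw [h.apply_inv (hγ (mem_range_self s)), h.apply_inv (hγ (mem_range_self t))]
      have := (eVariationOn.edist_le γ (mem_univ s) (mem_univ t)).trans_lt hl
      rw [edist_dist] at this
      exact (ENNReal.ofReal_lt_ofReal_iff hδ).1 this
  · intro δ hδ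
    obtain ⟨K, hK⟩ := h.exists_le
    refine ⟨δ / (K + 1), by positivity, fun {a b} hab => ?_⟩
    have h1 := hK _ (h.inv_mem a.2) _ (h.inv_mem b.2)
    rw [h.apply_inv a.2, h.apply_inv b.2, ← hed, edist_dist, edist_dist, ← ENNReal.ofReal_coe_nnreal,
      ← ENNReal.ofReal_mul K.coe_nonneg, ENNReal.ofReal_le_ofReal_iff (by positivity)] at h1
    have h2 : dist (inv C f a.1) (inv C f b.1) < δ / (K + 1) := hab
    rw [lt_div_iff₀ (by positivity)] at h2
    have : 0 ≤ dist (inv C f a.1) (inv C f b.1) := dist_nonneg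
    linarith

theorem denseRange_inv (h : IsDiskMap C f U) :
    DenseRange fun y : PathSpace U => (⟨inv C f y.1, interior_subset (h.inv_mem y.2)⟩ : C) := by
  rintro ⟨c, hc⟩
  rw [closure_subtype]
  have := hc
  rw [← h.closure_interior] at this
  refine closure_mono ?_ this
  intro c' hc'
  have hy : f c' ∈ U := h.image ▸ mem_image_of_mem f hc'
  exact ⟨⟨c', interior_subset hc'⟩, ⟨⟨f c', hy⟩, Subtype.ext (h.inv_apply hc')⟩, rfl⟩

end IsDiskMap
end

/-! ### The completion of a face -/

section
section
variable {X : Type u} [MetricSpace X] {C : Set E2} {f : E2 → X} {U : Set X}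

theorem IsDiskMap.exists_isPathCompletion (h : IsDiskMap C f U) :
    ∃ (Q : Type u) (_ : MetricSpace Q) (ι : U → Q), IsPathCompletion U ι := by
  let := pathMetric h.pathEDist_ne_top
  refine ⟨UniformSpace.Completion (PathSpace U), inferInstance,
    fun y => ((⟨y.1, y.2⟩ : PathSpace U) : UniformSpace.Completion (PathSpace U)),
    ⟨inferInstance, ?_, fun a b => UniformSpace.Completion.edist_eq _ _⟩⟩
  refine UniformSpace.Completion.denseRange_coe.mono ?_
  rintro _ ⟨y, rfl⟩
  exact ⟨⟨y.1, y.2⟩, rfl⟩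

/-- The closed disk is the completion of the open one with respect to the induced path metric. -/
theorem IsDiskMap.exists_homeomorph (h : IsDiskMap C f U) {Q : Type u} [MetricSpace Q] {ι : U → Q}
    (hι : IsPathCompletion U ι) : ∃ e : Q ≃ₜ C, ∀ y : U, (e (ι y) : E2) = inv C f y := by
  let := pathMetric h.pathEDist_ne_top
  have : CompactSpace C := isCompact_iff_compactSpace.1 h.compact
  have := hι.complete
  have hiso : Isometry fun y : PathSpace U => ι ⟨y.1, y.2⟩ := fun a b => hι.edist_eq _ _
  -- C and Q are two completions of the same uniform space, the face with its path metric, so they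
  -- are canonically isomorphic over it.
  let pkg : AbstractCompletion (PathSpace U) :=
    { space := C
      coe := fun y => ⟨inv C f y.1, interior_subset (h.inv_mem y.2)⟩
      uniformStruct := inferInstance
      complete := inferInstance
      separation := inferInstance
      isUniformInducing := h.isUniformInducing_inv
      dense := h.denseRange_inv }
  let pkg' : AbstractCompletion (PathSpace U) :=
    { space := Q
      coe := fun y => ι ⟨y.1, y.2⟩
      uniformStruct := inferInstance
      complete := inferInstance
      separation := inferInstance
      isUniformInducing := hiso.isUniformInducing
      dense := hι.denseRange.mono (by rintro _ ⟨y, rfl⟩; exact ⟨⟨y.1, y.2⟩, rfl⟩) }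
  let e : Q ≃ᵤ C := pkg'.compareEquiv pkg
  exact ⟨e.toHomeomorph, fun y => congrArg Subtype.val (pkg'.compare_coe pkg ⟨y.1, y.2⟩)⟩

end

variable {F : Type u} [MetricSpace F] {π : ℍ → F} {S : Set F} {L : ℍ → V3 →ₗ[ℝ] V3} {v v₀ : ℍ}

theorem IsLocallyIsometricCovering.finite_fiber [CompactSpace F]
    (hπ : IsLocallyIsometricCovering π) (y : F) {K : Set ℍ} (hK : IsCompact K) :
    {p ∈ K | π p = y}.Finite := by
  obtain ⟨r, hr⟩ := hK.isBounded.subset_closedBall UpperHalfPlane.I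
  refine ((hπ.isNet (finite_singleton y) (singleton_nonempty y)).finite_inter
    UpperHalfPlane.I r).subset ?_
  rintro p ⟨hp, e⟩
  exact ⟨e, hr hp⟩

/-- The development of a cluster parametrizes a face of the centered dual graph. -/
theorem IsDev.isDiskMap [CompactSpace F] (hπ : IsLocallyIsometricCovering π)
    (hN : IsFiniteNet (π ⁻¹' S)) (h₀ : IsRoot (π ⁻¹' S) v₀)
    (h : IsDev (π ⁻¹' S) (cluster (π ⁻¹' S) v₀) L) :
    IsDiskMap (plane (π ⁻¹' S) (cluster (π ⁻¹' S) v₀) L)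
      (π ∘ devMap (π ⁻¹' S) (cluster (π ⁻¹' S) v₀) L) (π '' region (π ⁻¹' S) v₀) where
  compact := h.isCompact_plane hN.toIsNet (hN.finite_cluster v₀)
  convex := h.convex_plane
  nonempty := h.interior_nonempty h₀.mem_cluster
  continuousOn := by
    obtain ⟨K, hK⟩ := h.exists_lipschitz hN.toIsNet (hN.finite_cluster v₀)
    exact hπ.continuous.comp_continuousOn hK.continuousOn
  mem_iff c hc := by
    constructor
    · intro hm
      refine (h.mem_interior_iff hN hc).2 fun hd => ?_
      exact image_region_subset hπ hm ((image_mem_centeredDualGraph hπ).2 hd)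
    · intro hm
      exact mem_image_of_mem π (hN.image_interior h ▸ mem_image_of_mem _ hm)
  injOn := by
    intro c hc c' hc' e
    refine h.injOn_interior hN (interior_subset hc) (interior_subset hc')
      ((h.mem_interior_iff hN (interior_subset hc)).1 hc) ?_
    refine injOn_region hπ hN h₀ ?_ ?_ e <;> rw [← hN.image_interior h]
    exacts [mem_image_of_mem _ hc, mem_image_of_mem _ hc']
  image := by rw [image_comp, hN.image_interior h]
  finite_fiber y := by
    obtain ⟨K, hK⟩ := h.exists_lipschitz hN.toIsNet (hN.finite_cluster v₀)
    have hc := (h.isCompact_plane hN.toIsNet (hN.finite_cluster v₀)).image_of_continuousOn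
      hK.continuousOn
    refine ((hπ.finite_fiber y hc).biUnion fun p _ =>
      h.finite_fiber (hN.finite_cluster v₀) p).subset ?_
    rintro c ⟨hc, e⟩
    exact mem_iUnion₂.2 ⟨_, ⟨mem_image_of_mem _ hc, e⟩, hc, rfl⟩
  exists_le := by
    obtain ⟨K, hK⟩ := h.exists_lipschitz hN.toIsNet (hN.finite_cluster v₀)
    refine ⟨K, fun c hc c' hc' => ?_⟩
    -- The interior is convex, so the image of a straight segment is an admissible path, whose
    -- length is at most K times that of the segment; π preserves it.
    have hseg : ∀ t : unitInterval, AffineMap.lineMap c c' (t : ℝ) ∈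
        interior (plane (π ⁻¹' S) (cluster (π ⁻¹' S) v₀) L) := fun t =>
      h.convex_plane.interior.lineMap_mem hc hc' t.2
    have hcont : Continuous fun t : unitInterval =>
        devMap (π ⁻¹' S) (cluster (π ⁻¹' S) v₀) L (AffineMap.lineMap c c' (t : ℝ)) :=
      hK.continuousOn.comp_continuous (by fun_prop) fun t => interior_subset (hseg t)
    let γ : Path ((π ∘ devMap (π ⁻¹' S) (cluster (π ⁻¹' S) v₀) L) c)
        ((π ∘ devMap (π ⁻¹' S) (cluster (π ⁻¹' S) v₀) L) c') :=
      { toFun := fun t => π (devMap (π ⁻¹' S) (cluster (π ⁻¹' S) v₀) L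
          (AffineMap.lineMap c c' (t : ℝ)))
        continuous_toFun := hπ.continuous.comp hcont
        source' := by simp
        target' := by simp }
    refine (pathEDist_le γ ?_).trans ?_
    · rintro _ ⟨t, rfl⟩
      exact mem_image_of_mem π (hN.image_interior h ▸ mem_image_of_mem _ (hseg t))
    · change eVariationOn (π ∘ fun t : unitInterval =>
        devMap (π ⁻¹' S) (cluster (π ⁻¹' S) v₀) L (AffineMap.lineMap c c' (t : ℝ))) univ ≤ _
      rw [hπ.eVariationOn_comp hcont]
      refine (hK.comp_eVariationOn_le (s := univ)
        (g := fun t : unitInterval => (AffineMap.lineMap c c' (t : ℝ) : E2))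
        fun t _ => interior_subset (hseg t)).trans ?_
      gcongr
      have hl : LipschitzWith (nndist c c') fun t : ℝ => AffineMap.lineMap c c' t :=
        lipschitzWith_lineMap c c'
      have := hl.lipschitzOnWith (s := univ).comp_eVariationOn_le
        (g := fun t : unitInterval => (t : ℝ)) (s := univ) (mapsTo_univ _ _)
      refine this.trans ?_
      have h1 : eVariationOn (fun t : unitInterval => (t : ℝ)) univ ≤ 1 := by
        have hm : Monotone fun t : unitInterval => (t : ℝ) := fun _ _ h => h
        have := (hm.monotoneOn univ).eVariationOn_eq (mem_univ (0 : unitInterval))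
          (mem_univ 1)
        have e3 : univ ∩ Icc (0 : unitInterval) 1 = univ := by
          ext t; simp [unitInterval.le_one']
        rw [e3] at this
        simpa using this.le
      calc (nndist c c' : ℝ≥0∞) * eVariationOn (fun t : unitInterval => (t : ℝ)) univ
          ≤ nndist c c' * 1 := by gcongr
        _ = edist c c' := by rw [mul_one, edist_nndist]
end

/-! ### Delaunay cells inside the completion -/

section
open IsDiskMap

variable {F : Type u} [MetricSpace F] {π : ℍ → F} {S : Set F} {L : ℍ → V3 →ₗ[ℝ] V3} {v v₀ p q : ℍ}

theorem hyp_mem_interior_of_mem_geodesicArc {N : Set ℍ} {r : ℍ}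
    (hp : hyp p ∈ interior (cone (near N v) : Set V3))
    (hq : hyp q ∈ interior (cone (near N v) : Set V3)) (hr : r ∈ geodesicArc p q) :
    hyp r ∈ interior (cone (near N v) : Set V3) := by
  obtain ⟨a, b, ha, hb, e⟩ := mem_geodesicArc_iff.1 hr
  have hadd : ∀ P ∈ (cone (near N v) : Set V3), ∀ Q ∈ (cone (near N v) : Set V3),
    P + Q ∈ (cone (near N v) : Set V3) := fun P hP Q hQ => Submodule.add_mem _ hP hQ
  have hsmul : ∀ (c : ℝ) P, 0 < c → P ∈ (cone (near N v) : Set V3) →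
      c • P ∈ (cone (near N v) : Set V3) := fun c P hc hP =>
    Submodule.smul_mem _ (⟨c, hc.le⟩ : {c : ℝ // 0 ≤ c}) hP
  rw [e]
  rcases ha.eq_or_lt with rfl | ha
  · rcases hb.eq_or_lt with rfl | hb
    · rw [zero_smul, zero_smul, add_zero] at e
      exact (hyp_ne_zero r e).elim
    · rw [zero_smul, zero_add]
      exact interior_smul_mem hsmul hq hb
  · refine interior_add_mem hadd (interior_smul_mem hsmul hp ha) ?_
    rcases hb.eq_or_lt with rfl | hb
    · rw [zero_smul]; exact Submodule.zero_mem _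
    · exact hsmul b _ hb (interior_subset hq)

theorem dense_interior_delaunayCell {N : Set ℍ} (hv : v ∈ voronoiVertices N) :
    Dense {p : delaunayCell N v | hyp p ∈ interior (cone (near N v) : Set V3)} := by
  rintro ⟨p, hp⟩
  rw [closure_subtype]
  obtain ⟨P, hP⟩ := interior_cone_nonempty hv
  have hsmul : ∀ (c : ℝ) P, 0 < c → P ∈ (cone (near N v) : Set V3) →
      c • P ∈ (cone (near N v) : Set V3) := fun c P hc hP => cone_smul hP hc.le
  have hF : ∀ᶠ t : ℝ in 𝓝[>] 0, IsFut (hyp p + t • P) := by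
    have hc : Continuous fun t : ℝ => hyp p + t • P := by fun_prop
    have := hc.continuousAt.preimage_mem_nhds (x := 0)
      (isOpen_Fut.mem_nhds (by simpa using hyp_mem_Fut p))
    exact nhdsWithin_le_nhds this
  refine mem_closure_of_tendsto ((tendsto_pt_add_smul p P).mono_left nhdsWithin_le_nhds) ?_
    (b := 𝓝[>] 0)
  filter_upwards [hF, self_mem_nhdsWithin] with t ht ht0
  have hI : hyp p + t • P ∈ interior (cone (near N v) : Set V3) := by
    rw [add_comm]
    exact interior_add_mem (fun P hP Q hQ => Submodule.add_mem _ hP hQ)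
      (interior_smul_mem hsmul hP ht0) (mem_delaunayCell.1 hp)
  obtain ⟨k, hk, e⟩ := exists_smul_hyp ht
  have hh : hyp (pt (hyp p + t • P)) ∈ interior (cone (near N v) : Set V3) := by
    have : hyp (pt (hyp p + t • P)) = k⁻¹ • (hyp p + t • P) := by
      rw [e, pt_smul (hyp_mem_Fut _) hk, pt_hyp, smul_smul, inv_mul_cancel₀ hk.ne', one_smul]
    rw [this]
    exact interior_smul_mem hsmul hI (inv_pos.2 hk)
  exact ⟨⟨_, mem_delaunayCell.2 (interior_subset hh)⟩, hh, rfl⟩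

/-- Each Delaunay cell of a face is isometrically embedded in the completion of the face. -/
theorem IsDev.dist_eq [CompactSpace F] (hπ : IsLocallyIsometricCovering π)
    (hN : IsFiniteNet (π ⁻¹' S)) (h₀ : IsRoot (π ⁻¹' S) v₀)
    (h : IsDev (π ⁻¹' S) (cluster (π ⁻¹' S) v₀) L) {Q : Type u} [MetricSpace Q]
    {ι : π '' region (π ⁻¹' S) v₀ → Q} (hι : IsPathCompletion (π '' region (π ⁻¹' S) v₀) ι)
    {e : Q ≃ₜ plane (π ⁻¹' S) (cluster (π ⁻¹' S) v₀) L}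
    (he : ∀ y, (e (ι y) : E2) = inv (plane (π ⁻¹' S) (cluster (π ⁻¹' S) v₀) L)
      (π ∘ devMap (π ⁻¹' S) (cluster (π ⁻¹' S) v₀) L) y) (hv : v ∈ cluster (π ⁻¹' S) v₀)
    (hp : p ∈ delaunayCell (π ⁻¹' S) v) (hq : q ∈ delaunayCell (π ⁻¹' S) v) :
    dist (e.symm ⟨_, h.sect_mem hv hp⟩) (e.symm ⟨_, h.sect_mem hv hq⟩) = dist p q := by
  have hd := h.isDiskMap hπ hN h₀
  obtain ⟨K, hK⟩ := h.exists_lipschitz hN.toIsNet (hN.finite_cluster v₀)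
  refine le_antisymm ?_ ?_
  -- For the upper bound, two points in the interior of the cell are joined by a geodesic that stays
  -- in the interior, hence in the face, and these points are dense in the cell.
  · let θ : delaunayCell (π ⁻¹' S) v → Q := fun p => e.symm ⟨_, h.sect_mem hv p.2⟩
    have hθ : Continuous θ := e.symm.continuous.comp
      ((continuousOn_iff_continuous_domRestrict.1 (h.continuousOn_sect hv)).subtype_mk _)
    have hD := (dense_interior_delaunayCell hv.1).denseRange_val
    refine isClosed_property2 (p := fun x y => dist (θ x) (θ y) ≤ dist (x : ℍ) y) hD
      (isClosed_le (by fun_prop) (by fun_prop)) ?_ ⟨p, hp⟩ ⟨q, hq⟩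
    · rintro ⟨⟨p, hp⟩, hpi⟩ ⟨⟨q, hq⟩, hqi⟩
      have hmem : ∀ r : ℍ, hyp r ∈ interior (cone (near (π ⁻¹' S) v) : Set V3) →
          r ∈ region (π ⁻¹' S) v₀ := by
        intro r hr
        have hrP := mem_delaunayCell.2 (interior_subset hr)
        rw [← h.devMap_sect hv hrP, ← hN.image_interior h]
        exact mem_image_of_mem _ (h.sect_mem_interior hv hr)
      have hθe : ∀ r (hr : hyp r ∈ interior (cone (near (π ⁻¹' S) v) : Set V3)),
          θ ⟨r, mem_delaunayCell.2 (interior_subset hr)⟩ =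
            ι ⟨π r, mem_image_of_mem π (hmem r hr)⟩ := by
        intro r hr
        rw [Homeomorph.symm_apply_eq]
        refine Subtype.ext ?_
        rw [he]
        have := hd.inv_apply (h.sect_mem_interior hv hr)
        rw [Function.comp_apply, h.devMap_sect hv (mem_delaunayCell.2 (interior_subset hr))] at this
        exact this.symm
      change dist (θ ⟨p, _⟩) (θ ⟨q, _⟩) ≤ dist p q
      rw [hθe p hpi, hθe q hqi, ← ENNReal.ofReal_le_ofReal_iff dist_nonneg, ← edist_dist,
        ← edist_dist, hι.edist_eq]
      obtain ⟨γ, hγ, hl⟩ := exists_geodesic_path p q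
      refine (pathEDist_le (γ.map hπ.continuous) ?_).trans (le_trans (le_of_eq ?_) hl)
      · rintro _ ⟨t, rfl⟩
        exact mem_image_of_mem π (hmem _
          (hyp_mem_interior_of_mem_geodesicArc hpi hqi (hγ (mem_range_self t))))
      · exact hπ.eVariationOn_comp γ.continuous
  -- For the lower bound, a path in the face lifts through the inverse of the disk map to a path of
  -- the same length in ℍ, so `devMap` does not increase distances on the face, nor on its
  -- completion.
  · have hcont : Continuous fun x => devMap (π ⁻¹' S) (cluster (π ⁻¹' S) v₀) L (e x) :=
      hK.continuousOn.comp_continuous (by fun_prop) fun x => (e x).2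
    have := isClosed_property2 (p := fun x y => dist (devMap (π ⁻¹' S) (cluster (π ⁻¹' S) v₀) L (e x))
      (devMap (π ⁻¹' S) (cluster (π ⁻¹' S) v₀) L (e y)) ≤ dist x y) hι.denseRange
      (isClosed_le ((hcont.comp continuous_fst).dist (hcont.comp continuous_snd)) continuous_dist) ?_ (e.symm ⟨_, h.sect_mem hv hp⟩)
      (e.symm ⟨_, h.sect_mem hv hq⟩)
    · simpa only [Homeomorph.apply_symm_apply, h.devMap_sect hv hp, h.devMap_sect hv hq] using this
    · intro a b
      rw [← ENNReal.ofReal_le_ofReal_iff dist_nonneg, ← edist_dist, ← edist_dist, hι.edist_eq, he, he]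
      refine le_iInf₂ fun γ hγ => ?_
      have hη : Continuous fun t => devMap (π ⁻¹' S) (cluster (π ⁻¹' S) v₀) L
          (inv (plane (π ⁻¹' S) (cluster (π ⁻¹' S) v₀) L)
            (π ∘ devMap (π ⁻¹' S) (cluster (π ⁻¹' S) v₀) L) (γ t)) :=
        hK.continuousOn.comp_continuous
          (hd.continuousOn_inv.comp_continuous γ.continuous fun t => hγ (mem_range_self t))
          fun t => interior_subset (hd.inv_mem (hγ (mem_range_self t)))
      have hγe : ⇑γ = π ∘ fun t => devMap (π ⁻¹' S) (cluster (π ⁻¹' S) v₀) L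
          (inv (plane (π ⁻¹' S) (cluster (π ⁻¹' S) v₀) L)
            (π ∘ devMap (π ⁻¹' S) (cluster (π ⁻¹' S) v₀) L) (γ t)) :=
        funext fun t => (hd.apply_inv (hγ (mem_range_self t))).symm
      rw [hγe, hπ.eVariationOn_comp hη]
      have := eVariationOn.edist_le (fun t => devMap (π ⁻¹' S) (cluster (π ⁻¹' S) v₀) L
          (inv (plane (π ⁻¹' S) (cluster (π ⁻¹' S) v₀) L)
            (π ∘ devMap (π ⁻¹' S) (cluster (π ⁻¹' S) v₀) L) (γ t))) (mem_univ 0) (mem_univ 1)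
      simpa using this
end

/-! ### Trees, topology of disk maps and frontier pairs -/

section
/-- A finite graph whose edges join each vertex but the root to a unique successor, and in which
the root is reached from everywhere, is a tree. -/
theorem isTree_of_successor {V : Type*} [Finite V] {G : SimpleGraph V} {R : V → V → Prop} {r : V}
    (hG : ∀ a b, G.Adj a b ↔ R a b ∨ R b a) (hu : ∀ a b c, R a b → R a c → b = c)
    (hr : ∀ a, ¬ R r a) (hreach : ∀ a, Relation.ReflTransGen R a r) : G.IsTree := by
  have hreach' : ∀ a, G.Reachable a r := by
    intro a
    induction hreach a using Relation.ReflTransGen.head_induction_on with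
    | refl => exact SimpleGraph.Reachable.refl _
    | head h _ ih => exact ((hG _ _).2 (Or.inl h)).reachable.trans ih
  have hc : G.Connected := by
    rw [SimpleGraph.connected_iff]
    exact ⟨fun a b => (hreach' a).trans (hreach' b).symm, ⟨r⟩⟩
  refine SimpleGraph.isTree_iff_connected_and_card.2 ⟨hc, le_antisymm ?_
    hc.card_vert_le_card_edgeSet_add_one⟩
  have hsucc : ∀ a : {a // a ≠ r}, ∃ b, R a b := by
    rintro ⟨a, ha⟩
    rcases (hreach a).cases_head with h | ⟨b, h, -⟩
    · exact (ha h).elim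
    · exact ⟨b, h⟩
  choose n hn using hsucc
  -- Sending a vertex to the edge towards its successor hits every edge, so there are at most as
  -- many edges as vertices other than the root. Connectedness gives the opposite inequality.
  let f : {a // a ≠ r} → G.edgeSet := fun a => ⟨s(a.1, n a), (hG _ _).2 (Or.inl (hn a))⟩
  have key : ∀ a b (h : R a b), ∃ c, (f c : Sym2 V) = s(a, b) := by
    intro a b h
    have ha : a ≠ r := by rintro rfl; exact hr _ h
    exact ⟨⟨a, ha⟩, by simp only [f, hu _ _ _ (hn ⟨a, ha⟩) h]⟩
  have hf : Function.Surjective f := by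
    rintro ⟨e, he⟩
    induction e with | _ a b => ?_
    rcases (hG a b).1 he with h | h
    · obtain ⟨c, hc⟩ := key a b h
      exact ⟨c, Subtype.ext hc⟩
    · obtain ⟨c, hc⟩ := key b a h
      exact ⟨c, Subtype.ext (hc.trans Sym2.eq_swap)⟩
  have h1 := Nat.card_le_card_of_surjective f hf
  have h2 : Nat.card {a // a ≠ r} + 1 = Nat.card V := by
    classical
    have := Fintype.ofFinite V
    have hpos : 0 < Fintype.card V := Fintype.card_pos_iff.2 ⟨r⟩
    simp only [Nat.card_eq_fintype_card, Fintype.card_subtype_compl, Fintype.card_subtype_eq]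
    omega
  omega

section
variable {X : Type u} [MetricSpace X] {C : Set E2} {f : E2 → X} {U : Set X}

namespace IsDiskMap

theorem isBounded (h : IsDiskMap C f U) : Bornology.IsBounded C := h.compact.isBounded

theorem nonempty_homeomorph_ball (h : IsDiskMap C f U) : Nonempty (U ≃ₜ ball (0 : E2) 1) := by
  obtain ⟨g, h1, -, -⟩ := exists_homeomorph_image_interior_closure_frontier_eq_unitBall h.convex
    h.nonempty h.isBounded
  exact ⟨h.homeomorph.trans ((g.image _).trans (Homeomorph.setCongr h1))⟩

theorem nonempty_homeomorph_closedBall (h : IsDiskMap C f U) :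
    Nonempty (C ≃ₜ closedBall (0 : E2) 1) := by
  obtain ⟨g, -, h2, -⟩ := exists_homeomorph_image_interior_closure_frontier_eq_unitBall h.convex
    h.nonempty h.isBounded
  rw [h.compact.isClosed.closure_eq] at h2
  exact ⟨(g.image _).trans (Homeomorph.setCongr h2)⟩

theorem closure_eq (h : IsDiskMap C f U) : closure U = f '' C := by
  refine Subset.antisymm (closure_minimal ?_ (h.compact.image_of_continuousOn
    h.continuousOn).isClosed) ?_
  · rw [← h.image]; exact image_mono interior_subset
  · conv_lhs => rw [← h.closure_interior]
    rw [← h.image]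
    exact ContinuousOn.image_closure (by rw [h.closure_interior]; exact h.continuousOn)

theorem closure_diff_eq (h : IsDiskMap C f U) : closure U \ U = f '' frontier C := by
  rw [h.closure_eq, h.compact.isClosed.frontier_eq]
  ext y
  constructor
  · rintro ⟨⟨c, hc, rfl⟩, hn⟩
    exact ⟨c, ⟨hc, fun hi => hn ((h.mem_iff c hc).2 hi)⟩, rfl⟩
  · rintro ⟨c, ⟨hc, hn⟩, rfl⟩
    exact ⟨⟨c, hc, rfl⟩, fun hi => hn ((h.mem_iff c hc).1 hi)⟩

variable {Q : Type u} [MetricSpace Q] {ι : U → Q} {e : Q ≃ₜ C}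

theorem mem_range_iff (h : IsDiskMap C f U) (he : ∀ y : U, (e (ι y) : E2) = inv C f y) {q : Q} :
    q ∈ (range ι)ᶜ ↔ (e q : E2) ∈ frontier C := by
  rw [h.compact.isClosed.frontier_eq, mem_sdiff, mem_compl_iff, and_iff_right (e q).2, not_iff_not]
  constructor
  · rintro ⟨y, rfl⟩
    rw [he]; exact h.inv_mem y.2
  · intro hq
    have hy : f (e q) ∈ U := h.image ▸ mem_image_of_mem f hq
    refine ⟨⟨_, hy⟩, e.injective (Subtype.ext ?_)⟩
    rw [he]; exact h.inv_apply hq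

/-- The extension of the inclusion of a disk into the space to the completion. -/
theorem eq_extension (h : IsDiskMap C f U) (hι : IsPathCompletion U ι)
    (he : ∀ y : U, (e (ι y) : E2) = inv C f y) {j : Q → X} (hj : Continuous j)
    (hjι : ∀ a : U, j (ι a) = a) (q : Q) : j q = f (e q) := by
  have hc : Continuous fun q => f (e q) :=
    h.continuousOn.comp_continuous (by fun_prop) fun q => (e q).2
  refine isClosed_property hι.denseRange (isClosed_eq hj hc) (fun a => ?_) q
  rw [hjι, he, h.apply_inv a.2]

end IsDiskMap
end

section
variable {S : Set ℍ} {v v₀ x y p : ℍ}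

theorem isGeometricDual_inter_iff (h : IsEdge S x y) {γ : Set ℍ} :
    IsGeometricDual S (voronoiCell S x ∩ voronoiCell S y) γ ↔ γ = geodesicArc x y := by
  rw [isGeometricDual_iff]
  constructor
  · rintro ⟨x', y', h', he, rfl⟩
    rcases h.arc_eq h' he with ⟨rfl, rfl⟩ | ⟨rfl, rfl⟩
    · rfl
    · exact geodesicArc_comm _ _
  · rintro rfl
    exact ⟨x, y, h, rfl, rfl⟩

theorem IsSide.arc_subset (h : IsSide S v x y) : geodesicArc x y ⊆ delaunayCell S v := by
  intro p hp
  obtain ⟨a, b, ha, hb, e⟩ := mem_geodesicArc_iff.1 hp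
  rw [mem_delaunayCell, e]
  exact Submodule.add_mem _ (cone_smul (hyp_mem_cone h.2.1) ha) (cone_smul (hyp_mem_cone h.2.2) hb)

theorem mem_voronoiVertices_of_mem_edges {x' y' : ℍ} (h : IsEdge S x y) (h' : IsEdge S x' y')
    (hne : voronoiCell S x ∩ voronoiCell S y ≠ voronoiCell S x' ∩ voronoiCell S y')
    (hp : p ∈ voronoiCell S x ∩ voronoiCell S y) (hp' : p ∈ voronoiCell S x' ∩ voronoiCell S y') :
    p ∈ voronoiVertices S := by
  have hx := h.near_left hp
  have hy := h.near_right hp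
  by_cases hx' : x' = x ∨ x' = y
  · by_cases hy' : y' = x ∨ y' = y
    · rcases hx' with rfl | rfl <;> rcases hy' with rfl | rfl
      · exact (h'.2.2.1 rfl).elim
      · exact (hne rfl).elim
      · exact (hne (inter_comm _ _)).elim
      · exact (h'.2.2.1 rfl).elim
    · push Not at hy'
      exact mem_voronoiVertices_iff.2 ⟨x, hx, y, hy, y', h'.near_right hp', h.2.2.1, hy'.2.symm,
        hy'.1.symm⟩
  · push Not at hx'
    exact mem_voronoiVertices_iff.2 ⟨x, hx, y, hy, x', h'.near_left hp', h.2.2.1, hx'.2.symm,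
      hx'.1.symm⟩

/-- A non-centered edge that meets the tree is connected and misses the dual graph, so it lies in
the region and hence in the tree; an edge of the frontier is therefore centered. Its common point
with the tree lies on two different edges, which makes it a Voronoi vertex of the cluster. -/
theorem IsFiniteNet.mem_frontierPairs_iff (hS : IsFiniteNet S) (h₀ : IsRoot S v₀)
    (hne : cluster S v₀ ≠ {v₀}) {q : Set ℍ × ℍ} : q ∈ frontierPairs S (tree S v₀) ↔
      q.2 ∈ cluster S v₀ ∧ ∃ x y, IsSide S q.2 x y ∧ IsCentered S x y ∧
        q.1 = voronoiCell S x ∩ voronoiCell S y := by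
  obtain ⟨e, v⟩ := q
  constructor
  · rintro ⟨⟨γ, hγ⟩, hn, hve, hvt⟩
    obtain ⟨x, y, h, he, -⟩ := isGeometricDual_iff.1 hγ
    dsimp only at he hn hve hvt ⊢
    subst he
    have hc : IsCentered S x y := by
      by_contra hc
      have hsub : voronoiCell S x ∩ voronoiCell S y ⊆ nonCenteredUnion S := subset_sUnion_of_mem
        ⟨⟨γ, hγ⟩, fun hm => hc ((hS.mem_centeredEdges_iff h).1 hm)⟩
      obtain ⟨a, b, hab, ha, hb, e, -⟩ := hS.exists_endpoints h
      have hconn : IsPreconnected (voronoiCell S x ∩ voronoiCell S y) :=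
        e ▸ (isConnected_geodesicArc a b).isPreconnected
      exact hn (subset_inter hsub (hS.subset_region hconn (hS.nonCenteredUnion_subset.mono_left hsub)
        h₀ hve hvt.2))
    obtain ⟨w, w', x', y', hst, hw', hve'⟩ := (hS.mem_tree_iff h₀).1 hvt
    have hvV : v ∈ voronoiVertices S := by
      refine mem_voronoiVertices_of_mem_edges h hst.edge (fun he => hst.not_isCentered ?_) hve hve'
      rcases h.arc_eq hst.edge he with ⟨rfl, rfl⟩ | ⟨rfl, rfl⟩
      exacts [hc, hc.symm]
    exact ⟨hS.vertices_inter_region h₀ ▸ ⟨hvV, hvt.2⟩, x, y, h.isSide hve, hc, rfl⟩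
  · rintro ⟨hv, x, y, hs, hc, he⟩
    dsimp only at he hv hs
    subst he
    refine ⟨⟨_, (isGeometricDual_inter_iff hs.1).2 rfl⟩, fun hsub => ?_, hs.mem,
      hS.cluster_subset_tree h₀ hne hv⟩
    have hm := (hc.aux hS.toIsNet).2.1
    exact disjoint_left.1 hS.nonCenteredUnion_subset (hsub hm).1
      (hS.mem_dualGraph_iff.2 ⟨x, y, hc, midpoint_mem_arc x y⟩)

theorem IsFiniteNet.tree_inter_vertices (hS : IsFiniteNet S) (h₀ : IsRoot S v₀)
    (hne : cluster S v₀ ≠ {v₀}) : tree S v₀ ∩ voronoiVertices S = cluster S v₀ := by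
  refine Subset.antisymm ?_ fun v hv => ⟨hS.cluster_subset_tree h₀ hne hv, hv.1⟩
  rintro v ⟨h1, h2⟩
  rw [← hS.vertices_inter_region h₀]
  exact ⟨h2, h1.2⟩

theorem IsFiniteNet.isTree_cluster (hS : IsFiniteNet S) (h₀ : IsRoot S v₀) :
    ((nonCenteredGraph S).induce (cluster S v₀)).IsTree := by
  have : Finite (cluster S v₀) := hS.finite_cluster v₀
  refine isTree_of_successor (R := fun a b => Next S a b) (r := ⟨v₀, h₀.mem_cluster⟩) ?_ ?_ ?_ ?_
  · rintro ⟨a, ha⟩ ⟨b, hb⟩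
    simp only [SimpleGraph.comap_adj, Function.Embedding.subtype_apply, nonCenteredGraph,
      SimpleGraph.fromRel_adj]
    constructor
    · rintro ⟨hab, h⟩
      have : ∃ e ∈ voronoiEdges S \ centeredEdges S, a ∈ e ∧ b ∈ e := by
        rcases h with ⟨-, -, e, he, h1, h2⟩ | ⟨-, -, e, he, h1, h2⟩
        exacts [⟨e, he, h1, h2⟩, ⟨e, he, h2, h1⟩]
      obtain ⟨e, ⟨⟨γ, hγ⟩, hn⟩, hae, hbe⟩ := this
      obtain ⟨x, y, h, rfl, -⟩ := isGeometricDual_iff.1 hγ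
      exact hS.step_of_side h (fun hc => hn ((hS.mem_centeredEdges_iff h).2 hc)) ha.1 hb.1 hab
        hae hbe
    · have key : ∀ a b, Next S a b → a ≠ b ∧ ∃ e ∈ voronoiEdges S \ centeredEdges S,
          a ∈ e ∧ b ∈ e := by
        rintro a b ⟨x, y, h⟩
        exact ⟨h.ne, _, ⟨⟨_, (isGeometricDual_inter_iff h.edge).2 rfl⟩, fun hm =>
          h.not_isCentered ((hS.mem_centeredEdges_iff h.edge).1 hm)⟩, h.mem_left, h.mem_right⟩
      rintro (h | h)
      · obtain ⟨h1, h2⟩ := key a b h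
        exact ⟨h1, Or.inl ⟨ha.1, hb.1, h2⟩⟩
      · obtain ⟨h1, h2⟩ := key b a h
        exact ⟨h1.symm, Or.inr ⟨hb.1, ha.1, h2⟩⟩
  · rintro a b c hb hc
    exact Subtype.ext (hb.unique hS.toIsNet hc)
  · exact fun a => h₀.2 a
  · have key : ∀ v, Relation.ReflTransGen (Next S) v v₀ → ∀ hv : v ∈ cluster S v₀,
        Relation.ReflTransGen (fun a b : cluster S v₀ => Next S a b) ⟨v, hv⟩
          ⟨v₀, h₀.mem_cluster⟩ := by
      intro v h
      induction h using Relation.ReflTransGen.head_induction_on with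
      | refl => exact fun _ => .refl
      | @head a c h hcv ih => exact fun hv => .head h (ih ⟨h.mem_right, hcv⟩)
    exact fun a => key a.1 a.2.2 a.2

theorem IsFiniteNet.isCentered_of_cluster_eq (hS : IsFiniteNet S) (h₀ : IsRoot S v₀)
    (he : cluster S v₀ = {v₀}) {e : Set ℍ} (hE : e ∈ voronoiEdges S) (hv : v₀ ∈ e) :
    e ∈ centeredEdges S := by
  by_contra hn
  have hm : v₀ ∈ tree S v₀ := ⟨mem_sUnion.2 ⟨e, ⟨hE, hn⟩, hv⟩,
    hS.cluster_subset_region h₀ h₀.mem_cluster⟩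
  rw [hS.tree_eq_empty h₀ he] at hm
  exact hm

end
end

/-! ### The arcs bounding a face -/

section
theorem mem_arcInterior_range {X Y : Type*} [MetricSpace X] [MetricSpace Y] {γ : Set X} {s : γ → Y}
    (hs : Isometry s) {y : Y} (hy : y ∈ arcInterior (range s)) :
    ∃ p : γ, (p : X) ∈ arcInterior γ ∧ s p = y := by
  obtain ⟨⟨p, rfl⟩, _, ⟨a, rfl⟩, _, ⟨b, rfl⟩, h1, h2, h3⟩ := hy
  refine ⟨p, ⟨p.2, a, a.2, b, b.2, ?_, ?_, ?_⟩, rfl⟩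
  · exact fun h => h1 (by rw [Subtype.ext h])
  · exact fun h => h2 (by rw [Subtype.ext h])
  · rw [hs.dist_eq, hs.dist_eq, hs.dist_eq] at h3; exact h3

variable {F : Type u} [MetricSpace F] [CompactSpace F] {π : ℍ → F} {S : Set F}
  {L : ℍ → V3 →ₗ[ℝ] V3} {v₀ : ℍ} {U : Set F}

theorem IsDev.mem_frontier_iff {N : Set ℍ} (hN : IsFiniteNet N) (h₀ : IsRoot N v₀)
    (h : IsDev N (cluster N v₀) L) {c : E2} : c ∈ frontier (plane N (cluster N v₀) L) ↔
      ∃ v ∈ cluster N v₀, ∃ x y, IsSide N v x y ∧ IsCentered N x y ∧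
        ∃ p ∈ geodesicArc x y, c = sect L v p := by
  refine ⟨h.exists_side_of_mem_frontier hN h₀, ?_⟩
  rintro ⟨v, hv, x, y, hs, hc, p, hp, rfl⟩
  rw [(h.isCompact_plane hN.toIsNet (hN.finite_cluster v₀)).isClosed.frontier_eq]
  exact ⟨h.sect_mem hv (hs.arc_subset hp), h.side_not_mem_interior hN hv hs hc hp⟩

theorem closure_diff_face (hπ : IsLocallyIsometricCovering π) (hN : IsFiniteNet (π ⁻¹' S))
    (h₀ : IsRoot (π ⁻¹' S) v₀) (hne : cluster (π ⁻¹' S) v₀ ≠ {v₀})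
    (hU : U = π '' region (π ⁻¹' S) v₀) :
    closure U \ U = ⋃ q ∈ frontierPairs (π ⁻¹' S) (tree (π ⁻¹' S) v₀),
      ⋃ γ ∈ {γ | IsGeometricDual (π ⁻¹' S) q.1 γ}, π '' γ := by
  subst hU
  obtain ⟨L, h⟩ := exists_isDev hN h₀
  rw [(h.isDiskMap hπ hN h₀).closure_diff_eq]
  ext y
  simp only [mem_iUnion, exists_prop, mem_ofPred_eq]
  constructor
  · rintro ⟨c, hc, rfl⟩
    obtain ⟨v, hv, x, y, hs, hcen, p, hp, rfl⟩ := (h.mem_frontier_iff hN h₀).1 hc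
    refine ⟨(_, v), (hN.mem_frontierPairs_iff h₀ hne).2 ⟨hv, x, y, hs, hcen, rfl⟩, _,
      (isGeometricDual_inter_iff hs.1).2 rfl, p, hp, ?_⟩
    rw [Function.comp_apply, h.devMap_sect hv (hs.arc_subset hp)]
  · rintro ⟨⟨_, v⟩, hq, γ, hγ, p, hp, rfl⟩
    obtain ⟨hv, x, y, hs, hcen, rfl⟩ := (hN.mem_frontierPairs_iff h₀ hne).1 hq
    obtain rfl := (isGeometricDual_inter_iff hs.1).1 hγ
    refine ⟨_, (h.mem_frontier_iff hN h₀).2 ⟨v, hv, x, y, hs, hcen, p, hp, rfl⟩, ?_⟩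
    rw [Function.comp_apply, h.devMap_sect hv (hs.arc_subset hp)]

/-- The arc with label (e, v) is the side dual to e, developed with the map of v. The vertex belongs
to the label because both ends of e may lie in the tree, in which case the side occurs twice along
the frontier of the disk model. Arcs meet only at developed sites: off the sites, a common point of
two arcs determines the cell, and then the side. -/
theorem exists_frontier_arcs (hπ : IsLocallyIsometricCovering π) (hN : IsFiniteNet (π ⁻¹' S))
    (h₀ : IsRoot (π ⁻¹' S) v₀) (hne : cluster (π ⁻¹' S) v₀ ≠ {v₀})
    (hU : U = π '' region (π ⁻¹' S) v₀) {Q : Type u} [MetricSpace Q] {ι : U → Q}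
    (hι : IsPathCompletion U ι) {j : Q → F} (hj : Continuous j) (hjι : ∀ a : U, j (ι a) = a) :
    ∃ A : Set ℍ × ℍ → Set Q,
      (range ι)ᶜ = ⋃ q ∈ frontierPairs (π ⁻¹' S) (tree (π ⁻¹' S) v₀), A q ∧
      (∀ q ∈ frontierPairs (π ⁻¹' S) (tree (π ⁻¹' S) v₀),
        ∀ q' ∈ frontierPairs (π ⁻¹' S) (tree (π ⁻¹' S) v₀), q ≠ q' →
          Disjoint (arcInterior (A q)) (A q')) ∧
      ∀ q ∈ frontierPairs (π ⁻¹' S) (tree (π ⁻¹' S) v₀), ∀ γ, IsGeometricDual (π ⁻¹' S) q.1 γ →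
        ∃ s : γ → Q, Isometry s ∧ range s = A q ∧ ∀ p : γ, j (s p) = π p := by
  subst hU
  obtain ⟨L, h⟩ := exists_isDev hN h₀
  have hd := h.isDiskMap hπ hN h₀
  obtain ⟨e, he⟩ := hd.exists_homeomorph hι
  let A : Set ℍ × ℍ → Set Q := fun q => {z | ∃ γ, IsGeometricDual (π ⁻¹' S) q.1 γ ∧
    ∃ p ∈ γ, (e z : E2) = sect L q.2 p}
  have hs : ∀ q ∈ frontierPairs (π ⁻¹' S) (tree (π ⁻¹' S) v₀), ∀ γ,
      IsGeometricDual (π ⁻¹' S) q.1 γ →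
        ∃ s : γ → Q, Isometry s ∧ range s = A q ∧ ∀ p : γ, (e (s p) : E2) = sect L q.2 p := by
    rintro ⟨_, v⟩ hq γ hγ
    obtain ⟨hv, x, y, hs, hcen, rfl⟩ := (hN.mem_frontierPairs_iff h₀ hne).1 hq
    obtain rfl := (isGeometricDual_inter_iff hs.1).1 hγ
    dsimp only at hv hs
    refine ⟨fun p => e.symm ⟨_, h.sect_mem hv (hs.arc_subset p.2)⟩, Isometry.of_dist_eq fun p q =>
      h.dist_eq hπ hN h₀ hι he hv (hs.arc_subset p.2) (hs.arc_subset q.2), ?_, fun p => by simp⟩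
    ext z
    constructor
    · rintro ⟨p, rfl⟩
      exact ⟨_, hγ, p, p.2, by simp⟩
    · rintro ⟨γ', hγ', p, hp, hz⟩
      obtain rfl := (isGeometricDual_inter_iff hs.1).1 hγ'
      exact ⟨⟨p, hp⟩, (e.symm_apply_eq).2 (Subtype.ext hz.symm)⟩
  refine ⟨A, ?_, ?_, ?_⟩
  · ext z
    rw [hd.mem_range_iff he, h.mem_frontier_iff hN h₀]
    simp only [mem_iUnion, exists_prop]
    constructor
    · rintro ⟨v, hv, x, y, hsd, hcen, p, hp, ez⟩
      exact ⟨(_, v), (hN.mem_frontierPairs_iff h₀ hne).2 ⟨hv, x, y, hsd, hcen, rfl⟩, _,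
        (isGeometricDual_inter_iff hsd.1).2 rfl, p, hp, ez⟩
    · rintro ⟨⟨_, v⟩, hq, γ, hγ, p, hp, ez⟩
      obtain ⟨hv, x, y, hsd, hcen, rfl⟩ := (hN.mem_frontierPairs_iff h₀ hne).1 hq
      obtain rfl := (isGeometricDual_inter_iff hsd.1).1 hγ
      exact ⟨v, hv, x, y, hsd, hcen, p, hp, ez⟩
  · rintro ⟨_, v⟩ hq ⟨_, v'⟩ hq' hqq
    obtain ⟨hv, x, y, hsd, hcen, rfl⟩ := (hN.mem_frontierPairs_iff h₀ hne).1 hq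
    obtain ⟨hv', x', y', hsd', hcen', rfl⟩ := (hN.mem_frontierPairs_iff h₀ hne).1 hq'
    dsimp only at hv hv' hsd hsd'
    rw [disjoint_left]
    rintro z hz ⟨γ', hγ', p', hp', ez⟩
    obtain rfl := (isGeometricDual_inter_iff hsd'.1).1 hγ'
    obtain ⟨s, hiso, hr, hse⟩ := hs _ hq _ ((isGeometricDual_inter_iff hsd.1).2 rfl)
    rw [← hr] at hz
    obtain ⟨p, hp, rfl⟩ := mem_arcInterior_range hiso hz
    rw [hse] at ez
    obtain rfl : (p : ℍ) = p' :=
      h.sect_inj hv hv' (hsd.arc_subset p.2) (hsd'.arc_subset hp') ez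
    obtain ⟨a, b, ha, hb, ep⟩ := (mem_arcInterior_geodesicArc hsd.1.2.2.1).1 hp
    have hvv : v = v' := h.eq_of_sect_eq hN hv hv' (hsd.arc_subset p.2) (hsd'.arc_subset hp') ez
      (hN.mem_dualGraph_iff.2 ⟨x, y, hcen, p.2⟩) (hsd.1.not_mem_of_pos hN.toIsNet ha hb ep)
    refine hqq (Prod.ext ?_ hvv)
    obtain ⟨a', b', ha', hb', ep'⟩ := mem_geodesicArc_iff.1 hp'
    rcases hsd.1.pair_eq_of_mem_cone hN.toIsNet hsd'.1 ha hb
      (ep ▸ mem_cone_pair.2 ⟨a', b', ha', hb', ep'⟩) with ⟨rfl, rfl⟩ | ⟨rfl, rfl⟩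
    · rfl
    · exact inter_comm _ _
  · intro q hq γ hγ
    obtain ⟨s, hiso, hr, hse⟩ := hs q hq γ hγ
    refine ⟨s, hiso, hr, fun p => ?_⟩
    obtain ⟨hv, x, y, hsd, hcen, hq1⟩ := (hN.mem_frontierPairs_iff h₀ hne).1 hq
    rw [hq1] at hγ
    obtain rfl := (isGeometricDual_inter_iff hsd.1).1 hγ
    rw [hd.eq_extension hι he hj hjι, hse, Function.comp_apply,
      h.devMap_sect hv (hsd.arc_subset p.2)]
end

/-! ### Finite cell decompositions from characteristic maps -/

section
/-- `φ` is a characteristic map of the open cell `A` attached to the set `B`. -/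
structure IsCellMap {X : Type u} [TopologicalSpace X] {n : ℕ} (φ : (Fin n → ℝ) → X) (A B : Set X) :
    Prop where
  continuousOn : ContinuousOn φ (closedBall 0 1)
  injOn : InjOn φ (ball 0 1)
  image : φ '' ball 0 1 = A
  mapsTo : MapsTo φ (sphere 0 1) B

/-- A finite family of disjoint open cells with characteristic maps is a cell decomposition. -/
theorem isFiniteCellDecomposition_of_cellMaps {X : Type u} [TopologicalSpace X] [T2Space X]
    (K : ℕ → Set (Set X)) (hK : ∀ n, (K n).Finite) (hK₃ : ∀ n, 3 ≤ n → K n = ∅)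
    (hmap : ∀ n, ∀ A ∈ K n, ∃ φ : (Fin n → ℝ) → X, IsCellMap φ A (⋃ m < n, ⋃₀ K m))
    (hd : ∀ m n, ∀ A ∈ K m, ∀ B ∈ K n, (A ∩ B).Nonempty → m = n ∧ A = B)
    (hcov : ∀ x, ∃ n, ∃ A ∈ K n, x ∈ A) {V : Set X} (hV : K 0 = {A | ∃ x ∈ V, A = {x}}) :
    IsFiniteCellDecomposition V (K 1) (K 2) := by
  choose φ hφ using fun n => fun A : K n => hmap n A A.2
  let map : ∀ n, K n → PartialEquiv (Fin n → ℝ) X := fun n A => (hφ n A).injOn.toPartialEquiv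
  have hmφ : ∀ n A, ⇑(map n A) = φ n A := fun n A => rfl
  have himg : ∀ n A, map n A '' ball 0 1 = A := fun n A => (hφ n A).image
  let C : CWComplex (univ : Set X) := CWComplex.mkFinite univ (fun n => K n) map
    (Filter.eventually_atTop.2 ⟨3, fun n hn => isEmpty_coe_sort.2 (hK₃ n hn)⟩)
    (fun n => hK n) (fun n A => rfl) (fun n A => (hφ n A).continuousOn)
    (fun n A => by
      -- Boundary points of the ball go to cells of lower dimension, which are disjoint from this
      -- one; compactness of the closed ball then gives continuity of the inverse on the open cell.
      refine continuousOn_of_leftInvOn (isCompact_closedBall 0 1) (hφ n A).continuousOn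
        ball_subset_closedBall (fun c hc hm => ?_) (map n A).leftInvOn
      by_contra hn
      have hs : c ∈ sphere (0 : Fin n → ℝ) 1 := by
        rw [mem_sphere]
        rw [mem_ball, not_lt] at hn
        exact le_antisymm hc hn
      obtain ⟨m, hmn, B, hB, hcB⟩ : ∃ m, m < n ∧ ∃ B ∈ K m, φ n A c ∈ B := by
        simpa using (hφ n A).mapsTo hs
      exact hmn.ne (hd m n B hB A A.2 ⟨_, hcB, (hφ n A).image ▸ hm⟩).1)
    (by
      rintro ⟨m, A⟩ - ⟨n, B⟩ - hne
      rw [Function.onFun, disjoint_iff_inter_eq_empty, ← not_nonempty_iff_eq_empty]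
      dsimp only
      rw [himg, himg]
      intro h
      obtain ⟨rfl, h⟩ := hd m n A A.2 B B.2 h
      exact hne (by rw [Subtype.ext h]))
    (fun n A c hc => by
      obtain ⟨m, hmn, B, hB, hcB⟩ : ∃ m, m < n ∧ ∃ B ∈ K m, φ n A c ∈ B := by
        simpa using (hφ n A).mapsTo hc
      refine mem_iUnion₂.2 ⟨m, hmn, mem_iUnion.2 ⟨⟨B, hB⟩, ?_⟩⟩
      exact image_mono ball_subset_closedBall ((himg m ⟨B, hB⟩).symm ▸ hcB))
    (by
      refine eq_univ_of_forall fun x => ?_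
      obtain ⟨n, A, hA, hx⟩ := hcov x
      refine mem_iUnion.2 ⟨n, mem_iUnion.2 ⟨⟨A, hA⟩, ?_⟩⟩
      exact image_mono ball_subset_closedBall ((himg n ⟨A, hA⟩).symm ▸ hx))
  have hr : ∀ n, range (fun A : K n => map n A '' ball 0 1) = K n := by
    intro n
    simp only [himg, Subtype.range_coe]
  exact ⟨C, fun n => hK n, (hr 0).trans hV, hr 1, hr 2, fun n hn => isEmpty_coe_sort.2 (hK₃ n hn)⟩

/-- A disk map yields the characteristic map of a `2`-cell. -/
theorem IsDiskMap.exists_isCellMap {X : Type u} [MetricSpace X] {C : Set E2} {f : E2 → X} {U : Set X}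
    (h : IsDiskMap C f U) {B : Set X} (hB : MapsTo f (frontier C) B) :
    ∃ φ : (Fin 2 → ℝ) → X, IsCellMap φ U B := by
  let ℓ : (Fin 2 → ℝ) ≃L[ℝ] E2 := (EuclideanSpace.equiv (Fin 2) ℝ).symm
  have hint : ∀ A : Set (Fin 2 → ℝ), interior (ℓ '' A) = ℓ '' interior A := fun A =>
    (ℓ.toHomeomorph.image_interior A).symm
  have hbi : interior (ℓ '' ball 0 1) = ℓ '' ball 0 1 := by rw [hint, isOpen_ball.interior_eq]
  have hcb : closure (ℓ '' ball 0 1) = ℓ '' closedBall 0 1 := by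
    rw [← closure_ball (0 : Fin 2 → ℝ) one_ne_zero]
    exact (ℓ.toHomeomorph.image_closure _).symm
  -- Cells are modelled on the ball of the sup norm. It and C are convex bodies in the plane, so a
  -- homeomorphism of the plane matches their interiors, closures and frontiers.
  obtain ⟨g, h1, h2, h3⟩ := exists_homeomorph_image_eq
    (s := ℓ '' ball 0 1) (t := C)
    ((convex_ball 0 1).linear_image (ℓ : (Fin 2 → ℝ) →ₗ[ℝ] E2))
    (by rw [hbi]; exact (nonempty_ball.2 one_pos).image _)
    (NormedSpace.isVonNBounded_of_isBounded _ (((isCompact_closedBall 0 1).image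
      ℓ.continuous).isBounded.subset (image_mono ball_subset_closedBall)))
    h.convex h.nonempty (NormedSpace.isVonNBounded_of_isBounded _ h.isBounded)
  rw [hbi] at h1
  rw [hcb, h.compact.isClosed.closure_eq] at h2
  have hfr : frontier (ℓ '' ball 0 1) = ℓ '' sphere 0 1 := by
    rw [← frontier_ball (0 : Fin 2 → ℝ) one_ne_zero]
    exact (ℓ.toHomeomorph.image_frontier _).symm
  rw [hfr] at h3
  refine ⟨fun t => f (g (ℓ t)), ?_, ?_, ?_, ?_⟩
  · refine h.continuousOn.comp (g.continuous.comp ℓ.continuous).continuousOn fun t ht => ?_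
    exact h2 ▸ mem_image_of_mem g (mem_image_of_mem ℓ ht)
  · intro s hs t ht e
    have hi : ∀ t ∈ ball (0 : Fin 2 → ℝ) 1, g (ℓ t) ∈ interior C := fun t ht =>
      h1 ▸ mem_image_of_mem g (mem_image_of_mem ℓ ht)
    exact ℓ.injective (g.injective (h.injOn (hi s hs) (hi t ht) e))
  · rw [← h.image, ← h1, image_image, image_image]
  · exact fun t ht => hB (h3 ▸ mem_image_of_mem g (mem_image_of_mem ℓ ht))
end

/-! ### The centered dual decomposition as a CW complex -/

section
variable {F : Type u} [MetricSpace F] {π : ℍ → F} {S : Set F} {x y x' y' p q : ℍ}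

theorem IsDeck.isCentered (hN : IsNet (π ⁻¹' S)) {g : ℍ ≃ᵢ ℍ} (hg : IsDeck π g)
    (h : IsCentered (π ⁻¹' S) x y) : IsCentered (π ⁻¹' S) (g x) (g y) := by
  have he := h.isEdge hN
  have hc := hg.preserves.centeredEdges ((hN.mem_centeredEdges_iff he).2 h)
  have hi : g '' (voronoiCell (π ⁻¹' S) x ∩ voronoiCell (π ⁻¹' S) y) =
      voronoiCell (π ⁻¹' S) (g x) ∩ voronoiCell (π ⁻¹' S) (g y) :=
    Preserves.image_eq fun p => and_congr hg.preserves.voronoiCell hg.preserves.voronoiCell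
  have he' : IsEdge (π ⁻¹' S) (g x) (g y) := by
    refine ⟨?_, ?_, fun e => he.2.2.1 (g.injective e), hi ▸ he.2.2.2.image g.injective⟩
    · rw [mem_preimage, hg]; exact he.1
    · rw [mem_preimage, hg]; exact he.2.1
  rw [hi] at hc
  exact (hN.mem_centeredEdges_iff he').1 hc

theorem IsCentered.pair_eq {N : Set ℍ} (hN : IsNet N) (h : IsCentered N x y)
    (h' : IsCentered N x' y') (hp : p ∈ arcInterior (geodesicArc x y)) (hp' : p ∈ geodesicArc x' y') :
    (x' = x ∧ y' = y) ∨ (x' = y ∧ y' = x) := by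
  obtain ⟨a, b, ha, hb, e⟩ := (mem_arcInterior_geodesicArc h.2.2.1).1 hp
  exact (h.isEdge hN).pair_eq_of_mem_cone hN (h'.isEdge hN) ha hb
    (e ▸ mem_cone_pair.2 (mem_geodesicArc_iff.1 hp'))

/-- Two centered dual arcs whose interiors share a point in the surface are translates. -/
theorem IsCentered.exists_deck (hπ : IsLocallyIsometricCovering π) (hN : IsNet (π ⁻¹' S))
    (h : IsCentered (π ⁻¹' S) x y) (h' : IsCentered (π ⁻¹' S) x' y')
    (hp : p ∈ arcInterior (geodesicArc x y)) (hq : q ∈ arcInterior (geodesicArc x' y'))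
    (e : π p = π q) : ∃ g, IsDeck π g ∧ g p = q ∧
      ((g x = x' ∧ g y = y') ∨ (g x = y' ∧ g y = x')) := by
  obtain ⟨g, hg, rfl⟩ := hπ.exists_deck e
  refine ⟨g, hg, rfl, h'.pair_eq hN (hg.isCentered hN h) hq ?_⟩
  exact Preserves.geodesicArc.2 hp.1

/-- A deck transformation that identifies two interior points preserves the arc. If it fixes the
ends, it is the identity. If it exchanges them, it fixes the midpoint, the only point of the arc
with two nearest sites; it is then the identity, which contradicts the exchange. -/
theorem IsCentered.injOn (hπ : IsLocallyIsometricCovering π) (hN : IsNet (π ⁻¹' S))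
    (h : IsCentered (π ⁻¹' S) x y) : InjOn π (arcInterior (geodesicArc x y)) := by
  intro p hp q hq e
  obtain ⟨g, hg, rfl, ⟨h1, h2⟩ | ⟨h1, h2⟩⟩ := h.exists_deck hπ hN h hp hq e
  · exact (hπ.deck_unique hg h1 p).symm
  · set m := pt (hyp x + hyp y)
    have hm := h.2.2.2
    have hxm : x ∈ near (π ⁻¹' S) m := hm ▸ mem_insert x _
    have hym : y ∈ near (π ⁻¹' S) m := hm ▸ mem_insert_of_mem x rfl
    have h3 : g m ∈ geodesicArc x y := by
      have := (Preserves.geodesicArc (g := g)).2 (midpoint_mem_arc x y)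
      rwa [h1, h2, geodesicArc_comm] at this
    have hgm : g m = m := h.near_of_mem_arc h3 (hg.preserves.near.2 hxm) (hg.preserves.near.2 hym)
      fun e => h.2.2.1 (g.injective e)
    exact (h.2.2.1 ((hπ.deck_unique hg hgm x).symm.trans h1)).elim

theorem IsCentered.exists_isCellMap (hπ : IsLocallyIsometricCovering π) (hN : IsNet (π ⁻¹' S))
    (h : IsCentered (π ⁻¹' S) x y) :
    ∃ φ : (Fin 1 → ℝ) → F, IsCellMap φ (π '' arcInterior (geodesicArc x y)) S := by
  have hnorm : ∀ t : Fin 1 → ℝ, ‖t‖ = |t 0| := fun t => by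
    rw [show t = fun _ => t 0 from funext fun i => by rw [Subsingleton.elim i 0]]
    exact pi_norm_const (t 0)
  have hball : ∀ t : Fin 1 → ℝ, t ∈ ball 0 1 ↔ -1 < t 0 ∧ t 0 < 1 := fun t => by
    rw [mem_ball_zero_iff, hnorm, abs_lt]
  have hcball : ∀ t : Fin 1 → ℝ, t ∈ closedBall 0 1 ↔ -1 ≤ t 0 ∧ t 0 ≤ 1 := fun t => by
    rw [mem_closedBall_zero_iff, hnorm, abs_le]
  let η : ℝ → ℍ := fun s => pt ((1 - s) • hyp x + (1 + s) • hyp y)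
  have hF : ∀ s : ℝ, -1 ≤ s ∧ s ≤ 1 → IsFut ((1 - s) • hyp x + (1 + s) • hyp y) := fun s hs =>
    isFut_comb x y (by linarith) (by linarith) (by linarith)
  have hk : ∀ s : ℝ, -1 ≤ s ∧ s ≤ 1 → ∃ k : ℝ, 0 < k ∧
      hyp (η s) = (k * (1 - s)) • hyp x + (k * (1 + s)) • hyp y := fun s hs =>
    ⟨_, inv_pos.2 (Real.sqrt_pos.2 (hF s hs).1), by
      rw [hyp_pt (hF s hs), smul_add, smul_smul, smul_smul]⟩
  have hmem : ∀ s : ℝ, -1 < s ∧ s < 1 → η s ∈ arcInterior (geodesicArc x y) := fun s hs => by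
    obtain ⟨k, hk, e⟩ := hk s ⟨hs.1.le, hs.2.le⟩
    exact (mem_arcInterior_geodesicArc h.2.2.1).2 ⟨_, _, mul_pos hk (by linarith),
      mul_pos hk (by linarith), e⟩
  have hinj : ∀ s t : ℝ, -1 < s ∧ s < 1 → -1 < t ∧ t < 1 → η s = η t → s = t := by
    intro s t hs ht e
    obtain ⟨k, hk0, e1⟩ := hk s ⟨hs.1.le, hs.2.le⟩
    obtain ⟨l, hl0, e2⟩ := hk t ⟨ht.1.le, ht.2.le⟩
    rw [e, e2] at e1
    obtain ⟨h1, h2⟩ := pair_unique h.2.2.1 e1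
    have : l = k := by linarith
    subst this
    nlinarith
  refine ⟨fun t => π (η (t 0)), ?_, ?_, ?_, ?_⟩
  · refine hπ.continuous.comp_continuousOn (continuousOn_pt.comp (by fun_prop) fun t ht => ?_)
    exact hF _ ((hcball t).1 ht)
  · intro s hs t ht e
    have := hinj _ _ ((hball s).1 hs) ((hball t).1 ht) (h.injOn hπ hN (hmem _ ((hball s).1 hs))
      (hmem _ ((hball t).1 ht)) e)
    funext i
    rw [Subsingleton.elim i 0, this]
  · ext z
    constructor
    · rintro ⟨t, ht, rfl⟩
      exact mem_image_of_mem π (hmem _ ((hball t).1 ht))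
    · rintro ⟨p, hp, rfl⟩
      obtain ⟨a, b, ha, hb, e⟩ := (mem_arcInterior_geodesicArc h.2.2.1).1 hp
      -- This is the parameter whose weights 1 - s and 1 + s are proportional to a and b.
      refine ⟨fun _ => (b - a) / (a + b), (hball _).2 ⟨?_, ?_⟩, ?_⟩
      · rw [lt_div_iff₀ (by positivity)]; linarith
      · rw [div_lt_one (by positivity)]; linarith
      · have h1 : 1 - (b - a) / (a + b) = 2 / (a + b) * a := by field_simp; ring
        have h2 : 1 + (b - a) / (a + b) = 2 / (a + b) * b := by field_simp; ring
        change π (pt _) = π p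
        rw [h1, h2, ← smul_smul, ← smul_smul, ← smul_add, ← e,
          pt_smul (hyp_mem_Fut p) (by positivity), pt_hyp]
  · intro t ht
    rw [mem_sphere_zero_iff_norm, hnorm] at ht
    have hend : π (η (t 0)) = π x ∨ π (η (t 0)) = π y := by
      rcases (abs_eq zero_le_one).1 ht with h1 | h1
      · right
        simp only [η]
        rw [h1, sub_self, zero_smul, zero_add, pt_smul (hyp_mem_Fut y) (by norm_num), pt_hyp]
      · left
        simp only [η]
        rw [h1, add_neg_cancel, zero_smul, add_zero, pt_smul (hyp_mem_Fut x) (by norm_num), pt_hyp]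
    rcases hend with e | e
    · exact Set.mem_of_eq_of_mem e h.1
    · exact Set.mem_of_eq_of_mem e h.2.1

theorem mem_centeredDualOpenEdges (hN : IsNet (π ⁻¹' S)) {A : Set F} :
    A ∈ centeredDualOpenEdges π S ↔ ∃ x y, IsCentered (π ⁻¹' S) x y ∧
      A = π '' arcInterior (geodesicArc x y) := by
  constructor
  · rintro ⟨γ, hγ, rfl⟩
    obtain ⟨x, y, h, rfl⟩ := hN.mem_centeredDuals_iff.1 hγ
    exact ⟨x, y, h, rfl⟩
  · rintro ⟨x, y, h, rfl⟩
    exact ⟨_, hN.mem_centeredDuals_iff.2 ⟨x, y, h, rfl⟩, rfl⟩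

theorem centeredDualGraph_eq (hπ : IsLocallyIsometricCovering π) (hN : IsNet (π ⁻¹' S)) :
    centeredDualGraph π S = S ∪ ⋃₀ centeredDualOpenEdges π S := by
  ext z
  obtain ⟨p, rfl⟩ := hπ.surjective z
  rw [image_mem_centeredDualGraph hπ]
  constructor
  · intro hp
    obtain ⟨x, y, h, hp⟩ := hN.mem_dualGraph_iff.1 hp
    by_cases hx : p = x
    · exact Or.inl (hx ▸ h.1)
    by_cases hy : p = y
    · exact Or.inl (hy ▸ h.2.1)
    exact Or.inr ⟨_, (mem_centeredDualOpenEdges hN).2 ⟨x, y, h, rfl⟩, mem_image_of_mem π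
      ((mem_arcInterior_geodesicArc' h.2.2.1).2 ⟨hp, hx, hy⟩)⟩
  · rintro (hp | ⟨A, hA, hp⟩)
    · exact hN.subset_dualGraph hp
    · obtain ⟨x, y, h, rfl⟩ := (mem_centeredDualOpenEdges hN).1 hA
      obtain ⟨q, hq, e⟩ := hp
      rw [← image_mem_centeredDualGraph hπ, ← e, image_mem_centeredDualGraph hπ]
      exact hN.mem_dualGraph_iff.2 ⟨x, y, h, hq.1⟩

theorem finite_centeredDualOpenEdges [CompactSpace F] (hπ : IsLocallyIsometricCovering π)
    (hN : IsNet (π ⁻¹' S)) : (centeredDualOpenEdges π S).Finite := by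
  obtain ⟨R, hR⟩ := hπ.exists_deck_dist_le UpperHalfPlane.I
  refine ((hN.finite_duals_inter UpperHalfPlane.I R).image fun γ => π '' arcInterior γ).subset ?_
  intro A hA
  obtain ⟨x, y, h, rfl⟩ := (mem_centeredDualOpenEdges hN).1 hA
  obtain ⟨g, hg, hd⟩ := hR x
  have hi : g '' geodesicArc x y = geodesicArc (g x) (g y) :=
    Preserves.image_eq fun p => Preserves.geodesicArc
  refine ⟨geodesicArc (g x) (g y), ⟨hN.mem_centeredDuals_iff.2 ⟨_, _, hg.isCentered hN h, rfl⟩,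
    g x, left_mem_geodesicArc _ _, hd⟩, ?_⟩
  dsimp only
  rw [← hi, ← Preserves.image_arcInterior, image_image]
  exact image_congr fun p _ => hg p

theorem finite_faces [CompactSpace F] (hπ : IsLocallyIsometricCovering π)
    (hN : IsFiniteNet (π ⁻¹' S)) : {U | IsComponent (centeredDualGraph π S)ᶜ U}.Finite := by
  obtain ⟨R, hR⟩ := hπ.exists_deck_dist_le UpperHalfPlane.I
  refine ((hN.toIsNet.finite_vertices_inter UpperHalfPlane.I R).image fun v =>
    connectedComponentIn (centeredDualGraph π S)ᶜ (π v)).subset ?_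
  intro U hU
  obtain ⟨v₀, h₀, rfl⟩ := (isComponent_iff hπ hN).1 hU
  obtain ⟨g, hg, hd⟩ := hR v₀
  refine ⟨g v₀, ⟨hg.preserves.voronoiVertices.2 h₀.1, hd⟩, ?_⟩
  dsimp only
  rw [hg v₀]
  exact component_eq hπ hN h₀ (hN.cluster_subset_region h₀ h₀.mem_cluster)

/-- The centered dual decomposition is a finite cell decomposition. -/
theorem isFiniteCellDecomposition [CompactSpace F] (hπ : IsLocallyIsometricCovering π)
    (hS : S.Finite) (hN : IsFiniteNet (π ⁻¹' S)) :
    IsFiniteCellDecomposition S (centeredDualOpenEdges π S)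
      {U | IsComponent (centeredDualGraph π S)ᶜ U} := by
  have hG := centeredDualGraph_eq hπ hN.toIsNet
  let K : ℕ → Set (Set F) := fun n => match n with
    | 0 => {A | ∃ x ∈ S, A = {x}}
    | 1 => centeredDualOpenEdges π S
    | 2 => {U | IsComponent (centeredDualGraph π S)ᶜ U}
    | _ => ∅
  have hSE : ∀ z ∈ S, ∀ A ∈ centeredDualOpenEdges π S, z ∉ A := by
    rintro z hz A hA hzA
    obtain ⟨x, y, h, rfl⟩ := (mem_centeredDualOpenEdges hN.toIsNet).1 hA
    obtain ⟨p, hp, rfl⟩ := hzA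
    obtain ⟨a, b, ha, hb, e⟩ := (mem_arcInterior_geodesicArc h.2.2.1).1 hp
    exact (h.isEdge hN.toIsNet).not_mem_of_pos hN.toIsNet ha hb e hz
  have hGU : ∀ z ∈ centeredDualGraph π S, ∀ U, IsComponent (centeredDualGraph π S)ᶜ U → z ∉ U := by
    rintro z hz _ ⟨a, -, rfl⟩ hzU
    exact connectedComponentIn_subset _ _ hzU hz
  have h0 : ∀ A ∈ K 0, ∀ z ∈ A, z ∈ S := by
    rintro _ ⟨x, hx, rfl⟩ z rfl
    exact hx
  have h1 : ∀ A ∈ K 1, ∀ z ∈ A, z ∈ centeredDualGraph π S := fun A hA z hz =>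
    hG ▸ Or.inr ⟨A, hA, hz⟩
  have hcomm : ∀ m n, ∀ A ∈ K m, ∀ B ∈ K n, (A ∩ B).Nonempty → m < n → False := by
    rintro m n A hA B hB ⟨z, hzA, hzB⟩ hmn
    match m, n with
    | 0, 1 => exact hSE z (h0 A hA z hzA) B hB hzB
    | 0, 2 => exact hGU z (hG ▸ Or.inl (h0 A hA z hzA)) B hB hzB
    | 1, 2 => exact hGU z (h1 A hA z hzA) B hB hzB
    | _, n + 3 => exact hB
    | 1, 1 => omega
    | 1, 0 => omega
    | 0, 0 => omega
    | m + 2, 0 => omega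
    | m + 2, 1 => omega
    | m + 2, 2 => omega
  refine isFiniteCellDecomposition_of_cellMaps K ?_ ?_ ?_ ?_ ?_ rfl
  · intro n
    match n with
    | 0 => exact (hS.image fun x => ({x} : Set F)).subset fun A ⟨x, hx, e⟩ => ⟨x, hx, e.symm⟩
    | 1 => exact finite_centeredDualOpenEdges hπ hN.toIsNet
    | 2 => exact finite_faces hπ hN
    | n + 3 => exact finite_empty
  · intro n hn
    match n with
    | n + 3 => rfl
  · intro n A hA
    match n with
    | 0 =>
      obtain ⟨x, hx, rfl⟩ := hA
      refine ⟨fun _ => x, continuousOn_const, fun s _ t _ _ => Subsingleton.elim s t, ?_, ?_⟩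
      · exact (nonempty_ball.2 one_pos).image_const x
      · rw [sphere_eq_empty_of_subsingleton one_ne_zero]
        exact mapsTo_empty _ _
    | 1 =>
      obtain ⟨x, y, h, rfl⟩ := (mem_centeredDualOpenEdges hN.toIsNet).1 hA
      obtain ⟨φ, hφ⟩ := h.exists_isCellMap hπ hN.toIsNet
      refine ⟨φ, hφ.continuousOn, hφ.injOn, hφ.image, hφ.mapsTo.mono_right fun z hz => ?_⟩
      exact mem_iUnion₂.2 ⟨0, one_pos, {z}, ⟨z, hz, rfl⟩, rfl⟩
    | 2 =>
      obtain ⟨v₀, h₀, rfl⟩ := (isComponent_iff hπ hN).1 hA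
      obtain ⟨L, h⟩ := exists_isDev hN h₀
      have hd := h.isDiskMap hπ hN h₀
      refine hd.exists_isCellMap fun c hc => ?_
      rw [hd.compact.isClosed.frontier_eq] at hc
      have hm : (π ∘ devMap (π ⁻¹' S) (cluster (π ⁻¹' S) v₀) L) c ∈ centeredDualGraph π S := by
        by_contra hn
        exact hc.2 ((h.mem_interior_iff hN hc.1).2 fun hm =>
          hn ((image_mem_centeredDualGraph hπ).2 hm))
      rw [hG] at hm
      rcases hm with hm | hm
      · exact mem_iUnion₂.2 ⟨0, two_pos, _, ⟨_, hm, rfl⟩, rfl⟩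
      · exact mem_iUnion₂.2 ⟨1, one_lt_two, hm⟩
  · intro m n A hA B hB hne
    obtain rfl : m = n := by
      by_contra hmn
      rcases lt_or_gt_of_ne hmn with hlt | hlt
      · exact hcomm m n A hA B hB hne hlt
      · exact hcomm n m B hB A hA (inter_comm A B ▸ hne) hlt
    refine ⟨rfl, ?_⟩
    obtain ⟨z, hzA, hzB⟩ := hne
    match m with
    | 0 =>
      obtain ⟨x, hx, rfl⟩ := hA
      obtain ⟨y, hy, rfl⟩ := hB
      rw [← mem_singleton_iff.1 hzA, ← mem_singleton_iff.1 hzB]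
    | 1 =>
      obtain ⟨x, y, h, rfl⟩ := (mem_centeredDualOpenEdges hN.toIsNet).1 hA
      obtain ⟨x', y', h', rfl⟩ := (mem_centeredDualOpenEdges hN.toIsNet).1 hB
      obtain ⟨p, hp, rfl⟩ := hzA
      obtain ⟨q, hq, e⟩ := hzB
      obtain ⟨g, hg, -, hxy⟩ := h.exists_deck hπ hN.toIsNet h' hp hq e.symm
      have hi : g '' geodesicArc x y = geodesicArc x' y' := by
        have : g '' geodesicArc x y = geodesicArc (g x) (g y) :=
          Preserves.image_eq fun p => Preserves.geodesicArc
        rcases hxy with ⟨h1, h2⟩ | ⟨h1, h2⟩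
        · rw [this, h1, h2]
        · rw [this, h1, h2, geodesicArc_comm]
      rw [← hi, ← Preserves.image_arcInterior, image_image]
      exact image_congr fun p _ => (hg p).symm
    | 2 =>
      obtain ⟨a, -, rfl⟩ := hA
      obtain ⟨b, -, rfl⟩ := hB
      rw [connectedComponentIn_eq hzA, connectedComponentIn_eq hzB]
    | n + 3 => exact hA.elim
  · intro z
    by_cases hz : z ∈ centeredDualGraph π S
    · rw [hG] at hz
      rcases hz with hz | ⟨A, hA, hz⟩
      · exact ⟨0, {z}, ⟨z, hz, rfl⟩, rfl⟩
      · exact ⟨1, A, hA, hz⟩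
    · exact ⟨2, _, ⟨z, hz, rfl⟩, mem_connectedComponentIn hz⟩
end

/-! ### The two kinds of faces -/

section
variable {F : Type u} [MetricSpace F] {π : ℍ → F} {S : Set F} {v₀ : ℍ}

/-- A face whose Voronoi vertices form a single-element cluster is the image of a Delaunay cell. -/
theorem face_of_cluster_eq (hπ : IsLocallyIsometricCovering π) (hN : IsFiniteNet (π ⁻¹' S))
    (h₀ : IsRoot (π ⁻¹' S) v₀) (hc : cluster (π ⁻¹' S) v₀ = {v₀}) :
    ∃ v, surfaceVertices π S ∩ π '' region (π ⁻¹' S) v₀ = {v} ∧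
      (∀ e ∈ surfaceEdges π S, v ∈ e → e ∈ surfaceCenteredEdges π S) ∧
      ∀ w, π w = v → π '' delaunayCell (π ⁻¹' S) w = closure (π '' region (π ⁻¹' S) v₀) := by
  refine ⟨π v₀, ?_, ?_, ?_⟩
  · rw [surfaceVertices_inter hπ hN h₀, hc, image_singleton]
  · rintro _ ⟨e, he, rfl⟩ ⟨p, hp, hpv⟩
    obtain ⟨g, hg, rfl⟩ := hπ.exists_deck hpv
    exact ⟨e, hg.preserves.centeredEdges_iff.1 (hN.isCentered_of_cluster_eq h₀ hc
      (hg.preserves.voronoiEdges he) (mem_image_of_mem g hp)), rfl⟩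
  · intro w hw
    obtain ⟨g, hg, rfl⟩ := hπ.exists_deck hw.symm
    rw [hg.image_delaunayCell, closure_image_region hπ hN h₀, hc, biUnion_singleton]

theorem isComponent_eq_of_subset (hπ : IsLocallyIsometricCovering π) (hN : IsFiniteNet (π ⁻¹' S))
    (h₀ : IsRoot (π ⁻¹' S) v₀) {T : Set F} (hT : IsComponent (surfaceNonCenteredUnion π S) T)
    (hTU : T ⊆ π '' region (π ⁻¹' S) v₀) : T = π '' tree (π ⁻¹' S) v₀ := by
  obtain ⟨v₁, h₁, ⟨p, hp⟩, rfl⟩ := (isComponent_surfaceNonCenteredUnion_iff hπ hN).1 hT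
  have hp' := mem_image_of_mem π hp
  obtain ⟨g, hg, hr⟩ := image_region_eq hπ hN h₁ h₀ ⟨_, mem_image_of_mem π hp.2, hTU hp'⟩
  rw [image_tree hπ, image_tree hπ, hg.image_eq hr]

/-- The edges and vertices of a face whose cluster has several elements. -/
theorem face_of_cluster_ne [CompactSpace F] (hπ : IsLocallyIsometricCovering π) (hN : IsFiniteNet (π ⁻¹' S))
    (h₀ : IsRoot (π ⁻¹' S) v₀) (hc : cluster (π ⁻¹' S) v₀ ≠ {v₀}) {U : Set F}
    (hU : U = π '' region (π ⁻¹' S) v₀) {Q : Type u} [MetricSpace Q] {ι : U → Q}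
    (hι : IsPathCompletion U ι) {j : Q → F} (hj : Continuous j) (hjι : ∀ a : U, j (ι a) = a) :
    ∃ T, IsComponent (surfaceNonCenteredUnion π S) T ∧ T ⊆ U ∧
      (∀ T', IsComponent (surfaceNonCenteredUnion π S) T' → T' ⊆ U → T' = T) ∧
      surfaceVertices π S ∩ U = surfaceVertices π S ∩ T ∧
      (∃ T₁, IsComponent (nonCenteredUnion (π ⁻¹' S)) T₁ ∧ π '' T₁ = T) ∧
      ∀ T₁, IsComponent (nonCenteredUnion (π ⁻¹' S)) T₁ → π '' T₁ = T →
        InjOn π T₁ ∧ (T₁ ∩ voronoiVertices (π ⁻¹' S)).Finite ∧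
        ((nonCenteredGraph (π ⁻¹' S)).induce (T₁ ∩ voronoiVertices (π ⁻¹' S))).IsTree ∧
        closure U \ U = ⋃ q ∈ frontierPairs (π ⁻¹' S) T₁,
          ⋃ γ ∈ {γ | IsGeometricDual (π ⁻¹' S) q.1 γ}, π '' γ ∧
        ∃ A : Set ℍ × ℍ → Set Q,
          (range ι)ᶜ = ⋃ q ∈ frontierPairs (π ⁻¹' S) T₁, A q ∧
          (∀ q ∈ frontierPairs (π ⁻¹' S) T₁, ∀ q' ∈ frontierPairs (π ⁻¹' S) T₁, q ≠ q' →
            Disjoint (arcInterior (A q)) (A q')) ∧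
          ∀ q ∈ frontierPairs (π ⁻¹' S) T₁, ∀ γ, IsGeometricDual (π ⁻¹' S) q.1 γ →
            ∃ s : γ → Q, Isometry s ∧ range s = A q ∧ ∀ p : γ, j (s p) = π p := by
  have hsub := hN.cluster_subset_tree h₀ hc
  have hne : (tree (π ⁻¹' S) v₀).Nonempty := ⟨v₀, hsub h₀.mem_cluster⟩
  refine ⟨π '' tree (π ⁻¹' S) v₀,
    (isComponent_surfaceNonCenteredUnion_iff hπ hN).2 ⟨v₀, h₀, hne, rfl⟩, ?_, ?_, ?_,
    ⟨_, hN.isComponent_nonCenteredUnion_iff.2 ⟨v₀, h₀, hne, rfl⟩, rfl⟩, ?_⟩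
  · rw [hU]; exact image_mono inter_subset_right
  · rw [hU]; exact fun T' hT' hsub => isComponent_eq_of_subset hπ hN h₀ hT' hsub
  · refine Subset.antisymm ?_ (inter_subset_inter_right _ (by
      rw [hU]; exact image_mono inter_subset_right))
    rintro z hz
    refine ⟨hz.1, ?_⟩
    rw [hU, surfaceVertices_inter hπ hN h₀] at hz
    exact image_mono hsub hz
  · intro T₁ hT₁ hT
    -- Any lift of T is the tree of some root v₁, whose region is a deck translate of that of v₀.
    -- Hence U is also the image of the region of v₁, and the results for a root apply to v₁
    -- directly.
    obtain ⟨v₁, h₁, ⟨p, hp⟩, rfl⟩ := hN.isComponent_nonCenteredUnion_iff.1 hT₁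
    have hp' : π p ∈ π '' region (π ⁻¹' S) v₀ := by
      have := mem_image_of_mem π hp
      rw [hT] at this
      exact image_mono inter_subset_right this
    obtain ⟨g, hg, hr⟩ := image_region_eq hπ hN h₁ h₀ ⟨_, mem_image_of_mem π hp.2, hp'⟩
    have hU₁ : U = π '' region (π ⁻¹' S) v₁ := hU.trans (hg.image_eq hr).symm
    have hc₁ : cluster (π ⁻¹' S) v₁ ≠ {v₁} := fun he => by
      rw [hN.tree_eq_empty h₁ he] at hp
      exact hp
    have hTV := hN.tree_inter_vertices h₁ hc₁
    refine ⟨(injOn_region hπ hN h₁).mono inter_subset_right, ?_, ?_,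
      closure_diff_face hπ hN h₁ hc₁ hU₁, exists_frontier_arcs hπ hN h₁ hc₁ hU₁ hι hj hjι⟩
    · rw [hTV]; exact hN.finite_cluster v₁
    · rw [hTV]; exact hN.isTree_cluster h₁
end

end CenteredDual

theorem mainTheorem4 {F : Type u} [MetricSpace F] [CompactSpace F]
    (π : ℍ → F) (hπ : IsLocallyIsometricCovering π)
    (S : Set F) (hS : S.Finite) (hS₀ : S.Nonempty) :
    -- the centered dual graph has vertex set `S` and is the 1-skeleton of a cell decomposition
    -- of `F` whose open 2-cells are its complementary components
    S ⊆ centeredDualGraph π S ∧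
    IsFiniteCellDecomposition S (centeredDualOpenEdges π S)
      {U | IsComponent (centeredDualGraph π S)ᶜ U} ∧
    ∀ U : Set F, IsComponent (centeredDualGraph π S)ᶜ U →
      -- `U` is an open disk
      Nonempty (U ≃ₜ ball (0 : EuclideanSpace ℝ (Fin 2)) 1) ∧
      -- its closure is the union of the Delaunay cells of the Voronoi vertices in `U`
      closure U = ⋃ v ∈ voronoiVertices (π ⁻¹' S) ∩ π ⁻¹' U, π '' delaunayCell (π ⁻¹' S) v ∧
      -- the completion `Q` of the induced path metric on `U` is a closed disk; `j` is the extension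
      -- to `Q` of the inclusion of `U` into `F`
      ∃ (Q : Type u) (_ : MetricSpace Q) (ι : U → Q) (j : Q → F),
        IsPathCompletion U ι ∧ Continuous j ∧ (∀ a : U, j (ι a) = a) ∧
        Nonempty (Q ≃ₜ closedBall (0 : EuclideanSpace ℝ (Fin 2)) 1) ∧
        ( -- (1) a single Voronoi vertex, all of whose edges are centered
          (∃ v, surfaceVertices π S ∩ U = {v} ∧
            (∀ e ∈ surfaceEdges π S, v ∈ e → e ∈ surfaceCenteredEdges π S) ∧
            ∀ w, π w = v → π '' delaunayCell (π ⁻¹' S) w = closure U) ∨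
          -- (2) exactly one component `T` of the union of the non-centered edges
          (∃ T, IsComponent (surfaceNonCenteredUnion π S) T ∧ T ⊆ U ∧
            (∀ T', IsComponent (surfaceNonCenteredUnion π S) T' → T' ⊆ U → T' = T) ∧
            surfaceVertices π S ∩ U = surfaceVertices π S ∩ T ∧
            (∃ T₁, IsComponent (nonCenteredUnion (π ⁻¹' S)) T₁ ∧ π '' T₁ = T) ∧
            ∀ T₁, IsComponent (nonCenteredUnion (π ⁻¹' S)) T₁ → π '' T₁ = T →
              -- `T` is the injective image of a finite tree `T₁`
              InjOn π T₁ ∧ (T₁ ∩ voronoiVertices (π ⁻¹' S)).Finite ∧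
              ((nonCenteredGraph (π ⁻¹' S)).induce (T₁ ∩ voronoiVertices (π ⁻¹' S))).IsTree ∧
              closure U \ U = ⋃ q ∈ frontierPairs (π ⁻¹' S) T₁,
                ⋃ γ ∈ {γ | IsGeometricDual (π ⁻¹' S) q.1 γ}, π '' γ ∧
              -- `Q \ U` is a union of arcs, one for each element of the frontier
              ∃ A : Set ℍ × ℍ → Set Q,
                (range ι)ᶜ = ⋃ q ∈ frontierPairs (π ⁻¹' S) T₁, A q ∧
                (∀ q ∈ frontierPairs (π ⁻¹' S) T₁, ∀ q' ∈ frontierPairs (π ⁻¹' S) T₁, q ≠ q' →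
                  Disjoint (arcInterior (A q)) (A q')) ∧
                ∀ q ∈ frontierPairs (π ⁻¹' S) T₁, ∀ γ, IsGeometricDual (π ⁻¹' S) q.1 γ →
                  ∃ s : γ → Q, Isometry s ∧ range s = A q ∧ ∀ p : γ, j (s p) = π p)) := by
  have hN := hπ.isFiniteNet hS hS₀
  refine ⟨?_, isFiniteCellDecomposition hπ hS hN, ?_⟩
  · rw [centeredDualGraph_eq hπ hN.toIsNet]
    exact subset_union_left
  · intro U hU
    obtain ⟨v₀, h₀, rfl⟩ := (isComponent_iff hπ hN).1 hU
    obtain ⟨L, h⟩ := exists_isDev hN h₀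
    have hd := h.isDiskMap hπ hN h₀
    obtain ⟨Q, _, ι, hι⟩ := hd.exists_isPathCompletion
    obtain ⟨e, he⟩ := hd.exists_homeomorph hι
    obtain ⟨b⟩ := hd.nonempty_homeomorph_closedBall
    have hj : Continuous fun q => (π ∘ devMap (π ⁻¹' S) (cluster (π ⁻¹' S) v₀) L) (e q) :=
      hd.continuousOn.comp_continuous (by fun_prop) fun q => (e q).2
    have hjι : ∀ a : π '' region (π ⁻¹' S) v₀,
        (π ∘ devMap (π ⁻¹' S) (cluster (π ⁻¹' S) v₀) L) (e (ι a)) = a := fun a => by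
      rw [he, hd.apply_inv a.2]
    refine ⟨hd.nonempty_homeomorph_ball, closure_face hπ hN h₀, Q, _, ι, _, hι, hj, hjι,
      ⟨e.trans b⟩, ?_⟩
    -- The alternative in (d) is whether any non-centered edge flows into the root: without one the
    -- face is a single cell, otherwise the cluster carries a nontrivial tree.
    by_cases hc : cluster (π ⁻¹' S) v₀ = {v₀}
    · exact Or.inl (face_of_cluster_eq hπ hN h₀ hc)
    · exact Or.inr (face_of_cluster_ne hπ hN h₀ hc rfl hι hj hjι)
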